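/- Let $k$ be a field, let $H$ be a Hopf algebra over $k$, and let $A$ be an augmented $H$-module algebra, that is, a left $H$-module algebra with an algebra homomorphism $\varepsilon\colon A\to k$ whose kernel is an $H$-submodule of $A$. Let $\Lambda=A\sharp H$ be the smash product, augmented by $ah\mapsto\varepsilon(a)\epsilon_H(h)$. Conventions. An augmented algebra $B$ satisfies the Artin-Schelter (AS) condition with dimension $n$ if $\dim_k\mathrm{Ext}^i_B({}_Bk,B)$ is $1$ for $i=n$ and $0$ for $i\neq n$, and the same holds for right modules. It is AS-Gorenstein with dimension $n$ if moreover the injective dimensions of ${}_BB$ and $B_B$ are finite and equal, and AS-regular with dimension $n$ if moreover $\mathrm{gl.dim}\,B<\infty$ (on both sides). $H$ has Van den Bergh duality with dimension $d$ if $H$ has a finite resolution by finitely generated projective left modules over $H^e=H\otimes H^{op}$, $\mathrm{Ext}^i_{H^e}(H,H^e)=0$ for $i\neq d$, and $\mathrm{Ext}^d_{H^e}(H,H^e)$ is an invertible $H$-bimodule. Theorem. Assume that $A$ is (left and right) noetherian and AS-Gorenstein with dimension $n$. 1. If $\mathrm{gl.dim}\,A<\infty$ and $H$ has Van den Bergh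 duality with dimension $d$, then $\Lambda$ satisfies the AS condition with dimension $n+d$, $\mathrm{gl.dim}\,\Lambda<\infty$, and the injective dimensions of ${}_\Lambda\Lambda$ and $\Lambda_\Lambda$ are finite. These are equal, so that $\Lambda$ is AS-regular with dimension $n+d$, whenever the common injective dimension of ${}_AA$ and $A_A$ is $n$ or $\Lambda$ is left and right noetherian; in the former case they are equal to $n+d$. 2. If $H$ is finite-dimensional, then $\Lambda$ is AS-Gorenstein with dimension $n$, and the common injective dimension of ${}_\Lambda\Lambda$ and $\Lambda_\Lambda$ is that of ${}_AA$ and $A_A$. 3. If $H$ has Van den Bergh duality with dimension $d$, then $\Lambda$ satisfies the AS condition with dimension $n+d$, and the injective dimensions of ${}_\Lambda\Lambda$ and $\Lambda_\Lambda$ are finite. These are equal, so that $\Lambda$ is AS-Gorenstein with dimension $n+d$, whenever the common injective dimension of ${}_AA$ and $A_A$ is $n$ or $\Lambda$ is left and right noetherian; in the former case they are equal to $n+d$. 4. If $\mathrm{gl.dim}\,A<\infty$, the antipode of $H$ is bijective, ${}_Hk$ has a resolution by finitely generated projective left $H$-modules, and $H$ is AS-regular with dimension $d$, then the conclusions of part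 1 hold. -/

import Mathlib

open CategoryTheory TensorProduct

universe u

namespace ASSmash

set_option linter.unusedSectionVars false

noncomputable section

/-! ### Module algebras over a Hopf algebra -/

/-- The linear map `h ↦ h • a`. -/
abbrev orbitMap (k : Type u) {H A : Type u} [Field k] [Ring H] [HopfAlgebra k H] [Ring A]
    [Algebra k A] [Module H A] [IsScalarTower k H A] (a : A) : H →ₗ[k] A :=
  (LinearMap.toSpanSingleton H A a).restrictScalars k

/-- `A` is an `H`-module algebra: `A` is a (`k`-linear) left `H`-module, `h • 1 = ε(h)` and
`h • (a b) = (h₁ • a) (h₂ • b)`. -/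
class IsModuleAlgebra (k H A : Type u) [Field k] [Ring H] [HopfAlgebra k H] [Ring A]
    [Algebra k A] [Module H A] [IsScalarTower k H A] : Prop where
  smul_one' : ∀ h : H, h • (1 : A) = algebraMap k A (Coalgebra.counit h)
  smul_mul' : ∀ (h : H) (a b : A), h • (a * b) =
    LinearMap.mul' k A (TensorProduct.map (orbitMap k a) (orbitMap k b) (Coalgebra.comul h))

/-! ### The smash product -/

/-- The underlying vector space `A ⊗ H` of the smash product `A ♯ H`. -/
def SmashProduct (k A H : Type u) [Field k] [Ring H] [HopfAlgebra k H] [Ring A]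
    [Algebra k A] : Type u := A ⊗[k] H

section Smash

variable (k A H : Type u) [Field k] [Ring H] [HopfAlgebra k H] [Ring A] [Algebra k A]
  [Module H A] [IsScalarTower k H A]

instance : AddCommGroup (SmashProduct k A H) := inferInstanceAs (AddCommGroup (A ⊗[k] H))
instance : Module k (SmashProduct k A H) := inferInstanceAs (Module k (A ⊗[k] H))

/-- Left multiplication by `A` on `A ⊗ H`: `b ⊗ l ↦ a b ⊗ l`. -/
def smashL : A →ₐ[k] Module.End k (A ⊗[k] H) :=
  (Module.endTensorEndAlgHom (R := k) (S := k) (A := k) (M := A) (N := H)).comp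
    (Algebra.TensorProduct.includeLeft.comp (Algebra.lmul k A))

/-- The diagonal action of `H` on `A ⊗ H`: `b ⊗ l ↦ (h₁ • b) ⊗ h₂ l`. -/
def smashT : H →ₐ[k] Module.End k (A ⊗[k] H) :=
  (Module.endTensorEndAlgHom (R := k) (S := k) (A := k) (M := A) (N := H)).comp
    ((Algebra.TensorProduct.map (Algebra.lsmul k k A) (Algebra.lmul k H)).comp
      (Bialgebra.comulAlgHom k H))

/-- The multiplication of the smash product:
`(a ⊗ h) (b ⊗ l) = a (h₁ • b) ⊗ h₂ l`. -/
def smashMul : A ⊗[k] H →ₗ[k] Module.End k (A ⊗[k] H) :=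
  TensorProduct.lift ((LinearMap.mul k (Module.End k (A ⊗[k] H))).compl₁₂
    (smashL k A H).toLinearMap (smashT k A H).toLinearMap)

variable {k A H}

@[simp] lemma smashL_tmul (a b : A) (l : H) :
    smashL k A H a (b ⊗ₜ l) = (a * b) ⊗ₜ l := rfl

lemma smashT_tmul (h l : H) (b : A) :
    smashT k A H h (b ⊗ₜ l) =
      TensorProduct.map (orbitMap k b) (LinearMap.mulRight k l) (Coalgebra.comul h) := by
  simp only [smashT, AlgHom.comp_apply, Bialgebra.comulAlgHom_apply]
  induction (Coalgebra.comul (R := k) h) using TensorProduct.induction_on with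
  | zero => simp
  | tmul x y => rfl
  | add x y hx hy => simp only [map_add, LinearMap.add_apply, hx, hy]

lemma smashMul_tmul (a : A) (h : H) :
    smashMul k A H (a ⊗ₜ h) = smashL k A H a * smashT k A H h := by
  simp [smashMul]

lemma smashMul_tmul_tmul (a b : A) (h l : H) :
    smashMul k A H (a ⊗ₜ h) (b ⊗ₜ l) = smashL k A H a
      (TensorProduct.map (orbitMap k b) (LinearMap.mulRight k l) (Coalgebra.comul h)) := by
  rw [smashMul_tmul, Module.End.mul_apply, smashT_tmul]

lemma smashMul_smashL (a : A) (w : A ⊗[k] H) :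
    smashMul k A H (smashL k A H a w) = smashL k A H a * smashMul k A H w := by
  induction w using TensorProduct.induction_on with
  | zero => simp
  | tmul x y => rw [smashL_tmul, smashMul_tmul, smashMul_tmul, map_mul, mul_assoc]
  | add x y hx hy => rw [map_add, map_add, map_add, hx, hy, mul_add]

lemma smashMul_right (g : H) (w : A ⊗[k] H) :
    smashMul k A H (LinearMap.lTensor A (LinearMap.mulRight k g) w) =
      smashMul k A H w * smashT k A H g := by
  induction w using TensorProduct.induction_on with
  | zero => simp
  | tmul x y =>
    rw [LinearMap.lTensor_tmul, LinearMap.mulRight_apply, smashMul_tmul, smashMul_tmul, map_mul,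
      mul_assoc]
  | add x y hx hy => rw [map_add, map_add, map_add, hx, hy, add_mul]

lemma smashT_tmul' (h g : H) (b : A) :
    smashT k A H h (b ⊗ₜ g) =
      LinearMap.lTensor A (LinearMap.mulRight k g) (smashT k A H h (b ⊗ₜ 1)) := by
  rw [smashT_tmul, smashT_tmul]
  induction (Coalgebra.comul (R := k) h) using TensorProduct.induction_on with
  | zero => simp
  | tmul x y => simp
  | add x y hx hy => simp only [map_add, hx, hy]

variable [IsModuleAlgebra k H A]

lemma smashT_mul_smashL (h : H) (b : A) :
    smashT k A H h * smashL k A H b = smashMul k A H (smashT k A H h (b ⊗ₜ 1)) := by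
  refine TensorProduct.ext' fun c l ↦ ?_
  let F : H ⊗[k] (H ⊗[k] H) →ₗ[k] A ⊗[k] H :=
    TensorProduct.map (LinearMap.mul' k A) LinearMap.id ∘ₗ
      (TensorProduct.assoc k A A H).symm.toLinearMap ∘ₗ
        TensorProduct.map (orbitMap k b)
          (TensorProduct.map (orbitMap k c) (LinearMap.mulRight k l))
  have h1 : ∀ t : H ⊗[k] H,
      TensorProduct.map (orbitMap k (b * c)) (LinearMap.mulRight k l) t =
        F ((TensorProduct.assoc k H H H) (LinearMap.rTensor H Coalgebra.comul t)) := by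
    intro t
    induction t using TensorProduct.induction_on with
    | zero => simp
    | tmul x z =>
      rw [LinearMap.rTensor_tmul, TensorProduct.map_tmul]
      change (x • (b * c)) ⊗ₜ[k] (z * l) = _
      rw [IsModuleAlgebra.smul_mul' (k := k)]
      induction (Coalgebra.comul (R := k) x) using TensorProduct.induction_on with
      | zero => simp
      | tmul x y => simp [F]
      | add x y hx hy => simp only [map_add, TensorProduct.add_tmul, hx, hy]
    | add x y hx hy => simp only [map_add, hx, hy]
  have h2 : ∀ t : H ⊗[k] H,
      smashMul k A H (TensorProduct.map (orbitMap k b) (LinearMap.mulRight k 1) t) (c ⊗ₜ l) =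
        F (LinearMap.lTensor H Coalgebra.comul t) := by
    intro t
    induction t using TensorProduct.induction_on with
    | zero => simp
    | tmul x z =>
      rw [LinearMap.lTensor_tmul, TensorProduct.map_tmul, LinearMap.mulRight_apply, mul_one,
        smashMul_tmul_tmul]
      induction (Coalgebra.comul (R := k) z) using TensorProduct.induction_on with
      | zero => simp
      | tmul x y => simp [F]
      | add x y hx hy => simp only [map_add, TensorProduct.tmul_add, hx, hy]
    | add x y hx hy => simp only [map_add, LinearMap.add_apply, hx, hy]
  rw [Module.End.mul_apply, smashL_tmul, smashT_tmul, smashT_tmul, h1, h2,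
    Coalgebra.coassoc_apply]

lemma smashMul_assoc (x y : A ⊗[k] H) :
    smashMul k A H (smashMul k A H x y) = smashMul k A H x * smashMul k A H y := by
  induction x using TensorProduct.induction_on with
  | zero => simp
  | tmul a h =>
    induction y using TensorProduct.induction_on with
    | zero => simp
    | tmul b g =>
      rw [smashMul_tmul, Module.End.mul_apply, smashMul_smashL, smashT_tmul', smashMul_right,
        ← smashT_mul_smashL, smashMul_tmul]
      simp only [mul_assoc]
    | add x y hx hy => simp only [map_add, hx, hy, mul_add]
  | add x y hx hy => simp only [map_add, LinearMap.add_apply, hx, hy, add_mul]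

lemma smashMul_one_left : smashMul k A H (1 ⊗ₜ 1) = 1 := by
  rw [smashMul_tmul, map_one, map_one, one_mul]

lemma smashMul_one_right (x : A ⊗[k] H) : smashMul k A H x (1 ⊗ₜ 1) = x := by
  induction x using TensorProduct.induction_on with
  | zero => simp
  | tmul a h =>
    have key : ∀ t : H ⊗[k] H,
        TensorProduct.map (orbitMap k (1 : A)) (LinearMap.mulRight k 1) t =
          TensorProduct.map (Algebra.linearMap k A) LinearMap.id
            (LinearMap.rTensor H Coalgebra.counit t) := by
      intro t
      induction t using TensorProduct.induction_on with
      | zero => simp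
      | tmul x y => simp [IsModuleAlgebra.smul_one' (k := k)]
      | add x y hx hy => simp only [map_add, hx, hy]
    rw [smashMul_tmul_tmul, key, Coalgebra.rTensor_counit_comul]
    simp
  | add x y hx hy => simp only [map_add, LinearMap.add_apply, hx, hy]

lemma smashMul_assoc_apply (x y z : A ⊗[k] H) :
    smashMul k A H (smashMul k A H x y) z = smashMul k A H x (smashMul k A H y z) := by
  rw [smashMul_assoc, Module.End.mul_apply]

lemma smashMul_one_apply (x : A ⊗[k] H) : smashMul k A H (1 ⊗ₜ 1) x = x := by
  rw [smashMul_one_left, Module.End.one_apply]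

/-- The ring structure of `A ♯ H`. -/
instance : Ring (SmashProduct k A H) :=
  { (inferInstance : AddCommGroup (SmashProduct k A H)) with
    mul := fun x y ↦ smashMul k A H x y
    one := ((1 : A) ⊗ₜ[k] (1 : H) : A ⊗[k] H)
    left_distrib := fun x y z ↦ map_add (smashMul k A H x) y z
    right_distrib := fun x y z ↦ LinearMap.map_add₂ (smashMul k A H) x y z
    zero_mul := fun x ↦ LinearMap.map_zero₂ (smashMul k A H) x
    mul_zero := fun x ↦ map_zero (smashMul k A H x)
    mul_assoc := fun x y z ↦ smashMul_assoc_apply x y z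
    one_mul := fun x ↦ smashMul_one_apply x
    mul_one := fun x ↦ smashMul_one_right x }

lemma smash_mul_def (x y : SmashProduct k A H) : x * y = smashMul k A H x y := rfl

/-- The `k`-algebra structure of `A ♯ H`. -/
instance : Algebra k (SmashProduct k A H) :=
  Algebra.ofModule
    (fun r x y ↦ LinearMap.map_smul₂ (smashMul k A H) r (x : A ⊗[k] H) y)
    (fun r x y ↦ map_smul (smashMul k A H x) r (y : A ⊗[k] H))

/-- If the augmentation ideal of `A` is an `H`-submodule, then `ε(h • a) = ε(h) ε(a)`. -/
lemma augmentation_smul (ε : A →ₐ[k] k) (hε : ∀ (h : H) (a : A), ε a = 0 → ε (h • a) = 0)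
    (h : H) (a : A) : ε (h • a) = Coalgebra.counit h * ε a := by
  have h0 := hε h (a - algebraMap k A (ε a)) (by simp)
  have h1 : h • algebraMap k A (ε a) = ε a • algebraMap k A (Coalgebra.counit h) := by
    rw [Algebra.algebraMap_eq_smul_one, ← IsModuleAlgebra.smul_one' (k := k),
      ← algebraMap_smul H (ε a) (1 : A), ← algebraMap_smul H (ε a) (h • (1 : A)), smul_smul,
      smul_smul, Algebra.commutes]
  rw [smul_sub, h1, map_sub, sub_eq_zero] at h0
  rw [h0, AlgHom.map_smul_of_tower, AlgHom.commutes, smul_eq_mul, mul_comm]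
  rfl

/-- The linear form `a ⊗ h ↦ ε(a) ε(h)` on `A ⊗ H`. -/
def smashCounit (H : Type u) [Ring H] [HopfAlgebra k H] (ε : A →ₐ[k] k) : A ⊗[k] H →ₗ[k] k :=
  LinearMap.mul' k k ∘ₗ TensorProduct.map ε.toLinearMap Coalgebra.counit

lemma smashCounit_tmul (ε : A →ₐ[k] k) (a : A) (h : H) :
    smashCounit H ε (a ⊗ₜ h) = ε a * Coalgebra.counit h := rfl

lemma smashCounit_mul (ε : A →ₐ[k] k) (hε : ∀ (h : H) (a : A), ε a = 0 → ε (h • a) = 0)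
    (x y : A ⊗[k] H) :
    smashCounit H ε (smashMul k A H x y) = smashCounit H ε x * smashCounit H ε y := by
  have key : ∀ (a b : A) (g : H) (t : H ⊗[k] H),
      smashCounit H ε
          (smashL k A H a (TensorProduct.map (orbitMap k b) (LinearMap.mulRight k g) t)) =
        ε a * (ε b * Coalgebra.counit g) * Coalgebra.counit (R := k)
          ((TensorProduct.lid k H) (LinearMap.rTensor H Coalgebra.counit t)) := by
    intro a b g t
    induction t using TensorProduct.induction_on with
    | zero => simp
    | tmul x y =>
      simp [smashCounit_tmul, augmentation_smul ε hε]
      ring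
    | add x y hx hy => simp only [map_add, mul_add, hx, hy]
  induction x using TensorProduct.induction_on with
  | zero => simp
  | tmul a h =>
    induction y using TensorProduct.induction_on with
    | zero => simp
    | tmul b g =>
      rw [smashMul_tmul_tmul, key, Coalgebra.rTensor_counit_comul, smashCounit_tmul,
        smashCounit_tmul]
      simp
      ring
    | add x y hx hy => simp only [map_add, hx, hy, mul_add]
  | add x y hx hy => simp only [map_add, LinearMap.add_apply, hx, hy, add_mul]

lemma smashCounit_one (ε : A →ₐ[k] k) : smashCounit H ε (1 ⊗ₜ 1) = 1 := by
  simp [smashCounit_tmul]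

/-- The augmentation `a ⊗ h ↦ ε(a) ε(h)` of `A ♯ H`, for an augmentation `ε` of `A` whose kernel
is an `H`-submodule of `A`. -/
def smashAugmentation (ε : A →ₐ[k] k) (hε : ∀ (h : H) (a : A), ε a = 0 → ε (h • a) = 0) :
    SmashProduct k A H →ₐ[k] k :=
  AlgHom.ofLinearMap (smashCounit H ε) (smashCounit_one ε)
    (fun x y ↦ smashCounit_mul ε hε x y)

end Smash

/-! ### Homological conditions on augmented algebras

Right `B`-modules are the left modules over `Bᵐᵒᵖ`. -/

/-- The augmentation `B → k`, seen as an augmentation of the opposite algebra. -/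
def opAugmentation {k B : Type u} [Field k] [Ring B] [Algebra k B] (ε : B →ₐ[k] k) :
    Bᵐᵒᵖ →ₐ[k] k :=
  ε.fromOpposite fun _ _ ↦ mul_comm _ _

/-- The trivial left `B`-module `k` of an augmented algebra `B`. -/
abbrev trivialModule {k B : Type u} [Field k] [Ring B] [Algebra k B] (ε : B →ₐ[k] k) :
    ModuleCat.{u} B :=
  (ModuleCat.restrictScalars (ε : B →+* k)).obj (ModuleCat.of k k)

/-- The left Artin-Schelter condition with dimension `n`:
`dim_k Ext^i_B(k, B)` is `1` if `i = n` and `0` otherwise. -/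
def LeftASCondition (k B : Type u) [Field k] [Ring B] [Algebra k B] (ε : B →ₐ[k] k)
    (n : ℕ) : Prop :=
  ∀ i : ℕ, Module.rank k (Abelian.Ext.{u} (trivialModule ε) (ModuleCat.of B B) i) =
    if i = n then 1 else 0

/-- The (two-sided) Artin-Schelter condition with dimension `n`. -/
def ASCondition (k B : Type u) [Field k] [Ring B] [Algebra k B] (ε : B →ₐ[k] k)
    (n : ℕ) : Prop :=
  LeftASCondition k B ε n ∧ LeftASCondition k Bᵐᵒᵖ (opAugmentation ε) n

/-- The injective dimension of the left module `B`. -/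
def leftSelfInjDim (B : Type u) [Ring B] : WithBot ℕ∞ :=
  injectiveDimension (ModuleCat.of.{u} B B)

/-- The injective dimension of the right module `B`. -/
def rightSelfInjDim (B : Type u) [Ring B] : WithBot ℕ∞ :=
  injectiveDimension (ModuleCat.of.{u} Bᵐᵒᵖ Bᵐᵒᵖ)

/-- Both one-sided injective dimensions of `B` are finite. -/
def HasFiniteSelfInjDims (B : Type u) [Ring B] : Prop :=
  (∃ m : ℕ, leftSelfInjDim B = m) ∧ (∃ m : ℕ, rightSelfInjDim B = m)

/-- Both one-sided injective dimensions of `B` are equal to `m`. -/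
def HasSelfInjDim (B : Type u) [Ring B] (m : ℕ) : Prop :=
  leftSelfInjDim B = m ∧ rightSelfInjDim B = m

/-- `gl.dim B < ∞` (on both sides). -/
def HasFiniteGlobalDimension (B : Type u) [Ring B] : Prop :=
  (∃ N : ℕ, ∀ M : ModuleCat.{u} B, HasProjectiveDimensionLE M N) ∧
    (∃ N : ℕ, ∀ M : ModuleCat.{u} Bᵐᵒᵖ, HasProjectiveDimensionLE M N)

/-- `B` is Artin-Schelter Gorenstein with dimension `n`: it satisfies the Artin-Schelter condition
with dimension `n`, and its left and right injective dimensions are finite and equal. -/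
structure IsASGorenstein (k B : Type u) [Field k] [Ring B] [Algebra k B] (ε : B →ₐ[k] k)
    (n : ℕ) : Prop where
  asCondition : ASCondition k B ε n
  injDim : ∃ m : ℕ, HasSelfInjDim B m

/-- `B` is Artin-Schelter regular with dimension `n`. -/
structure IsASRegular (k B : Type u) [Field k] [Ring B] [Algebra k B] (ε : B →ₐ[k] k)
    (n : ℕ) : Prop extends IsASGorenstein k B ε n where
  glDim : HasFiniteGlobalDimension B

/-- `B` is noetherian (on both sides). -/
def IsTwoSidedNoetherian (B : Type u) [Ring B] : Prop :=
  IsNoetherianRing B ∧ IsNoetherianRing Bᵐᵒᵖ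

/-- `M` has a resolution by finitely generated projective modules. -/
def HasFGProjectiveResolution {R : Type u} [Ring R] (M : ModuleCat.{u} R) : Prop :=
  ∃ P : ProjectiveResolution M, ∀ i, Module.Finite R (P.complex.X i)

/-- `M` has a resolution of finite length by finitely generated projective modules. -/
def HasFiniteFGProjectiveResolution {R : Type u} [Ring R] (M : ModuleCat.{u} R) : Prop :=
  ∃ P : ProjectiveResolution M, (∀ i, Module.Finite R (P.complex.X i)) ∧
    ∃ N : ℕ, ∀ i, N < i → Limits.IsZero (P.complex.X i)

/-! ### Van den Bergh duality -/

section VdB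

variable (k H : Type u) [Field k] [Ring H] [Algebra k H]

/-- The enveloping algebra `H^e = H ⊗ H^op`. -/
abbrev Env : Type u := H ⊗[k] Hᵐᵒᵖ

/-- `H` as a left `H^e`-module, `(a ⊗ b) • x = a x b`. -/
def diagonalBimodule : ModuleCat.{u} (Env k H) :=
  letI : Module (Env k H) H := TensorProduct.Algebra.module
  ModuleCat.of (Env k H) H

/-- `Ext^i_{H^e}(H, H^e)`. -/
def ExtEnv (i : ℕ) : Type u :=
  Abelian.Ext.{u} (diagonalBimodule k H) (ModuleCat.of.{u} (Env k H) (Env k H)) i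

instance (i : ℕ) : AddCommGroup (ExtEnv k H i) :=
  inferInstanceAs (AddCommGroup (Abelian.Ext.{u} (diagonalBimodule k H)
    (ModuleCat.of.{u} (Env k H) (Env k H)) i))

instance (i : ℕ) : Module k (ExtEnv k H i) :=
  inferInstanceAs (Module k (Abelian.Ext.{u} (diagonalBimodule k H)
    (ModuleCat.of.{u} (Env k H) (Env k H)) i))

/-- Right multiplication by `e`, an endomorphism of the left module `H^e`. -/
def envMulRight (e : Env k H) :
    ModuleCat.of.{u} (Env k H) (Env k H) ⟶ ModuleCat.of.{u} (Env k H) (Env k H) :=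
  ModuleCat.ofHom (LinearMap.toSpanSingleton (Env k H) (Env k H) e)

lemma envMulRight_add (e e' : Env k H) :
    envMulRight k H (e + e') = envMulRight k H e + envMulRight k H e' := by
  ext
  simp [envMulRight, LinearMap.toSpanSingleton_add]

lemma envMulRight_comp (e e' : Env k H) :
    envMulRight k H e ≫ envMulRight k H e' = envMulRight k H (e * e') := by
  ext
  simp [envMulRight]

lemma envMulRight_one : envMulRight k H 1 = 𝟙 _ := by
  ext
  simp [envMulRight]

section

variable {i : ℕ}
  (x : Abelian.Ext.{u} (diagonalBimodule k H) (ModuleCat.of.{u} (Env k H) (Env k H)) i)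

lemma extEnv_comp_one :
    x.comp (Abelian.Ext.mk₀ (envMulRight k H 1)) (add_zero i) = x := by
  rw [envMulRight_one, Abelian.Ext.comp_mk₀_id]

lemma extEnv_comp_mul (e e' : Env k H) :
    x.comp (Abelian.Ext.mk₀ (envMulRight k H (e * e'))) (add_zero i) =
      (x.comp (Abelian.Ext.mk₀ (envMulRight k H e)) (add_zero i)).comp
        (Abelian.Ext.mk₀ (envMulRight k H e')) (add_zero i) := by
  rw [Abelian.Ext.comp_assoc_of_third_deg_zero, Abelian.Ext.mk₀_comp_mk₀, envMulRight_comp]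

lemma extEnv_comp_zero :
    x.comp (Abelian.Ext.mk₀ (envMulRight k H 0)) (add_zero i) = 0 := by
  have : envMulRight k H 0 = 0 := by ext; simp [envMulRight]
  rw [this, Abelian.Ext.mk₀_zero, Abelian.Ext.comp_zero]

lemma extEnv_comp_add (e e' : Env k H) :
    x.comp (Abelian.Ext.mk₀ (envMulRight k H (e + e'))) (add_zero i) =
      x.comp (Abelian.Ext.mk₀ (envMulRight k H e)) (add_zero i) +
        x.comp (Abelian.Ext.mk₀ (envMulRight k H e')) (add_zero i) := by
  rw [envMulRight_add, Abelian.Ext.mk₀_add, Abelian.Ext.comp_add]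

end

/-- The right action of `H^e` on `Ext^i_{H^e}(H, H^e)` induced by right multiplication
on `H^e`. -/
def extEnvAction (i : ℕ) : (Env k H)ᵐᵒᵖ →+* Module.End k (ExtEnv k H i) where
  toFun e := (Abelian.Ext.mk₀ (envMulRight k H e.unop)).postcompOfLinear k
    (diagonalBimodule k H) (add_zero i)
  map_one' := LinearMap.ext fun x ↦ extEnv_comp_one k H x
  map_mul' e e' := LinearMap.ext fun x ↦ extEnv_comp_mul k H x e'.unop e.unop
  map_zero' := LinearMap.ext fun x ↦ extEnv_comp_zero k H x
  map_add' e e' := LinearMap.ext fun x ↦ extEnv_comp_add k H x e.unop e'.unop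

/-- The left `H`-module structure of `Ext^i_{H^e}(H, H^e)`: `h` acts by right multiplication
by `1 ⊗ h` on `H^e`, that is, through `x ⊗ y ↦ x ⊗ h y`. -/
instance (i : ℕ) : Module H (ExtEnv k H i) :=
  Module.compHom (ExtEnv k H i) ((extEnvAction k H i).comp
    { toFun := fun h : H ↦ MulOpposite.op ((1 : H) ⊗ₜ[k] MulOpposite.op h : Env k H)
      map_one' := rfl
      map_mul' := fun a b ↦ by
        rw [← MulOpposite.op_mul, Algebra.TensorProduct.tmul_mul_tmul, MulOpposite.op_mul, one_mul]
      map_zero' := by simp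
      map_add' := fun a b ↦ by
        rw [← MulOpposite.op_add, ← TensorProduct.tmul_add, MulOpposite.op_add] })

/-- The right `H`-module structure of `Ext^i_{H^e}(H, H^e)`: `h` acts by right multiplication
by `h ⊗ 1` on `H^e`, that is, through `x ⊗ y ↦ x h ⊗ y`. -/
instance (i : ℕ) : Module Hᵐᵒᵖ (ExtEnv k H i) :=
  Module.compHom (ExtEnv k H i) ((extEnvAction k H i).comp
    (RingHom.op (Algebra.TensorProduct.includeLeft :
      H →ₐ[k] Env k H).toRingHom))

/-- The tensor product `U ⊗_H V` of a right `H`-module and a left `H`-module. -/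
def BalancedTensor (U V : Type u) [AddCommGroup U] [Module k U] [Module Hᵐᵒᵖ U]
    [AddCommGroup V] [Module k V] [Module H V] : Type u :=
  (U ⊗[k] V) ⧸ Submodule.span k
    {t : U ⊗[k] V | ∃ (x : U) (h : H) (y : V),
      t = (MulOpposite.op h • x) ⊗ₜ[k] y - x ⊗ₜ[k] (h • y)}

instance (U V : Type u) [AddCommGroup U] [Module k U] [Module Hᵐᵒᵖ U]
    [AddCommGroup V] [Module k V] [Module H V] : AddCommGroup (BalancedTensor k H U V) :=
  inferInstanceAs (AddCommGroup ((U ⊗[k] V) ⧸ _))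

instance (U V : Type u) [AddCommGroup U] [Module k U] [Module Hᵐᵒᵖ U]
    [AddCommGroup V] [Module k V] [Module H V] : Module k (BalancedTensor k H U V) :=
  inferInstanceAs (Module k ((U ⊗[k] V) ⧸ _))

/-- The class of `x ⊗ y` in `U ⊗_H V`. -/
def BalancedTensor.mk {U V : Type u} [AddCommGroup U] [Module k U] [Module Hᵐᵒᵖ U]
    [AddCommGroup V] [Module k V] [Module H V] (x : U) (y : V) : BalancedTensor k H U V :=
  Submodule.Quotient.mk (x ⊗ₜ[k] y)

/-- `U ⊗_H V ≃ H` as `H`-bimodules. -/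
def BalancedTensorIsoUnit (U V : Type u) [AddCommGroup U] [Module k U] [Module H U]
    [Module Hᵐᵒᵖ U] [AddCommGroup V] [Module k V] [Module H V] [Module Hᵐᵒᵖ V] : Prop :=
  ∃ φ : BalancedTensor k H U V ≃ₗ[k] H, ∀ (h : H) (x : U) (y : V),
    φ (BalancedTensor.mk k H (h • x) y) = h * φ (BalancedTensor.mk k H x y) ∧
    φ (BalancedTensor.mk k H x (MulOpposite.op h • y)) = φ (BalancedTensor.mk k H x y) * h

/-- The `H`-bimodule `U` is invertible: there is an `H`-bimodule `V` such that `U ⊗_H V` and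
`V ⊗_H U` are isomorphic to `H` as `H`-bimodules. -/
def IsInvertibleBimodule (U : Type u) [AddCommGroup U] [Module k U] [Module H U]
    [Module Hᵐᵒᵖ U] : Prop :=
  ∃ (V : Type u) (_ : AddCommGroup V) (_ : Module k V) (_ : Module H V) (_ : Module Hᵐᵒᵖ V)
    (_ : IsScalarTower k H V) (_ : IsScalarTower k Hᵐᵒᵖ V) (_ : SMulCommClass H Hᵐᵒᵖ V),
    BalancedTensorIsoUnit k H U V ∧ BalancedTensorIsoUnit k H V U

/-- `H` has Van den Bergh duality with dimension `d`: the `H^e`-module `H` has a finite resolution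
by finitely generated projectives, `Ext^i_{H^e}(H, H^e)` is zero for `i ≠ d`, and it is an
invertible `H`-bimodule for `i = d`. -/
structure HasVanDenBerghDuality (d : ℕ) : Prop where
  homologicallySmooth : HasFiniteFGProjectiveResolution (diagonalBimodule k H)
  ext_eq_zero : ∀ i : ℕ, i ≠ d → Subsingleton (ExtEnv k H i)
  invertible : IsInvertibleBimodule k H (ExtEnv k H d)

end VdB

end

end ASSmash

/-!
Write `Λ = A ♯ H`. The properties of `Λ` that are used are collected in `SmashExtension`: the
inclusions of `A` and `H`, for which both multiplication maps `A ⊗ H → Λ` and `H ⊗ A → Λ` are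
bijective, the projection `a h ↦ ε(a) h` onto `H`, the coaction `a h ↦ a h₁ ⊗ h₂`, and the
bijectivity of the antipode `S`. These properties are symmetric: `Λᵐᵒᵖ` is a smash extension of
`Aᵐᵒᵖ` by the co-opposite of `H`, which embeds in `Λᵐᵒᵖ` through `S` (`SmashExtension.op`). So it
suffices to prove statements about left modules.

*The Artin-Schelter condition.* The `Λ`-module `H` is induced from the trivial `A`-module, and `Λ`
is a free `A`-module. Hence `Ext_Λ (H, Λ) ≃ Ext_A (k, Λ) ≃ Ext_A (k, A) ⊗ H` is concentrated in
degree `n`, where it is the right `H`-module generated freely by a class `e`. Right multiplication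
by `h` on the first argument `H` sends `e` to `e φ(h)`, for an endomorphism `φ` of the algebra `H`.
As the coactions of `H` and `Λ` are `Λ`-linear, `φ` is compatible with the comultiplication; so it
is a winding map `φ(h) = χ(h₁) h₂` for a character `χ` (`inclClass_winding`), hence bijective. Thus
`Ext^n_Λ (H, Λ)` is free of rank one on `e` from the other side, too (`exists_isTransferClass`), and
composition with `e` is an isomorphism
`Ext^j_H (W, H) ≃ Ext^{j+n}_Λ (W, Λ)`, first for `W = H` and, by dimension shift, for every
`H`-module `W` that is resolved by finitely generated projectives
(`IsTransferClass.extTransfer_bijective`). The case `W = k` is the Artin-Schelter condition in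
dimension `n + d`.

*Dimensions.* For `Λ`-modules `M`, the tensor product `M ⊗ H` is induced from the restriction of `M`
to `A`. Resolving the trivial `H`-module of projective dimension `d`, this gives
`Ext^i_Λ (M, N) = 0` as soon as `i` exceeds the injective dimension of `N` over `A` plus `d`
(`subsingleton_ext_tens`), hence the bounds for the injective dimension of `Λ` and for its global
dimension. If the injective dimension of `A` is `n`, the upper bound `n + d` is attained, as
`Ext^{n+d}_Λ (k, Λ)` does not vanish. In general the two injective dimensions are finite, and they
agree over a two-sided noetherian ring by a theorem of Zaks (`hasInjectiveDimensionLT_op`). It is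
proved here with exact sequences of matrices in place of Tor groups.

*Finite-dimensional `H`.* An integral on `H` with dual bases exists
(`exists_isIntegral_dual_bases`), and it makes `A ⊆ Λ` a Frobenius extension, so that
`Ext_Λ (M, Λ) ≃ Ext_A (M, A)` for all `Λ`-modules `M` (`bijective_frobHom`).

*Van den Bergh duality.* Along the homomorphism `δ : H → H^e`, `h ↦ h₁ ⊗ S(h₂)`, the algebra `H^e`
is free on both sides, the bimodule `H` is induced from the trivial module, and it has the trivial
module as a direct summand. Hence the trivial module has finite projective dimension, and
`Ext_{H^e} (H, H^e) ≃ Ext_H (k, H) ⊗ H`. That this is invertible in degree `d` forces `Ext^d_H (k, H)`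
to be one-dimensional (`HasVanDenBerghDuality.leftASCondition`) and the homomorphism
`h ↦ S²(χ(h₁) h₂)`, which describes the right action of `H` on the generator, to be bijective; so
the antipode is bijective (`HasVanDenBerghDuality.bijective_antipode`). A resolution of the trivial
module by finitely generated projectives is obtained by applying `- ⊗_H k` to one of the bimodule
`H`.
-/

namespace ASSmash

noncomputable section

open Abelian Limits

/-! ### Ext groups and exact functors -/

section ExtFunctor

universe w w' v v' t t'

variable {C : Type t} [Category.{v} C] [Abelian C]

lemma exists_shortExact_injective [EnoughInjectives C] (Y : C) :
    ∃ (S : ShortComplex C) (_ : S.ShortExact), Injective S.X₂ ∧ S.X₁ = Y := by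
  let I : InjectivePresentation Y := Classical.arbitrary _
  exact ⟨ShortComplex.mk _ _ (cokernel.condition I.f),
    { exact := ShortComplex.exact_cokernel I.f }, I.injective, rfl⟩

lemma exists_shortExact_projective [EnoughProjectives C] (Y : C) :
    ∃ (S : ShortComplex C) (_ : S.ShortExact), Projective S.X₂ ∧ S.X₃ = Y := by
  let P : ProjectivePresentation Y := Classical.arbitrary _
  exact ⟨ShortComplex.mk _ _ (kernel.condition P.f),
    { exact := ShortComplex.exact_kernel P.f }, P.projective, rfl⟩

variable [HasExt.{w} C]
  {D : Type t'} [Category.{v'} D] [Abelian D] [HasExt.{w'} D]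

/-- The case of an extension class of the naturality below. -/
lemma mapExactFunctor_extClass_natTrans {F G : C ⥤ D} [F.Additive]
    [PreservesFiniteLimits F] [PreservesFiniteColimits F] [G.Additive]
    [PreservesFiniteLimits G] [PreservesFiniteColimits G] (η : F ⟶ G) {S : ShortComplex C}
    (hS : S.ShortExact) :
    (hS.extClass.mapExactFunctor F).comp (Ext.mk₀ (η.app S.X₁)) (add_zero 1) =
      (Ext.mk₀ (η.app S.X₃)).comp (hS.extClass.mapExactFunctor G) (zero_add 1) := by
  rw [Ext.mapExactFunctor_extClass, Ext.mapExactFunctor_extClass]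
  exact ShortComplex.ShortExact.extClass_naturality (hS.map_of_exact F) (hS.map_of_exact G)
    (S.mapNatTrans η)

/-- The maps on `Ext` induced by exact functors are natural in the functor. -/
lemma mapExactFunctor_natTrans [EnoughInjectives C] {F G : C ⥤ D} [F.Additive]
    [PreservesFiniteLimits F] [PreservesFiniteColimits F] [G.Additive]
    [PreservesFiniteLimits G] [PreservesFiniteColimits G] (η : F ⟶ G) {X Y : C} {n : ℕ}
    (x : Ext.{w} X Y n) :
    (x.mapExactFunctor F).comp (Ext.mk₀ (η.app Y)) (add_zero n) =
      (Ext.mk₀ (η.app X)).comp (x.mapExactFunctor G) (zero_add n) := by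
  induction n generalizing Y with
  | zero =>
    obtain ⟨f, rfl⟩ := (Ext.mk₀_bijective X Y).2 x
    simp [Ext.mapExactFunctor_mk₀]
  | succ n hn =>
    -- Dimension shifting: a class of degree `n + 1` is a class of degree `n` times an extension
    -- class.
    obtain ⟨S, hS, hI, rfl⟩ := exists_shortExact_injective Y
    obtain ⟨y, rfl⟩ := Ext.covariant_sequence_exact₁ X hS x (Ext.eq_zero_of_injective _) rfl
    rw [Ext.mapExactFunctor_comp, Ext.mapExactFunctor_comp, Ext.comp_assoc_of_third_deg_zero,
      mapExactFunctor_extClass_natTrans, ← Ext.comp_assoc_of_second_deg_zero, hn,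
      Ext.comp_assoc _ _ _ _ _ (by lia)]

/-- For an exact functor `F` and `f : X ⟶ F M`, the map `Ext (M, N) → Ext (X, F N)`. -/
def extPreMap (F : D ⥤ C) [F.Additive] [PreservesFiniteLimits F] [PreservesFiniteColimits F]
    {X : C} {M : D} (f : X ⟶ F.obj M) (N : D) (n : ℕ) :
    Ext.{w'} M N n →+ Ext.{w} X (F.obj N) n :=
  ((Ext.mk₀ f).precomp (F.obj N) (zero_add n)).comp (F.mapExtAddHom M N n)

lemma extPreMap_apply (F : D ⥤ C) [F.Additive] [PreservesFiniteLimits F]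
    [PreservesFiniteColimits F] {X : C} {M : D} (f : X ⟶ F.obj M) (N : D) (n : ℕ)
    (x : Ext.{w'} M N n) :
    extPreMap F f N n x = (Ext.mk₀ f).comp (x.mapExactFunctor F) (zero_add n) := rfl

/-- If `F` preserves injectives and `f : X ⟶ F M` is universal, then `Ext (M, N) ≃ Ext (X, F N)`. -/
lemma extPreMap_bijective [EnoughInjectives D] (F : D ⥤ C) [F.Additive] [PreservesFiniteLimits F]
    [PreservesFiniteColimits F] [F.PreservesInjectiveObjects] {X : C} {M : D} (f : X ⟶ F.obj M)
    (hf : ∀ N : D, Function.Bijective (fun g : M ⟶ N ↦ f ≫ F.map g)) (N : D) (n : ℕ) :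
    Function.Bijective (extPreMap F f N n) := by
  induction n generalizing N with
  | zero =>
    have : ⇑(extPreMap F f N 0) =
        Ext.homEquiv₀.symm ∘ (fun g : M ⟶ N ↦ f ≫ F.map g) ∘ Ext.homEquiv₀ := by
      ext x
      obtain ⟨g, rfl⟩ := (Ext.mk₀_bijective M N).2 x
      simp [extPreMap_apply, Ext.mapExactFunctor_mk₀, Ext.homEquiv₀]
    rw [this]
    exact (Equiv.bijective _).comp ((hf N).comp (Equiv.bijective _))
  | succ n hn =>
    -- Embed `N` in an injective object and compare the two long exact sequences; the terms with an
    -- injective second argument vanish in degree `n + 1`.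
    obtain ⟨S, hS, hI, rfl⟩ := exists_shortExact_injective N
    have hI' : Injective (S.map F).X₂ :=
      Functor.PreservesInjectiveObjects.injective_obj hI
    have hFS := hS.map_of_exact F
    let δ : Ext (F.obj S.X₃) (F.obj S.X₁) 1 := hFS.extClass
    have hδ : hS.extClass.mapExactFunctor F = δ := Ext.mapExactFunctor_extClass F hS
    refine AddMonoidHom.bijective_of_surjective_of_bijective_of_right_exact
      ((Ext.mk₀ S.g).postcomp M (add_zero n)) (hS.extClass.postcomp M rfl)
      ((Ext.mk₀ (F.map S.g)).postcomp X (add_zero n)) (δ.postcomp X rfl)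
      (extPreMap F f S.X₂ n) (extPreMap F f S.X₃ n) (extPreMap F f S.X₁ (n + 1)) ?_ ?_
      ((ShortComplex.ab_exact_iff_function_exact _).mp
        (Ext.covariant_sequence_exact₃' M hS n (n + 1) rfl))
      ((ShortComplex.ab_exact_iff_function_exact _).mp
        (Ext.covariant_sequence_exact₃' X hFS n (n + 1) rfl))
      (hn _).surjective (hn _)
      (fun x ↦ Ext.covariant_sequence_exact₁ _ hS x (Ext.eq_zero_of_injective _) rfl)
      (fun x ↦ Ext.covariant_sequence_exact₁ _ hFS x (Ext.eq_zero_of_injective _) rfl)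
    · ext x
      simp [extPreMap_apply, Ext.mapExactFunctor_comp, Ext.mapExactFunctor_mk₀]
    · ext x
      simp [extPreMap_apply, Ext.mapExactFunctor_comp, hδ]
      rw [Ext.comp_assoc _ _ _ _ _ (by lia)]

/-- For an exact functor `F` and `f : F N ⟶ Y`, the map `Ext (M, N) → Ext (F M, Y)`. -/
def extPostMap (F : D ⥤ C) [F.Additive] [PreservesFiniteLimits F] [PreservesFiniteColimits F]
    {Y : C} {N : D} (f : F.obj N ⟶ Y) (M : D) (n : ℕ) :
    Ext.{w'} M N n →+ Ext.{w} (F.obj M) Y n :=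
  ((Ext.mk₀ f).postcomp (F.obj M) (add_zero n)).comp (F.mapExtAddHom M N n)

lemma extPostMap_apply (F : D ⥤ C) [F.Additive] [PreservesFiniteLimits F]
    [PreservesFiniteColimits F] {Y : C} {N : D} (f : F.obj N ⟶ Y) (M : D) (n : ℕ)
    (x : Ext.{w'} M N n) :
    extPostMap F f M n x = (x.mapExactFunctor F).comp (Ext.mk₀ f) (add_zero n) := rfl

/-- If `F` preserves projectives and `f : F N ⟶ Y` is universal, then
`Ext (M, N) ≃ Ext (F M, Y)`. -/
lemma extPostMap_bijective [EnoughProjectives D] (F : D ⥤ C) [F.Additive]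
    [PreservesFiniteLimits F] [PreservesFiniteColimits F] [F.PreservesProjectiveObjects] {Y : C}
    {N : D} (f : F.obj N ⟶ Y)
    (hf : ∀ M : D, Function.Bijective (fun g : M ⟶ N ↦ F.map g ≫ f)) (M : D) (n : ℕ) :
    Function.Bijective (extPostMap F f M n) := by
  induction n generalizing M with
  | zero =>
    have : ⇑(extPostMap F f M 0) =
        Ext.homEquiv₀.symm ∘ (fun g : M ⟶ N ↦ F.map g ≫ f) ∘ Ext.homEquiv₀ := by
      ext x
      obtain ⟨g, rfl⟩ := (Ext.mk₀_bijective M N).2 x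
      simp [extPostMap_apply, Ext.mapExactFunctor_mk₀, Ext.homEquiv₀]
    rw [this]
    exact (Equiv.bijective _).comp ((hf M).comp (Equiv.bijective _))
  | succ n hn =>
    -- Dually, cover `M` by a projective object.
    obtain ⟨S, hS, hP, rfl⟩ := exists_shortExact_projective M
    have hP' : Projective (S.map F).X₂ :=
      Functor.PreservesProjectiveObjects.projective_obj hP
    have hFS := hS.map_of_exact F
    let δ : Ext (F.obj S.X₃) (F.obj S.X₁) 1 := hFS.extClass
    have hδ : hS.extClass.mapExactFunctor F = δ := Ext.mapExactFunctor_extClass F hS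
    refine AddMonoidHom.bijective_of_surjective_of_bijective_of_right_exact
      ((Ext.mk₀ S.f).precomp N (zero_add n)) (hS.extClass.precomp N (add_comm 1 n))
      ((Ext.mk₀ (F.map S.f)).precomp Y (zero_add n)) (δ.precomp Y (add_comm 1 n))
      (extPostMap F f S.X₂ n) (extPostMap F f S.X₁ n) (extPostMap F f S.X₃ (n + 1)) ?_ ?_
      ((ShortComplex.ab_exact_iff_function_exact _).mp
        (Ext.contravariant_sequence_exact₁' hS N n (n + 1) (add_comm 1 n)))
      ((ShortComplex.ab_exact_iff_function_exact _).mp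
        (Ext.contravariant_sequence_exact₁' hFS Y n (n + 1) (add_comm 1 n)))
      (hn _).surjective (hn _)
      (fun x ↦ Ext.contravariant_sequence_exact₃ hS _ x (Ext.eq_zero_of_projective _)
        (add_comm 1 n))
      (fun x ↦ Ext.contravariant_sequence_exact₃ hFS _ x (Ext.eq_zero_of_projective _)
        (add_comm 1 n))
    · ext x
      simp [extPostMap_apply, Ext.mapExactFunctor_comp, Ext.mapExactFunctor_mk₀]
    · ext x
      simp [extPostMap_apply, Ext.mapExactFunctor_comp, hδ]

end ExtFunctor

/-! ### Modules with finitely generated projective resolutions -/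

section FP

variable {R : Type u} [Ring R]

/-- `M` has a partial resolution `P_{n-1} → ⋯ → P₀ → M → 0` by finitely generated projective
modules (no condition if `n = 0`, finite generation if `n = 1`). -/
def IsFP : ℕ → ModuleCat.{u} R → Prop
  | 0, _ => True
  | n + 1, M => ∃ S : ShortComplex (ModuleCat.{u} R), S.ShortExact ∧ Projective S.X₂ ∧
      Module.Finite R S.X₂ ∧ IsFP n S.X₁ ∧ Nonempty (S.X₃ ≅ M)

lemma IsFP.of_iso {n : ℕ} {M N : ModuleCat.{u} R} (h : IsFP n M) (e : M ≅ N) : IsFP n N := by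
  cases n with
  | zero => trivial
  | succ n =>
    obtain ⟨S, h1, h2, h3, h4, ⟨e'⟩⟩ := h
    exact ⟨S, h1, h2, h3, h4, ⟨e' ≪≫ e⟩⟩

/-- A module satisfying `IsFP (n + 1)` is the cokernel of an injection of a module satisfying
`IsFP n` into a finitely generated projective module. -/
lemma IsFP.exists_shortExact {n : ℕ} {M : ModuleCat.{u} R} (h : IsFP (n + 1) M) :
    ∃ (S : ShortComplex (ModuleCat.{u} R)) (_ : S.ShortExact), Projective S.X₂ ∧
      Module.Finite R S.X₂ ∧ IsFP n S.X₁ ∧ S.X₃ = M := by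
  obtain ⟨S, h1, h2, h3, h4, ⟨e⟩⟩ := h
  exact ⟨ShortComplex.mk S.f (S.g ≫ e.hom) (by simp),
    ShortComplex.shortExact_of_iso (S₁ := S)
      (ShortComplex.isoMk (Iso.refl _) (Iso.refl _) e) h1,
    h2, h3, h4, rfl⟩

lemma IsFP.finite {n : ℕ} {M : ModuleCat.{u} R} (h : IsFP (n + 1) M) : Module.Finite R M := by
  obtain ⟨S, hS, _, _, _, rfl⟩ := h.exists_shortExact
  exact Module.Finite.of_surjective S.g.hom hS.moduleCat_surjective_g

lemma IsFP.of_succ {n : ℕ} {M : ModuleCat.{u} R} (h : IsFP (n + 1) M) : IsFP n M := by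
  induction n generalizing M with
  | zero => trivial
  | succ n hn =>
    obtain ⟨S, h1, h2, h3, h4, h5⟩ := h
    exact ⟨S, h1, h2, h3, hn h4, h5⟩

lemma IsFP.of_le {m n : ℕ} {M : ModuleCat.{u} R} (h : IsFP n M) (hmn : m ≤ n) : IsFP m M := by
  induction n, hmn using Nat.le_induction with
  | base => exact h
  | succ n _ hn => exact hn h.of_succ

/-- A finitely generated projective module is resolved by itself. -/
lemma isFP_of_projective (P : ModuleCat.{u} R) [Projective P] [Module.Finite R P] (n : ℕ) :
    IsFP n P := by
  have key : ∀ (n : ℕ) (P : ModuleCat.{u} R), Projective P → Module.Finite R P → IsFP n P := by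
    intro n
    induction n with
    | zero => exact fun _ _ _ ↦ trivial
    | succ n hn =>
      intro P _ _
      refine ⟨ShortComplex.mk (0 : ModuleCat.of R PUnit ⟶ P) (𝟙 P) (by simp), ?_, ‹_›, ‹_›,
        hn _ (ModuleCat.isZero_of_iff_subsingleton.2 inferInstance).projective
          (inferInstance : Module.Finite R PUnit.{u + 1}), ⟨Iso.refl _⟩⟩
      exact ModuleCat.shortComplex_shortExact _
        (fun x ↦ ⟨fun h ↦ ⟨0, by simpa using h.symm⟩, fun ⟨y, h⟩ ↦ by simpa using h.symm⟩)
        (fun x y _ ↦ Subsingleton.elim (α := PUnit) _ _) (fun x ↦ ⟨x, rfl⟩)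
  exact key n P ‹_› ‹_›

lemma isFP_of_isNoetherianRing [IsNoetherianRing R] (n : ℕ) (M : ModuleCat.{u} R)
    [Module.Finite R M] : IsFP n M := by
  induction n generalizing M with
  | zero => trivial
  | succ n hn =>
    obtain ⟨r, f, hf⟩ := Module.Finite.exists_fin' R M
    have : Module.Projective R (Fin r → R) := inferInstance
    exact ⟨_, LinearMap.shortExact_shortComplexKer hf,
      ModuleCat.projective_of_categoryTheory_projective _,
      inferInstanceAs (Module.Finite R (Fin r → R)),
      @hn _ (inferInstanceAs (Module.Finite R (LinearMap.ker f))), ⟨Iso.refl _⟩⟩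

/-- A finitely generated projective module is a summand of a finite free one, in the form of a
dual basis. -/
lemma exists_dual_basis (P : ModuleCat.{u} R) [hP : Projective P] [Module.Finite R P] :
    ∃ (r : ℕ) (a : Fin r → (P ⟶ ModuleCat.of R R)) (b : Fin r → (ModuleCat.of R R ⟶ P)),
      ∑ j, a j ≫ b j = 𝟙 P := by
  have : Module.Projective R P := (IsProjective.iff_projective _).2 hP
  obtain ⟨r, f, g, hf, hg, hfg⟩ := Module.Finite.exists_comp_eq_id_of_projective R P
  refine ⟨r, fun j ↦ ModuleCat.ofHom (LinearMap.proj j ∘ₗ g),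
    fun j ↦ ModuleCat.ofHom (f ∘ₗ LinearMap.single R (fun _ ↦ R) j), ?_⟩
  ext x
  have h1 := LinearMap.congr_fun hfg x
  simp only [LinearMap.comp_apply, LinearMap.id_apply] at h1
  simp only [ModuleCat.hom_sum, LinearMap.sum_apply, ModuleCat.hom_comp, ModuleCat.hom_ofHom,
    LinearMap.comp_apply, LinearMap.proj_apply, ← map_sum, ModuleCat.hom_id, LinearMap.id_apply]
  rw [← h1]
  exact congrArg f (by rw [h1]; exact Finset.univ_sum_single (g x))

/-! ### Direct sums -/

/-- A family `ι j : N₀ ⟶ N` exhibits `N` as a direct sum of copies of `N₀`. -/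
def IsDirectSum {J : Type u} {N₀ N : ModuleCat.{u} R} (ι : J → (N₀ ⟶ N)) : Prop :=
  Function.Bijective (Finsupp.lsum ℕ (fun j ↦ (ι j).hom.restrictScalars ℕ) : (J →₀ N₀) → N)

/-- The comparison map `⨁ Ext (X, N₀) → Ext (X, N)`. -/
def extSumMap {J : Type u} {N₀ N : ModuleCat.{u} R} (ι : J → (N₀ ⟶ N)) (X : ModuleCat.{u} R)
    (i : ℕ) : (J →₀ Ext.{u} X N₀ i) →+ Ext.{u} X N i :=
  Finsupp.liftAddHom fun j ↦ (Ext.mk₀ (ι j)).postcomp X (add_zero i)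

/-- The projections of a direct sum decomposition. -/
lemma IsDirectSum.exists_proj {J : Type u} {N₀ N : ModuleCat.{u} R} {ι : J → (N₀ ⟶ N)}
    (hι : IsDirectSum ι) : ∃ e : N ≃ₗ[R] (J →₀ N₀), ∀ j x, e (ι j x) = Finsupp.single j x := by
  let f : (J →₀ N₀) →ₗ[R] N := Finsupp.lsum ℕ fun j ↦ (ι j).hom
  have hf : Function.Bijective f := hι
  refine ⟨(LinearEquiv.ofBijective f hf).symm, fun j x ↦ ?_⟩
  rw [LinearEquiv.symm_apply_eq]
  simp [f]

/-- `Ext^i (X, -)` commutes with direct sums of copies of a module if `X` has the first `i + 1`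
steps of a resolution by finitely generated projective modules. Injectivity needs no hypothesis on
`X`. -/
lemma extSumMap_bijective {J : Type u} {N₀ N : ModuleCat.{u} R} {ι : J → (N₀ ⟶ N)}
    (hι : IsDirectSum ι) (X : ModuleCat.{u} R) (i : ℕ) (hX : IsFP (i + 1) X) :
    Function.Bijective (extSumMap ι X i) := by
  classical
  obtain ⟨e, he⟩ := hι.exists_proj
  have hinj : ∀ (X : ModuleCat.{u} R) (i : ℕ), Function.Injective (extSumMap ι X i) := by
    intro X i
    rw [injective_iff_map_eq_zero]
    intro c hc
    ext j
    -- Compose with the projection to the `j`-th summand.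
    let p : N ⟶ N₀ := ModuleCat.ofHom (Finsupp.lapply j ∘ₗ e.toLinearMap)
    have h1 : ∀ l, ι l ≫ p = if l = j then 𝟙 _ else 0 := by
      intro l
      ext x
      simp only [p, ModuleCat.hom_comp, ModuleCat.hom_ofHom, LinearMap.comp_apply]
      split_ifs with h
      · subst h
        simp [he]
      · simp [he, h]
    have h2 : ((Ext.mk₀ p).postcomp X (add_zero i)).comp (extSumMap ι X i) =
        Finsupp.applyAddHom j := by
      refine Finsupp.addHom_ext fun l x ↦ ?_
      simp only [extSumMap, AddMonoidHom.comp_apply, Finsupp.liftAddHom_apply_single,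
        Finsupp.applyAddHom_apply]
      change (x.comp (Ext.mk₀ (ι l)) (add_zero i)).comp (Ext.mk₀ p) (add_zero i) = _
      rw [Ext.comp_assoc_of_third_deg_zero, Ext.mk₀_comp_mk₀, h1]
      split_ifs with h
      · subst h
        simp
      · simp [h]
    have h3 := DFunLike.congr_fun h2 c
    rw [AddMonoidHom.comp_apply, hc, map_zero] at h3
    exact h3.symm
  refine ⟨hinj X i, ?_⟩
  induction i generalizing X with
  | zero =>
    intro y
    obtain ⟨T, hT⟩ := hX.finite
    obtain ⟨g, rfl⟩ := (Ext.mk₀_bijective X N).2 y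
    -- The images of finitely many generators lie in finitely many summands.
    let s : Finset J := T.biUnion fun x ↦ (e (g x)).support
    let p (j : J) : N ⟶ N₀ := ModuleCat.ofHom (Finsupp.lapply j ∘ₗ e.toLinearMap)
    have hg : g = ∑ j ∈ s, (g ≫ p j) ≫ ι j := by
      ext1
      refine LinearMap.ext_on hT fun x hx ↦ e.injective ?_
      have hs : (e (g x)).support ⊆ s := Finset.subset_biUnion_of_mem (fun x ↦ (e (g x)).support) hx
      rw [ModuleCat.hom_sum, LinearMap.sum_apply, map_sum]
      simp only [ModuleCat.hom_comp, LinearMap.comp_apply, he, p, ModuleCat.hom_ofHom,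
        Finsupp.lapply_apply, LinearEquiv.coe_coe]
      exact ((e (g x)).sum_of_support_subset hs _ (by simp)).symm.trans
        (Finsupp.sum_single _) |>.symm
    refine ⟨∑ j ∈ s, Finsupp.single j (Ext.mk₀ (g ≫ p j)), ?_⟩
    rw [map_sum]
    conv_rhs => rw [hg]
    simp only [extSumMap, Finsupp.liftAddHom_apply_single]
    change ∑ j ∈ s, (Ext.mk₀ (g ≫ p j)).comp (Ext.mk₀ (ι j)) (add_zero 0) = _
    simp only [Ext.mk₀_comp_mk₀]
    exact (map_sum (Ext.addEquiv₀ (X := X) (Y := N)).symm _ _).symm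
  | succ i hi =>
    intro y
    obtain ⟨S, hS, hP, _, hK, rfl⟩ := hX.exists_shortExact
    obtain ⟨y, rfl⟩ := Ext.contravariant_sequence_exact₃ hS N y (Ext.eq_zero_of_projective _)
      (add_comm 1 i)
    obtain ⟨c, rfl⟩ := hi S.X₁ hK y
    refine ⟨Finsupp.mapRange.addMonoidHom (hS.extClass.precomp N₀ (add_comm 1 i)) c, ?_⟩
    have : (extSumMap ι S.X₃ (i + 1)).comp
        (Finsupp.mapRange.addMonoidHom (hS.extClass.precomp N₀ (add_comm 1 i))) =
          (hS.extClass.precomp N (add_comm 1 i)).comp (extSumMap ι S.X₁ i) := by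
      refine Finsupp.addHom_ext fun l x ↦ ?_
      simp only [extSumMap, AddMonoidHom.comp_apply, Finsupp.liftAddHom_apply_single,
        Finsupp.mapRange.addMonoidHom_apply, Finsupp.mapRange_single]
      exact Ext.comp_assoc_of_third_deg_zero _ _ _ (add_comm 1 i)
    exact DFunLike.congr_fun this c

end FP

/-! ### Transfer of Ext along composition with a class -/

section Transfer

universe w' v' t'

variable {R : Type u} [Ring R] {D : Type t'} [Category.{v'} D] [Abelian D] [HasExt.{w'} D]
  (F : ModuleCat.{u} R ⥤ D) [F.Additive] [PreservesFiniteLimits F] [PreservesFiniteColimits F]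
  {Y : ModuleCat.{u} R} {Z : D} {n : ℕ} (e : Ext.{w'} (F.obj Y) Z n)

/-- The map `Ext^j (W, Y) → Ext^m (F W, Z)`, `x ↦ F(x) · e`, for `e ∈ Ext^n (F Y, Z)` and
`m = j + n`. -/
def extTransfer (W : ModuleCat.{u} R) (j m : ℕ) (h : j + n = m) :
    Ext.{u} W Y j →+ Ext.{w'} (F.obj W) Z m :=
  (e.postcomp (F.obj W) h).comp (F.mapExtAddHom W Y j)

lemma extTransfer_apply (W : ModuleCat.{u} R) (j m : ℕ) (h : j + n = m) (x : Ext.{u} W Y j) :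
    extTransfer F e W j m h x = (x.mapExactFunctor F).comp e h := rfl

/-- The hypotheses on the free module of rank one under which `extTransfer` is bijective. -/
structure IsTransferClass : Prop where
  subsingleton : ∀ i, i ≠ n → Subsingleton (Ext.{w'} (F.obj (ModuleCat.of R R)) Z i)
  bijective : Function.Bijective (extTransfer F e (ModuleCat.of R R) 0 n (zero_add n))

variable {F e}

/-- `extTransfer` is natural in the first argument. -/
lemma extTransfer_precomp {W W' : ModuleCat.{u} R} (f : W ⟶ W') (j m : ℕ) (h : j + n = m)
    (x : Ext.{u} W' Y j) :
    extTransfer F e W j m h ((Ext.mk₀ f).comp x (zero_add j)) =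
      (Ext.mk₀ (F.map f)).comp (extTransfer F e W' j m h x) (zero_add m) := by
  rw [extTransfer_apply, Ext.mapExactFunctor_comp, Ext.mapExactFunctor_mk₀, extTransfer_apply,
    Ext.comp_assoc _ _ _ _ _ (by lia)]

/-- `extTransfer` commutes with the connecting homomorphisms. -/
lemma extTransfer_extClass {S : ShortComplex (ModuleCat.{u} R)} (hS : S.ShortExact) (j m : ℕ)
    (h : j + n = m) (x : Ext.{u} S.X₁ Y j) :
    extTransfer F e S.X₃ (j + 1) (m + 1) (by lia) (hS.extClass.comp x (add_comm 1 j)) =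
      (hS.extClass.mapExactFunctor F).comp (extTransfer F e S.X₁ j m h x) (add_comm 1 m) := by
  rw [extTransfer_apply, Ext.mapExactFunctor_comp, extTransfer_apply,
    Ext.comp_assoc _ _ _ _ _ (by lia)]

/-- A dual basis of `P` expresses classes on `G P` by classes on the image of the free module of
rank one. -/
lemma sum_comp_eq (G : ModuleCat.{u} R ⥤ D) [G.Additive] (P : ModuleCat.{u} R) {r : ℕ}
    {a : Fin r → (P ⟶ ModuleCat.of R R)}
    {b : Fin r → (ModuleCat.of R R ⟶ P)} (hab : ∑ j, a j ≫ b j = 𝟙 P) {m : ℕ}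
    (x : Ext.{w'} (G.obj P) Z m) :
    ∑ l, (Ext.mk₀ (G.map (a l))).comp ((Ext.mk₀ (G.map (b l))).comp x (zero_add m))
      (zero_add m) = x := by
  have h : 𝟙 (G.obj P) = ∑ j, G.map (a j) ≫ G.map (b j) := by
    rw [← G.map_id, ← hab, G.map_sum]
    simp
  conv_rhs => rw [← Ext.mk₀_id_comp x, h, Ext.mk₀_sum, Ext.sum_comp]
  simp

section Projective

variable (P : ModuleCat.{u} R) [Projective P] [Module.Finite R P]

lemma IsTransferClass.subsingleton_of_projective (he : IsTransferClass F e) (i : ℕ) (hi : i ≠ n) :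
    Subsingleton (Ext.{w'} (F.obj P) Z i) := by
  obtain ⟨r, a, b, hab⟩ := exists_dual_basis P
  refine subsingleton_of_forall_eq 0 fun x ↦ ?_
  have := he.subsingleton i hi
  rw [← sum_comp_eq F P hab x]
  refine Finset.sum_eq_zero fun l _ ↦ ?_
  rw [Subsingleton.elim ((Ext.mk₀ (F.map (b l))).comp x (zero_add i)) 0, Ext.comp_zero]

lemma IsTransferClass.bijective_of_projective (he : IsTransferClass F e) :
    Function.Bijective (extTransfer F e P 0 n (zero_add n)) := by
  obtain ⟨r, a, b, hab⟩ := exists_dual_basis P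
  refine ⟨(injective_iff_map_eq_zero _).2 fun x hx ↦ ?_, fun y ↦ ?_⟩
  · rw [← sum_comp_eq (𝟭 _) P hab x]
    refine Finset.sum_eq_zero fun l _ ↦ ?_
    have : (Ext.mk₀ (b l)).comp x (zero_add 0) = 0 := he.bijective.1 (by
      rw [extTransfer_precomp, hx, Ext.comp_zero, map_zero])
    simp [this]
  · choose z hz using fun l ↦ he.bijective.2 ((Ext.mk₀ (F.map (b l))).comp y (zero_add n))
    refine ⟨∑ l, (Ext.mk₀ (a l)).comp (z l) (zero_add 0), ?_⟩
    rw [map_sum, ← sum_comp_eq F P hab y]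
    refine Finset.sum_congr rfl fun l _ ↦ ?_
    rw [extTransfer_precomp, hz]

end Projective

/-- `Ext^i (F W, Z)` vanishes below the degree of a transfer class, by dimension shifting along a
resolution of `W`. -/
lemma IsTransferClass.subsingleton_of_lt (he : IsTransferClass F e) (i : ℕ) (hi : i < n)
    (W : ModuleCat.{u} R) (hW : IsFP (i + 1) W) : Subsingleton (Ext.{w'} (F.obj W) Z i) := by
  induction i generalizing W with
  | zero =>
    obtain ⟨S, hS, hP, _, hK, rfl⟩ := hW.exists_shortExact
    have := he.subsingleton_of_projective S.X₂ 0 (by lia)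
    have hFS := hS.map_of_exact F
    have : Epi (F.map S.g) := hFS.epi_g
    exact (Ext.precomp_mk₀_injective_of_epi Z (F.map S.g)).subsingleton
  | succ i hi' =>
    obtain ⟨S, hS, hP, _, hK, rfl⟩ := hW.exists_shortExact
    have h1 := he.subsingleton_of_projective S.X₂ (i + 1) (by lia)
    have h2 := hi' (by lia) S.X₁ hK
    refine subsingleton_of_forall_eq 0 fun x ↦ ?_
    obtain ⟨y, hy⟩ := Ext.contravariant_sequence_exact₃ (hS.map_of_exact F) Z x
      (Subsingleton.elim (α := Ext.{w'} (F.obj S.X₂) Z (i + 1)) _ _) (add_comm 1 i)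
    rw [← hy, Subsingleton.elim (α := Ext.{w'} (F.obj S.X₁) Z i) y 0]
    exact Ext.comp_zero _ _ _ _ _

lemma IsTransferClass.injective_zero (he : IsTransferClass F e) (W : ModuleCat.{u} R)
    (hW : IsFP 1 W) : Function.Injective (extTransfer F e W 0 n (zero_add n)) := by
  obtain ⟨S, hS, hP, _, -, rfl⟩ := hW.exists_shortExact
  refine (injective_iff_map_eq_zero _).2 fun x hx ↦ ?_
  have := hS.epi_g
  apply Ext.precomp_mk₀_injective_of_epi Y S.g
  have h : (Ext.mk₀ S.g).comp x (zero_add 0) = 0 := (he.bijective_of_projective S.X₂).1 (by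
    rw [extTransfer_precomp, hx, Ext.comp_zero, map_zero])
  exact h.trans (map_zero ((Ext.mk₀ S.g).precomp Y (zero_add 0))).symm

lemma IsTransferClass.bijective_zero (he : IsTransferClass F e) (W : ModuleCat.{u} R)
    (hW : IsFP (n + 2) W) : Function.Bijective (extTransfer F e W 0 n (zero_add n)) := by
  refine ⟨he.injective_zero W (hW.of_le (by lia)), fun y ↦ ?_⟩
  obtain ⟨S, hS, hP, _, hK, rfl⟩ := hW.exists_shortExact
  have hFS := hS.map_of_exact F
  -- Lift the restriction of `y` to the projective cover; the lift `p` descends to `W` because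
  -- `extTransfer` is injective on the kernel `S.X₁`.
  obtain ⟨p, hp⟩ := (he.bijective_of_projective S.X₂).2
    ((Ext.mk₀ (F.map S.g)).comp y (zero_add n))
  have hp0 : (Ext.mk₀ S.f).comp p (zero_add 0) = 0 := he.injective_zero S.X₁ (hK.of_le (by lia)) (by
    rw [extTransfer_precomp, hp, map_zero, Ext.mk₀_comp_mk₀_assoc, ← F.map_comp, S.zero]
    simp)
  obtain ⟨x, rfl⟩ := Ext.contravariant_sequence_exact₂ hS Y p hp0
  refine ⟨x, ?_⟩
  rw [extTransfer_precomp, ← sub_eq_zero] at hp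
  replace hp := (map_sub ((Ext.mk₀ (F.map S.g)).precomp Z (zero_add n)) _ _).trans hp
  rw [← sub_eq_zero]
  generalize extTransfer F e S.X₃ 0 n _ x - y = z at hp
  -- The difference `z` vanishes on the projective cover, hence comes from degree `n - 1` on `S.X₁`,
  -- where there are no classes.
  rcases n with _ | n
  · have : Epi (F.map S.g) := hFS.epi_g
    apply Ext.precomp_mk₀_injective_of_epi Z (F.map S.g)
    exact hp.trans (map_zero ((Ext.mk₀ (F.map S.g)).precomp Z (zero_add 0))).symm
  · obtain ⟨z', hz'⟩ := Ext.contravariant_sequence_exact₃ hFS Z z hp (add_comm 1 n)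
    have := he.subsingleton_of_lt n (by lia) S.X₁ (hK.of_le (by lia))
    rw [← hz', Subsingleton.elim (α := Ext.{w'} (F.obj S.X₁) Z n) z' 0]
    exact Ext.comp_zero _ _ _ _ _

/-- Composition with a transfer class gives isomorphisms on modules with finitely generated
projective resolutions. -/
lemma IsTransferClass.extTransfer_bijective (he : IsTransferClass F e) (j m : ℕ) (h : j + n = m)
    (W : ModuleCat.{u} R) (hW : IsFP (m + 2) W) :
    Function.Bijective (extTransfer F e W j m h) := by
  induction j generalizing W m with
  | zero =>
    obtain rfl : n = m := by lia
    exact he.bijective_zero W hW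
  | succ j hj =>
    obtain ⟨m, rfl⟩ : ∃ m', m = m' + 1 := ⟨j + n, by lia⟩
    obtain ⟨S, hS, hP, hf, hK, rfl⟩ := hW.exists_shortExact
    have hFS := hS.map_of_exact F
    have hj' := hj m (by lia) S.X₁ hK
    have hP' := hj m (by lia) S.X₂ (isFP_of_projective S.X₂ _)
    have h0 := he.subsingleton_of_projective S.X₂ (m + 1) (by lia)
    -- Compare the long exact sequences of `0 → S.X₁ → S.X₂ → W → 0` for `Ext (-, Y)` and `Ext (F -,
    -- Z)`.
    let δ : Ext.{w'} (F.obj S.X₃) (F.obj S.X₁) 1 := hFS.extClass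
    have hδ : hS.extClass.mapExactFunctor F = δ := Ext.mapExactFunctor_extClass F hS
    refine ⟨(injective_iff_map_eq_zero _).2 fun x hx ↦ ?_, fun y ↦ ?_⟩
    · obtain ⟨x, rfl⟩ := Ext.contravariant_sequence_exact₃ hS Y x (Ext.eq_zero_of_projective _)
        (add_comm 1 j)
      rw [extTransfer_extClass hS j m (by lia), hδ] at hx
      obtain ⟨z, hz⟩ := Ext.contravariant_sequence_exact₁ hFS Z _ (add_comm 1 m) hx
      obtain ⟨p, rfl⟩ := hP'.2 z
      have : (Ext.mk₀ S.f).comp p (zero_add j) = x := hj'.1 (by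
        rw [extTransfer_precomp]
        exact hz)
      rw [← this]
      simp
    · obtain ⟨z, hz⟩ := Ext.contravariant_sequence_exact₃ hFS Z y
        (Subsingleton.elim (α := Ext.{w'} (F.obj S.X₂) Z (m + 1)) _ _) (add_comm 1 m)
      obtain ⟨x, rfl⟩ := hj'.2 z
      exact ⟨hS.extClass.comp x (add_comm 1 j), by
        rw [extTransfer_extClass hS j m (by lia), hδ]
        exact hz⟩

end Transfer

/-! ### Change of rings -/

section ChangeOfRings

variable {R T : Type u} [Ring R] [Ring T] (f : R →+* T)

lemma restrictScalars_exact (S : ShortComplex (ModuleCat.{u} T)) (h : S.Exact) :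
    (S.map (ModuleCat.restrictScalars.{u} f)).Exact := by
  rw [ShortComplex.ShortExact.moduleCat_exact_iff_function_exact] at h ⊢
  exact h

instance : PreservesFiniteLimits (ModuleCat.restrictScalars.{u} f) := by
  have := ((Functor.exact_tfae (ModuleCat.restrictScalars.{u} f)).out 1 3).mp
    (restrictScalars_exact f)
  exact this.1

instance : PreservesFiniteColimits (ModuleCat.restrictScalars.{u} f) := by
  have := ((Functor.exact_tfae (ModuleCat.restrictScalars.{u} f)).out 1 3).mp
    (restrictScalars_exact f)
  exact this.2

/-- `T` is free as a right `R`-module. -/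
def IsRightFree : Prop :=
  ∃ (J : Type u) (t : J → T), Function.Bijective fun c : J →₀ R ↦ c.sum fun j r ↦ t j * f r

variable {f}

/-- If `T` is free as a right `R`-module, restriction of scalars preserves injectivity: a map
from a left ideal `I` of `R` extends to the left ideal `T ⊗ I` of `T`, so that Baer's criterion
passes from `T` to `R`. -/
lemma IsRightFree.injective_restrictScalars (hf : IsRightFree f) (N : ModuleCat.{u} T)
    [hN : Injective N] : Injective ((ModuleCat.restrictScalars f).obj N) := by
  classical
  obtain ⟨J, t, ht⟩ := hf
  let Ψ : (J →₀ R) →+ T := Finsupp.liftAddHom fun j ↦ (AddMonoidHom.mulLeft (t j)).comp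
    f.toAddMonoidHom
  have hΨ : Function.Bijective Ψ := ht
  -- `Φ x` is the family of coordinates of `x` in the right basis `t`.
  let Φ : T ≃+ (J →₀ R) := (AddEquiv.ofBijective Ψ hΨ).symm
  have hΦt : ∀ x, x = (Φ x).sum fun j r ↦ t j * f r := fun x ↦
    ((AddEquiv.ofBijective Ψ hΨ).apply_symm_apply x).symm
  -- The coordinates are right `R`-linear; left multiplication acts on them through a matrix.
  have hΦr : ∀ (x : T) (r : R) (j : J), Φ (x * f r) j = Φ x j * r := by
    intro x r j
    have : Φ (x * f r) = (Φ x).mapRange (· * r) (zero_mul r) := by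
      rw [AddEquiv.symm_apply_eq]
      change _ = Finsupp.sum _ _
      rw [Finsupp.sum_mapRange_index (by simp)]
      conv_lhs => rw [hΦt x]
      rw [Finsupp.sum_mul]
      simp [mul_assoc]
    rw [this, Finsupp.mapRange_apply]
  have hmul : ∀ (s x : T) (l : J), Φ (s * x) l = (Φ x).sum fun j r ↦ Φ (s * t j) l * r := by
    intro s x l
    conv_lhs => rw [hΦt x, Finsupp.mul_sum, Finsupp.sum, map_sum, Finsupp.finsetSum_apply]
    simp only [← mul_assoc, hΦr]
    rfl
  rw [← Module.injective_iff_injective_object, ← Module.Baer.iff_injective]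
  have hNB : Module.Baer T N :=
    Module.Baer.iff_injective.2 (Module.injective_module_of_injective_object T N)
  intro I g
  -- The homomorphism `g` on the ideal `I`, extended by zero to a function on `R`.
  let g' : R → N := fun r ↦ if h : r ∈ I then g ⟨r, h⟩ else 0
  have g'_of : ∀ r (h : r ∈ I), g' r = g ⟨r, h⟩ := fun r h ↦ dif_pos h
  have g'_zero : g' 0 = 0 := by rw [g'_of 0 I.zero_mem]; exact map_zero g
  have g'_add : ∀ r r', r ∈ I → r' ∈ I → g' (r + r') = g' r + g' r' := by
    intro r r' h h'
    rw [g'_of _ h, g'_of _ h', g'_of _ (I.add_mem h h')]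
    exact map_add g ⟨r, h⟩ ⟨r', h'⟩
  have g'_mul : ∀ c r, r ∈ I → g' (c * r) = f c • g' r := by
    intro c r h
    rw [g'_of _ h, g'_of _ (I.mul_mem_left c h)]
    exact map_smul g c ⟨r, h⟩
  have g'_sum : ∀ (s : Finset J) (c : J → R), (∀ j, c j ∈ I) →
      g' (∑ j ∈ s, c j) = ∑ j ∈ s, g' (c j) := by
    intro s c hc
    induction s using Finset.induction_on with
    | empty => simpa using g'_zero
    | insert a s ha hs =>
      rw [Finset.sum_insert ha, Finset.sum_insert ha, g'_add _ _ (hc a)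
        (I.sum_mem fun j _ ↦ hc j), hs]
  -- `L` is the left ideal `⨁ tⱼ I`, the image of `T ⊗ I`, and `G` extends `g` to `L`.
  let L : Ideal T :=
    { carrier := {x | ∀ j, Φ x j ∈ I}
      add_mem' := fun {x y} hx hy j ↦ by
        rw [map_add]
        exact I.add_mem (hx j) (hy j)
      zero_mem' := fun j ↦ by simp
      smul_mem' := fun s x hx l ↦ by
        rw [smul_eq_mul, hmul]
        exact I.sum_mem fun j _ ↦ I.mul_mem_left _ (hx j) }
  let G₀ : T → N := fun x ↦ (Φ x).sum fun j r ↦ t j • g' r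
  have hG₀ : ∀ (x : T) (s : Finset J), (Φ x).support ⊆ s →
      G₀ x = ∑ j ∈ s, t j • g' (Φ x j) := fun x s hs ↦
    Finsupp.sum_of_support_subset _ hs _ (by simp [g'_zero])
  let G : L →ₗ[T] N :=
    { toFun := fun x ↦ G₀ x
      map_add' := fun x y ↦ by
        let s := (Φ (x + y : T)).support ∪ ((Φ (x : T)).support ∪ (Φ (y : T)).support)
        rw [Submodule.coe_add, hG₀ (x + y) s Finset.subset_union_left,
          hG₀ x s (Finset.subset_union_left.trans Finset.subset_union_right),
          hG₀ y s (Finset.subset_union_right.trans Finset.subset_union_right),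
          ← Finset.sum_add_distrib]
        refine Finset.sum_congr rfl fun j _ ↦ ?_
        rw [map_add, Finsupp.add_apply, g'_add _ _ (x.2 j) (y.2 j), smul_add]
      map_smul' := fun s x ↦ by
        let u := (Φ (s * x : T)).support ∪
          (Φ (x : T)).support.biUnion fun j ↦ (Φ (s * t j)).support
        have hu : ∀ j ∈ (Φ (x : T)).support, (Φ (s * t j)).support ⊆ u := fun j hj ↦
          (Finset.subset_biUnion_of_mem (fun j ↦ (Φ (s * t j)).support) hj).trans
            Finset.subset_union_right
        have h1 : G₀ (s * x) = ∑ l ∈ u, ∑ j ∈ (Φ (x : T)).support,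
            (t l * f (Φ (s * t j) l)) • g' (Φ (x : T) j) := by
          rw [hG₀ (s * x) u Finset.subset_union_left]
          refine Finset.sum_congr rfl fun l _ ↦ ?_
          rw [hmul, Finsupp.sum, g'_sum _ _ (fun j ↦ I.mul_mem_left _ (x.2 j)), Finset.smul_sum]
          refine Finset.sum_congr rfl fun j _ ↦ ?_
          rw [g'_mul _ _ (x.2 j), mul_smul]
        change G₀ (s * x) = s • G₀ x
        rw [h1, Finset.sum_comm]
        simp only [G₀, Finsupp.sum, Finset.smul_sum]
        refine Finset.sum_congr rfl fun j hj ↦ ?_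
        rw [← Finset.sum_smul, ← mul_smul]
        congr 1
        conv_rhs => rw [hΦt (s * t j)]
        exact (Finsupp.sum_of_support_subset _ (hu j hj) (fun j r ↦ t j * f r)
          fun i _ ↦ by rw [map_zero, mul_zero]).symm }
  -- An extension of `G` to `T` is determined by its value at `1`, which also extends `g`.
  obtain ⟨G', hG'⟩ := hNB L G
  refine ⟨(LinearMap.toSpanSingleton R ((ModuleCat.restrictScalars f).obj N) (G' 1)), ?_⟩
  intro r hr
  have h1 : f r ∈ L := fun j ↦ by
    rw [← one_mul (f r), hΦr]
    exact I.mul_mem_left _ hr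
  have h2 : G₀ (f r) = g' r := by
    have : (Φ (f r)) = (Φ 1).mapRange (· * r) (zero_mul r) := by
      ext j
      rw [← one_mul (f r), hΦr, Finsupp.mapRange_apply]
    simp only [G₀, this]
    rw [Finsupp.sum_mapRange_index (by simp [g'_zero])]
    have h3 : (1 : T) • g' r = ((Φ 1).sum fun j c ↦ t j * f c) • g' r := by rw [← hΦt 1]
    rw [one_smul] at h3
    rw [h3, Finsupp.sum, Finsupp.sum, Finset.sum_smul]
    refine Finset.sum_congr rfl fun j _ ↦ ?_
    rw [g'_mul _ _ hr, mul_smul]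
  have h3 : f r • G' 1 = G₀ (f r) := by
    rw [← map_smul, smul_eq_mul, mul_one, hG' _ h1]
    rfl
  rw [← g'_of r hr, ← h2, ← h3]
  rfl

lemma IsRightFree.preservesInjectiveObjects (hf : IsRightFree f) :
    (ModuleCat.restrictScalars.{u} f).PreservesInjectiveObjects where
  injective_obj _ := hf.injective_restrictScalars _

/-- If `T` is projective as a left `R`-module, restriction of scalars preserves projectives. -/
lemma preservesProjectiveObjects_restrictScalars
    (hf : Projective ((ModuleCat.restrictScalars f).obj (ModuleCat.of T T))) :
    (ModuleCat.restrictScalars.{u} f).PreservesProjectiveObjects where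
  projective_obj {P} hP := by
    classical
    let : Module R T := Module.compHom T f
    let : Module R P := Module.compHom P f
    have hP' : Module.Projective T P := (IsProjective.iff_projective _).2 hP
    have hT : Module.Projective R T :=
      (IsProjective.iff_projective ((ModuleCat.restrictScalars f).obj (ModuleCat.of T T))).2 hf
    have hF : Module.Projective R (P →₀ T) :=
      Module.Projective.of_equiv' (finsuppLequivDFinsupp R).symm
    obtain ⟨s, hs⟩ := Module.projective_def'.1 hP'
    have : Module.Projective R P := Module.Projective.of_split (M := P →₀ T)
      { toFun := s
        map_add' := map_add s
        map_smul' := fun r x ↦ map_smul s (f r) x }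
      { toFun := Finsupp.linearCombination T id
        map_add' := map_add _
        map_smul' := fun r x ↦ map_smul (Finsupp.linearCombination T id) (f r) x }
      (LinearMap.ext fun x ↦ LinearMap.congr_fun hs x)
    exact (IsProjective.iff_projective ((ModuleCat.restrictScalars f).obj P)).1 this

/-- If `T` is free as a right `R`-module, restriction of scalars does not increase injective
dimensions. -/
lemma IsRightFree.hasInjectiveDimensionLT (hf : IsRightFree f) (n : ℕ) (N : ModuleCat.{u} T)
    (hN : HasInjectiveDimensionLT N n) :
    HasInjectiveDimensionLT ((ModuleCat.restrictScalars f).obj N) n := by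
  induction n generalizing N with
  | zero =>
    rw [hasInjectiveDimensionLT_zero_iff_isZero] at hN ⊢
    exact Functor.map_isZero _ hN
  | succ n ih =>
    obtain _ | n := n
    · rw [zero_add, ← injective_iff_hasInjectiveDimensionLT_one] at hN ⊢
      exact hf.injective_restrictScalars N
    · obtain ⟨S, hS, hI, rfl⟩ := exists_shortExact_injective N
      have hS' := hS.map_of_exact (ModuleCat.restrictScalars.{u} f)
      exact (hS'.hasInjectiveDimensionLT_X₃_iff n (hf.injective_restrictScalars S.X₂)).1
        (ih S.X₃ ((hS.hasInjectiveDimensionLT_X₃_iff n hI).2 hN))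

end ChangeOfRings

/-! ### Bounds for injective and projective dimensions -/

section Dimension

variable {R : Type u} [Ring R]

/-- Baer's criterion for the injective dimension. -/
lemma hasInjectiveDimensionLT_of_ideal (N : ModuleCat.{u} R) (m : ℕ)
    (h : ∀ I : Ideal R, Subsingleton (Ext.{u} (ModuleCat.of R (R ⧸ I)) N (m + 1))) :
    HasInjectiveDimensionLT N (m + 1) := by
  induction m generalizing N with
  | zero =>
    rw [zero_add, ← injective_iff_hasInjectiveDimensionLT_one,
      ← Module.injective_iff_injective_object, ← Module.Baer.iff_injective]
    intro I g
    have hS : (ShortComplex.mk (ModuleCat.ofHom I.subtype) (ModuleCat.ofHom I.mkQ) (by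
        ext x; simp [Submodule.Quotient.mk_eq_zero])).ShortExact :=
      { exact := (ShortComplex.ShortExact.moduleCat_exact_iff_function_exact _).2
          (LinearMap.exact_subtype_mkQ I)
        mono_f := (ModuleCat.mono_iff_injective _).2 I.subtype_injective
        epi_g := (ModuleCat.epi_iff_surjective _).2 I.mkQ_surjective }
    have := h I
    obtain ⟨x, hx⟩ := Ext.contravariant_sequence_exact₁ hS _ (Ext.mk₀ (ModuleCat.ofHom g))
      (add_zero 1) (Subsingleton.elim _ _)
    obtain ⟨g', rfl⟩ := (Ext.mk₀_bijective _ _).2 x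
    rw [Ext.mk₀_comp_mk₀] at hx
    have h1 := (Ext.mk₀_bijective _ _).1 hx
    exact ⟨g'.hom, fun r hr ↦ congr($h1 ⟨r, hr⟩)⟩
  | succ m ih =>
    -- Pass to the cokernel of an embedding in an injective module.
    obtain ⟨S, hS, hI, rfl⟩ := exists_shortExact_injective N
    refine (hS.hasInjectiveDimensionLT_X₃_iff m hI).1 (ih S.X₃ fun I ↦ ⟨fun x y ↦ ?_⟩)
    have := h I
    have h1 : ∀ x : Ext.{u} (ModuleCat.of R (R ⧸ I)) S.X₃ (m + 1), x = 0 := fun x ↦ by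
      obtain ⟨z, rfl⟩ := Ext.covariant_sequence_exact₃ _ hS x rfl (Subsingleton.elim _ _)
      rw [Ext.eq_zero_of_injective z, Ext.zero_comp]
    rw [h1 x, h1 y]

/-- Over a noetherian ring, the injective dimension does not increase under direct sums. -/
lemma IsDirectSum.hasInjectiveDimensionLT [IsNoetherianRing R] {J : Type u}
    {N₀ N : ModuleCat.{u} R} {ι : J → (N₀ ⟶ N)} (hι : IsDirectSum ι) (m : ℕ)
    (h : HasInjectiveDimensionLT N₀ (m + 1)) : HasInjectiveDimensionLT N (m + 1) := by
  refine hasInjectiveDimensionLT_of_ideal N m fun I ↦ ?_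
  have := HasInjectiveDimensionLT.subsingleton N₀ (m + 1) (m + 1) le_rfl
    (ModuleCat.of R (R ⧸ I))
  have h1 := extSumMap_bijective hι (ModuleCat.of R (R ⧸ I)) (m + 1)
    (isFP_of_isNoetherianRing _ _)
  exact (Equiv.ofBijective _ h1).symm.subsingleton

/-- A module is a quotient of a direct sum of copies of `R`. -/
lemma exists_shortExact_free (Y : ModuleCat.{u} R) :
    ∃ (S : ShortComplex (ModuleCat.{u} R)) (_ : S.ShortExact) (J : Type u)
      (ι : J → (ModuleCat.of R R ⟶ S.X₂)), IsDirectSum ι ∧ S.X₃ = Y := by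
  let g : (Y →₀ R) →ₗ[R] Y := Finsupp.linearCombination R id
  have hg : Function.Surjective g := Finsupp.linearCombination_id_surjective R Y
  refine ⟨g.shortComplexKer, LinearMap.shortExact_shortComplexKer hg, Y,
    fun y ↦ ModuleCat.ofHom (Finsupp.lsingle y), ?_, rfl⟩
  have h : (Finsupp.lsum ℕ fun y : Y ↦ (Finsupp.lsingle y : R →ₗ[R] Y →₀ R).restrictScalars ℕ :
      (Y →₀ R) → (Y →₀ R)) = id := funext fun c ↦ Finsupp.sum_single c
  exact (congrArg Function.Bijective h).mpr Function.bijective_id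

/-- For a module with a resolution by finitely generated projectives, the vanishing of the Ext
into `R` in the top degree lowers the projective dimension. -/
lemma hasProjectiveDimensionLT_of_subsingleton_ext (W : ModuleCat.{u} R) (p : ℕ)
    (hW : IsFP (p + 2) W) (hp : HasProjectiveDimensionLT W (p + 2))
    (h : Subsingleton (Ext.{u} W (ModuleCat.of R R) (p + 1))) :
    HasProjectiveDimensionLT W (p + 1) := by
  refine hasProjectiveDimensionLT_of_enoughInjectives W (p + 1) fun Y ↦ ⟨fun x y ↦ ?_⟩
  -- Every module `Y` is a quotient of a free module, and `Ext^(p + 1) (W, -)` is right exact and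
  -- commutes with direct sums of copies of `R`.
  obtain ⟨S, hS, J, ι, hι, rfl⟩ := exists_shortExact_free Y
  have h0 := (Equiv.ofBijective _ (extSumMap_bijective hι W (p + 1) hW)).symm.subsingleton
  have h1 : ∀ x : Ext.{u} W S.X₃ (p + 1), x = 0 := fun x ↦ by
    obtain ⟨z, rfl⟩ := Ext.covariant_sequence_exact₃ _ hS x rfl
      (Ext.eq_zero_of_hasProjectiveDimensionLT _ (p + 2) le_rfl)
    rw [Subsingleton.elim z 0, Ext.zero_comp]
  rw [h1 x, h1 y]

/-- The projective dimension of a module with a resolution by finitely generated projectives is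
detected by the Ext into `R`, if it is finite. -/
lemma hasProjectiveDimensionLT_of_forall_subsingleton_ext (W : ModuleCat.{u} R) (p d : ℕ)
    (hW : ∀ m, IsFP m W) (hp : HasProjectiveDimensionLT W p)
    (h : ∀ i, d < i → Subsingleton (Ext.{u} W (ModuleCat.of R R) i)) :
    HasProjectiveDimensionLT W (d + 1) := by
  have key : ∀ e, HasProjectiveDimensionLT W (d + 1 + e) → HasProjectiveDimensionLT W (d + 1) := by
    intro e
    induction e with
    | zero => exact id
    | succ e ih =>
      intro he
      refine ih ?_
      have := hasProjectiveDimensionLT_of_subsingleton_ext W (d + e) (hW _)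
        (by convert he using 1; omega) (h _ (by omega))
      convert this using 1
      omega
  exact key p (hasProjectiveDimensionLT_of_ge W p (d + 1 + p) (by omega))

end Dimension

/-! ### Hopf algebras: the antipode, winding maps, the opposite coalgebra -/

section Hopf

open HopfAlgebra Coalgebra WithConv

variable {k H : Type u} [Field k] [Ring H] [HopfAlgebra k H]

/-- `S(h₁) h₂ ⊗ h₃ = 1 ⊗ h`. -/
lemma antipode_tmul_one_mul_comul (h : H) :
    LinearMap.mul' k (H ⊗[k] H) (TensorProduct.map
      ((TensorProduct.mk k H H).flip 1 ∘ₗ antipode k) comul (comul h)) = 1 ⊗ₜ[k] h := by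
  have key : ∀ t : H ⊗[k] H, LinearMap.mul' k (H ⊗[k] H) (TensorProduct.map
      ((TensorProduct.mk k H H).flip 1 ∘ₗ antipode k) comul t) =
      ((LinearMap.mul' k H ∘ₗ (antipode k).rTensor H).rTensor H ∘ₗ
        (TensorProduct.assoc k H H H).symm.toLinearMap) (LinearMap.lTensor H comul t) := by
    intro t
    induction t using TensorProduct.induction_on with
    | zero => simp
    | add x y hx hy => simp only [map_add, hx, hy]
    | tmul x y =>
      simp only [TensorProduct.map_tmul, LinearMap.lTensor_tmul, LinearMap.mul'_apply]
      induction comul (R := k) y using TensorProduct.induction_on with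
      | zero => simp
      | add x y hx hy => simp only [map_add, mul_add, TensorProduct.tmul_add, hx, hy]
      | tmul y z => simp
  rw [key, LinearMap.comp_apply, LinearEquiv.coe_coe, coassoc_symm_apply,
    ← LinearMap.rTensor_comp_apply, LinearMap.comp_assoc, mul_antipode_rTensor_comul,
    LinearMap.rTensor_comp_apply, rTensor_counit_comul]
  simp

/-- The antipode reverses the comultiplication. -/
lemma comul_comp_antipode :
    comul ∘ₗ antipode k = TensorProduct.map (antipode k) (antipode k) ∘ₗ
      (TensorProduct.comm k H H).toLinearMap ∘ₗ comul := by
  refine (toConv_injective (left_inv_eq_right_inv (a := toConv (comul (R := k) (A := H))) ?_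
    LinearMap.comul_right_inv)).symm
  ext h
  have key : ∀ t : H ⊗[k] H, LinearMap.mul' k (H ⊗[k] H) (TensorProduct.map
      (TensorProduct.map (antipode k) (antipode k) ∘ₗ
        (TensorProduct.comm k H H).toLinearMap ∘ₗ comul) comul t) =
      (LinearMap.mul' k (H ⊗[k] H) ∘ₗ TensorProduct.map (TensorProduct.mk k H H 1 ∘ₗ antipode k)
        (LinearMap.mul' k (H ⊗[k] H) ∘ₗ TensorProduct.map
          ((TensorProduct.mk k H H).flip 1 ∘ₗ antipode k) comul))
        (TensorProduct.assoc k H H H (LinearMap.rTensor H comul t)) := by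
    intro t
    induction t using TensorProduct.induction_on with
    | zero => simp
    | add x y hx hy => simp only [map_add, hx, hy]
    | tmul x y =>
      simp only [TensorProduct.map_tmul, LinearMap.rTensor_tmul, LinearMap.mul'_apply,
        LinearMap.comp_apply]
      induction comul (R := k) x using TensorProduct.induction_on with
      | zero => simp
      | add x y hx hy => simp only [map_add, add_mul, TensorProduct.add_tmul, hx, hy]
      | tmul z w => simp [← mul_assoc]
  have key2 : ∀ t : H ⊗[k] H, (LinearMap.mul' k (H ⊗[k] H) ∘ₗ
      TensorProduct.map (TensorProduct.mk k H H 1 ∘ₗ antipode k)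
        (LinearMap.mul' k (H ⊗[k] H) ∘ₗ TensorProduct.map
          ((TensorProduct.mk k H H).flip 1 ∘ₗ antipode k) comul)) (LinearMap.lTensor H comul t) =
      TensorProduct.mk k H H 1 (LinearMap.mul' k H ((antipode k).rTensor H t)) := by
    intro t
    induction t using TensorProduct.induction_on with
    | zero => simp
    | add x y hx hy => simp only [map_add, hx, hy]
    | tmul x y =>
      simp only [LinearMap.comp_apply, LinearMap.lTensor_tmul, TensorProduct.map_tmul,
        antipode_tmul_one_mul_comul]
      simp
  rw [LinearMap.convMul_apply]
  change LinearMap.mul' k (H ⊗[k] H) (TensorProduct.map _ comul _) = _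
  rw [key, coassoc_apply, key2, mul_antipode_rTensor_comul_apply]
  simp [Algebra.algebraMap_eq_smul_one, Algebra.TensorProduct.one_def]

lemma comul_antipode (h : H) : comul (R := k) (antipode k h) =
    TensorProduct.map (antipode k) (antipode k) (TensorProduct.comm k H H (comul h)) :=
  LinearMap.congr_fun comul_comp_antipode h

variable (H) in
/-- The antipode as a linear equivalence, if it is bijective. -/
def antipodeEquiv (hS : Function.Bijective (antipode k : H →ₗ[k] H)) : H ≃ₗ[k] H :=
  LinearEquiv.ofBijective (antipode k) hS

@[simp] lemma antipode_antipodeEquiv_symm (hS : Function.Bijective (antipode k : H →ₗ[k] H))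
    (h : H) : antipode k ((antipodeEquiv H hS).symm h) = h :=
  (antipodeEquiv H hS).apply_symm_apply h

@[simp] lemma antipodeEquiv_symm_antipode (hS : Function.Bijective (antipode k : H →ₗ[k] H))
    (h : H) : (antipodeEquiv H hS).symm (antipode k h) = h :=
  (antipodeEquiv H hS).symm_apply_apply h

lemma antipodeEquiv_symm_mul (hS : Function.Bijective (antipode k : H →ₗ[k] H)) (g h : H) :
    (antipodeEquiv H hS).symm (g * h) =
      (antipodeEquiv H hS).symm h * (antipodeEquiv H hS).symm g := by
  apply hS.1
  simp [antipode_mul_antidistrib]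

lemma antipodeEquiv_symm_one (hS : Function.Bijective (antipode k : H →ₗ[k] H)) :
    (antipodeEquiv H hS).symm 1 = 1 := by
  rw [LinearEquiv.symm_apply_eq]
  exact antipode_one.symm

lemma antipodeEquiv_symm_algebraMap (hS : Function.Bijective (antipode k : H →ₗ[k] H)) (c : k) :
    (antipodeEquiv H hS).symm (algebraMap k H c) = algebraMap k H c := by
  rw [Algebra.algebraMap_eq_smul_one, map_smul, antipodeEquiv_symm_one]

/-- `S⁻¹(h₂) h₁ = ε(h)`. -/
lemma antipodeEquiv_symm_mul_comul (hS : Function.Bijective (antipode k : H →ₗ[k] H)) :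
    LinearMap.mul' k H ∘ₗ LinearMap.rTensor H (antipodeEquiv H hS).symm.toLinearMap ∘ₗ
      (TensorProduct.comm k H H).toLinearMap ∘ₗ comul = Algebra.linearMap k H ∘ₗ counit := by
  ext h
  apply hS.1
  have key : ∀ t : H ⊗[k] H, antipode k (LinearMap.mul' k H (LinearMap.rTensor H
      (antipodeEquiv H hS).symm.toLinearMap (TensorProduct.comm k H H t))) =
        LinearMap.mul' k H ((antipode k).rTensor H t) := by
    intro t
    induction t using TensorProduct.induction_on with
    | zero => simp
    | add x y hx hy => simp only [map_add, hx, hy]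
    | tmul x y => simp [antipode_mul_antidistrib]
  simp [key, Algebra.algebraMap_eq_smul_one]

/-- `h₂ S⁻¹(h₁) = ε(h)`. -/
lemma mul_antipodeEquiv_symm_comul (hS : Function.Bijective (antipode k : H →ₗ[k] H)) :
    LinearMap.mul' k H ∘ₗ LinearMap.lTensor H (antipodeEquiv H hS).symm.toLinearMap ∘ₗ
      (TensorProduct.comm k H H).toLinearMap ∘ₗ comul = Algebra.linearMap k H ∘ₗ counit := by
  ext h
  apply hS.1
  have key : ∀ t : H ⊗[k] H, antipode k (LinearMap.mul' k H (LinearMap.lTensor H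
      (antipodeEquiv H hS).symm.toLinearMap (TensorProduct.comm k H H t))) =
        LinearMap.mul' k H ((antipode k).lTensor H t) := by
    intro t
    induction t using TensorProduct.induction_on with
    | zero => simp
    | add x y hx hy => simp only [map_add, hx, hy]
    | tmul x y => simp [antipode_mul_antidistrib]
  simp [key, Algebra.algebraMap_eq_smul_one]

/-! ### Winding maps -/

/-- The map `h ↦ χ(h₁) h₂`. -/
def winding (χ : H →ₗ[k] k) : H →ₗ[k] H :=
  TensorProduct.lid k H ∘ₗ LinearMap.rTensor H χ ∘ₗ comul

lemma winding_winding (χ χ' : H →ₗ[k] k) (h : H) :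
    winding χ (winding χ' h) =
      winding (LinearMap.mul' k k ∘ₗ TensorProduct.map χ' χ ∘ₗ comul) h := by
  have key : ∀ t : H ⊗[k] H, winding χ (TensorProduct.lid k H (LinearMap.rTensor H χ' t)) =
      (TensorProduct.lid k H ∘ₗ LinearMap.rTensor H (LinearMap.mul' k k ∘ₗ TensorProduct.map χ' χ)
        ∘ₗ (TensorProduct.assoc k H H H).symm.toLinearMap) (LinearMap.lTensor H comul t) := by
    intro t
    induction t using TensorProduct.induction_on with
    | zero => simp
    | add x y hx hy => simp only [map_add, hx, hy]
    | tmul x y =>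
      simp only [winding, LinearMap.rTensor_tmul, TensorProduct.lid_tmul, map_smul,
        LinearMap.comp_apply, LinearMap.lTensor_tmul, LinearEquiv.coe_coe]
      induction comul (R := k) y using TensorProduct.induction_on with
      | zero => simp
      | add x y hx hy => simp only [map_add, smul_add, TensorProduct.tmul_add, hx, hy]
      | tmul y z => simp [mul_smul]
  change winding χ (TensorProduct.lid k H (LinearMap.rTensor H χ' (comul h))) = _
  rw [key, LinearMap.comp_apply, LinearMap.comp_apply, LinearEquiv.coe_coe, LinearEquiv.coe_coe,
    coassoc_symm_apply, ← LinearMap.rTensor_comp_apply]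
  rfl

lemma winding_counit (h : H) : winding (counit (R := k)) h = h := by
  simp [winding]

/-- The winding map of an algebra homomorphism `χ : H → k` is bijective, with inverse the winding
map of `χ ∘ S`. -/
lemma winding_bijective (χ : H →ₐ[k] k) : Function.Bijective (winding χ.toLinearMap) := by
  have h1 : LinearMap.mul' k k ∘ₗ TensorProduct.map χ.toLinearMap
      (χ.toLinearMap ∘ₗ antipode k) ∘ₗ comul = counit := by
    ext h
    have key : ∀ t : H ⊗[k] H, LinearMap.mul' k k (TensorProduct.map χ.toLinearMap
      (χ.toLinearMap ∘ₗ antipode k) t) = χ (LinearMap.mul' k H ((antipode k).lTensor H t)) := by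
      intro t
      induction t using TensorProduct.induction_on with
      | zero => simp
      | add x y hx hy => simp only [map_add, hx, hy]
      | tmul x y => simp
    simp [key]
  have h2 : LinearMap.mul' k k ∘ₗ TensorProduct.map (χ.toLinearMap ∘ₗ antipode k)
      χ.toLinearMap ∘ₗ comul = counit := by
    ext h
    have key : ∀ t : H ⊗[k] H, LinearMap.mul' k k (TensorProduct.map (χ.toLinearMap ∘ₗ antipode k)
      χ.toLinearMap t) = χ (LinearMap.mul' k H ((antipode k).rTensor H t)) := by
      intro t
      induction t using TensorProduct.induction_on with
      | zero => simp
      | add x y hx hy => simp only [map_add, hx, hy]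
      | tmul x y => simp
    simp [key]
  refine Function.bijective_iff_has_inverse.2 ⟨winding (χ.toLinearMap ∘ₗ antipode k), ?_, ?_⟩
  · intro h
    rw [winding_winding, h1, winding_counit]
  · intro h
    rw [winding_winding, h2, winding_counit]

/-! ### The co-opposite Hopf algebra -/

/-- A copy of the algebra `H`, for the opposite comultiplication. -/
def Cop (H : Type u) : Type u := H

instance : Ring (Cop H) := inferInstanceAs (Ring H)

instance : Algebra k (Cop H) := inferInstanceAs (Algebra k H)

/-- The co-opposite of a Hopf algebra with bijective antipode: the comultiplication is
`h ↦ h₂ ⊗ h₁` and the antipode is `S⁻¹`. -/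
@[reducible] def copHopfAlgebra (hS : Function.Bijective (antipode k : H →ₗ[k] H)) :
    HopfAlgebra k (Cop H) :=
  { (inferInstance : Algebra k (Cop H)) with
    comul := ((TensorProduct.comm k H H).toLinearMap ∘ₗ comul : H →ₗ[k] H ⊗[k] H)
    counit := (counit : H →ₗ[k] k)
    coassoc := by
      change TensorProduct.assoc k H H H ∘ₗ LinearMap.rTensor H
        ((TensorProduct.comm k H H).toLinearMap ∘ₗ comul) ∘ₗ
        ((TensorProduct.comm k H H).toLinearMap ∘ₗ comul) = LinearMap.lTensor H
        ((TensorProduct.comm k H H).toLinearMap ∘ₗ comul) ∘ₗ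
        ((TensorProduct.comm k H H).toLinearMap ∘ₗ comul)
      ext h
      let σ : H ⊗[k] (H ⊗[k] H) →ₗ[k] H ⊗[k] (H ⊗[k] H) :=
        LinearMap.lTensor H (TensorProduct.comm k H H).toLinearMap ∘ₗ
          (TensorProduct.assoc k H H H).toLinearMap ∘ₗ
            (TensorProduct.comm k H (H ⊗[k] H)).toLinearMap
      have h1 : ∀ t : H ⊗[k] H, TensorProduct.assoc k H H H (LinearMap.rTensor H
          ((TensorProduct.comm k H H).toLinearMap ∘ₗ comul) (TensorProduct.comm k H H t)) =
            TensorProduct.assoc k H H H ((TensorProduct.comm k H H).toLinearMap.rTensor H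
              (TensorProduct.comm k H (H ⊗[k] H) (LinearMap.lTensor H comul t))) := by
        intro t
        induction t using TensorProduct.induction_on with
        | zero => simp
        | add x y hx hy => simp only [map_add, hx, hy]
        | tmul x y => simp
      have h2 : ∀ t : H ⊗[k] H, LinearMap.lTensor H
          ((TensorProduct.comm k H H).toLinearMap ∘ₗ comul) (TensorProduct.comm k H H t) =
            TensorProduct.assoc k H H H ((TensorProduct.comm k H H).toLinearMap.rTensor H
              (TensorProduct.comm k H (H ⊗[k] H) (TensorProduct.assoc k H H H
                (LinearMap.rTensor H comul t)))) := by
        intro t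
        induction t using TensorProduct.induction_on with
        | zero => simp
        | add x y hx hy => simp only [map_add, hx, hy]
        | tmul x y =>
          simp only [TensorProduct.comm_tmul, LinearMap.lTensor_tmul, LinearMap.rTensor_tmul,
            LinearMap.comp_apply]
          induction comul (R := k) x using TensorProduct.induction_on with
          | zero => simp
          | add x y hx hy =>
            simp only [map_add, TensorProduct.add_tmul, TensorProduct.tmul_add, hx, hy]
          | tmul z w => simp
      simp only [LinearMap.comp_apply, LinearEquiv.coe_coe]
      rw [h1, h2, coassoc_apply]
    rTensor_counit_comp_comul := by
      change LinearMap.rTensor H counit ∘ₗ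
        ((TensorProduct.comm k H H).toLinearMap ∘ₗ comul) = TensorProduct.mk k k H 1
      ext h
      have h1 : ∀ t : H ⊗[k] H, LinearMap.rTensor H counit (TensorProduct.comm k H H t) =
          TensorProduct.comm k H k (LinearMap.lTensor H (counit (R := k)) t) := by
        intro t
        induction t using TensorProduct.induction_on with
        | zero => simp
        | add x y hx hy => simp only [map_add, hx, hy]
        | tmul x y => simp
      simp [h1]
    lTensor_counit_comp_comul := by
      change LinearMap.lTensor H counit ∘ₗ
        ((TensorProduct.comm k H H).toLinearMap ∘ₗ comul) = (TensorProduct.mk k H k).flip 1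
      ext h
      have h1 : ∀ t : H ⊗[k] H, LinearMap.lTensor H counit (TensorProduct.comm k H H t) =
          TensorProduct.comm k k H (LinearMap.rTensor H (counit (R := k)) t) := by
        intro t
        induction t using TensorProduct.induction_on with
        | zero => simp
        | add x y hx hy => simp only [map_add, hx, hy]
        | tmul x y => simp
      simp [h1]
    counit_one := Bialgebra.counit_one (R := k) (A := H)
    mul_compr₂_counit := Bialgebra.mul_compr₂_counit (R := k) (A := H)
    comul_one := by
      change TensorProduct.comm k H H (comul (1 : H)) = (1 : H) ⊗ₜ[k] (1 : H)
      rw [Bialgebra.comul_one]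
      rfl
    mul_compr₂_comul := by
      refine LinearMap.ext₂ fun (a b : H) ↦ ?_
      change TensorProduct.comm k H H (comul (a * b)) =
        (TensorProduct.comm k H H (comul a) * TensorProduct.comm k H H (comul b) : H ⊗[k] H)
      rw [Bialgebra.comul_mul]
      exact map_mul (Algebra.TensorProduct.comm k H H) _ _
    antipode := ((antipodeEquiv H hS).symm.toLinearMap : H →ₗ[k] H)
    mul_antipode_rTensor_comul := antipodeEquiv_symm_mul_comul hS
    mul_antipode_lTensor_comul := mul_antipodeEquiv_symm_comul hS }

/-! ### The twist `H ⊗ M → M ⊗ H` -/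

/-- The twist `h ⊗ m ↦ h₁ m ⊗ h₂`, for an action of `H` on `M`. -/
def twist {M : Type u} [AddCommGroup M] [Module k M] (L : H →ₐ[k] Module.End k M) :
    H ⊗[k] M →ₗ[k] M ⊗[k] H :=
  LinearMap.rTensor H (TensorProduct.lift L.toLinearMap) ∘ₗ
    (TensorProduct.rightComm k H H M).toLinearMap ∘ₗ LinearMap.rTensor M comul

lemma twist_tmul {M : Type u} [AddCommGroup M] [Module k M] (L : H →ₐ[k] Module.End k M)
    (h : H) (m : M) : twist L (h ⊗ₜ m) =
      TensorProduct.map (L.toLinearMap.flip m) LinearMap.id (comul h) := by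
  simp only [twist, LinearMap.comp_apply, LinearMap.rTensor_tmul, LinearEquiv.coe_coe]
  induction comul (R := k) h using TensorProduct.induction_on with
  | zero => simp
  | add x y hx hy => simp only [map_add, TensorProduct.add_tmul, hx, hy]
  | tmul x y => simp

/-- If the antipode is bijective, the twist is bijective, with inverse
`m ⊗ h ↦ h₂ ⊗ S⁻¹(h₁) m`. -/
lemma twist_bijective (hS : Function.Bijective (antipode k : H →ₗ[k] H)) {M : Type u}
    [AddCommGroup M] [Module k M] (L : H →ₐ[k] Module.End k M) :
    Function.Bijective (twist L) := by
  let T : H →ₗ[k] H := (antipodeEquiv H hS).symm.toLinearMap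
  let act : H ⊗[k] M →ₗ[k] M := TensorProduct.lift L.toLinearMap
  have hact : ∀ x m, act (x ⊗ₜ m) = L x m := fun x m ↦ rfl
  -- `τ` is the inverse `m ⊗ h ↦ h₂ ⊗ S⁻¹(h₁) m`.
  let τ : M ⊗[k] H →ₗ[k] H ⊗[k] M :=
    LinearMap.lTensor H (act ∘ₗ LinearMap.rTensor M T) ∘ₗ
      (TensorProduct.assoc k H H M).toLinearMap ∘ₗ
        (TensorProduct.comm k M (H ⊗[k] H)).toLinearMap ∘ₗ
        LinearMap.lTensor M ((TensorProduct.comm k H H).toLinearMap ∘ₗ comul)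
  have hτ : ∀ m x, τ (m ⊗ₜ x) = TensorProduct.map LinearMap.id (L.toLinearMap.flip m ∘ₗ T)
      (TensorProduct.comm k H H (comul x)) := by
    intro m x
    simp only [τ, LinearMap.comp_apply, LinearMap.lTensor_tmul, LinearEquiv.coe_coe]
    induction comul (R := k) x using TensorProduct.induction_on with
    | zero => simp
    | add x y hx hy => simp only [map_add, TensorProduct.tmul_add, hx, hy]
    | tmul x y => simp [hact]
  refine Function.bijective_iff_has_inverse.2 ⟨τ, ?_, ?_⟩
  · refine LinearMap.congr_fun (f := τ ∘ₗ twist L) (g := LinearMap.id) (TensorProduct.ext' ?_)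
    intro h m
    let K : H ⊗[k] H →ₗ[k] H ⊗[k] M :=
      TensorProduct.map LinearMap.id (L.toLinearMap.flip m) ∘ₗ
        (TensorProduct.comm k H H).toLinearMap
    let ν : H ⊗[k] H →ₗ[k] H :=
      LinearMap.mul' k H ∘ₗ LinearMap.rTensor H T ∘ₗ (TensorProduct.comm k H H).toLinearMap
    have key : ∀ t : H ⊗[k] H, τ (TensorProduct.map (L.toLinearMap.flip m) LinearMap.id t) =
        K (LinearMap.rTensor H ν
          ((TensorProduct.assoc k H H H).symm (LinearMap.lTensor H comul t))) := by
      intro t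
      induction t using TensorProduct.induction_on with
      | zero => simp
      | add x y hx hy => simp only [map_add, hx, hy]
      | tmul x y =>
        rw [TensorProduct.map_tmul, LinearMap.id_apply, hτ, LinearMap.lTensor_tmul]
        induction comul (R := k) y using TensorProduct.induction_on with
        | zero => simp
        | add x y hx hy => simp only [map_add, TensorProduct.tmul_add, hx, hy]
        | tmul y z => simp [K, ν]
    rw [LinearMap.comp_apply, twist_tmul, key, coassoc_symm_apply, ← LinearMap.rTensor_comp_apply,
      LinearMap.comp_assoc, LinearMap.comp_assoc, antipodeEquiv_symm_mul_comul,
      LinearMap.rTensor_comp_apply, rTensor_counit_comul]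
    simp [K]
  · refine LinearMap.congr_fun (f := twist L ∘ₗ τ) (g := LinearMap.id) (TensorProduct.ext' ?_)
    intro m h
    let K : H ⊗[k] H →ₗ[k] M ⊗[k] H :=
      TensorProduct.map (L.toLinearMap.flip m) LinearMap.id
    let ν : H ⊗[k] H →ₗ[k] H :=
      LinearMap.mul' k H ∘ₗ LinearMap.lTensor H T ∘ₗ (TensorProduct.comm k H H).toLinearMap
    have key : ∀ t : H ⊗[k] H, twist L (TensorProduct.map LinearMap.id (L.toLinearMap.flip m ∘ₗ T)
        (TensorProduct.comm k H H t)) = K (LinearMap.rTensor H ν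
          ((TensorProduct.assoc k H H H).symm (LinearMap.lTensor H comul t))) := by
      intro t
      induction t using TensorProduct.induction_on with
      | zero => simp
      | add x y hx hy => simp only [map_add, hx, hy]
      | tmul x y =>
        rw [TensorProduct.comm_tmul, TensorProduct.map_tmul, LinearMap.id_apply, twist_tmul,
          LinearMap.lTensor_tmul]
        induction comul (R := k) y using TensorProduct.induction_on with
        | zero => simp
        | add x y hx hy => simp only [map_add, TensorProduct.tmul_add, hx, hy]
        | tmul y z => simp [K, ν]
    rw [LinearMap.comp_apply, hτ, key, coassoc_symm_apply, ← LinearMap.rTensor_comp_apply,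
      LinearMap.comp_assoc, LinearMap.comp_assoc, mul_antipodeEquiv_symm_comul,
      LinearMap.rTensor_comp_apply, rTensor_counit_comul]
    simp [K]

end Hopf

/-! ### Integrals on finite-dimensional Hopf algebras -/

section Integral

open HopfAlgebra Coalgebra

variable {k H : Type u} [Field k] [Ring H] [HopfAlgebra k H]

/-- The map `h ↦ h₁ f(h₂)`. -/
def rightConv (f : H →ₗ[k] k) : H →ₗ[k] H :=
  TensorProduct.rid k H ∘ₗ LinearMap.lTensor H f ∘ₗ comul

lemma rightConv_apply (f : H →ₗ[k] k) (h : H) :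
    rightConv f h = TensorProduct.rid k H (LinearMap.lTensor H f (comul h)) := rfl

lemma rightConv_sum {ι : Type*} (s : Finset ι) (f : ι → H →ₗ[k] k) (h : H) :
    rightConv (∑ i ∈ s, f i) h = ∑ i ∈ s, rightConv (f i) h := by
  simp only [rightConv_apply]
  rw [← map_sum]
  congr 1
  have : LinearMap.lTensor H (∑ i ∈ s, f i) = ∑ i ∈ s, LinearMap.lTensor H (f i) :=
    map_sum (LinearMap.lTensorHom H) f s
  rw [this, LinearMap.sum_apply]

lemma counit_rightConv (f : H →ₗ[k] k) (h : H) : counit (R := k) (rightConv f h) = f h := by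
  have key : ∀ t : H ⊗[k] H, counit (R := k) (TensorProduct.rid k H (LinearMap.lTensor H f t)) =
      f (TensorProduct.lid k H (LinearMap.rTensor H counit t)) := by
    intro t
    induction t using TensorProduct.induction_on with
    | zero => simp
    | add x y hx hy => simp only [map_add, hx, hy]
    | tmul x y => simp [mul_comm]
  simp [rightConv_apply, key]

/-- `h₁ S(h₂ f(h₃)) = f(h) 1`. -/
lemma mul_antipode_rightConv (f : H →ₗ[k] k) (h : H) :
    LinearMap.mul' k H (LinearMap.lTensor H (antipode k ∘ₗ rightConv f) (comul h)) = f h • 1 := by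
  have key : ∀ t : H ⊗[k] H,
      LinearMap.mul' k H (LinearMap.lTensor H (antipode k ∘ₗ rightConv f) t) =
      ((TensorProduct.rid k H).toLinearMap ∘ₗ
        TensorProduct.map (LinearMap.mul' k H ∘ₗ LinearMap.lTensor H (antipode k)) f)
          ((TensorProduct.assoc k H H H).symm (LinearMap.lTensor H comul t)) := by
    intro t
    induction t using TensorProduct.induction_on with
    | zero => simp
    | add x y hx hy => simp only [map_add, hx, hy]
    | tmul x y =>
      simp only [LinearMap.lTensor_tmul, LinearMap.comp_apply, rightConv_apply]
      induction comul (R := k) y using TensorProduct.induction_on with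
      | zero => simp
      | add x y hx hy => simp only [map_add, TensorProduct.tmul_add, hx, hy]
      | tmul y z => simp
  have key2 : ∀ t : H ⊗[k] H, ((TensorProduct.rid k H).toLinearMap ∘ₗ
        TensorProduct.map (LinearMap.mul' k H ∘ₗ LinearMap.lTensor H (antipode k)) f)
          (LinearMap.rTensor H comul t) =
      f (TensorProduct.lid k H (LinearMap.rTensor H counit t)) • 1 := by
    intro t
    induction t using TensorProduct.induction_on with
    | zero => simp
    | add x y hx hy => simp only [map_add, add_smul, hx, hy]
    | tmul x y => simp [Algebra.algebraMap_eq_smul_one, smul_smul, mul_comm]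
  rw [key, coassoc_symm_apply, key2, rTensor_counit_comul]
  simp

/-- `y₁ f(y₂ S(h)) = (y S(h₁))₁ f((y S(h₁))₂) h₂`: the dual of `H` is a Hopf module. -/
lemma rightConv_comp_mulRight_antipode (f : H →ₗ[k] k) (y h : H) :
    rightConv (f ∘ₗ LinearMap.mulRight k (antipode k h)) y =
      LinearMap.mul' k H (LinearMap.rTensor H
        (rightConv f ∘ₗ LinearMap.mulLeft k y ∘ₗ antipode k) (comul h)) := by
  let Q : H ⊗[k] H →ₗ[k] H := TensorProduct.rid k H ∘ₗ LinearMap.lTensor H f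
  have hQ : ∀ (t : H ⊗[k] H) (z : H), Q t * z = Q (t * z ⊗ₜ 1) := by
    intro t z
    induction t using TensorProduct.induction_on with
    | zero => simp
    | add x y hx hy => simp only [map_add, add_mul, hx, hy]
    | tmul x y => simp [Q]
  let G : H ⊗[k] (H ⊗[k] H) →ₗ[k] H ⊗[k] H := (TensorProduct.comm k H H).toLinearMap ∘ₗ
    TensorProduct.map (antipode k) (LinearMap.mul' k H ∘ₗ LinearMap.rTensor H (antipode k))
  have key : ∀ t : H ⊗[k] H, LinearMap.mul' k H (LinearMap.rTensor H
        (rightConv f ∘ₗ LinearMap.mulLeft k y ∘ₗ antipode k) t) =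
      Q (comul y * G (TensorProduct.assoc k H H H (LinearMap.rTensor H comul t))) := by
    intro t
    induction t using TensorProduct.induction_on with
    | zero => simp
    | add x y hx hy => simp only [map_add, mul_add, hx, hy]
    | tmul x z =>
      simp only [LinearMap.rTensor_tmul, LinearMap.comp_apply, LinearMap.mul'_apply,
        LinearMap.mulLeft_apply]
      change Q (comul (y * antipode k x)) * z = _
      rw [hQ, Bialgebra.comul_mul, comul_antipode, mul_assoc]
      congr 2
      induction comul (R := k) x using TensorProduct.induction_on with
      | zero => simp
      | add x y hx hy => simp only [map_add, TensorProduct.add_tmul, add_mul, hx, hy]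
      | tmul x w => simp [G]
  have h1 : G ∘ₗ LinearMap.lTensor H comul = (TensorProduct.comm k H H).toLinearMap ∘ₗ
      TensorProduct.map (antipode k) (Algebra.linearMap k H ∘ₗ counit) := by
    rw [← mul_antipode_rTensor_comul]
    ext x z
    simp [G]
  -- `G (h₁ ⊗ h₂ ⊗ h₃) = S(h₂) h₃ ⊗ S(h₁)`.
  have h2 : G (LinearMap.lTensor H comul (comul h)) = 1 ⊗ₜ antipode k h := by
    have := LinearMap.congr_fun h1 (comul h)
    rw [LinearMap.comp_apply] at this
    rw [this]
    have h3 : TensorProduct.map (antipode k) (Algebra.linearMap k H ∘ₗ counit) =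
        TensorProduct.map (antipode k) (Algebra.linearMap k H) ∘ₗ
          LinearMap.lTensor H (counit (R := k) (A := H)) := by
      exact TensorProduct.ext' fun x y ↦ rfl
    rw [LinearMap.comp_apply, h3, LinearMap.comp_apply, lTensor_counit_comul]
    simp
  rw [key, coassoc_apply, h2, rightConv_apply]
  induction comul (R := k) y using TensorProduct.induction_on with
  | zero => simp
  | add x y hx hy => simp only [map_add, add_mul, hx, hy]
  | tmul y z => simp [Q]

/-- A linear form `f` on `H` with `h₁ f(h₂) = f(h) 1`. -/
def IsIntegral (f : H →ₗ[k] k) : Prop := ∀ h, rightConv f h = f h • 1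

section

variable {ι : Type u} [Fintype ι] (b : Module.Basis ι k H)

/-- If `h₁ f(h₂) = ∑ᵢ φᵢ(h) bᵢ` for all `h`, then `∑ᵢ y₁ φᵢ(y₂) ⊗ bᵢ = Δ(y₁ f(y₂))`. -/
lemma sum_rightConv_tmul (f : H →ₗ[k] k) (y : H) :
    ∑ i, rightConv (b.coord i ∘ₗ rightConv f) y ⊗ₜ[k] b i = comul (rightConv f y) := by
  have key : ∀ t : H ⊗[k] H, ∑ i, TensorProduct.rid k H (LinearMap.lTensor H
      (b.coord i ∘ₗ rightConv f) t) ⊗ₜ[k] b i = LinearMap.lTensor H (rightConv f) t := by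
    intro t
    induction t using TensorProduct.induction_on with
    | zero => simp
    | add x y hx hy => simp only [map_add, TensorProduct.add_tmul, Finset.sum_add_distrib, hx, hy]
    | tmul x z =>
      simp only [LinearMap.lTensor_tmul, TensorProduct.rid_tmul, TensorProduct.smul_tmul]
      rw [← TensorProduct.tmul_sum]
      congr 1
      exact b.sum_repr _
  have key2 : ∀ t : H ⊗[k] H, LinearMap.lTensor H (rightConv f) t = (LinearMap.lTensor H
      (TensorProduct.rid k H ∘ₗ LinearMap.lTensor H f)) (LinearMap.lTensor H comul t) := by
    intro t
    rw [← LinearMap.lTensor_comp_apply]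
    rfl
  have key3 : ∀ t : H ⊗[k] H, (LinearMap.lTensor H
      (TensorProduct.rid k H ∘ₗ LinearMap.lTensor H f)) (TensorProduct.assoc k H H H
        (LinearMap.rTensor H comul t)) =
      comul (TensorProduct.rid k H (LinearMap.lTensor H f t)) := by
    intro t
    induction t using TensorProduct.induction_on with
    | zero => simp
    | add x y hx hy => simp only [map_add, hx, hy]
    | tmul x z =>
      simp only [LinearMap.rTensor_tmul, LinearMap.lTensor_tmul, TensorProduct.rid_tmul, map_smul]
      induction comul (R := k) x using TensorProduct.induction_on with
      | zero => simp
      | add x y hx hy => simp only [map_add, TensorProduct.add_tmul, smul_add, hx, hy]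
      | tmul x w => simp
  simp only [rightConv_apply _ y]
  rw [key, key2, ← coassoc_apply, key3]

/-- The trace of `z ↦ C(x S²(z))`, where `C(h) = h₁ f(h₂)`. -/
def traceForm (f : H →ₗ[k] k) : H →ₗ[k] k :=
  ∑ j, b.coord j ∘ₗ rightConv f ∘ₗ LinearMap.mulRight k (antipode k (antipode k (b j)))

/-- The trace form of every linear form is an integral. This replaces the fundamental theorem of
Hopf modules for the dual of `H`. -/
lemma isIntegral_traceForm (f : H →ₗ[k] k) : IsIntegral (traceForm b f) := by
  intro y
  let Ξ (j : ι) : H ⊗[k] H →ₗ[k] H :=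
    LinearMap.mul' k H ∘ₗ LinearMap.lTensor H (antipode k ∘ₗ rightConv (b.coord j))
  let yy (j : ι) : H := y * antipode k (antipode k (b j))
  -- The Hopf module identity for `S (S bᵢ)`, whose comultiplication is expanded in the basis.
  have h1 : ∀ i, rightConv ((b.coord i ∘ₗ rightConv f) ∘ₗ
      LinearMap.mulRight k (antipode k (antipode k (b i)))) y =
        ∑ j, Ξ j (rightConv (b.coord i ∘ₗ rightConv f) (yy j) ⊗ₜ b i) := by
    intro i
    rw [rightConv_comp_mulRight_antipode, comul_antipode]
    simp only [Ξ, LinearMap.comp_apply, LinearMap.lTensor_tmul, LinearMap.mul'_apply,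
      rightConv_apply (b.coord _) (b i)]
    induction comul (R := k) (b i) using TensorProduct.induction_on with
    | zero => simp
    | add x y hx hy => simp only [map_add, mul_add, Finset.sum_add_distrib, hx, hy]
    | tmul x z =>
      simp only [TensorProduct.comm_tmul, TensorProduct.map_tmul, LinearMap.rTensor_tmul,
        LinearMap.lTensor_tmul, TensorProduct.rid_tmul, LinearMap.mul'_apply, map_smul,
        Algebra.mul_smul_comm, ← Algebra.smul_mul_assoc]
      rw [← Finset.sum_mul]
      congr 1
      conv_lhs => rw [← b.sum_repr z]
      simp only [map_sum, map_smul]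
      rfl
  -- By `sum_rightConv_tmul`, the sum over `i` is an expression `h₁ S(h₂ φ(h₃))`.
  have h2 : ∀ j, ∑ i, Ξ j (rightConv (b.coord i ∘ₗ rightConv f) (yy j) ⊗ₜ b i) =
      b.coord j (rightConv f (yy j)) • 1 := by
    intro j
    rw [← map_sum, sum_rightConv_tmul, ← mul_antipode_rightConv (b.coord j)]
    rfl
  calc rightConv (traceForm b f) y = ∑ i, ∑ j, Ξ j
        (rightConv (b.coord i ∘ₗ rightConv f) (yy j) ⊗ₜ b i) := by
        rw [traceForm, rightConv_sum]
        exact Finset.sum_congr rfl fun i _ ↦ h1 i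
    _ = traceForm b f y • 1 := by
        rw [Finset.sum_comm, traceForm, LinearMap.sum_apply, Finset.sum_smul]
        exact Finset.sum_congr rfl fun j _ ↦ h2 j

/-- Every linear form is a combination of translates of trace forms. Hence not all trace forms
vanish on a nonzero `H`. -/
lemma sum_traceForm (f : H →ₗ[k] k) (y : H) :
    ∑ i, traceForm b (b.coord i ∘ₗ rightConv f) (y * antipode k (b i)) = f y := by
  let ψ (l j : ι) : H ⊗[k] H →ₗ[k] k :=
    LinearMap.mul' k k ∘ₗ TensorProduct.map (b.coord j) (b.coord l)
  let yy (l j : ι) : H := y * antipode k (antipode k (b j) * b l)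
  -- Write the form as a double sum, in order to sum over `i` first by `sum_rightConv_tmul`.
  have h1 : ∀ i, traceForm b (b.coord i ∘ₗ rightConv f) (y * antipode k (b i)) =
      ∑ l, ∑ j, ψ l j (rightConv (b.coord i ∘ₗ rightConv f) (yy l j) ⊗ₜ b i) := by
    intro i
    classical
    rw [Finset.sum_eq_single i]
    · simp [traceForm, ψ, yy, antipode_mul_antidistrib, mul_assoc]
    · intro l _ hl
      simp [ψ, hl.symm]
    · simp
  simp only [h1]
  rw [Finset.sum_comm]
  have h2 : ∀ l, ∑ i, ∑ j, ψ l j (rightConv (b.coord i ∘ₗ rightConv f) (yy l j) ⊗ₜ b i) =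
      ∑ j, ψ l j (comul (rightConv f (yy l j))) := by
    intro l
    rw [Finset.sum_comm]
    exact Finset.sum_congr rfl fun j _ ↦ by rw [← map_sum, sum_rightConv_tmul]
  have h3 : ∀ z, rightConv f z = ∑ i, b.coord i (rightConv f z) • b i := fun z ↦
    (b.sum_repr _).symm
  -- The sum over `j` and `l` then produces `S(x₁) x₂`, where `S` is the antipode.
  have h4 : ∀ i (t : H ⊗[k] H), ∑ l, ∑ j, b.coord i (rightConv f (yy l j)) • ψ l j t =
      b.coord i (rightConv f (y * antipode k (LinearMap.mul' k H ((antipode k).rTensor H t)))) := by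
    intro i t
    induction t using TensorProduct.induction_on with
    | zero => simp
    | add x y hx hy => simp only [map_add, smul_add, mul_add, Finset.sum_add_distrib, hx, hy]
    | tmul x z =>
      have : antipode k x * z = ∑ l, ∑ j, (b.coord j x * b.coord l z) •
          (antipode k (b j) * b l) := by
        conv_lhs => rw [← b.sum_repr x, ← b.sum_repr z]
        rw [map_sum, Finset.sum_mul_sum, Finset.sum_comm]
        refine Finset.sum_congr rfl fun l _ ↦ Finset.sum_congr rfl fun j _ ↦ ?_
        simp [smul_smul, mul_comm]
      rw [LinearMap.rTensor_tmul, LinearMap.mul'_apply, this]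
      simp only [map_sum, map_smul, Finset.mul_sum, Algebra.mul_smul_comm, ψ, yy,
        LinearMap.comp_apply, TensorProduct.map_tmul, LinearMap.mul'_apply, smul_eq_mul]
      refine Finset.sum_congr rfl fun l _ ↦ Finset.sum_congr rfl fun j _ ↦ mul_comm _ _
  simp only [h2]
  calc ∑ l, ∑ j, ψ l j (comul (rightConv f (yy l j)))
      = ∑ l, ∑ j, ∑ i, b.coord i (rightConv f (yy l j)) • ψ l j (comul (b i)) := by
        refine Finset.sum_congr rfl fun l _ ↦ Finset.sum_congr rfl fun j _ ↦ ?_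
        conv_lhs => rw [h3 (yy l j)]
        simp only [map_sum, map_smul]
    _ = ∑ i, ∑ l, ∑ j, b.coord i (rightConv f (yy l j)) • ψ l j (comul (b i)) := by
        rw [Finset.sum_comm]
        conv_lhs => enter [2, j]; rw [Finset.sum_comm]
        rw [Finset.sum_comm]
        exact Finset.sum_congr rfl fun i _ ↦ Finset.sum_comm
    _ = ∑ i, b.coord i (rightConv f y) * counit (R := k) (b i) := by
        refine Finset.sum_congr rfl fun i _ ↦ ?_
        rw [h4, mul_antipode_rTensor_comul_apply]
        simp [Algebra.algebraMap_eq_smul_one, mul_comm]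
    _ = f y := by
        rw [← counit_rightConv f y]
        conv_rhs => rw [h3 y]
        simp only [map_sum, map_smul, smul_eq_mul]

end

/-- A finite-dimensional Hopf algebra has a nonzero integral in its dual. -/
lemma exists_isIntegral [Module.Finite k H] : ∃ f : H →ₗ[k] k, IsIntegral f ∧ f ≠ 0 := by
  by_contra! h
  let b := Module.finBasis k H
  let b' : Module.Basis (ULift.{u} (Fin _)) k H := b.reindex Equiv.ulift.symm
  have h1 : counit (R := k) (1 : H) = 0 := by
    rw [← sum_traceForm b' counit 1]
    exact Finset.sum_eq_zero fun i _ ↦ by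
      rw [h _ (isIntegral_traceForm b' _), LinearMap.zero_apply]
  rw [Bialgebra.counit_one] at h1
  exact one_ne_zero h1

/-- A nonzero integral `f` is a free generator of the dual of `H`: the kernel `N` of
`h ↦ f(- S(h))` is a right ideal and a right coideal, so that it contains `h₁ S(h₂) = ε(h) 1` for
`h ∈ N`; as `1 ∉ N`, the counit vanishes on `N`, and `N = 0`. -/
lemma IsIntegral.eq_zero {f : H →ₗ[k] k} (hf : IsIntegral f) (hf0 : f ≠ 0) (h : H)
    (hh : ∀ x, f (x * antipode k h) = 0) : h = 0 := by
  let g : H →ₗ[k] (H →ₗ[k] k) := (LinearMap.mul k H).flip.compr₂ f ∘ₗ antipode k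
  have hg : ∀ h x, g h x = f (x * antipode k h) := fun h x ↦ rfl
  -- The kernel of `g` is a right ideal.
  have hN : ∀ h ∈ LinearMap.ker g, ∀ y, h * y ∈ LinearMap.ker g := by
    intro h hh y
    rw [LinearMap.mem_ker] at hh ⊢
    ext x
    have := LinearMap.congr_fun hh (x * antipode k y)
    rw [hg] at this ⊢
    rw [antipode_mul_antidistrib, ← mul_assoc, this, LinearMap.zero_apply, LinearMap.zero_apply]
  -- The kernel of `g` is a right coideal: `h₁ ⊗ h₂` is killed by `g ⊗ 1` if `g h = 0`.
  have h1 : ∀ h, g h = 0 → LinearMap.rTensor H g (comul h) = 0 := by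
    intro h hh
    classical
    have h2 : ∀ x, LinearMap.mul' k H (LinearMap.rTensor H
        (rightConv f ∘ₗ LinearMap.mulLeft k x ∘ₗ antipode k) (comul h)) = 0 := by
      intro x
      rw [← rightConv_comp_mulRight_antipode]
      have : f ∘ₗ LinearMap.mulRight k (antipode k h) = 0 :=
        LinearMap.ext fun x ↦ LinearMap.congr_fun hh x
      simp [this, rightConv_apply]
    have h3 : ∀ (x : H) (t : H ⊗[k] H), LinearMap.mul' k H (LinearMap.rTensor H
        (rightConv f ∘ₗ LinearMap.mulLeft k x ∘ₗ antipode k) t) =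
          TensorProduct.lid k H (LinearMap.rTensor H (LinearMap.applyₗ x)
            (LinearMap.rTensor H g t)) := by
      intro x t
      induction t using TensorProduct.induction_on with
      | zero => simp
      | add x y hx hy => simp only [map_add, hx, hy]
      | tmul z w => simp [hf _, hg]
    let b := Module.Basis.ofVectorSpace k H
    apply (TensorProduct.equivFinsuppOfBasisRight b).injective
    rw [map_zero]
    ext i x
    have h4 : ∀ t : (H →ₗ[k] k) ⊗[k] H, (TensorProduct.equivFinsuppOfBasisRight b t i) x =
        b.coord i (TensorProduct.lid k H (LinearMap.rTensor H (LinearMap.applyₗ x) t)) := by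
      intro t
      induction t using TensorProduct.induction_on with
      | zero => simp
      | add x y hx hy => simp only [map_add, Finsupp.add_apply, LinearMap.add_apply, hx, hy]
      | tmul z w => simp [mul_comm]
    rw [h4, ← h3, h2, map_zero]
    rfl
  -- Thus `h₁ S(h₂) = ε(h) 1` lies in the kernel of `g`, which does not contain `1`.
  have h5 : ∀ t : LinearMap.ker g ⊗[k] H, LinearMap.mul' k H ((antipode k).lTensor H
      ((LinearMap.ker g).subtype.rTensor H t)) ∈ LinearMap.ker g := by
    intro t
    induction t using TensorProduct.induction_on with
    | zero => simp
    | add x y hx hy =>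
      simp only [map_add]
      exact add_mem hx hy
    | tmul x y => simpa using hN x x.2 (antipode k y)
  have h6 : counit (R := k) ∘ₗ (LinearMap.ker g).subtype = 0 := by
    ext ⟨h, hh⟩
    obtain ⟨t, ht⟩ := (Module.Flat.rTensor_exact H
      (LinearMap.exact_subtype_ker_map g) (comul h)).1 (h1 h (LinearMap.mem_ker.1 hh))
    change counit (R := k) h = 0
    by_contra h0
    have := h5 t
    rw [ht, mul_antipode_lTensor_comul_apply, Algebra.algebraMap_eq_smul_one,
      Submodule.smul_mem_iff _ h0] at this
    apply hf0
    ext x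
    simpa [hg] using LinearMap.congr_fun (LinearMap.mem_ker.1 this) x
  obtain ⟨t, ht⟩ := (Module.Flat.rTensor_exact H
    (LinearMap.exact_subtype_ker_map g) (comul h)).1 (h1 h (LinearMap.ext hh))
  have h7 : (1 : k) ⊗ₜ[k] h = 0 := by
    rw [← rTensor_counit_comul, ← ht, ← LinearMap.rTensor_comp_apply, h6, LinearMap.rTensor_zero,
      LinearMap.zero_apply]
  simpa using congrArg (TensorProduct.lid k H) h7

/-- The antipode of a finite-dimensional Hopf algebra is bijective, and an integral is a
nondegenerate form on it (Larson-Sweedler). -/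
theorem exists_isIntegral_dual_bases [Module.Finite k H] :
    Function.Bijective (antipode k : H →ₗ[k] H) ∧ ∃ (f : H →ₗ[k] k) (ι : Type u) (_ : Fintype ι)
      (_ : DecidableEq ι) (b b' : Module.Basis ι k H), IsIntegral f ∧
        ∀ i j, f (b' i * b j) = if i = j then 1 else 0 := by
  classical
  obtain ⟨f, hf, hf0⟩ := exists_isIntegral (k := k) (H := H)
  have hS : Function.Injective (antipode k : H →ₗ[k] H) := by
    rw [injective_iff_map_eq_zero]
    intro h hh
    exact hf.eq_zero hf0 h fun x ↦ by rw [hh, mul_zero, map_zero]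
  have hS' : Function.Bijective (antipode k : H →ₗ[k] H) :=
    ⟨hS, LinearMap.injective_iff_surjective.1 hS⟩
  refine ⟨hS', f, ULift.{u} (Fin (Module.finrank k H)), inferInstance, inferInstance, ?_⟩
  -- The form `(x, y) ↦ f (x y)` is nondegenerate on the right by `IsIntegral.eq_zero`, and on the
  -- left by dimension count.
  let B : LinearMap.BilinForm k H := (LinearMap.mul k H).compr₂ f
  have hB : ∀ x y, B x y = f (x * y) := fun _ _ ↦ rfl
  have hr : ∀ y, (∀ x, B x y = 0) → y = 0 := by
    intro y hy
    obtain ⟨h, rfl⟩ := hS'.2 y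
    rw [hf.eq_zero hf0 h hy, map_zero]
  have hl : ∀ x, (∀ y, B x y = 0) → x = 0 := by
    intro x hx
    have h1 : Function.Injective (B.flip : H →ₗ[k] Module.Dual k H) := by
      rw [injective_iff_map_eq_zero]
      exact fun y hy ↦ hr y fun x ↦ LinearMap.congr_fun hy x
    have h2 : Function.Surjective (B.flip : H →ₗ[k] Module.Dual k H) :=
      (LinearMap.injective_iff_surjective_of_finrank_eq_finrank
        (Subspace.dual_finrank_eq (K := k) (V := H)).symm).1 h1
    refine (Module.forall_dual_apply_eq_zero_iff k x).1 fun φ ↦ ?_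
    obtain ⟨y, rfl⟩ := h2 φ
    exact hx y
  let b : Module.Basis (ULift.{u} (Fin (Module.finrank k H))) k H :=
    (Module.finBasis k H).reindex Equiv.ulift.symm
  have hB' : B.Nondegenerate := ⟨hl, hr⟩
  refine ⟨b, LinearMap.BilinForm.dualBasis B hB' b, hf, fun i j ↦ ?_⟩
  rw [← hB, LinearMap.BilinForm.apply_dualBasis_left]
  simp only [eq_comm]

end Integral

/-! ### Universal maps along a change of rings -/

section Universal

variable {R T : Type u} [Ring R] [Ring T] {f : R →+* T}

/-- If the `t j` form a basis of `T` as a right `R`-module, and if `Y` is the direct sum of the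
`t j • u(X)`, then `Y` is the module induced from `X`: maps `Y → N` correspond to `R`-linear maps
`X → N`. -/
lemma bijective_comp_map_of_bijective {J : Type u} {t : J → T}
    (ht : Function.Surjective fun c : J →₀ R ↦ c.sum fun j r ↦ t j * f r)
    {X : ModuleCat.{u} R} {Y : ModuleCat.{u} T} (u : X ⟶ (ModuleCat.restrictScalars f).obj Y)
    (hu : Function.Bijective fun c : J →₀ X ↦ c.sum fun j x ↦ t j • (show Y from u x))
    (N : ModuleCat.{u} T) :
    Function.Bijective fun g : Y ⟶ N ↦ u ≫ (ModuleCat.restrictScalars f).map g := by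
  let u' : X → Y := fun x ↦ u x
  have u'_add : ∀ x y, u' (x + y) = u' x + u' y := fun x y ↦ map_add u.hom x y
  have u'_zero : u' 0 = 0 := map_zero u.hom
  have u'_smul : ∀ (r : R) x, u' (r • x) = f r • u' x := fun r x ↦ map_smul u.hom r x
  -- By hypothesis, `Ψ` identifies `Y` with the sum of the `t j • u(X)`.
  let Ψ : (J →₀ X) →+ Y := Finsupp.liftAddHom fun j ↦
    { toFun := fun x ↦ t j • u' x
      map_zero' := by rw [u'_zero, smul_zero]
      map_add' := fun x y ↦ by rw [u'_add, smul_add] }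
  have hΨ : Function.Bijective Ψ := hu
  constructor
  · intro g g' h
    ext y
    obtain ⟨c, rfl⟩ := hΨ.2 y
    have h1 : ∀ x, g (u' x) = g' (u' x) := fun x ↦ congr($h x)
    simp only [Ψ, Finsupp.liftAddHom_apply, Finsupp.sum, map_sum]
    refine Finset.sum_congr rfl fun j _ ↦ ?_
    change g (t j • u' (c j)) = g' (t j • u' (c j))
    rw [map_smul, map_smul, h1]
  · intro g₀
    let v : X → N := fun x ↦ g₀ x
    have v_add : ∀ x y, v (x + y) = v x + v y := fun x y ↦ map_add g₀.hom x y
    have v_zero : v 0 = 0 := map_zero g₀.hom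
    have v_smul : ∀ (r : R) x, v (r • x) = f r • v x := fun r x ↦ map_smul g₀.hom r x
    -- The extension `G` of `g₀` maps `t j • u x` to `t j • g₀ x`.
    let Θ : (J →₀ X) →+ N := Finsupp.liftAddHom fun j ↦
      { toFun := fun x ↦ t j • v x
        map_zero' := by rw [v_zero, smul_zero]
        map_add' := fun x y ↦ by rw [v_add, smul_add] }
    let e : (J →₀ X) ≃+ Y := AddEquiv.ofBijective Ψ hΨ
    let G : Y →+ N := Θ.comp e.symm.toAddMonoidHom
    have hG : ∀ j x, G (t j • u' x) = t j • v x := by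
      intro j x
      have h1 : e (Finsupp.single j x) = t j • u' x := by
        exact Finsupp.liftAddHom_apply_single _ _ _
      rw [← h1]
      change Θ (e.symm (e _)) = _
      rw [e.symm_apply_apply]
      exact Finsupp.liftAddHom_apply_single _ _ _
    have hG' : ∀ (s : T) x, G (s • u' x) = s • v x := by
      intro s x
      obtain ⟨c, rfl⟩ := ht s
      simp only [Finsupp.sum, Finset.sum_smul, map_sum, mul_smul, ← u'_smul, ← v_smul, hG]
    let G' : Y →ₗ[T] N :=
      { G with
        map_smul' := by
          intro s y
          change G (s • y) = s • G y
          obtain ⟨c, rfl⟩ := hΨ.2 y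
          simp only [Ψ, Finsupp.liftAddHom_apply, Finsupp.sum, map_sum, Finset.smul_sum]
          refine Finset.sum_congr rfl fun j _ ↦ ?_
          change G (s • t j • u' (c j)) = s • G (t j • u' (c j))
          rw [← mul_smul, hG', hG', mul_smul] }
    refine ⟨ModuleCat.ofHom G', ?_⟩
    ext x
    change G (u' x) = v x
    rw [← one_smul T (u' x), hG', one_smul]

end Universal

/-! ### Smash products, axiomatically -/

open Coalgebra

/-- The structure of a smash product `Λ = A ♯ H` that is used below. There are algebra maps
`A → Λ` and `H → Λ` such that multiplication gives isomorphisms `A ⊗ H ≃ Λ` and `H ⊗ A ≃ Λ`, the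
projection `π : Λ → H`, `a h ↦ ε(a) h`, and the coaction `ρ : Λ → Λ ⊗ H`,
`a h ↦ a h₁ ⊗ h₂`, are algebra maps, and the antipode of `H` is bijective. Contrary to the
definition of the smash product, these axioms are symmetric: they pass to opposite algebras. -/
structure SmashExtension (k A H Λ : Type u) [Field k] [Ring A] [Algebra k A] [Ring H]
    [HopfAlgebra k H] [Ring Λ] [Algebra k Λ] where
  /-- The inclusion of `A`. -/
  iA : A →ₐ[k] Λ
  /-- The inclusion of `H`. -/
  iH : H →ₐ[k] Λ
  /-- The augmentation of `A`. -/
  ε : A →ₐ[k] k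
  /-- The projection `a h ↦ ε(a) h`. -/
  π : Λ →ₐ[k] H
  /-- The coaction `a h ↦ a h₁ ⊗ h₂`. -/
  ρ : Λ →ₐ[k] Λ ⊗[k] H
  π_iA : ∀ a, π (iA a) = algebraMap k H (ε a)
  π_iH : ∀ h, π (iH h) = h
  ρ_iA : ∀ a, ρ (iA a) = iA a ⊗ₜ 1
  ρ_iH : ∀ h, ρ (iH h) = TensorProduct.map iH.toLinearMap LinearMap.id (comul h)
  bijective_mul : Function.Bijective
    (LinearMap.mul' k Λ ∘ₗ TensorProduct.map iA.toLinearMap iH.toLinearMap)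
  bijective_mul' : Function.Bijective
    (LinearMap.mul' k Λ ∘ₗ TensorProduct.map iH.toLinearMap iA.toLinearMap)
  bijective_antipode : Function.Bijective (HopfAlgebra.antipode k : H →ₗ[k] H)

/-- A copy of a module `M` over the `k`-algebra `B`, carrying the `k`-vector space structure given
by `k → B`. -/
def BaseSpace (k B M : Type u) [Field k] [Ring B] [Algebra k B] [AddCommGroup M] [Module B M] :
    Type u := M

section BaseSpace

variable {k B M : Type u} [Field k] [Ring B] [Algebra k B] [AddCommGroup M] [Module B M]

instance : AddCommGroup (BaseSpace k B M) := inferInstanceAs (AddCommGroup M)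

instance : Module B (BaseSpace k B M) := inferInstanceAs (Module B M)

instance : Module k (BaseSpace k B M) := Module.compHom M (algebraMap k B)

lemma BaseSpace.smul_eq (c : k) (m : BaseSpace k B M) : c • m = algebraMap k B c • m := rfl

instance : IsScalarTower k B (BaseSpace k B M) where
  smul_assoc c x m := by rw [Algebra.smul_def, mul_smul, BaseSpace.smul_eq]

end BaseSpace

namespace SmashExtension

variable {k A H Λ : Type u} [Field k] [Ring A] [Algebra k A] [Ring H] [HopfAlgebra k H]
  [Ring Λ] [Algebra k Λ] (D : SmashExtension k A H Λ)

section Tens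

variable (M : Type u) [AddCommGroup M] [Module Λ M] (W : Type u) [AddCommGroup W] [Module H W]

/-- The underlying space of the `Λ`-module `M ⊗ W`, for a `Λ`-module `M` and an `H`-module
`W`. -/
def Tens (_ : SmashExtension k A H Λ) : Type u :=
  BaseSpace k Λ M ⊗[k] BaseSpace k H W

instance : AddCommGroup (D.Tens M W) :=
  inferInstanceAs (AddCommGroup (BaseSpace k Λ M ⊗[k] BaseSpace k H W))

/-- The action of `Λ` on `M ⊗ W`, through `ρ : Λ → Λ ⊗ H`. -/
def tensAction : Λ →+* AddMonoid.End (D.Tens M W) :=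
  (Module.toAddMonoidEnd (Module.End k (BaseSpace k Λ M ⊗[k] BaseSpace k H W))
    (BaseSpace k Λ M ⊗[k] BaseSpace k H W)).comp
      ((Module.endTensorEndAlgHom (R := k) (S := k) (A := k) (M := BaseSpace k Λ M)
        (N := BaseSpace k H W)).comp
          ((Algebra.TensorProduct.map (Algebra.lsmul k k (BaseSpace k Λ M))
            (Algebra.lsmul k k (BaseSpace k H W))).comp D.ρ)).toRingHom

instance : Module Λ (D.Tens M W) :=
  Module.compHom (D.Tens M W) (D.tensAction M W)

variable {M W}

/-- The tensor `m ⊗ w`. -/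
def tmul (m : M) (w : W) : D.Tens M W :=
  (show BaseSpace k Λ M from m) ⊗ₜ[k] (show BaseSpace k H W from w)

lemma tmul_add (m : M) (w w' : W) : D.tmul m (w + w') = D.tmul m w + D.tmul m w' :=
  TensorProduct.tmul_add (M := BaseSpace k Λ M) (N := BaseSpace k H W) m w w'

lemma add_tmul (m m' : M) (w : W) : D.tmul (m + m') w = D.tmul m w + D.tmul m' w :=
  TensorProduct.add_tmul (M := BaseSpace k Λ M) (N := BaseSpace k H W) m m' w

lemma smul_tmul (c : k) (m : M) (w : W) :
    D.tmul (algebraMap k Λ c • m) w = D.tmul m (algebraMap k H c • w) :=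
  TensorProduct.smul_tmul (M := BaseSpace k Λ M) (N := BaseSpace k H W) c m w

lemma tens_induction {p : D.Tens M W → Prop} (z : D.Tens M W) (h0 : p 0)
    (h1 : ∀ m w, p (D.tmul m w)) (h2 : ∀ x y, p x → p y → p (x + y)) : p z :=
  TensorProduct.induction_on z h0 h1 h2

/-- Additive maps out of `M ⊗ W`. -/
def tensLift {N : Type u} [AddCommGroup N] (φ : M →+ W →+ N)
    (hφ : ∀ (c : k) m w, φ (algebraMap k Λ c • m) w = φ m (algebraMap k H c • w)) :
    D.Tens M W →+ N :=
  TensorProduct.liftAddHom (M := BaseSpace k Λ M) (N := BaseSpace k H W) φ fun c m w ↦ hφ c m w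

/-- The map `x ⊗ y ↦ x m ⊗ y w`. -/
def orbit (m : M) (w : W) : Λ ⊗[k] H →+ D.Tens M W :=
  (TensorProduct.map ((LinearMap.toSpanSingleton Λ (BaseSpace k Λ M) m).restrictScalars k)
    ((LinearMap.toSpanSingleton H (BaseSpace k H W) w).restrictScalars k)).toAddMonoidHom

@[simp] lemma orbit_tmul (m : M) (w : W) (x : Λ) (y : H) :
    D.orbit m w (x ⊗ₜ y) = D.tmul (x • m) (y • w) := rfl

lemma smul_tmul_eq (x : Λ) (m : M) (w : W) : x • D.tmul m w = D.orbit m w (D.ρ x) := by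
  have key : ∀ t : Λ ⊗[k] H, (Module.endTensorEndAlgHom (R := k) (S := k) (A := k)
      (M := BaseSpace k Λ M) (N := BaseSpace k H W)
      (Algebra.TensorProduct.map (Algebra.lsmul k k (BaseSpace k Λ M))
        (Algebra.lsmul k k (BaseSpace k H W)) t)) (m ⊗ₜ w) =
      TensorProduct.map ((LinearMap.toSpanSingleton Λ (BaseSpace k Λ M) m).restrictScalars k)
        ((LinearMap.toSpanSingleton H (BaseSpace k H W) w).restrictScalars k) t := by
    intro t
    induction t using TensorProduct.induction_on with
    | zero => simp
    | add x y hx hy => simp only [map_add, LinearMap.add_apply, hx, hy]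
    | tmul x y => rfl
  exact key (D.ρ x)

lemma iA_smul_tmul (a : A) (m : M) (w : W) :
    D.iA a • D.tmul m w = D.tmul (D.iA a • m) w := by
  rw [smul_tmul_eq, ρ_iA, orbit_tmul, one_smul]

end Tens

end SmashExtension

lemma bijective_congr {α β : Type*} {f g : α → β} (hf : Function.Bijective f)
    (h : ∀ x, g x = f x) : Function.Bijective g := by
  rwa [funext h]

/-- A linear map over the `k`-algebra `B`, as a `k`-linear map. -/
def baseMap (k : Type u) {B M M' : Type u} [Field k] [Ring B] [Algebra k B] [AddCommGroup M]
    [Module B M] [AddCommGroup M'] [Module B M'] (f : M →ₗ[B] M') :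
    BaseSpace k B M →ₗ[k] BaseSpace k B M' where
  toFun := f
  map_add' := map_add f
  map_smul' c m := map_smul f (algebraMap k B c) m

/-- The identification of `B` with the vector space underlying the module `B`. -/
def baseSelf (k B : Type u) [Field k] [Ring B] [Algebra k B] : B ≃ₗ[k] BaseSpace k B B where
  __ := AddEquiv.refl B
  map_smul' c x := Algebra.smul_def c x

namespace SmashExtension

variable {k A H Λ : Type u} [Field k] [Ring A] [Algebra k A] [Ring H] [HopfAlgebra k H]
  [Ring Λ] [Algebra k Λ] (D : SmashExtension k A H Λ)

/-! ### The tensor product functors -/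

section TensHom

variable {M M' M'' W W' W'' : Type u} [AddCommGroup M] [Module Λ M] [AddCommGroup M'] [Module Λ M']
  [AddCommGroup M''] [Module Λ M''] [AddCommGroup W] [Module H W] [AddCommGroup W'] [Module H W']
  [AddCommGroup W''] [Module H W'']

/-- The map `f ⊗ g` between tensor products. -/
def tensHom (f : M →ₗ[Λ] M') (g : W →ₗ[H] W') : D.Tens M W →ₗ[Λ] D.Tens M' W' where
  toFun := TensorProduct.map (baseMap k f) (baseMap k g)
  map_add' := map_add (TensorProduct.map (baseMap k f) (baseMap k g))
  map_smul' x z := by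
    let F : D.Tens M W →+ D.Tens M' W' :=
      (TensorProduct.map (baseMap k f) (baseMap k g)).toAddMonoidHom
    have hF : ∀ m w, F (D.tmul m w) = D.tmul (f m) (g w) := fun m w ↦ rfl
    have h1 : ∀ m w (t : Λ ⊗[k] H), F (D.orbit m w t) = D.orbit (f m) (g w) t := by
      intro m w t
      induction t using TensorProduct.induction_on with
      | zero => simp
      | add x y hx hy => simp only [map_add, hx, hy]
      | tmul x y => rw [orbit_tmul, hF, map_smul, map_smul, orbit_tmul]
    change F (x • z) = x • F z
    induction z using D.tens_induction with
    | h0 => simp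
    | h1 m w => rw [smul_tmul_eq, h1, hF, smul_tmul_eq]
    | h2 x y hx hy => simp only [map_add, smul_add, hx, hy]

@[simp] lemma tensHom_tmul (f : M →ₗ[Λ] M') (g : W →ₗ[H] W') (m : M) (w : W) :
    D.tensHom f g (D.tmul m w) = D.tmul (f m) (g w) := rfl

lemma tens_hom_ext {N : Type u} [AddCommGroup N] [Module Λ N] {f g : D.Tens M W →ₗ[Λ] N}
    (h : ∀ m w, f (D.tmul m w) = g (D.tmul m w)) : f = g := by
  ext z
  induction z using D.tens_induction with
  | h0 => simp
  | h1 m w => exact h m w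
  | h2 x y hx hy => simp only [map_add, hx, hy]

lemma tensHom_exact_left {f : M →ₗ[Λ] M'} {g : M' →ₗ[Λ] M''} (h : Function.Exact f g) :
    Function.Exact (D.tensHom f (LinearMap.id (R := H) (M := W))) (D.tensHom g LinearMap.id) :=
  Module.Flat.rTensor_exact (BaseSpace k H W) (f := baseMap k f) (g := baseMap k g) h

lemma tensHom_exact_right {f : W →ₗ[H] W'} {g : W' →ₗ[H] W''} (h : Function.Exact f g) :
    Function.Exact (D.tensHom (LinearMap.id (R := Λ) (M := M)) f) (D.tensHom LinearMap.id g) :=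
  Module.Flat.lTensor_exact (BaseSpace k Λ M) (f := baseMap k f) (g := baseMap k g) h

end TensHom

/-- The functor `- ⊗ W` on `Λ`-modules, for an `H`-module `W`. -/
def tensLeft (W : ModuleCat.{u} H) : ModuleCat.{u} Λ ⥤ ModuleCat.{u} Λ where
  obj M := ModuleCat.of Λ (D.Tens M W)
  map f := ModuleCat.ofHom (D.tensHom f.hom LinearMap.id)
  map_id M := by
    ext1
    exact D.tens_hom_ext fun m w ↦ rfl
  map_comp f g := by
    ext1
    exact D.tens_hom_ext fun m w ↦ rfl

/-- The functor `M ⊗ -` from `H`-modules to `Λ`-modules, for a `Λ`-module `M`. -/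
def tensRight (M : ModuleCat.{u} Λ) : ModuleCat.{u} H ⥤ ModuleCat.{u} Λ where
  obj W := ModuleCat.of Λ (D.Tens M W)
  map f := ModuleCat.ofHom (D.tensHom LinearMap.id f.hom)
  map_id M := by
    ext1
    exact D.tens_hom_ext fun m w ↦ rfl
  map_comp f g := by
    ext1
    exact D.tens_hom_ext fun m w ↦ rfl

instance (W : ModuleCat.{u} H) : (D.tensLeft W).Additive where
  map_add := by
    intros
    ext1
    exact D.tens_hom_ext fun m w ↦ D.add_tmul _ _ _

instance (M : ModuleCat.{u} Λ) : (D.tensRight M).Additive where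
  map_add := by
    intros
    ext1
    exact D.tens_hom_ext fun m w ↦ D.tmul_add _ _ _

lemma tensLeft_exact (W : ModuleCat.{u} H) (S : ShortComplex (ModuleCat.{u} Λ)) (h : S.Exact) :
    (S.map (D.tensLeft W)).Exact := by
  rw [ShortComplex.ShortExact.moduleCat_exact_iff_function_exact] at h ⊢
  exact D.tensHom_exact_left h

lemma tensRight_exact (M : ModuleCat.{u} Λ) (S : ShortComplex (ModuleCat.{u} H)) (h : S.Exact) :
    (S.map (D.tensRight M)).Exact := by
  rw [ShortComplex.ShortExact.moduleCat_exact_iff_function_exact] at h ⊢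
  exact D.tensHom_exact_right h

instance (W : ModuleCat.{u} H) : PreservesFiniteLimits (D.tensLeft W) := by
  have := ((Functor.exact_tfae (D.tensLeft W)).out 1 3).mp (D.tensLeft_exact W)
  exact this.1

instance (W : ModuleCat.{u} H) : PreservesFiniteColimits (D.tensLeft W) := by
  have := ((Functor.exact_tfae (D.tensLeft W)).out 1 3).mp (D.tensLeft_exact W)
  exact this.2

instance (M : ModuleCat.{u} Λ) : PreservesFiniteLimits (D.tensRight M) := by
  have := ((Functor.exact_tfae (D.tensRight M)).out 1 3).mp (D.tensRight_exact M)
  exact this.1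

instance (M : ModuleCat.{u} Λ) : PreservesFiniteColimits (D.tensRight M) := by
  have := ((Functor.exact_tfae (D.tensRight M)).out 1 3).mp (D.tensRight_exact M)
  exact this.2

/-! ### Restriction functors and bases -/

/-- Restriction of scalars from `Λ` to `A`. -/
abbrev resA : ModuleCat.{u} Λ ⥤ ModuleCat.{u} A := ModuleCat.restrictScalars.{u} D.iA.toRingHom

/-- Restriction of scalars along the projection `π : Λ → H`. -/
abbrev resπ : ModuleCat.{u} H ⥤ ModuleCat.{u} Λ := ModuleCat.restrictScalars.{u} D.π.toRingHom

variable {J : Type u} (b : Module.Basis J k H)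

lemma bijective_rightBasis :
    Function.Bijective fun c : J →₀ A ↦ c.sum fun j a ↦ D.iH (b j) * D.iA.toRingHom a := by
  classical
  have h := D.bijective_mul'.comp (TensorProduct.equivFinsuppOfBasisLeft (N := A) b).symm.bijective
  convert h using 1
  ext c
  simp [Finsupp.sum, map_sum]

/-- A basis of `H` is a basis of `Λ` as a right `A`-module. -/
lemma isRightFree : IsRightFree D.iA.toRingHom :=
  ⟨_, _, D.bijective_rightBasis (Module.Basis.ofVectorSpace k H)⟩

/-- The `A`-linear map `a ↦ a y` from `A` to `Λ`, for `y ∈ H`. -/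
def incl (y : H) : ModuleCat.of A A ⟶ D.resA.obj (ModuleCat.of Λ Λ) :=
  ModuleCat.ofHom (Y := D.resA.obj (ModuleCat.of Λ Λ))
    { toFun := fun a ↦ (D.iA a * D.iH y : Λ)
      map_add' := fun a a' ↦ by rw [map_add, add_mul]; rfl
      map_smul' := fun a a' ↦ by
        change D.iA (a * a') * D.iH y = D.iA a * (D.iA a' * D.iH y)
        rw [map_mul, mul_assoc] }

/-- A basis of `H` is a basis of `Λ` as a left `A`-module. -/
lemma isDirectSum_incl : IsDirectSum fun j ↦ D.incl (b j) := by
  classical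
  have h := D.bijective_mul.comp (TensorProduct.equivFinsuppOfBasisRight (M := A) b).symm.bijective
  convert h using 1
  unfold IsDirectSum
  congr! 1
  ext c
  simp [Finsupp.sum, map_sum]
  rfl

/-- The inclusion `k → H`, an `A`-linear map. -/
def unitH : trivialModule D.ε ⟶ D.resA.obj (D.resπ.obj (ModuleCat.of H H)) :=
  ModuleCat.ofHom (X := trivialModule D.ε) (Y := D.resA.obj (D.resπ.obj (ModuleCat.of H H)))
    { toFun := fun (c : k) ↦ (algebraMap k H c : H)
      map_add' := fun c c' ↦ map_add (algebraMap k H) c c'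
      map_smul' := fun a (c : k) ↦ by
        change algebraMap k H (D.ε a * c) = D.π (D.iA a) * algebraMap k H c
        rw [π_iA, map_mul] }

/-- Maps `H → N` of `Λ`-modules correspond to `A`-linear maps `k → N`. -/
lemma bijective_unitH (N : ModuleCat.{u} Λ) :
    Function.Bijective fun g : D.resπ.obj (ModuleCat.of H H) ⟶ N ↦ D.unitH ≫ D.resA.map g := by
  let b := Module.Basis.ofVectorSpace k H
  refine bijective_comp_map_of_bijective (D.bijective_rightBasis b).2 D.unitH ?_ N
  refine bijective_congr b.repr.symm.bijective fun c ↦ ?_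
  refine Eq.trans ?_ (Module.Basis.repr_symm_apply b c).symm
  refine Eq.trans ?_ (Finsupp.linearCombination_apply k (v := b) (show _ →₀ k from c)).symm
  refine Finset.sum_congr rfl fun j _ ↦ ?_
  change D.π (D.iH (b j)) * algebraMap k H (show k from c j) = (show k from c j) • b j
  rw [π_iH, Algebra.smul_def, Algebra.commutes]

/-- The inclusion `m ↦ m ⊗ w`, an `A`-linear map. -/
def inclTens (W : ModuleCat.{u} H) (w : W) (M : ModuleCat.{u} Λ) :
    D.resA.obj M ⟶ D.resA.obj ((D.tensLeft W).obj M) :=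
  ModuleCat.ofHom (X := D.resA.obj M) (Y := D.resA.obj ((D.tensLeft W).obj M))
    { toFun := fun m ↦ D.tmul (M := M) m w
      map_add' := fun m m' ↦ D.add_tmul m m' w
      map_smul' := fun a m ↦ (D.iA_smul_tmul (M := M) a m w).symm }

/-- The span of `m ⊗ 1` under `H` in `M ⊗ H` is described by the twist. -/
lemma iH_smul_tmul_one {M : Type u} [AddCommGroup M] [Module Λ M] (h : H) (m : M) :
    D.iH h • D.tmul m (1 : H) = (LinearMap.lTensor (BaseSpace k Λ M) (baseSelf k H).toLinearMap
      (twist ((Algebra.lsmul k k (BaseSpace k Λ M)).comp D.iH)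
        (h ⊗ₜ (show BaseSpace k Λ M from m))) : D.Tens M H) := by
  rw [smul_tmul_eq, ρ_iH, twist_tmul]
  induction comul (R := k) h using TensorProduct.induction_on with
  | zero => simp; rfl
  | add x y hx hy =>
    simp only [map_add, hx, hy]
    rfl
  | tmul x y =>
    simp only [TensorProduct.map_tmul, orbit_tmul, smul_eq_mul, mul_one, LinearMap.id_apply]
    rfl

/-- `M ⊗ H` is induced from the `A`-module `M`. -/
lemma bijective_inclTens_one (M N : ModuleCat.{u} Λ) :
    Function.Bijective fun g : (D.tensLeft (ModuleCat.of H H)).obj M ⟶ N ↦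
      D.inclTens (ModuleCat.of H H) (1 : H) M ≫ D.resA.map g := by
  classical
  let b := Module.Basis.ofVectorSpace k H
  refine bijective_comp_map_of_bijective (D.bijective_rightBasis b).2 _ ?_ N
  -- The elements `bⱼ • (m ⊗ 1)` decompose `M ⊗ H`, since the twist is bijective.
  have h1 := twist_bijective D.bijective_antipode
    ((Algebra.lsmul k k (BaseSpace k Λ M)).comp D.iH)
  have h2 := ((LinearEquiv.lTensor (BaseSpace k Λ M) (baseSelf k H)).bijective.comp h1).comp
    (TensorProduct.equivFinsuppOfBasisLeft (N := BaseSpace k Λ M) b).symm.bijective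
  refine bijective_congr h2 fun (c : _ →₀ BaseSpace k Λ M) ↦ ?_
  refine Eq.trans ?_ (congrArg (fun z ↦ (LinearEquiv.lTensor (BaseSpace k Λ M) (baseSelf k H))
    (twist ((Algebra.lsmul k k (BaseSpace k Λ M)).comp D.iH) z))
    (TensorProduct.equivFinsuppOfBasisLeft_symm_apply b c).symm)
  simp only [Finsupp.sum, map_sum]
  exact Finset.sum_congr rfl fun j _ ↦ D.iH_smul_tmul_one (M := M) (b j) (c j)

end SmashExtension

section Comp

universe w w' w'' v v' v'' t t' t''

variable {C : Type t} [Category.{v} C] [Abelian C] [HasExt.{w} C]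
  {D : Type t'} [Category.{v'} D] [Abelian D] [HasExt.{w'} D]
  {E : Type t''} [Category.{v''} E] [Abelian E] [HasExt.{w''} E]

/-- The maps on `Ext` induced by exact functors are functorial in the functor. -/
lemma mapExactFunctor_mapExactFunctor [EnoughInjectives C] (F : C ⥤ D) (G : D ⥤ E) [F.Additive]
    [PreservesFiniteLimits F] [PreservesFiniteColimits F] [G.Additive]
    [PreservesFiniteLimits G] [PreservesFiniteColimits G] {X Y : C} {n : ℕ} (x : Ext.{w} X Y n) :
    (x.mapExactFunctor F).mapExactFunctor G = x.mapExactFunctor (F ⋙ G) := by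
  induction n generalizing Y with
  | zero =>
    obtain ⟨f, rfl⟩ := (Ext.mk₀_bijective X Y).2 x
    simp [Ext.mapExactFunctor_mk₀]
  | succ n hn =>
    obtain ⟨S, hS, hI, rfl⟩ := exists_shortExact_injective Y
    obtain ⟨y, rfl⟩ := Ext.covariant_sequence_exact₁ X hS x (Ext.eq_zero_of_injective _) rfl
    rw [Ext.mapExactFunctor_comp, Ext.mapExactFunctor_comp, Ext.mapExactFunctor_comp, hn,
      Ext.mapExactFunctor_extClass, Ext.mapExactFunctor_extClass]
    congr 1
    exact Ext.mapExactFunctor_extClass G (hS.map_of_exact F)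

end Comp

/-! ### The Artin-Schelter condition for smash products -/

/-- Right multiplication by `y`. -/
def rightMul {B : Type u} [Ring B] (y : B) : ModuleCat.of.{u} B B ⟶ ModuleCat.of B B :=
  ModuleCat.ofHom
    { toFun := fun x ↦ x * y
      map_add' := fun _ _ ↦ add_mul _ _ _
      map_smul' := fun _ _ ↦ mul_assoc _ _ _ }

lemma rightMul_comp {B : Type u} [Ring B] (y y' : B) :
    rightMul y ≫ rightMul y' = rightMul (y * y') := by
  ext
  exact mul_assoc _ _ _

lemma hom_self_ext {B : Type u} [Ring B] {N : ModuleCat.{u} B} {f g : ModuleCat.of B B ⟶ N}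
    (h : f (1 : B) = g (1 : B)) : f = g := by
  ext
  exact h

lemma eq_rightMul {B : Type u} [Ring B] (f : ModuleCat.of.{u} B B ⟶ ModuleCat.of B B) :
    f = rightMul (f (1 : B)) :=
  hom_self_ext (one_mul _).symm

namespace SmashExtension

variable {k A H Λ : Type u} [Field k] [Ring A] [Algebra k A] [Ring H] [HopfAlgebra k H]
  [Ring Λ] [Algebra k Λ] (D : SmashExtension k A H Λ)

/-- The inclusion `a ↦ a y` is the inclusion of `A` followed by right multiplication by `y`. -/
lemma incl_eq (y : H) : D.incl y = D.incl 1 ≫ D.resA.map (rightMul (D.iH y)) := by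
  ext
  change D.iA 1 * D.iH y = D.iA 1 * D.iH 1 * D.iH y
  rw [map_one D.iH, mul_one]

/-- The comparison isomorphism `Ext_Λ (H, N) ≃ Ext_A (k, N)`. -/
def extResA (N : ModuleCat.{u} Λ) (i : ℕ) :
    Ext.{u} (D.resπ.obj (ModuleCat.of H H)) N i →+ Ext.{u} (trivialModule D.ε) (D.resA.obj N) i :=
  extPreMap D.resA D.unitH N i

/-- By `bijective_unitH`, the `Λ`-module `H` is induced from the trivial `A`-module. -/
lemma extResA_bijective (N : ModuleCat.{u} Λ) (i : ℕ) : Function.Bijective (D.extResA N i) :=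
  have := D.isRightFree.preservesInjectiveObjects
  extPreMap_bijective _ _ D.bijective_unitH N i

lemma extResA_smul {N : ModuleCat.{u} Λ} {i : ℕ} (c : k)
    (x : Ext.{u} (D.resπ.obj (ModuleCat.of H H)) N i) :
    D.extResA N i (c • x) = c • D.extResA N i x := by
  rw [extResA, extPreMap_apply, extPreMap_apply, Functor.mapExactFunctor_smul, Ext.comp_smul]

lemma extResA_comp {N N' : ModuleCat.{u} Λ} {i : ℕ}
    (x : Ext.{u} (D.resπ.obj (ModuleCat.of H H)) N i) (f : N ⟶ N') :
    D.extResA N' i (x.comp (Ext.mk₀ f) (add_zero i)) =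
      (D.extResA N i x).comp (Ext.mk₀ (D.resA.map f)) (add_zero i) := by
  simp only [extResA, extPreMap_apply, Ext.mapExactFunctor_comp, Ext.mapExactFunctor_mk₀]
  rw [Ext.comp_assoc_of_third_deg_zero]

lemma subsingleton_ext_resπ (hFP : ∀ m, IsFP m (trivialModule D.ε)) {i : ℕ}
    (h : Subsingleton (Ext.{u} (trivialModule D.ε) (ModuleCat.of A A) i)) :
    Subsingleton (Ext.{u} (D.resπ.obj (ModuleCat.of H H)) (ModuleCat.of Λ Λ) i) := by
  have h1 := (extSumMap_bijective (D.isDirectSum_incl (Module.Basis.ofVectorSpace k H)) _ i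
    (hFP _)).surjective.subsingleton
  exact (D.extResA_bijective _ i).injective.subsingleton

/-- The `k`-linear map `H → Ext_A (k, Λ)`, `y ↦ e₀ y`. -/
def inclClass {n : ℕ} (e₀ : Ext.{u} (trivialModule D.ε) (ModuleCat.of A A) n) :
    H →ₗ[k] Ext.{u} (trivialModule D.ε) (D.resA.obj (ModuleCat.of Λ Λ)) n where
  toFun y := e₀.comp (Ext.mk₀ (D.incl y)) (add_zero n)
  map_add' y y' := by
    rw [← Ext.comp_add, ← Ext.mk₀_add]
    congr 2
    ext
    change D.iA 1 * D.iH (y + y') = D.iA 1 * D.iH y + D.iA 1 * D.iH y'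
    rw [map_add, mul_add]
  map_smul' c y := by
    rw [RingHom.id_apply, ← Ext.comp_smul, ← Ext.mk₀_smul]
    congr 2
    ext
    change D.iA 1 * D.iH (c • y) = D.iA (algebraMap k A c) * (D.iA 1 * D.iH y)
    rw [map_smul, mul_smul_comm, D.iA.commutes, Algebra.smul_def]

/-- If `Ext^n_A (k, A)` is spanned by `e₀`, then `Ext^n_A (k, Λ)` consists of the `e₀ y`, since `Λ`
is the direct sum of the `A bⱼ`. -/
lemma inclClass_bijective (hFP : ∀ m, IsFP m (trivialModule D.ε)) {n : ℕ}
    (e₀ : Ext.{u} (trivialModule D.ε) (ModuleCat.of A A) n)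
    (he₀ : Function.Bijective fun c : k ↦ c • e₀) : Function.Bijective (D.inclClass e₀) := by
  let b := Module.Basis.ofVectorSpace k H
  have h1 := extSumMap_bijective (D.isDirectSum_incl b) _ n (hFP _)
  let s : k ≃+ Ext.{u} (trivialModule D.ε) (ModuleCat.of A A) n :=
    AddEquiv.ofBijective (AddMonoidHom.mk' (fun c : k ↦ c • e₀) fun c c' ↦ add_smul c c' e₀) he₀
  have h2 := h1.comp ((Finsupp.mapRange.addEquiv s).bijective.comp b.repr.bijective)
  refine bijective_congr h2 fun y ↦ ?_
  obtain ⟨c, rfl⟩ := b.repr.symm.surjective y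
  simp only [Function.comp_apply, LinearEquiv.apply_symm_apply]
  induction c using Finsupp.induction_linear with
  | zero => simp
  | add x y hx hy => simp only [map_add, hx, hy]
  | single j c =>
    simp only [Finsupp.mapRange.addEquiv_apply, Finsupp.mapRange_single, extSumMap,
      Finsupp.liftAddHom_apply_single, Module.Basis.repr_symm_single, map_smul]
    exact (Ext.smul_comp _ _ (add_zero n) _).symm

section DiagonalHom

/-- If `A` acts on `z` through the augmentation, then `Λ` acts on `z` through `π`. -/
lemma smul_eq_of_iA_smul {N : Type u} [AddCommGroup N] [Module Λ N] (z : N)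
    (hz : ∀ a, D.iA a • z = algebraMap k Λ (D.ε a) • z) (l : Λ) : l • z = D.iH (D.π l) • z := by
  obtain ⟨t, ht⟩ := D.bijective_mul'.2 l
  rw [← ht]
  clear ht
  induction t using TensorProduct.induction_on with
  | zero => simp
  | add x y hx hy => simp only [map_add, add_smul, hx, hy]
  | tmul h a =>
    have h1 : (LinearMap.mul' k Λ ∘ₗ TensorProduct.map D.iH.toLinearMap D.iA.toLinearMap)
      (h ⊗ₜ a) = D.iH h * D.iA a := rfl
    rw [h1, mul_smul, hz, map_mul, π_iH, π_iA, map_mul, D.iH.commutes, mul_smul]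

/-- The generator of the `Λ`-module `H`. -/
def oneπ : D.resπ.obj (ModuleCat.of H H) := (1 : H)

lemma iA_smul_oneπ (a : A) : D.iA a • D.oneπ = algebraMap k Λ (D.ε a) • D.oneπ := by
  change D.π (D.iA a) * 1 = D.π (algebraMap k Λ (D.ε a)) * 1
  rw [π_iA, AlgHom.commutes]

lemma exists_eq_smul_oneπ (z : D.resπ.obj (ModuleCat.of H H)) : ∃ h, z = D.iH h • D.oneπ := by
  refine ⟨(show H from z), ?_⟩
  change (show H from z) = D.π (D.iH (show H from z)) * 1
  rw [π_iH, mul_one]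

lemma map_rightMul_oneπ (h : H) : D.resπ.map (rightMul h) D.oneπ = D.iH h • D.oneπ := by
  change 1 * h = D.π (D.iH h) * 1
  rw [π_iH, one_mul, mul_one]

lemma homπ_ext {N : ModuleCat.{u} Λ} {f g : D.resπ.obj (ModuleCat.of H H) ⟶ N}
    (h : f D.oneπ = g D.oneπ) : f = g := by
  ext x
  obtain ⟨y, rfl⟩ := D.exists_eq_smul_oneπ x
  rw [map_smul, map_smul]
  exact congrArg _ h

/-- Maps of `Λ`-modules out of `H` are given by elements on which `A` acts through `ε`. -/
lemma exists_homπ (N : ModuleCat.{u} Λ) (z : N)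
    (hz : ∀ a, D.iA a • z = algebraMap k Λ (D.ε a) • z) :
    ∃ f : D.resπ.obj (ModuleCat.of H H) ⟶ N, f D.oneπ = z := by
  refine ⟨ModuleCat.ofHom (X := D.resπ.obj (ModuleCat.of H H))
    { toFun := fun (x : H) ↦ D.iH x • z
      map_add' := fun (x y : H) ↦ (congrArg (· • z) (map_add D.iH x y)).trans (add_smul _ _ _)
      map_smul' := fun l (x : H) ↦ ?_ }, ?_⟩
  · change D.iH (D.π l * x) • z = l • D.iH x • z
    rw [← mul_smul, D.smul_eq_of_iA_smul z hz (l * D.iH x), map_mul D.π, D.π_iH]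
  · exact (congrArg (· • z) (map_one D.iH)).trans (one_smul _ _)

/-- On `H ⊗ H` with the diagonal action of `Λ`, the algebra `A` acts through the augmentation. -/
lemma iA_smul_orbit_oneπ (a : A) (t : H ⊗[k] H) :
    D.iA a • D.orbit D.oneπ (1 : H) (TensorProduct.map D.iH.toLinearMap LinearMap.id t) =
    algebraMap k Λ (D.ε a) • D.orbit D.oneπ (1 : H)
      (TensorProduct.map D.iH.toLinearMap LinearMap.id t) := by
  induction t using TensorProduct.induction_on with
  | zero => simp
  | add x y hx hy => simp only [map_add, smul_add, hx, hy]
  | tmul x y =>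
    rw [TensorProduct.map_tmul, orbit_tmul, iA_smul_tmul, ← D.iA.commutes, iA_smul_tmul,
      ← mul_smul, ← mul_smul, D.smul_eq_of_iA_smul _ D.iA_smul_oneπ (D.iA a * _),
      D.smul_eq_of_iA_smul _ D.iA_smul_oneπ (D.iA (algebraMap k A _) * _), map_mul D.π,
      map_mul D.π, π_iA, π_iA, AlgHom.commutes]
    rfl

lemma exists_diagHom (t : H ⊗[k] H) : ∃ f : D.resπ.obj (ModuleCat.of H H) ⟶
    (D.tensLeft (ModuleCat.of H H)).obj (D.resπ.obj (ModuleCat.of H H)), f D.oneπ =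
    D.orbit D.oneπ (1 : H) (TensorProduct.map D.iH.toLinearMap LinearMap.id t) :=
  D.exists_homπ _ _ fun a ↦ D.iA_smul_orbit_oneπ a t

/-- The map `H → H ⊗ H` of `Λ`-modules sending `1` to `t`. -/
def diagHom (t : H ⊗[k] H) : D.resπ.obj (ModuleCat.of H H) ⟶
    (D.tensLeft (ModuleCat.of H H)).obj (D.resπ.obj (ModuleCat.of H H)) :=
  (D.exists_diagHom t).choose

lemma diagHom_oneπ (t : H ⊗[k] H) : D.diagHom t D.oneπ =
    D.orbit D.oneπ (1 : H) (TensorProduct.map D.iH.toLinearMap LinearMap.id t) :=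
  (D.exists_diagHom t).choose_spec

/-- The map `Λ → Λ ⊗ H` of `Λ`-modules sending `1` to `s`. -/
def selfHom (s : Λ ⊗[k] H) : ModuleCat.of Λ Λ ⟶
    (D.tensLeft (ModuleCat.of H H)).obj (ModuleCat.of Λ Λ) :=
  ModuleCat.ofHom (LinearMap.toSpanSingleton Λ (D.Tens Λ H) (D.orbit (1 : Λ) (1 : H) s))

lemma selfHom_one (s : Λ ⊗[k] H) : D.selfHom s (1 : Λ) = D.orbit (1 : Λ) (1 : H) s :=
  one_smul _ _

lemma selfHom_add (s s' : Λ ⊗[k] H) : D.selfHom (s + s') = D.selfHom s + D.selfHom s' :=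
  hom_self_ext ((D.selfHom_one _).trans
    ((map_add _ _ _).trans (congrArg₂ (· + ·) (D.selfHom_one s) (D.selfHom_one s')).symm))

lemma diagHom_add (s s' : H ⊗[k] H) : D.diagHom (s + s') = D.diagHom s + D.diagHom s' :=
  D.homπ_ext ((D.diagHom_oneπ _).trans ((congrArg _ (map_add _ _ _)).trans
    ((map_add _ _ _).trans (congrArg₂ (· + ·) (D.diagHom_oneπ s) (D.diagHom_oneπ s')).symm)))

/-- The natural transformation `id ⊗ R_y`, for right multiplication `R_y` on `H`. -/
def tensRightMul (y : H) : D.tensLeft (ModuleCat.of H H) ⟶ D.tensLeft (ModuleCat.of H H) where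
  app M := (D.tensRight M).map (rightMul y)
  naturality _ _ _ := by
    ext1
    exact D.tens_hom_ext fun m w ↦ rfl

/-- The natural map `m ↦ m ⊗ 1`. -/
def inclTensNat : D.resA ⟶ D.tensLeft (ModuleCat.of H H) ⋙ D.resA where
  app M := D.inclTens (ModuleCat.of H H) (1 : H) M
  naturality _ _ _ := rfl

lemma diagHom_tmul (x y : H) : D.diagHom (x ⊗ₜ y) = D.diagHom (1 ⊗ₜ 1) ≫
    (D.tensLeft (ModuleCat.of H H)).map (D.resπ.map (rightMul x)) ≫
      (D.tensRightMul y).app _ := by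
  refine D.homπ_ext ((D.diagHom_oneπ _).trans ?_)
  change _ = D.tensHom _ (rightMul y).hom (D.tensHom (D.resπ.map (rightMul x)).hom _
    (D.diagHom (1 ⊗ₜ 1) D.oneπ))
  rw [diagHom_oneπ, TensorProduct.map_tmul, TensorProduct.map_tmul, orbit_tmul, orbit_tmul,
    tensHom_tmul, tensHom_tmul]
  have h1 : (D.resπ.map (rightMul x)).hom (D.iH.toLinearMap 1 • D.oneπ) = D.iH x • D.oneπ := by
    rw [← D.map_rightMul_oneπ, AlgHom.toLinearMap_apply, map_one, one_smul]
  rw [h1]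
  have h2 : (rightMul y).hom (LinearMap.id (R := H) (LinearMap.id (R := k) (1 : H) • (1 : H))) =
      (LinearMap.id (R := k) y • (1 : H) : H) := by
    change (1 * 1) * y = y * 1
    rw [one_mul, one_mul, mul_one]
  exact congrArg (D.tmul _) h2.symm

lemma selfHom_tmul (x : Λ) (y : H) : D.selfHom (x ⊗ₜ y) = D.selfHom (1 ⊗ₜ 1) ≫
    (D.tensLeft (ModuleCat.of H H)).map (rightMul x) ≫ (D.tensRightMul y).app _ := by
  refine hom_self_ext ((D.selfHom_one _).trans ?_)
  change _ = D.tensHom _ (rightMul y).hom (D.tensHom (rightMul x).hom _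
    (D.selfHom (1 ⊗ₜ 1) (1 : Λ)))
  rw [selfHom_one, orbit_tmul, orbit_tmul, tensHom_tmul, tensHom_tmul]
  change D.tmul (x * 1) (y * 1) = D.tmul (1 * 1 * x) (1 * 1 * y)
  simp only [one_mul, mul_one]

/-- The comultiplication of `H` is `Λ`-linear. -/
lemma diagHom_comul (h : H) :
    D.diagHom (comul h) = D.resπ.map (rightMul h) ≫ D.diagHom (1 ⊗ₜ 1) := by
  refine D.homπ_ext ((D.diagHom_oneπ _).trans ?_)
  change _ = D.diagHom (1 ⊗ₜ 1) (D.resπ.map (rightMul h) D.oneπ)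
  rw [map_rightMul_oneπ, map_smul, diagHom_oneπ, TensorProduct.map_tmul, orbit_tmul]
  simp only [AlgHom.toLinearMap_apply, map_one, one_smul, LinearMap.id_apply]
  exact ((D.smul_tmul_eq _ _ _).trans (congrArg _ (D.ρ_iH h))).symm

/-- The map `a h ↦ f(h) a`, for a linear form `f` on `H`. -/
def projA (f : H →ₗ[k] k) : Λ →ₗ[k] A :=
  (TensorProduct.rid k A).toLinearMap ∘ₗ LinearMap.lTensor A f ∘ₗ
    (LinearEquiv.ofBijective _ D.bijective_mul).symm.toLinearMap

lemma projA_mul (f : H →ₗ[k] k) (a : A) (h : H) : D.projA f (D.iA a * D.iH h) = f h • a := by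
  have h1 : (LinearEquiv.ofBijective _ D.bijective_mul).symm (D.iA a * D.iH h) = a ⊗ₜ[k] h := by
    rw [LinearEquiv.symm_apply_eq]
    rfl
  simp [projA, h1]

lemma induction_mul {p : Λ → Prop} (x : Λ) (hm : ∀ a h, p (D.iA a * D.iH h))
    (ha : ∀ x y, p x → p y → p (x + y)) : p x := by
  obtain ⟨t, rfl⟩ := D.bijective_mul.2 x
  induction t using TensorProduct.induction_on with
  | zero => simpa using hm 0 0
  | tmul a h => exact hm a h
  | add x y hx hy => rw [map_add]; exact ha _ _ hx hy

lemma projA_iA_mul (f : H →ₗ[k] k) (a : A) (x : Λ) :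
    D.projA f (D.iA a * x) = a * D.projA f x := by
  induction x using D.induction_mul with
  | hm b h => rw [← mul_assoc, ← map_mul, projA_mul, projA_mul, mul_smul_comm]
  | ha x y hx hy => rw [mul_add, map_add, map_add, mul_add, hx, hy]

/-- The map `Λ ⊗ H → Λ`, `a x ⊗ y ↦ ε(x) a y`. -/
def foldMap : D.Tens Λ H →+ Λ :=
  D.tensLift (AddMonoidHom.mk' (fun x ↦ AddMonoidHom.mk' (fun h ↦ D.iA (D.projA counit x) * D.iH h)
    fun y y' ↦ by rw [map_add, mul_add]) fun x x' ↦ by ext; simp [add_mul])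
    fun c x y ↦ by simp [← Algebra.smul_def]

lemma foldMap_tmul (x : Λ) (y : H) :
    D.foldMap (D.tmul x y) = D.iA (D.projA counit x) * D.iH y := rfl

lemma foldMap_iA_smul (a : A) (z : D.Tens Λ H) :
    D.foldMap (D.iA a • z) = D.iA a * D.foldMap z := by
  induction z using D.tens_induction with
  | h0 => simp
  | h2 x y hx hy => rw [smul_add, map_add, map_add, mul_add, hx, hy]
  | h1 x y =>
    rw [iA_smul_tmul, foldMap_tmul, foldMap_tmul, smul_eq_mul, projA_iA_mul, map_mul, mul_assoc]

/-- The `A`-linear map `Λ ⊗ H → Λ`, `a x ⊗ y ↦ ε(x) a y`. -/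
def foldHom : D.resA.obj ((D.tensLeft (ModuleCat.of H H)).obj (ModuleCat.of Λ Λ)) ⟶
    D.resA.obj (ModuleCat.of Λ Λ) :=
  ModuleCat.ofHom (X := D.resA.obj ((D.tensLeft (ModuleCat.of H H)).obj (ModuleCat.of Λ Λ)))
    (Y := D.resA.obj (ModuleCat.of Λ Λ))
    { toFun := D.foldMap
      map_add' := map_add D.foldMap
      map_smul' := D.foldMap_iA_smul }

lemma foldMap_orbit (t : H ⊗[k] H) :
    D.foldMap (D.orbit (1 : Λ) (1 : H) (TensorProduct.map D.iH.toLinearMap LinearMap.id t)) =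
      D.iH (TensorProduct.lid k H (LinearMap.rTensor H counit t)) := by
  induction t using TensorProduct.induction_on with
  | zero => simp
  | add x y hx hy => simp only [map_add, hx, hy]
  | tmul x y =>
    have h1 : D.projA counit (D.iH x) = counit (R := k) x • 1 := by
      rw [← D.projA_mul, map_one, one_mul]
    simp [foldMap_tmul, h1]

lemma incl_selfHom_foldHom (t : H ⊗[k] H) :
    D.incl 1 ≫ D.resA.map (D.selfHom (TensorProduct.map D.iH.toLinearMap LinearMap.id t)) ≫
      D.foldHom = D.incl (TensorProduct.lid k H (LinearMap.rTensor H counit t)) := by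
  refine hom_self_ext ?_
  change D.foldMap ((D.iA 1 * D.iH 1) • D.orbit (1 : Λ) (1 : H) _) = (D.iA 1 * D.iH _ : Λ)
  have h1 : (D.iA 1 * D.iH 1 : Λ) = 1 := by rw [map_one, map_one, one_mul]
  rw [h1, map_one D.iA, one_smul, foldMap_orbit, one_mul]

/-- The coaction of `Λ` is `Λ`-linear. -/
lemma rightMul_selfHom (h : H) : rightMul (D.iH h) ≫ D.selfHom (1 ⊗ₜ 1) =
    D.selfHom (TensorProduct.map D.iH.toLinearMap LinearMap.id (comul h)) := by
  refine hom_self_ext (Eq.trans ?_ (D.selfHom_one _).symm)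
  change (1 * D.iH h) • D.orbit (1 : Λ) (1 : H) (1 ⊗ₜ 1) = _
  rw [one_mul, ← ρ_iH, ← smul_tmul_eq, orbit_tmul, one_smul, one_smul]

variable {n : ℕ} (e : Ext.{u} (D.resπ.obj (ModuleCat.of H H)) (ModuleCat.of Λ Λ) n)
  (e₀ : Ext.{u} (trivialModule D.ε) (ModuleCat.of A A) n)

/-- The class `e ⊗ H`, restricted along `h ↦ h₁ ⊗ h₂`, is the class `e` pushed forward along the
coaction `Λ → Λ ⊗ H`. Here `e` is the class of `Ext_Λ (H, Λ)` corresponding to `e₀`. -/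
lemma diagHom_comp_one
    (he : D.extResA _ n e = e₀.comp (Ext.mk₀ (D.incl 1)) (add_zero n)) :
    (Ext.mk₀ (D.diagHom (1 ⊗ₜ 1))).comp
      (e.mapExactFunctor (D.tensLeft (ModuleCat.of H H))) (zero_add n) =
    e.comp (Ext.mk₀ (D.selfHom (1 ⊗ₜ 1))) (add_zero n) := by
  refine (D.extResA_bijective _ n).1 ?_
  rw [extResA_comp, he]
  -- It suffices to compare the images in `Ext_A (k, Λ ⊗ H)`. As `A`-linear maps, both the
  -- comultiplication on `k ⊆ H` and the coaction on `A ⊆ Λ` are the natural map `m ↦ m ⊗ 1`.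
  have h1 : D.unitH ≫ D.resA.map (D.diagHom (1 ⊗ₜ 1)) =
      D.unitH ≫ D.inclTensNat.app (D.resπ.obj (ModuleCat.of H H)) := by
    have h3 : D.diagHom (1 ⊗ₜ 1) D.oneπ = D.tmul D.oneπ (1 : H) := by
      rw [diagHom_oneπ, TensorProduct.map_tmul, orbit_tmul, AlgHom.toLinearMap_apply, map_one,
        one_smul]
      exact congrArg (D.tmul _) (one_mul (1 : H))
    ext (c : k)
    have h4 : D.unitH c = algebraMap k Λ c • D.oneπ := by
      change algebraMap k H c = D.π (algebraMap k Λ c) * 1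
      rw [AlgHom.commutes, mul_one]
    change D.diagHom (1 ⊗ₜ 1) (D.unitH c) = D.tmul (D.unitH c) (1 : H)
    rw [h4, map_smul, h3, ← D.iA.commutes]
    exact D.iA_smul_tmul _ _ _
  have h2 : D.incl 1 ≫ D.resA.map (D.selfHom (1 ⊗ₜ 1)) =
      D.incl 1 ≫ D.inclTensNat.app (ModuleCat.of Λ Λ) := by
    refine hom_self_ext ?_
    change (D.iA 1 * D.iH 1) • D.orbit (1 : Λ) (1 : H) (1 ⊗ₜ 1) =
      D.tmul (D.iA 1 * D.iH 1 : Λ) (1 : H)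
    rw [map_one, map_one, one_mul, one_smul, orbit_tmul, one_smul, one_smul]
  simp only [extResA, extPreMap_apply, Ext.mapExactFunctor_comp, Ext.mapExactFunctor_mk₀] at he ⊢
  rw [← Ext.comp_assoc_of_second_deg_zero, Ext.mk₀_comp_mk₀, h1,
    Ext.comp_assoc_of_third_deg_zero e₀, Ext.mk₀_comp_mk₀, h2, ← Ext.mk₀_comp_mk₀,
    ← Ext.mk₀_comp_mk₀, ← Ext.comp_assoc_of_third_deg_zero e₀, ← he,
    Ext.comp_assoc_of_third_deg_zero, mapExactFunctor_natTrans, mapExactFunctor_mapExactFunctor,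
    Ext.comp_assoc_of_second_deg_zero]

/-- The same for all maps `H → H ⊗ H`: moving them past `e` applies `φ` to the first factor. -/
lemma diagHom_comp
    (he : D.extResA _ n e = e₀.comp (Ext.mk₀ (D.incl 1)) (add_zero n))
    (φ : H →ₗ[k] H) (hφ : ∀ h, (Ext.mk₀ (D.resπ.map (rightMul h))).comp e (zero_add n) =
      e.comp (Ext.mk₀ (rightMul (D.iH (φ h)))) (add_zero n))
    (t : H ⊗[k] H) : (Ext.mk₀ (D.diagHom t)).comp
      (e.mapExactFunctor (D.tensLeft (ModuleCat.of H H))) (zero_add n) =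
    e.comp (Ext.mk₀ (D.selfHom (TensorProduct.map (D.iH.toLinearMap ∘ₗ φ) LinearMap.id t)))
      (add_zero n) := by
  have hmul : ∀ x y : H, (Ext.mk₀ (D.diagHom (x ⊗ₜ y))).comp
      (e.mapExactFunctor (D.tensLeft (ModuleCat.of H H))) (zero_add n) =
    e.comp (Ext.mk₀ (D.selfHom
      (TensorProduct.map (D.iH.toLinearMap ∘ₗ φ) LinearMap.id (x ⊗ₜ y)))) (add_zero n) := by
    intro x y
    have h1 := congrArg (Ext.mapExactFunctor (D.tensLeft (ModuleCat.of H H))) (hφ x)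
    rw [Ext.mapExactFunctor_comp, Ext.mapExactFunctor_comp, Ext.mapExactFunctor_mk₀,
      Ext.mapExactFunctor_mk₀] at h1
    rw [diagHom_tmul, TensorProduct.map_tmul, selfHom_tmul, ← Ext.mk₀_comp_mk₀,
      ← Ext.mk₀_comp_mk₀, Ext.comp_assoc_of_second_deg_zero, Ext.comp_assoc_of_second_deg_zero,
      ← mapExactFunctor_natTrans, ← Ext.comp_assoc_of_third_deg_zero (Ext.mk₀ _), h1,
      Ext.comp_assoc_of_third_deg_zero, Ext.mk₀_comp_mk₀, ← Ext.comp_assoc_of_third_deg_zero,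
      D.diagHom_comp_one e e₀ he, Ext.comp_assoc_of_third_deg_zero, Ext.mk₀_comp_mk₀]
    rfl
  induction t using TensorProduct.induction_on with
  | zero => simpa using hmul 0 0
  | add x y hx hy =>
    rw [map_add, diagHom_add, selfHom_add, Ext.mk₀_add, Ext.mk₀_add, Ext.add_comp, Ext.comp_add,
      hx, hy]
  | tmul x y => exact hmul x y

/-- The automorphism `φ` of `H` by which `H` acts on the class `e` is a winding map:
`φ(h) = ε(φ(h₁)) h₂`. -/
lemma inclClass_winding
    (he : D.extResA _ n e = e₀.comp (Ext.mk₀ (D.incl 1)) (add_zero n))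
    (φ : H →ₗ[k] H) (hφ : ∀ h, (Ext.mk₀ (D.resπ.map (rightMul h))).comp e (zero_add n) =
      e.comp (Ext.mk₀ (rightMul (D.iH (φ h)))) (add_zero n))
    (h : H) :
    D.inclClass e₀ (winding (counit ∘ₗ φ) h) = D.inclClass e₀ (φ h) := by
  -- Evaluate `diagHom (Δ h)` against `e ⊗ H` in two ways: as `h` acting on `e`, followed by the
  -- coaction, and by applying `φ` to the first factor of `Δ h`. Then apply the counit to the first
  -- factor.
  have h1 := D.diagHom_comp e e₀ he φ hφ (comul h)
  rw [diagHom_comul, ← Ext.mk₀_comp_mk₀, Ext.comp_assoc_of_second_deg_zero,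
    diagHom_comp_one D e e₀ he, ← Ext.comp_assoc_of_third_deg_zero, hφ,
    Ext.comp_assoc_of_third_deg_zero, Ext.mk₀_comp_mk₀, rightMul_selfHom] at h1
  have h2 := congrArg (fun z ↦ (D.extResA _ n z).comp (Ext.mk₀ D.foldHom) (add_zero n)) h1
  simp only [extResA_comp, he, Ext.comp_assoc_of_third_deg_zero, Ext.mk₀_comp_mk₀] at h2
  have h3 : TensorProduct.map (D.iH.toLinearMap ∘ₗ φ) LinearMap.id (comul h) =
      TensorProduct.map D.iH.toLinearMap LinearMap.id
        (TensorProduct.map φ LinearMap.id (comul h)) := by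
    generalize comul (R := k) h = t
    induction t using TensorProduct.induction_on with
    | zero => simp
    | add x y hx hy => simp only [map_add, hx, hy]
    | tmul x y => rfl
  have h4 : LinearMap.rTensor H counit (TensorProduct.map φ LinearMap.id (comul h)) =
      LinearMap.rTensor H (counit ∘ₗ φ) (comul h) := by
    rw [LinearMap.rTensor_comp]
    rfl
  rw [h3, Category.assoc, Category.assoc, incl_selfHom_foldHom, incl_selfHom_foldHom,
    rTensor_counit_comul, h4] at h2
  exact h2.symm.trans (by rw [TensorProduct.lid_tmul, one_smul]; rfl)

end DiagonalHom

/-- The main step: `Ext^n_Λ (H, Λ)` is generated by one class, on which `H` acts through an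
automorphism of `H`. -/
lemma exists_isTransferClass (hFP : ∀ m, IsFP m (trivialModule D.ε)) {n : ℕ}
    (hA : LeftASCondition k A D.ε n) :
    ∃ e : Ext.{u} (D.resπ.obj (ModuleCat.of H H)) (ModuleCat.of Λ Λ) n,
      IsTransferClass D.resπ e := by
  obtain ⟨e₀, he₀, hgen⟩ := finrank_eq_one_iff'.1
    (Module.finrank_eq_of_rank_eq (n := 1) (by simpa using hA n))
  have hinj : Function.Bijective fun c : k ↦ c • e₀ :=
    ⟨fun c c' h ↦ smul_left_injective k he₀ h, hgen⟩
  let Ψ := LinearEquiv.ofBijective _ (D.inclClass_bijective hFP e₀ hinj)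
  obtain ⟨e, he⟩ := (D.extResA_bijective _ n).2 (D.inclClass e₀ 1)
  have hE : ∀ y, D.extResA _ n (e.comp (Ext.mk₀ (rightMul (D.iH y))) (add_zero n)) =
      D.inclClass e₀ y := by
    intro y
    rw [extResA_comp, he]
    change (e₀.comp (Ext.mk₀ (D.incl 1)) (add_zero n)).comp _ _ = e₀.comp _ (add_zero n)
    rw [Ext.comp_assoc_of_third_deg_zero, Ext.mk₀_comp_mk₀, D.incl_eq y]
  -- The action of `H` on the first argument translates into right multiplication by `φ h`.
  let φ : H →ₗ[k] H := Ψ.symm.toLinearMap ∘ₗ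
    { toFun := fun h ↦ D.extResA _ n
        ((Ext.mk₀ (D.resπ.map (rightMul h))).comp e (zero_add n))
      map_add' := fun h h' ↦ by
        rw [← map_add, ← Ext.add_comp, ← Ext.mk₀_add]
        congr 3
        exact D.homπ_ext (mul_add (1 : H) h h')
      map_smul' := fun c h ↦ by
        have h1 : D.resπ.map (rightMul (c • h)) = c • D.resπ.map (rightMul h) := by
          refine D.homπ_ext ?_
          change (1 : H) * c • h = D.π (algebraMap k Λ c) * (1 * h)
          rw [AlgHom.commutes, one_mul, one_mul, Algebra.smul_def]
        rw [h1, Ext.mk₀_smul, Ext.smul_comp]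
        exact D.extResA_smul _ _ }
  have hφ : ∀ h, (Ext.mk₀ (D.resπ.map (rightMul h))).comp e (zero_add n) =
      e.comp (Ext.mk₀ (rightMul (D.iH (φ h)))) (add_zero n) := by
    intro h
    refine (D.extResA_bijective _ n).1 ?_
    rw [hE]
    exact (Ψ.apply_symm_apply _).symm
  have hφ' : ∀ h y, (Ext.mk₀ (D.resπ.map (rightMul h))).comp e (zero_add n) =
      e.comp (Ext.mk₀ (rightMul (D.iH y))) (add_zero n) → φ h = y := by
    intro h y hy
    refine (D.inclClass_bijective hFP e₀ hinj).1 ?_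
    rw [← hE, ← hE, ← hφ, hy]
  -- The algebra homomorphism `φ` is the winding map of the character `χ`, hence bijective.
  let χ : H →ₐ[k] k := AlgHom.ofLinearMap (counit ∘ₗ φ)
    (by
      have : φ 1 = 1 := by
        refine hφ' _ _ ?_
        have h1 : D.resπ.map (rightMul (1 : H)) = 𝟙 _ := D.homπ_ext (mul_one (1 : H))
        have h2 : rightMul (D.iH 1) = 𝟙 _ := hom_self_ext
          ((one_mul (D.iH 1)).trans (map_one D.iH))
        rw [h1, h2, Ext.mk₀_id_comp, Ext.comp_mk₀_id]
      simp [this])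
    (fun h h' ↦ by
      have : φ (h * h') = φ h * φ h' := by
        refine hφ' _ _ ?_
        rw [← rightMul_comp, Functor.map_comp, ← Ext.mk₀_comp_mk₀,
          Ext.comp_assoc_of_second_deg_zero, hφ, ← Ext.comp_assoc_of_third_deg_zero, hφ,
          Ext.comp_assoc_of_third_deg_zero, Ext.mk₀_comp_mk₀, rightMul_comp, map_mul]
      simp [this])
  have hφb : Function.Bijective φ := by
    refine bijective_congr (winding_bijective χ) fun h ↦ ?_
    exact ((D.inclClass_bijective hFP e₀ hinj).1 (D.inclClass_winding e e₀ he φ hφ h)).symm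
  refine ⟨e, fun i hi ↦ ?_, ?_⟩
  · refine D.subsingleton_ext_resπ hFP ?_
    have := hA i
    rw [if_neg hi, rank_zero_iff] at this
    exact this
  · have h1 : Function.Bijective (fun h ↦ extTransfer D.resπ e (ModuleCat.of H H) 0 n (zero_add n)
        (Ext.mk₀ (rightMul h))) := by
      rw [← Function.Bijective.of_comp_iff' (D.extResA_bijective (ModuleCat.of Λ Λ) n)]
      refine bijective_congr ((D.inclClass_bijective hFP e₀ hinj).comp hφb) fun h ↦ ?_
      rw [Function.comp_apply, Function.comp_apply, extTransfer_apply, Ext.mapExactFunctor_mk₀, hφ,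
        hE]
    have h2 : Function.Surjective fun h : H ↦ Ext.mk₀ (rightMul h) := fun x ↦ by
      obtain ⟨f, rfl⟩ := (Ext.mk₀_bijective _ _).2 x
      exact ⟨_, congrArg Ext.mk₀ (eq_rightMul f).symm⟩
    refine ⟨fun x y hxy ↦ ?_, fun z ↦ ?_⟩
    · obtain ⟨x, rfl⟩ := h2 x
      obtain ⟨y, rfl⟩ := h2 y
      rw [h1.1 hxy]
    · obtain ⟨h, hh⟩ := h1.2 z
      exact ⟨_, hh⟩

/-- A smash product satisfies the left Artin-Schelter condition. -/
theorem leftASCondition (hFP : ∀ m, IsFP m (trivialModule D.ε)) {n d : ℕ}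
    (hA : LeftASCondition k A D.ε n)
    (hFP' : ∀ m, IsFP m (trivialModule (Bialgebra.counitAlgHom k H)))
    (hH : LeftASCondition k H (Bialgebra.counitAlgHom k H) d) :
    LeftASCondition k Λ ((Bialgebra.counitAlgHom k H).comp D.π) (n + d) := by
  obtain ⟨e, he⟩ := D.exists_isTransferClass hFP hA
  intro m
  have h1 : trivialModule ((Bialgebra.counitAlgHom k H).comp D.π) =
    D.resπ.obj (trivialModule (Bialgebra.counitAlgHom k H)) := rfl
  rw [h1]
  rcases lt_or_ge m n with hm | hm
  · have := he.subsingleton_of_lt m hm _ (hFP' _)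
    rw [if_neg (by lia), rank_zero_iff]
    exact this
  · obtain ⟨j, rfl⟩ := Nat.exists_eq_add_of_le' hm
    let F : Ext.{u} (trivialModule (Bialgebra.counitAlgHom k H)) (ModuleCat.of H H) j →ₗ[k]
        Ext.{u} (D.resπ.obj (trivialModule (Bialgebra.counitAlgHom k H)))
          (ModuleCat.of Λ Λ) (j + n) :=
      { extTransfer D.resπ e (trivialModule (Bialgebra.counitAlgHom k H)) j (j + n) rfl with
        map_smul' := fun c x ↦ by
          change extTransfer _ _ _ _ _ rfl _ = c • extTransfer _ _ _ _ _ rfl _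
          rw [extTransfer_apply, extTransfer_apply, Functor.mapExactFunctor_smul, Ext.smul_comp] }
    have hF : Function.Bijective F := he.extTransfer_bijective _ _ rfl _ (hFP' _)
    rw [← (LinearEquiv.ofBijective F hF).rank_eq, hH j]
    congr 1
    simp [add_comm]

end SmashExtension

namespace SmashExtension

variable {k A H Λ : Type u} [Field k] [Ring A] [Algebra k A] [Ring H] [HopfAlgebra k H]
  [Ring Λ] [Algebra k Λ] (D : SmashExtension k A H Λ)

/-! ### Homological dimensions of smash products -/

/-- The module `M ⊗ H` is induced from the restriction of `M` to `A`, so that `Ext_Λ (M ⊗ H, N) ≃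
Ext_A (M, N)`. -/
lemma subsingleton_ext_tens_self (M N : ModuleCat.{u} Λ) (m : ℕ)
    (hN : HasInjectiveDimensionLT (D.resA.obj N) m) (i : ℕ) (hi : m ≤ i) :
    Subsingleton (Ext.{u} ((D.tensRight M).obj (ModuleCat.of H H)) N i) := by
  have := D.isRightFree.preservesInjectiveObjects
  have := HasInjectiveDimensionLT.subsingleton (D.resA.obj N) m i hi (D.resA.obj M)
  exact (extPreMap_bijective D.resA (D.inclTens (ModuleCat.of H H) (1 : H) M)
    (D.bijective_inclTens_one M) N i).injective.subsingleton

/-- The Ext groups out of `M ⊗ W` vanish above the injective dimension over `A` plus the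
projective dimension of `W`: this reduces to `W = H`, where `M ⊗ H` is induced from `A`. -/
lemma subsingleton_ext_tens (M N : ModuleCat.{u} Λ) (m : ℕ)
    (hN : HasInjectiveDimensionLT (D.resA.obj N) m) (p : ℕ) (W : ModuleCat.{u} H)
    (hW : IsFP (p + 1) W) (hp : HasProjectiveDimensionLT W (p + 1)) (i : ℕ) (hi : m + p ≤ i) :
    Subsingleton (Ext.{u} ((D.tensRight M).obj W) N i) := by
  have hproj : ∀ (P : ModuleCat.{u} H), Projective P → Module.Finite H P → ∀ i, m ≤ i →
      Subsingleton (Ext.{u} ((D.tensRight M).obj P) N i) := by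
    intro P _ _ i hi
    -- `P` is a direct summand of some `Hʳ`.
    obtain ⟨r, a, b, hab⟩ := exists_dual_basis P
    refine subsingleton_of_forall_eq 0 fun x ↦ ?_
    have := D.subsingleton_ext_tens_self M N m hN i hi
    rw [← sum_comp_eq (D.tensRight M) P hab x]
    refine Finset.sum_eq_zero fun l _ ↦ ?_
    rw [Subsingleton.elim ((Ext.mk₀ ((D.tensRight M).map (b l))).comp x (zero_add i)) 0,
      Ext.comp_zero]
  induction p generalizing W i with
  | zero =>
    rw [zero_add, ← projective_iff_hasProjectiveDimensionLT_one] at hp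
    exact hproj W hp hW.finite i hi
  | succ p ih =>
    -- Dimension shift along `0 → S.X₁ → S.X₂ → W → 0` with `S.X₂` projective.
    obtain ⟨S, hS, hP, hF, hK, rfl⟩ := hW.exists_shortExact
    have h1 := ih S.X₁ hK ((hS.hasProjectiveDimensionLT_X₃_iff p hP).1 hp) (i - 1) (by lia)
    have h2 := hproj S.X₂ hP hF i (by lia)
    have h0 : ∀ x : Ext.{u} ((D.tensRight M).obj S.X₃) N i, x = 0 := fun x ↦ by
      obtain ⟨y, hy⟩ := Ext.contravariant_sequence_exact₃ (hS.map_of_exact (D.tensRight M)) N x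
        (Subsingleton.elim (α := Ext.{u} ((D.tensRight M).obj S.X₂) N i) _ _)
        (show 1 + (i - 1) = i by lia)
      have : Subsingleton (Ext.{u} (S.map (D.tensRight M)).X₁ N (i - 1)) := h1
      rw [← hy, Subsingleton.elim y 0, Ext.comp_zero]
      rfl
    exact ⟨fun x y ↦ by rw [h0 x, h0 y]⟩

/-- The coaction `ρ : Λ → Λ ⊗ H` followed by `f` on the second factor. -/
lemma rid_lTensor_ρ (f : H →ₗ[k] k) (a : A) (h : H) :
    TensorProduct.rid k Λ (LinearMap.lTensor Λ f (D.ρ (D.iA a * D.iH h))) =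
      D.iA a * D.iH (rightConv f h) := by
  have key : ∀ t : H ⊗[k] H, TensorProduct.rid k Λ (LinearMap.lTensor Λ f
      ((D.iA a ⊗ₜ[k] (1 : H)) * TensorProduct.map D.iH.toLinearMap LinearMap.id t)) =
      D.iA a * D.iH (TensorProduct.rid k H (LinearMap.lTensor H f t)) := by
    intro t
    induction t using TensorProduct.induction_on with
    | zero => simp
    | add x y hx hy => simp only [map_add, mul_add, hx, hy]
    | tmul x y => simp
  rw [map_mul D.ρ, ρ_iA, ρ_iH, key, rightConv_apply]

lemma rid_lTensor_counit_ρ (x : Λ) :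
    TensorProduct.rid k Λ (LinearMap.lTensor Λ counit (D.ρ x)) = x := by
  induction x using D.induction_mul with
  | ha x y hx hy => simp only [map_add, hx, hy]
  | hm a h => rw [rid_lTensor_ρ, rightConv_apply, lTensor_counit_comul]; simp

/-- The map `m ⊗ c ↦ c m`. -/
def tensTrivialMap (M : ModuleCat.{u} Λ) :
    D.Tens M (trivialModule (Bialgebra.counitAlgHom k H)) →+ M :=
  D.tensLift (AddMonoidHom.mk' (fun m ↦ AddMonoidHom.mk' (fun (c : k) ↦ algebraMap k Λ c • m)
    fun c c' ↦ (congrArg (· • m) (map_add (algebraMap k Λ) c c')).trans (add_smul _ _ _))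
      fun m m' ↦ by ext (c : k); exact smul_add (algebraMap k Λ c) m m')
    fun c m (w : k) ↦ by
      change algebraMap k Λ w • algebraMap k Λ c • m =
        algebraMap k Λ (counit (R := k) (algebraMap k H c) * w) • m
      rw [← mul_smul, ← map_mul, Bialgebra.counit_algebraMap, mul_comm]

/-- The scalar underlying an element of the trivial module. -/
def trivialScalar (c : trivialModule (Bialgebra.counitAlgHom k H)) : k := c

/-- The generator of the trivial module. -/
def trivialOne (k H : Type u) [Field k] [Ring H] [HopfAlgebra k H] :
    trivialModule (Bialgebra.counitAlgHom k H) := (1 : k)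

lemma trivialScalar_smul (y : H) (c : trivialModule (Bialgebra.counitAlgHom k H)) :
    trivialScalar (y • c) = counit (R := k) y * trivialScalar c := rfl

lemma algebraMap_smul_trivialOne (c : trivialModule (Bialgebra.counitAlgHom k H)) :
    algebraMap k H (trivialScalar c) • trivialOne k H = c := by
  change counit (R := k) (algebraMap k H (trivialScalar c)) * 1 = trivialScalar c
  rw [Bialgebra.counit_algebraMap, mul_one]

lemma tensTrivialMap_tmul (M : ModuleCat.{u} Λ) (m : M)
    (c : trivialModule (Bialgebra.counitAlgHom k H)) :
    D.tensTrivialMap M (D.tmul m c) = algebraMap k Λ (trivialScalar c) • m := rfl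

lemma tensTrivialMap_smul (M : ModuleCat.{u} Λ) (x : Λ)
    (z : D.Tens M (trivialModule (Bialgebra.counitAlgHom k H))) :
    D.tensTrivialMap M (x • z) = x • D.tensTrivialMap M z := by
  induction z using D.tens_induction with
  | h0 => simp
  | h2 y z hy hz => simp only [smul_add, map_add, hy, hz]
  | h1 m c =>
    have key : ∀ t : Λ ⊗[k] H, D.tensTrivialMap M (D.orbit m c t) =
        TensorProduct.rid k Λ (LinearMap.lTensor Λ counit t) •
          algebraMap k Λ (trivialScalar c) • m := by
      intro t
      induction t using TensorProduct.induction_on with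
      | zero => simp
      | add x y hx hy => simp only [map_add, add_smul, hx, hy]
      | tmul x y =>
        rw [orbit_tmul, tensTrivialMap_tmul, trivialScalar_smul, LinearMap.lTensor_tmul,
          TensorProduct.rid_tmul, ← mul_smul, ← mul_smul, Algebra.smul_def, map_mul, mul_assoc,
          mul_assoc, Algebra.commutes (trivialScalar c) x]
    rw [smul_tmul_eq, key, rid_lTensor_counit_ρ, tensTrivialMap_tmul]

lemma tmul_tensTrivialMap (M : ModuleCat.{u} Λ)
    (z : D.Tens M (trivialModule (Bialgebra.counitAlgHom k H))) :
    D.tmul (D.tensTrivialMap M z) (trivialOne k H) = z := by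
  induction z using D.tens_induction with
  | h0 => rw [map_zero]; exact TensorProduct.zero_tmul _ _
  | h2 y z hy hz => rw [map_add, add_tmul, hy, hz]
  | h1 m c => rw [tensTrivialMap_tmul, smul_tmul, algebraMap_smul_trivialOne]

/-- The `Λ`-linear isomorphism `M ⊗ k ≃ M`. -/
def tensTrivialIso (M : ModuleCat.{u} Λ) :
    (D.tensRight M).obj (trivialModule (Bialgebra.counitAlgHom k H)) ≅ M :=
  LinearEquiv.toModuleIso
    { toFun := D.tensTrivialMap M
      map_add' := map_add _
      map_smul' := D.tensTrivialMap_smul M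
      invFun := fun m ↦ D.tmul m (trivialOne k H)
      left_inv := D.tmul_tensTrivialMap M
      right_inv := fun m ↦ by
        rw [tensTrivialMap_tmul]
        exact (congrArg (· • m) (map_one (algebraMap k Λ))).trans (one_smul _ _) }

/-- The case `W = k` of `subsingleton_ext_tens`, since `M ⊗ k ≃ M` for every `M`. -/
lemma hasInjectiveDimensionLT (N : ModuleCat.{u} Λ) (m p : ℕ)
    (hN : HasInjectiveDimensionLT (D.resA.obj N) m)
    (hFP : ∀ j, IsFP j (trivialModule (Bialgebra.counitAlgHom k H)))
    (hp : HasProjectiveDimensionLT (trivialModule (Bialgebra.counitAlgHom k H)) (p + 1)) :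
    HasInjectiveDimensionLT N (m + p) := by
  refine hasInjectiveDimensionLT_of_enoughProjectives N (m + p) fun M ↦ ?_
  have := D.subsingleton_ext_tens M N m hN p _ (hFP _) hp _ le_rfl
  refine ⟨fun x y ↦ ?_⟩
  have h1 : ∀ x : Ext.{u} M N (m + p), x = 0 := fun x ↦ by
    rw [← Ext.mk₀_id_comp x, ← (D.tensTrivialIso M).inv_hom_id, ← Ext.mk₀_comp_mk₀,
      Ext.comp_assoc_of_second_deg_zero,
      Subsingleton.elim ((Ext.mk₀ (D.tensTrivialIso M).hom).comp x _) 0, Ext.comp_zero]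
  rw [h1 x, h1 y]

/-- The bound on the injective dimension of a smash product. -/
theorem hasInjectiveDimensionLT_self (D : SmashExtension k A H Λ) [IsNoetherianRing A] (m p : ℕ)
    (hA : HasInjectiveDimensionLT (ModuleCat.of A A) (m + 1))
    (hFP : ∀ j, IsFP j (trivialModule (Bialgebra.counitAlgHom k H)))
    (hp : HasProjectiveDimensionLT (trivialModule (Bialgebra.counitAlgHom k H)) (p + 1)) :
    HasInjectiveDimensionLT (ModuleCat.of Λ Λ) (m + p + 1) := by
  have h := D.hasInjectiveDimensionLT _ _ p
    ((D.isDirectSum_incl (Module.Basis.ofVectorSpace k H)).hasInjectiveDimensionLT m hA) hFP hp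
  convert h using 1
  ring

/-- The bound on the global dimension of a smash product. -/
theorem hasProjectiveDimensionLT (D : SmashExtension k A H Λ) (m p : ℕ)
    (hA : ∀ M : ModuleCat.{u} A, HasProjectiveDimensionLT M m)
    (hFP : ∀ j, IsFP j (trivialModule (Bialgebra.counitAlgHom k H)))
    (hp : HasProjectiveDimensionLT (trivialModule (Bialgebra.counitAlgHom k H)) (p + 1))
    (M : ModuleCat.{u} Λ) : HasProjectiveDimensionLT M (m + p) := by
  refine hasProjectiveDimensionLT_of_enoughInjectives M (m + p) fun N ↦ ?_
  have : HasInjectiveDimensionLT (D.resA.obj N) m :=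
    hasInjectiveDimensionLT_of_enoughProjectives _ _ fun Y ↦
      HasProjectiveDimensionLT.subsingleton Y m m le_rfl (D.resA.obj N)
  have := D.hasInjectiveDimensionLT N m p this hFP hp
  exact HasInjectiveDimensionLT.subsingleton N _ _ le_rfl M

/-! ### Finite-dimensional Hopf algebras: `A ⊆ Λ` is a Frobenius extension -/

lemma iA_injective : Function.Injective D.iA :=
  Function.LeftInverse.injective (g := D.projA counit) fun a ↦ by
    rw [← mul_one (D.iA a), ← map_one D.iH, projA_mul, Bialgebra.counit_one, one_smul]

/-- For an integral `f`, the map `a h ↦ f(h) a` can be written in terms of the coaction, `x ↦ x₀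
f(x₁)`. As the coaction is multiplicative and trivial on `A`, this map is also right `A`-linear. -/
lemma iA_projA {f : H →ₗ[k] k} (hf : IsIntegral f) (x : Λ) :
    D.iA (D.projA f x) = TensorProduct.rid k Λ (LinearMap.lTensor Λ f (D.ρ x)) := by
  induction x using D.induction_mul with
  | ha x y hx hy => simp only [map_add, hx, hy]
  | hm a h =>
    rw [rid_lTensor_ρ, projA_mul, hf, map_smul, map_smul, map_one, mul_smul_comm, mul_one]

lemma projA_mul_iA {f : H →ₗ[k] k} (hf : IsIntegral f) (x : Λ) (b : A) :
    D.projA f (x * D.iA b) = D.projA f x * b := by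
  apply D.iA_injective
  rw [map_mul D.iA, D.iA_projA hf, D.iA_projA hf, map_mul D.ρ, ρ_iA]
  generalize D.ρ x = t
  induction t using TensorProduct.induction_on with
  | zero => simp
  | add x y hx hy => simp only [map_add, add_mul, hx, hy]
  | tmul x y => simp

section Frobenius

variable {f : H →ₗ[k] k} {ι : Type u} {b b' : Module.Basis ι k H}

/-- The `A`-linear map `Λ → A`, `a h ↦ f(h) a`. -/
def frobHom (f : H →ₗ[k] k) : D.resA.obj (ModuleCat.of Λ Λ) ⟶ ModuleCat.of A A :=
  ModuleCat.ofHom (X := D.resA.obj (ModuleCat.of Λ Λ))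
    { toFun := fun (x : Λ) ↦ D.projA f x
      map_add' := fun (x y : Λ) ↦ map_add (D.projA f) x y
      map_smul' := fun a (x : Λ) ↦ D.projA_iA_mul f a x }

lemma projA_iH_mul_iH [DecidableEq ι] (i j : ι)
    (hb : ∀ i j, f (b' i * b j) = if i = j then 1 else 0) :
    D.projA f (D.iH (b' i) * D.iH (b j)) = if i = j then 1 else 0 := by
  rw [← map_mul, ← one_mul (D.iH _), ← map_one D.iA, D.projA_mul, hb]
  split_ifs <;> simp

/-- Expansion with respect to the right `A`-basis `b`. -/
lemma sum_mul_projA [Fintype ι] [DecidableEq ι] (hf : IsIntegral f)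
    (hb : ∀ i j, f (b' i * b j) = if i = j then 1 else 0) (x : Λ) :
    ∑ j, D.iH (b j) * D.iA (D.projA f (D.iH (b' j) * x)) = x := by
  obtain ⟨c, rfl⟩ := (D.bijective_rightBasis b).2 x
  have h1 : (c.sum fun j a ↦ D.iH (b j) * D.iA.toRingHom a) = ∑ j, D.iH (b j) * D.iA (c j) :=
    Finsupp.sum_fintype _ _ fun j ↦ by simp
  dsimp only
  rw [h1]
  refine Finset.sum_congr rfl fun j _ ↦ ?_
  simp only [Finset.mul_sum, map_sum, ← mul_assoc, D.projA_mul_iA hf,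
    D.projA_iH_mul_iH _ _ hb]
  simp [apply_ite D.iA]

/-- Expansion with respect to the left `A`-basis `b'`. -/
lemma sum_projA_mul [Fintype ι] [DecidableEq ι]
    (hb : ∀ i j, f (b' i * b j) = if i = j then 1 else 0) (x : Λ) :
    ∑ j, D.iA (D.projA f (x * D.iH (b j))) * D.iH (b' j) = x := by
  classical
  obtain ⟨t, rfl⟩ := D.bijective_mul.2 x
  obtain ⟨c, rfl⟩ := (TensorProduct.equivFinsuppOfBasisRight (M := A) b').symm.surjective t
  have h1 : (LinearMap.mul' k Λ ∘ₗ TensorProduct.map D.iA.toLinearMap D.iH.toLinearMap)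
      ((TensorProduct.equivFinsuppOfBasisRight (M := A) b').symm c) =
        ∑ j, D.iA (c j) * D.iH (b' j) := by
    rw [TensorProduct.equivFinsuppOfBasisRight_symm_apply, Finsupp.sum_fintype _ _ (by simp)]
    simp
  rw [h1]
  refine Finset.sum_congr rfl fun j _ ↦ ?_
  simp only [Finset.sum_mul, map_sum, mul_assoc, D.projA_iA_mul, D.projA_iH_mul_iH _ _ hb]
  simp [apply_ite D.iA]

/-- Since `f` is an integral with dual bases `b`, `b'`, every `A`-linear `ψ : M → A` is the
composition of a unique `Λ`-linear `g : M → Λ` with `a h ↦ f(h) a`, namely of `g m = ∑ⱼ bⱼ ψ (b'ⱼ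
m)`. -/
lemma bijective_frobHom [Fintype ι] [DecidableEq ι] (hf : IsIntegral f)
    (hb : ∀ i j, f (b' i * b j) = if i = j then 1 else 0) (M : ModuleCat.{u} Λ) :
    Function.Bijective fun g : M ⟶ ModuleCat.of Λ Λ ↦ D.resA.map g ≫ D.frobHom f := by
  constructor
  · intro g g' h
    have h1 : ∀ m : M, D.projA f (show Λ from g m) = D.projA f (show Λ from g' m) :=
      fun m ↦ congr($h m)
    ext m
    -- `g` is determined by its composition with `a h ↦ f(h) a`.
    have h2 : ∀ g : M ⟶ ModuleCat.of Λ Λ, (show Λ from g m) =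
        ∑ j, D.iH (b j) * D.iA (D.projA f (show Λ from g (D.iH (b' j) • m))) := fun g ↦ by
      conv_lhs => rw [← D.sum_mul_projA hf hb (show Λ from g m)]
      refine Finset.sum_congr rfl fun j _ ↦ ?_
      rw [map_smul]
      rfl
    exact (h2 g).trans (by simp only [h1]; exact (h2 g').symm)
  · intro ψ
    let v : M → A := fun m ↦ ψ m
    have v_add : ∀ m m', v (m + m') = v m + v m' := fun m m' ↦ map_add ψ.hom m m'
    have v_smul : ∀ (a : A) m, v (D.iA a • m) = a * v m := fun a m ↦
      map_smul ψ.hom a (show D.resA.obj M from m)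
    have v_sum : ∀ u : ι → M, v (∑ i, u i) = ∑ i, v (u i) := fun u ↦ map_sum ψ.hom u _
    let g : M → Λ := fun m ↦ ∑ j, D.iH (b j) * D.iA (v (D.iH (b' j) • m))
    refine ⟨ModuleCat.ofHom (Y := ModuleCat.of Λ Λ)
      { toFun := g
        map_add' := fun m m' ↦ by
          simp only [g, smul_add, v_add, map_add, mul_add, Finset.sum_add_distrib]
        map_smul' := fun x m ↦ ?_ }, ?_⟩
    · have h1 : ∀ y : Λ, v (y • m) =
          ∑ i, D.projA f (y * D.iH (b i)) * v (D.iH (b' i) • m) := fun y ↦ by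
        conv_lhs => rw [← D.sum_projA_mul hb y, Finset.sum_smul, v_sum]
        exact Finset.sum_congr rfl fun i _ ↦ by rw [mul_smul, v_smul]
      change g (x • m) = x * g m
      have h2 : ∀ j, v (D.iH (b' j) • x • m) = ∑ i,
          D.projA f (D.iH (b' j) * x * D.iH (b i)) * v (D.iH (b' i) • m) := fun j ↦ by
        rw [← mul_smul, h1]
      simp only [g, h2, map_sum, Finset.mul_sum]
      rw [Finset.sum_comm]
      refine Finset.sum_congr rfl fun i _ ↦ ?_
      rw [← mul_assoc]
      conv_rhs => rw [← D.sum_mul_projA hf hb (x * D.iH (b i)), Finset.sum_mul]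
      exact Finset.sum_congr rfl fun j _ ↦ by rw [map_mul, mul_assoc, mul_assoc]
    · ext (m : M)
      change D.projA f (g m) = v m
      conv_rhs => rw [← one_smul Λ m, ← D.sum_projA_mul hb 1, Finset.sum_smul, v_sum]
      simp only [g, map_sum, D.projA_mul_iA hf, one_mul, mul_smul, v_smul]

/-- `Λ` is free as a left `A`-module. -/
lemma preservesProjectiveObjects_resA (D : SmashExtension k A H Λ) :
    D.resA.PreservesProjectiveObjects := by
  refine preservesProjectiveObjects_restrictScalars ?_
  obtain ⟨e, -⟩ := (D.isDirectSum_incl (Module.Basis.ofVectorSpace k H)).exists_proj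
  have : Module.Projective A (D.resA.obj (ModuleCat.of Λ Λ)) := Module.Projective.of_equiv e.symm
  exact (IsProjective.iff_projective (D.resA.obj (ModuleCat.of Λ Λ))).1 this

/-- For finite-dimensional `H`, `Ext_Λ (M, Λ) ≃ Ext_A (M, A)`. -/
lemma extPostMap_frobHom_bijective [Fintype ι] [DecidableEq ι] (hf : IsIntegral f)
    (hb : ∀ i j, f (b' i * b j) = if i = j then 1 else 0) (M : ModuleCat.{u} Λ) (i : ℕ) :
    Function.Bijective (extPostMap D.resA (D.frobHom f) M i) :=
  have := D.preservesProjectiveObjects_resA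
  extPostMap_bijective _ _ (D.bijective_frobHom hf hb) M i

end Frobenius

/-- The restriction of the trivial `Λ`-module to `A`. -/
def trivialIso : D.resA.obj (trivialModule ((Bialgebra.counitAlgHom k H).comp D.π)) ≅
    trivialModule D.ε :=
  let e : D.resA.obj (trivialModule ((Bialgebra.counitAlgHom k H).comp D.π)) ≃ₗ[A]
      trivialModule D.ε :=
    { toFun := fun (c : k) ↦ (c : k)
      invFun := fun (c : k) ↦ (c : k)
      left_inv := fun _ ↦ rfl
      right_inv := fun _ ↦ rfl
      map_add' := fun _ _ ↦ rfl
      map_smul' := fun a (c : k) ↦ by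
        change counit (R := k) (D.π (D.iA a)) * c = D.ε a * c
        rw [π_iA, Bialgebra.counit_algebraMap] }
  e.toModuleIso

/-- The left Artin-Schelter condition for finite-dimensional `H`. -/
theorem leftASCondition_of_finite [Module.Finite k H] {n : ℕ} (hA : LeftASCondition k A D.ε n) :
    LeftASCondition k Λ ((Bialgebra.counitAlgHom k H).comp D.π) n := by
  obtain ⟨-, f, ι, _, _, b, b', hf, hb⟩ := exists_isIntegral_dual_bases (k := k) (H := H)
  intro i
  let F : Ext.{u} (trivialModule ((Bialgebra.counitAlgHom k H).comp D.π)) (ModuleCat.of Λ Λ) i →ₗ[k]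
      Ext.{u} (D.resA.obj (trivialModule ((Bialgebra.counitAlgHom k H).comp D.π)))
        (ModuleCat.of A A) i :=
    { extPostMap D.resA (D.frobHom f) _ i with
      map_smul' := fun c x ↦ by
        change extPostMap _ _ _ _ _ = c • extPostMap _ _ _ _ _
        rw [extPostMap_apply, extPostMap_apply, Functor.mapExactFunctor_smul, Ext.smul_comp] }
  have hF : Function.Bijective F := D.extPostMap_frobHom_bijective hf hb _ i
  let e : Ext.{u} (trivialModule D.ε) (ModuleCat.of A A) i ≃ₗ[k]
      Ext.{u} (D.resA.obj (trivialModule ((Bialgebra.counitAlgHom k H).comp D.π)))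
        (ModuleCat.of A A) i :=
    { toFun := fun x ↦ (Ext.mk₀ D.trivialIso.hom).comp x (zero_add i)
      invFun := fun x ↦ (Ext.mk₀ D.trivialIso.inv).comp x (zero_add i)
      map_add' := fun x y ↦ Ext.comp_add _ _ _ _
      map_smul' := fun c x ↦ Ext.comp_smul _ _ _ _
      left_inv := fun x ↦ by
        dsimp only
        rw [← Ext.comp_assoc_of_second_deg_zero, Ext.mk₀_comp_mk₀, Iso.inv_hom_id, Ext.mk₀_id_comp]
      right_inv := fun x ↦ by
        dsimp only
        rw [← Ext.comp_assoc_of_second_deg_zero, Ext.mk₀_comp_mk₀, Iso.hom_inv_id,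
          Ext.mk₀_id_comp] }
  rw [(LinearEquiv.ofBijective F hF).rank_eq, ← e.rank_eq, hA i]

/-- For finite-dimensional `H`, the injective dimensions of `A` and `Λ` agree. -/
theorem injectiveDimension_eq_of_finite (D : SmashExtension k A H Λ) [Module.Finite k H] :
    injectiveDimension (ModuleCat.of Λ Λ) = injectiveDimension (ModuleCat.of A A) := by
  obtain ⟨-, f, ι, _, _, b, b', hf, hb⟩ := exists_isIntegral_dual_bases (k := k) (H := H)
  have h1 : ∀ m, HasInjectiveDimensionLT (ModuleCat.of A A) m →
      HasInjectiveDimensionLT (ModuleCat.of Λ Λ) m := by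
    intro m hm
    refine hasInjectiveDimensionLT_of_enoughProjectives _ m fun M ↦ ?_
    have := HasInjectiveDimensionLT.subsingleton (ModuleCat.of A A) m m le_rfl (D.resA.obj M)
    exact (D.extPostMap_frobHom_bijective hf hb M m).injective.subsingleton
  have h2 : ∀ m, HasInjectiveDimensionLT (ModuleCat.of Λ Λ) m →
      HasInjectiveDimensionLT (ModuleCat.of A A) m := by
    intro m hm
    have := D.isRightFree.hasInjectiveDimensionLT m _ hm
    -- `A` is a direct summand of `Λ` as a left `A`-module.
    let r : Retract (ModuleCat.of A A) (D.resA.obj (ModuleCat.of Λ Λ)) :=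
      { i := D.incl 1
        r := D.frobHom counit
        retract := by
          refine hom_self_ext ?_
          change D.projA counit (D.iA 1 * D.iH 1) = 1
          rw [projA_mul, Bialgebra.counit_one, one_smul] }
    exact r.hasInjectiveDimensionLT m
  unfold injectiveDimension
  congr! 5
  exact ⟨h2 _, h1 _⟩

end SmashExtension

/-! ### Invertible bimodules -/

section Invertible

variable {k H : Type u} [Field k] [Ring H]

section

variable {U V : Type u} [AddCommGroup U] [Module k U] [Module Hᵐᵒᵖ U] [AddCommGroup V]
  [Module k V] [Module H V]

lemma BalancedTensor.mk_add (x : U) (y y' : V) :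
    BalancedTensor.mk k H x (y + y') = BalancedTensor.mk k H x y + BalancedTensor.mk k H x y' :=
  congrArg (Submodule.Quotient.mk (p := Submodule.span k
    {t : U ⊗[k] V | ∃ (x : U) (h : H) (y : V),
      t = (MulOpposite.op h • x) ⊗ₜ[k] y - x ⊗ₜ[k] (h • y)})) (TensorProduct.tmul_add x y y')

lemma BalancedTensor.add_mk (x x' : U) (y : V) :
    BalancedTensor.mk k H (x + x') y = BalancedTensor.mk k H x y + BalancedTensor.mk k H x' y :=
  congrArg (Submodule.Quotient.mk (p := Submodule.span k
    {t : U ⊗[k] V | ∃ (x : U) (h : H) (y : V),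
      t = (MulOpposite.op h • x) ⊗ₜ[k] y - x ⊗ₜ[k] (h • y)})) (TensorProduct.add_tmul x x' y)

lemma BalancedTensor.mk_zero (x : U) : BalancedTensor.mk k H x (0 : V) = 0 :=
  congrArg (Submodule.Quotient.mk (p := Submodule.span k
    {t : U ⊗[k] V | ∃ (x : U) (h : H) (y : V),
      t = (MulOpposite.op h • x) ⊗ₜ[k] y - x ⊗ₜ[k] (h • y)})) (TensorProduct.tmul_zero V x)

lemma BalancedTensor.smul_mk (x : U) (h : H) (y : V) :
    BalancedTensor.mk k H (MulOpposite.op h • x) y = BalancedTensor.mk k H x (h • y) :=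
  (Submodule.Quotient.eq _).2 (Submodule.subset_span ⟨x, h, y, rfl⟩)

lemma BalancedTensor.induction {p : BalancedTensor k H U V → Prop} (z : BalancedTensor k H U V)
    (h0 : p 0) (h1 : ∀ x y, p (BalancedTensor.mk k H x y))
    (h2 : ∀ x y, p x → p y → p (x + y)) : p z := by
  obtain ⟨t, rfl⟩ := Submodule.Quotient.mk_surjective _ z
  induction t using TensorProduct.induction_on with
  | zero => exact h0
  | tmul x y => exact h1 x y
  | add x y hx hy => exact h2 _ _ hx hy

/-- Additive maps out of `U ⊗_H V`. -/
lemma BalancedTensor.exists_lift {N : Type u} [AddCommGroup N] [Module k N]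
    (φ : U →ₗ[k] V →ₗ[k] N) (hφ : ∀ x (h : H) y, φ (MulOpposite.op h • x) y = φ x (h • y)) :
    ∃ F : BalancedTensor k H U V →ₗ[k] N, ∀ x y, F (BalancedTensor.mk k H x y) = φ x y := by
  refine ⟨Submodule.liftQ _ (TensorProduct.lift φ) ?_, fun x y ↦ rfl⟩
  rw [Submodule.span_le]
  rintro _ ⟨x, h, y, rfl⟩
  simp [hφ]

end

variable [Algebra k H] {U V : Type u} [AddCommGroup U] [Module k U] [Module H U]
  [AddCommGroup V] [Module k V] [Module H V] [Module Hᵐᵒᵖ V]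

/-- A functional on `U` induced from an isomorphism `V ⊗_H U ≃ H` is multiplied by scalars under
endomorphisms of `U`. -/
lemma exists_smul_of_balanced [IsScalarTower k H V] [SMulCommClass H Hᵐᵒᵖ V] (ε : H →ₐ[k] k)
    (Θ : BalancedTensor k H V U ≃ₗ[k] H)
    (hΘ : ∀ (h : H) (x : V) (y : U),
      Θ (BalancedTensor.mk k H (h • x) y) = h * Θ (BalancedTensor.mk k H x y))
    (T : U →ₗ[k] U) (hT : ∀ (h : H) u, T (h • u) = h • T u) :
    ∃ c : k, ∀ v u, ε (Θ (BalancedTensor.mk k H v (T u))) =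
      c * ε (Θ (BalancedTensor.mk k H v u)) := by
  obtain ⟨F, hF⟩ := BalancedTensor.exists_lift (k := k) (H := H) (U := V) (V := U)
    (N := BalancedTensor k H V U)
    (LinearMap.mk₂ k (fun v u ↦ BalancedTensor.mk k H v (T u))
      (fun v v' u ↦ BalancedTensor.add_mk _ _ _) (fun c v u ↦ rfl)
      (fun v u u' ↦ by rw [map_add, BalancedTensor.mk_add]) (fun c v u ↦ by
        rw [map_smul]
        exact congrArg (Submodule.Quotient.mk (p := Submodule.span k _))
          (TensorProduct.tmul_smul c v (T u))))
    (fun v h u ↦ by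
      change BalancedTensor.mk k H (MulOpposite.op h • v) (T u) =
        BalancedTensor.mk k H v (T (h • u))
      rw [hT, BalancedTensor.smul_mk])
  have hF' : ∀ v u, F (BalancedTensor.mk k H v u) = BalancedTensor.mk k H v (T u) := hF
  -- Through `Θ`, the endomorphism `T` induces a left `H`-linear endomorphism of `H`, that is, right
  -- multiplication by `L 1`.
  let L : H →ₗ[k] H := Θ.toLinearMap ∘ₗ F ∘ₗ Θ.symm.toLinearMap
  have hL : ∀ z, Θ (F z) = L (Θ z) := fun z ↦ by simp [L]
  have hLmul : ∀ h x, L (h * x) = h * L x := by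
    intro h x
    obtain ⟨z, rfl⟩ := Θ.surjective x
    induction z using BalancedTensor.induction with
    | h0 => simp
    | h1 v u => rw [← hΘ, ← hL, hF', hΘ, ← hF', hL]
    | h2 x y hx hy => rw [map_add, mul_add, map_add, map_add, mul_add, hx, hy]
  refine ⟨ε (L 1), fun v u ↦ ?_⟩
  rw [← hF', hL, ← mul_one (Θ _), hLmul, map_mul, mul_one, mul_comm]

/-- If the left `H`-module `D ⊗ H` underlies an invertible bimodule, then `D` is
one-dimensional. -/
lemma finrank_eq_one_of_balanced [IsScalarTower k H V] [SMulCommClass H Hᵐᵒᵖ V]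
    (ε : H →ₐ[k] k) (Θ : BalancedTensor k H V U ≃ₗ[k] H)
    (hΘ : ∀ (h : H) (x : V) (y : U),
      Θ (BalancedTensor.mk k H (h • x) y) = h * Θ (BalancedTensor.mk k H x y))
    {D : Type u} [AddCommGroup D] [Module k D] (Ω : D ⊗[k] H ≃ₗ[k] U)
    (hΩ : ∀ d (h y : H), Ω (d ⊗ₜ (h * y)) = h • Ω (d ⊗ₜ y)) : Module.finrank k D = 1 := by
  -- The functional `ε ∘ Θ` is nonzero, as `Θ` is surjective.
  have hne : ∃ v d y, ε (Θ (BalancedTensor.mk k H v (Ω (d ⊗ₜ y)))) ≠ 0 := by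
    by_contra! hcon
    have h1 : ∀ z, ε (Θ z) = 0 := by
      intro z
      induction z using BalancedTensor.induction with
      | h0 => simp
      | h2 x y hx hy => rw [map_add, map_add, hx, hy, add_zero]
      | h1 v u =>
        obtain ⟨t, rfl⟩ := Ω.surjective u
        induction t using TensorProduct.induction_on with
        | zero => rw [map_zero, BalancedTensor.mk_zero, map_zero, map_zero]
        | tmul d y => exact hcon v d y
        | add x y hx hy => rw [map_add, BalancedTensor.mk_add, map_add, map_add, hx, hy, add_zero]
    have := h1 (Θ.symm 1)
    simp at this
  obtain ⟨v, d, y, hd⟩ := hne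
  refine finrank_eq_one_iff'.2 ⟨d, ?_, fun d' ↦ ?_⟩
  · rintro rfl
    rw [TensorProduct.zero_tmul, map_zero, BalancedTensor.mk_zero, map_zero, map_zero] at hd
    exact hd rfl
  · by_contra hcon
    have h1 : d' ∉ Submodule.span k {d} := by
      rwa [Submodule.mem_span_singleton]
    obtain ⟨g, hg1, hg2⟩ := Submodule.exists_le_ker_of_notMem h1
    -- An endomorphism `T` of `D` with `T d = 0` and `T d' ≠ 0` a multiple of `d`. It induces an
    -- endomorphism of `U`, which would have to act on `ε ∘ Θ` as a scalar.
    let T : D →ₗ[k] D := (LinearMap.toSpanSingleton k D d) ∘ₗ g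
    let T' : U →ₗ[k] U := Ω.toLinearMap ∘ₗ LinearMap.rTensor H T ∘ₗ Ω.symm.toLinearMap
    have hT' : ∀ t, T' (Ω t) = Ω (LinearMap.rTensor H T t) := fun t ↦ by simp [T']
    have hΩ' : ∀ h t, h • Ω t = Ω (LinearMap.lTensor D (LinearMap.mulLeft k h) t) := by
      intro h t
      induction t using TensorProduct.induction_on with
      | zero => simp
      | tmul d y => simp [hΩ]
      | add x y hx hy => rw [map_add, smul_add, hx, hy, map_add, map_add]
    obtain ⟨c, hc⟩ := exists_smul_of_balanced ε Θ hΘ T' (fun h u ↦ by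
      obtain ⟨t, rfl⟩ := Ω.surjective u
      rw [hΩ', hT', hT', hΩ']
      congr 1
      induction t using TensorProduct.induction_on with
      | zero => simp
      | tmul d y => simp
      | add x y hx hy => simp only [map_add, hx, hy])
    have hgd : g d = 0 := hg2 (Submodule.mem_span_singleton_self d)
    have h2 := hc v (Ω (d ⊗ₜ y))
    rw [hT', LinearMap.rTensor_tmul] at h2
    simp only [T, LinearMap.comp_apply, hgd, map_zero, TensorProduct.zero_tmul,
      BalancedTensor.mk_zero] at h2
    have hc0 : c = 0 := (mul_eq_zero.1 h2.symm).resolve_right hd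
    have h3 := hc v (Ω (((g d')⁻¹ • d') ⊗ₜ y))
    rw [hT', LinearMap.rTensor_tmul] at h3
    simp only [T, LinearMap.comp_apply, map_smul, LinearMap.toSpanSingleton_apply, smul_smul,
      inv_mul_cancel₀ hg1, one_smul, hc0, zero_mul] at h3
    exact hd h3

/-- If an invertible bimodule is free of rank one with generator `u₀` as a left module, then the
homomorphism `φ` with `u₀ h = φ(h) u₀` is bijective. -/
lemma bijective_of_balanced [Module Hᵐᵒᵖ U] [IsScalarTower k H V] [IsScalarTower k Hᵐᵒᵖ V]
    [SMulCommClass H Hᵐᵒᵖ V] (h₁ : BalancedTensorIsoUnit k H U V)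
    (h₂ : BalancedTensorIsoUnit k H V U) (u₀ : U) (c : U →ₗ[k] H)
    (hc : ∀ y : H, c (y • u₀) = y) (hc' : ∀ u, c u • u₀ = u) (φ : H → H)
    (hφ : ∀ y h, MulOpposite.op h • (y • u₀) = (y * φ h) • u₀)
    (hφ0 : ∀ g h, φ (g - h) = φ g - φ h) :
    Function.Bijective φ := by
  obtain ⟨Ξ, hΞ⟩ := h₁
  obtain ⟨Θ, hΘ⟩ := h₂
  have hΞr : ∀ (x : U) (y : V) (h : H), Ξ (BalancedTensor.mk k H x (MulOpposite.op h • y)) =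
    Ξ (BalancedTensor.mk k H x y) * h := fun x y h ↦ (hΞ h x y).2
  have hΘl : ∀ (x : V) (y : U) (h : H), Θ (BalancedTensor.mk k H (h • x) y) =
    h * Θ (BalancedTensor.mk k H x y) := fun x y h ↦ (hΘ h x y).1
  have hΘr : ∀ (x : V) (y : U) (h : H), Θ (BalancedTensor.mk k H x (MulOpposite.op h • y)) =
    Θ (BalancedTensor.mk k H x y) * h := fun x y h ↦ (hΘ h x y).2
  constructor
  · intro g h hgh
    rw [← sub_eq_zero]
    have h0 : φ (g - h) = 0 := by rw [hφ0, hgh, sub_self]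
    have h1 : ∀ z, Θ z * (g - h) = 0 := by
      intro z
      induction z using BalancedTensor.induction with
      | h0 => simp
      | h2 x y hx hy => rw [map_add, add_mul, hx, hy, add_zero]
      | h1 v u =>
        rw [← hΘr, ← hc' u, hφ, h0, mul_zero, zero_smul, BalancedTensor.mk_zero, map_zero]
    have := h1 (Θ.symm 1)
    rwa [LinearEquiv.apply_symm_apply, one_mul] at this
  · -- `V` is free of rank one as a left module, with generator `v₀`; the map `F` shows that
    -- `v ↦ v ⊗ u₀` is injective.
    obtain ⟨F, hF⟩ := BalancedTensor.exists_lift (k := k) (H := H) (U := V) (V := U) (N := V)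
      (LinearMap.mk₂ k (fun v u ↦ MulOpposite.op (c u) • v)
        (fun v v' u ↦ smul_add _ _ _) (fun a v u ↦ smul_comm _ _ _)
        (fun v u u' ↦ by rw [map_add, MulOpposite.op_add, add_smul])
        (fun a v u ↦ by rw [map_smul, MulOpposite.op_smul, smul_assoc]))
      (fun v h u ↦ by
        have h1 : c (h • u) = h * c u := by
          rw [← hc' u, ← mul_smul, hc, hc]
        rw [LinearMap.mk₂_apply, LinearMap.mk₂_apply, h1, MulOpposite.op_mul, mul_smul])
    have hF' : ∀ v, F (BalancedTensor.mk k H v u₀) = v := fun v ↦ by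
      rw [hF, LinearMap.mk₂_apply, ← one_smul H u₀, hc, MulOpposite.op_one, one_smul]
    have hinj : ∀ v v', Θ (BalancedTensor.mk k H v u₀) = Θ (BalancedTensor.mk k H v' u₀) →
        v = v' := fun v v' h ↦ by rw [← hF' v, Θ.injective h, hF']
    have hsurj : ∀ z : BalancedTensor k H V U, ∃ v, z = BalancedTensor.mk k H v u₀ := by
      intro z
      induction z using BalancedTensor.induction with
      | h0 => exact ⟨0, by rw [← BalancedTensor.mk_zero (k := k) (H := H) (0 : V), ← zero_smul H u₀,
          ← BalancedTensor.smul_mk, MulOpposite.op_zero, smul_zero]⟩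
      | h1 v u => exact ⟨MulOpposite.op (c u) • v, by rw [BalancedTensor.smul_mk, hc']⟩
      | h2 x y hx hy =>
        obtain ⟨v, rfl⟩ := hx
        obtain ⟨v', rfl⟩ := hy
        exact ⟨v + v', (BalancedTensor.add_mk _ _ _).symm⟩
    obtain ⟨v₀, hv₀⟩ := hsurj (Θ.symm 1)
    rw [LinearEquiv.symm_apply_eq] at hv₀
    -- The right action on `v₀` through `φ` is the left action.
    have h3 : ∀ h, MulOpposite.op (φ h) • v₀ = h • v₀ := by
      intro h
      apply hinj
      have h4 := hφ 1 h
      rw [one_smul, one_mul] at h4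
      rw [BalancedTensor.smul_mk, ← h4, hΘr, hΘl, ← hv₀, one_mul, mul_one]
    have hgen : ∀ v : V, ∃ h : H, v = h • v₀ := fun v ↦
      ⟨Θ (BalancedTensor.mk k H v u₀), hinj _ _ (by rw [hΘl, ← hv₀, mul_one])⟩
    intro y
    obtain ⟨h, hh⟩ := hgen (MulOpposite.op y • v₀)
    refine ⟨h, ?_⟩
    rw [← sub_eq_zero]
    have h4 : MulOpposite.op (φ h - y) • v₀ = 0 := by
      rw [MulOpposite.op_sub, sub_smul, h3, hh, sub_self]
    -- `φ h - y` annihilates `V` from the right, hence also `U ⊗ V ≃ H`.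
    have h5 : ∀ z, Ξ z * (φ h - y) = 0 := by
      intro z
      induction z using BalancedTensor.induction with
      | h0 => simp
      | h2 x y hx hy => rw [map_add, add_mul, hx, hy, add_zero]
      | h1 u v =>
        obtain ⟨g, rfl⟩ := hgen v
        rw [← hΞr, ← smul_comm, h4, smul_zero, BalancedTensor.mk_zero, map_zero]
    have := h5 (Ξ.symm 1)
    rwa [LinearEquiv.apply_symm_apply, one_mul] at this

end Invertible

/-! ### Finite resolutions -/

section Resolution

variable {R : Type u} [Ring R]

/-- By induction, the kernel of `X 0 → M` being resolved by the shifted sequence. -/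
lemma isFP_of_exact (n : ℕ) (X : ℕ → ModuleCat.{u} R) (d : ∀ i, X (i + 1) ⟶ X i)
    (hX : ∀ i, Projective (X i)) (hX' : ∀ i, Module.Finite R (X i))
    (hd : ∀ i, Function.Exact (d (i + 1)) (d i)) (M : ModuleCat.{u} R) (π : X 0 ⟶ M)
    (hπ : Function.Surjective π) (hdπ : Function.Exact (d 0) π) : IsFP n M := by
  induction n generalizing X d M with
  | zero => trivial
  | succ n ih =>
    let K : ModuleCat.{u} R := ModuleCat.of R (LinearMap.ker π.hom)
    let π' : X 1 ⟶ K := ModuleCat.ofHom ((d 0).hom.codRestrict (LinearMap.ker π.hom)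
      fun x ↦ hdπ.apply_apply_eq_zero x)
    refine ⟨π.hom.shortComplexKer, LinearMap.shortExact_shortComplexKer hπ, hX 0, hX' 0,
      ih (fun i ↦ X (i + 1)) (fun i ↦ d (i + 1)) (fun i ↦ hX _) (fun i ↦ hX' _) (fun i ↦ hd _)
        K π' ?_ ?_, ⟨Iso.refl _⟩⟩
    · rintro ⟨x, hx⟩
      obtain ⟨y, hy⟩ := (hdπ x).1 hx
      exact ⟨y, Subtype.ext hy⟩
    · intro x
      rw [← hd 0 x]
      exact Subtype.ext_iff

lemma isFP_of_projectiveResolution {M : ModuleCat.{u} R} (P : ProjectiveResolution M)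
    (hP : ∀ i, Module.Finite R (P.complex.X i)) (n : ℕ) : IsFP n M := by
  refine isFP_of_exact n P.complex.X (fun i ↦ P.complex.d (i + 1) i) P.projective hP
    (fun i ↦ ?_) M (P.π.f 0) ?_ ?_
  · have := P.exact_succ i
    exact (ShortComplex.ShortExact.moduleCat_exact_iff_function_exact _).1 this
  · exact (ModuleCat.epi_iff_surjective (P.π.f 0)).1 inferInstance
  · exact (ShortComplex.ShortExact.moduleCat_exact_iff_function_exact _).1 P.exact₀

lemma hasProjectiveDimensionLT_of_projectiveResolution {M : ModuleCat.{u} R}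
    (P : ProjectiveResolution M) (N : ℕ) (hN : IsZero (P.complex.X N)) :
    HasProjectiveDimensionLT M N := by
  refine hasProjectiveDimensionLT_of_enoughInjectives M N fun Y ↦ ?_
  have h1 : ∀ x : Ext.{u} M Y N, x = 0 := fun x ↦ by
    obtain ⟨f, hf, rfl⟩ := P.extMk_surjective x (N + 1) rfl
    obtain rfl : f = 0 := hN.eq_of_src _ _
    exact P.extMk_zero _ rfl
  exact ⟨fun x y ↦ by rw [h1 x, h1 y]⟩

end Resolution

open HopfAlgebra

/-! ### The enveloping algebra of a Hopf algebra -/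

section Spread

variable {k H : Type u} [Field k] [Ring H] [HopfAlgebra k H] {M : Type u} [AddCommGroup M]
  [Module k M]

/-- The map `x ⊗ m ↦ x₁ ⊗ L(x₂) m`, for a linear map `L : H → End M`. -/
def spread (L : H →ₗ[k] Module.End k M) : H ⊗[k] M →ₗ[k] H ⊗[k] M :=
  LinearMap.lTensor H (TensorProduct.lift L) ∘ₗ (TensorProduct.assoc k H H M).toLinearMap ∘ₗ
    LinearMap.rTensor M comul

lemma spread_tmul (L : H →ₗ[k] Module.End k M) (x : H) (m : M) :
    spread L (x ⊗ₜ m) = LinearMap.lTensor H (L.flip m) (comul x) := by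
  simp only [spread, LinearMap.comp_apply, LinearMap.rTensor_tmul, LinearEquiv.coe_coe]
  induction comul (R := k) x using TensorProduct.induction_on with
  | zero => simp
  | add x y hx hy => simp only [map_add, TensorProduct.add_tmul, hx, hy]
  | tmul x y => simp

/-- If `L` is a convolution inverse of `L'`, then `spread L` is inverse to `spread L'`. -/
lemma spread_spread (L L' : H →ₗ[k] Module.End k M)
    (h : ∀ x, LinearMap.mul' k (Module.End k M) (TensorProduct.map L L' (comul x)) =
      algebraMap k _ (counit (R := k) x)) (t : H ⊗[k] M) : spread L (spread L' t) = t := by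
  induction t using TensorProduct.induction_on with
  | zero => simp
  | add x y hx hy => simp only [map_add, hx, hy]
  | tmul x m =>
    let N : H ⊗[k] H →ₗ[k] M :=
      (LinearMap.mul' k (Module.End k M) ∘ₗ TensorProduct.map L L').flip m
    have key : ∀ t : H ⊗[k] H, spread L (LinearMap.lTensor H (L'.flip m) t) =
        LinearMap.lTensor H N (TensorProduct.assoc k H H H (LinearMap.rTensor H comul t)) := by
      intro t
      induction t using TensorProduct.induction_on with
      | zero => simp
      | add x y hx hy => simp only [map_add, hx, hy]
      | tmul y z =>
        rw [LinearMap.lTensor_tmul, spread_tmul, LinearMap.rTensor_tmul]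
        induction comul (R := k) y using TensorProduct.induction_on with
        | zero => simp
        | add x y hx hy => simp only [map_add, TensorProduct.add_tmul, hx, hy]
        | tmul x y => simp [N]
    have hN : N ∘ₗ comul = (LinearMap.toSpanSingleton k M m) ∘ₗ counit := by
      ext y
      simp [N, h]
    rw [spread_tmul, key, coassoc_apply, ← LinearMap.lTensor_comp_apply, hN,
      LinearMap.lTensor_comp_apply, lTensor_counit_comul]
    simp

lemma spread_bijective (L L' : H →ₗ[k] Module.End k M)
    (h : ∀ x, LinearMap.mul' k (Module.End k M) (TensorProduct.map L L' (comul x)) =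
      algebraMap k _ (counit (R := k) x))
    (h' : ∀ x, LinearMap.mul' k (Module.End k M) (TensorProduct.map L' L (comul x)) =
      algebraMap k _ (counit (R := k) x)) : Function.Bijective (spread L) :=
  Function.bijective_iff_has_inverse.2 ⟨spread L', spread_spread L' L h', spread_spread L L' h⟩

end Spread

section Env

variable {k H : Type u} [Field k] [Ring H] [Algebra k H]

lemma diagonalBimodule_smul (a : H) (b : Hᵐᵒᵖ) (x : H) :
    (show H from (a ⊗ₜ[k] b : Env k H) • (show diagonalBimodule k H from x)) =
      a * (x * b.unop) :=
  letI : Module (Env k H) H := TensorProduct.Algebra.module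
  TensorProduct.Algebra.smul_def a b x

end Env

section Delta

variable (k H : Type u) [Field k] [Ring H] [HopfAlgebra k H]

/-- The algebra homomorphism `H → H^e`, `h ↦ h₁ ⊗ S(h₂)`. -/
def delta : H →ₐ[k] Env k H :=
  (Algebra.TensorProduct.map (AlgHom.id k H) (antipodeAlgHomOp k H)).comp
    (Bialgebra.comulAlgHom k H)

variable {k H}

lemma delta_mul_tmul (x : H) (y : Hᵐᵒᵖ) : delta k H x * (1 ⊗ₜ y) =
    spread ((LinearMap.mul k Hᵐᵒᵖ) ∘ₗ (antipodeAlgHomOp k H).toLinearMap) (x ⊗ₜ y) := by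
  rw [spread_tmul]
  change Algebra.TensorProduct.map (AlgHom.id k H) (antipodeAlgHomOp k H) (comul x) * _ = _
  induction comul (R := k) x using TensorProduct.induction_on with
  | zero => simp
  | add x y hx hy => simp only [map_add, add_mul, hx, hy]
  | tmul x y => simp

lemma tmul_mul_delta (x : H) (y : Hᵐᵒᵖ) : (1 ⊗ₜ y) * delta k H x =
    spread ((LinearMap.mul k Hᵐᵒᵖ).flip ∘ₗ (antipodeAlgHomOp k H).toLinearMap) (x ⊗ₜ y) := by
  rw [spread_tmul]
  change _ * Algebra.TensorProduct.map (AlgHom.id k H) (antipodeAlgHomOp k H) (comul x) = _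
  induction comul (R := k) x using TensorProduct.induction_on with
  | zero => simp
  | add x y hx hy => simp only [map_add, mul_add, hx, hy]
  | tmul x y => simp

/-- `y ↦ y S²(x)`, as a map on `H^op`. -/
def leftInv : H →ₗ[k] Module.End k Hᵐᵒᵖ :=
  (LinearMap.mul k Hᵐᵒᵖ) ∘ₗ (antipodeAlgHomOp k H).toLinearMap ∘ₗ antipode k

/-- `leftInv` is a right convolution inverse of the map sending `h` to right multiplication by
`S(h)` on `H`. -/
lemma left_leftInv (x : H) : LinearMap.mul' k (Module.End k Hᵐᵒᵖ) (TensorProduct.map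
    ((LinearMap.mul k Hᵐᵒᵖ) ∘ₗ (antipodeAlgHomOp k H).toLinearMap) leftInv (comul x)) =
      algebraMap k _ (counit (R := k) x) := by
  have key : ∀ t : H ⊗[k] H, LinearMap.mul' k (Module.End k Hᵐᵒᵖ) (TensorProduct.map
    ((LinearMap.mul k Hᵐᵒᵖ) ∘ₗ (antipodeAlgHomOp k H).toLinearMap) leftInv t) =
      LinearMap.mul k Hᵐᵒᵖ
        (antipodeAlgHomOp k H (LinearMap.mul' k H ((antipode k).lTensor H t))) := by
    intro t
    induction t using TensorProduct.induction_on with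
    | zero => simp
    | add x y hx hy => simp only [map_add, hx, hy]
    | tmul x y =>
      ext z
      simp [leftInv, antipode_mul_antidistrib, mul_assoc]
  rw [key, mul_antipode_lTensor_comul_apply, AlgHom.commutes]
  ext z
  simp [Algebra.smul_def]

/-- `leftInv` is also a left convolution inverse of that map. -/
lemma leftInv_left (x : H) : LinearMap.mul' k (Module.End k Hᵐᵒᵖ) (TensorProduct.map leftInv
    ((LinearMap.mul k Hᵐᵒᵖ) ∘ₗ (antipodeAlgHomOp k H).toLinearMap) (comul x)) =
      algebraMap k _ (counit (R := k) x) := by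
  have key : ∀ t : H ⊗[k] H, LinearMap.mul' k (Module.End k Hᵐᵒᵖ) (TensorProduct.map leftInv
    ((LinearMap.mul k Hᵐᵒᵖ) ∘ₗ (antipodeAlgHomOp k H).toLinearMap) t) =
      LinearMap.mul k Hᵐᵒᵖ
        (antipodeAlgHomOp k H (LinearMap.mul' k H ((antipode k).rTensor H t))) := by
    intro t
    induction t using TensorProduct.induction_on with
    | zero => simp
    | add x y hx hy => simp only [map_add, hx, hy]
    | tmul x y =>
      ext z
      simp [leftInv, antipode_mul_antidistrib, mul_assoc]
  rw [key, mul_antipode_rTensor_comul_apply, AlgHom.commutes]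
  ext z
  simp [Algebra.smul_def]

lemma spread_left_bijective : Function.Bijective
    (spread ((LinearMap.mul k Hᵐᵒᵖ) ∘ₗ (antipodeAlgHomOp k H).toLinearMap)) :=
  spread_bijective _ _ left_leftInv leftInv_left

lemma spread_right_bijective : Function.Bijective
    (spread ((LinearMap.mul k Hᵐᵒᵖ).flip ∘ₗ (antipodeAlgHomOp k H).toLinearMap)) := by
  refine spread_bijective _
    ((LinearMap.mul k Hᵐᵒᵖ).flip ∘ₗ (MulOpposite.opLinearEquiv k).toLinearMap) (fun x ↦ ?_)
    fun x ↦ ?_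
  · have key : ∀ t : H ⊗[k] H, LinearMap.mul' k (Module.End k Hᵐᵒᵖ) (TensorProduct.map
      ((LinearMap.mul k Hᵐᵒᵖ).flip ∘ₗ (antipodeAlgHomOp k H).toLinearMap)
        ((LinearMap.mul k Hᵐᵒᵖ).flip ∘ₗ (MulOpposite.opLinearEquiv k).toLinearMap) t) =
          (LinearMap.mul k Hᵐᵒᵖ).flip
            (MulOpposite.op (LinearMap.mul' k H ((antipode k).rTensor H t))) := by
      intro t
      induction t using TensorProduct.induction_on with
      | zero => simp
      | add x y hx hy => simp only [map_add, MulOpposite.op_add, hx, hy]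
      | tmul x y =>
        ext z
        simp [mul_assoc]
    rw [key, mul_antipode_rTensor_comul_apply]
    ext z
    simpa [Algebra.smul_def] using (Algebra.commutes (counit (R := k) x) z).symm
  · have key : ∀ t : H ⊗[k] H, LinearMap.mul' k (Module.End k Hᵐᵒᵖ) (TensorProduct.map
      ((LinearMap.mul k Hᵐᵒᵖ).flip ∘ₗ (MulOpposite.opLinearEquiv k).toLinearMap)
        ((LinearMap.mul k Hᵐᵒᵖ).flip ∘ₗ (antipodeAlgHomOp k H).toLinearMap) t) =
          (LinearMap.mul k Hᵐᵒᵖ).flip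
            (MulOpposite.op (LinearMap.mul' k H ((antipode k).lTensor H t))) := by
      intro t
      induction t using TensorProduct.induction_on with
      | zero => simp
      | add x y hx hy => simp only [map_add, MulOpposite.op_add, hx, hy]
      | tmul x y =>
        ext z
        simp [mul_assoc]
    rw [key, mul_antipode_lTensor_comul_apply]
    ext z
    simpa [Algebra.smul_def] using (Algebra.commutes (counit (R := k) x) z).symm

variable (k H) in
/-- Restriction of scalars along `delta`. -/
abbrev resδ : ModuleCat.{u} (Env k H) ⥤ ModuleCat.{u} H :=
  ModuleCat.restrictScalars.{u} (delta k H).toRingHom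

/-- `H^e` is free as a right `H`-module through `δ`, with basis `1 ⊗ bⱼ`. -/
lemma bijective_tmul_mul_delta {J : Type u} (b : Module.Basis J k H) :
    Function.Bijective fun c : J →₀ H ↦ c.sum fun j x ↦
      ((1 : H) ⊗ₜ[k] MulOpposite.op (b j) : Env k H) * (delta k H).toRingHom x := by
  classical
  have h := spread_right_bijective.comp (TensorProduct.equivFinsuppOfBasisRight (M := H)
    (b.map (MulOpposite.opLinearEquiv k))).symm.bijective
  refine bijective_congr h fun c ↦ ?_
  simp only [Function.comp_apply, TensorProduct.equivFinsuppOfBasisRight_symm_apply, Finsupp.sum,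
    map_sum]
  exact Finset.sum_congr rfl fun j _ ↦ tmul_mul_delta _ _

lemma isRightFree_delta : IsRightFree (delta k H).toRingHom :=
  ⟨_, _, bijective_tmul_mul_delta (Module.Basis.ofVectorSpace k H)⟩

/-- The `H`-linear map `x ↦ δ(x) (1 ⊗ y)`. -/
def kappa (y : H) : ModuleCat.of H H ⟶ (resδ k H).obj (ModuleCat.of (Env k H) (Env k H)) :=
  ModuleCat.ofHom (Y := (resδ k H).obj (ModuleCat.of (Env k H) (Env k H)))
    { toFun := fun x ↦ (delta k H x * (1 ⊗ₜ MulOpposite.op y) : Env k H)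
      map_add' := fun x x' ↦ by rw [map_add, add_mul]; rfl
      map_smul' := fun x x' ↦ by
        change delta k H (x * x') * _ = delta k H x * (delta k H x' * _)
        rw [map_mul, mul_assoc] }

/-- `H^e` is free as a left `H`-module through `δ`, with basis `1 ⊗ bⱼ`. -/
lemma isDirectSum_kappa {J : Type u} (b : Module.Basis J k H) :
    IsDirectSum fun j ↦ kappa (k := k) (b j) := by
  classical
  have h := spread_left_bijective.comp (TensorProduct.equivFinsuppOfBasisRight (M := H)
    (b.map (MulOpposite.opLinearEquiv k))).symm.bijective
  unfold IsDirectSum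
  refine bijective_congr h fun c ↦ ?_
  simp only [Function.comp_apply, TensorProduct.equivFinsuppOfBasisRight_symm_apply, Finsupp.sum,
    map_sum, Finsupp.lsum_apply]
  exact Finset.sum_congr rfl fun j _ ↦ delta_mul_tmul _ _

/-- The map `e ↦ e • x`, for `x` in the bimodule `H`. -/
def envAct (x : H) : Env k H →+ H :=
  (LinearMap.toSpanSingleton (Env k H) (diagonalBimodule k H) x).toAddMonoidHom

lemma envAct_tmul (a : H) (b : Hᵐᵒᵖ) (x : H) : envAct (k := k) x (a ⊗ₜ b) = a * (x * b.unop) :=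
  diagonalBimodule_smul a b x

/-- The action of `δ(h)` on `H` is the adjoint action. -/
lemma delta_smul_algebraMap (h : H) (c : k) :
    envAct (algebraMap k H c) (delta k H h) =
      algebraMap k H (counit h * c) := by
  have key : ∀ t : H ⊗[k] H, envAct (algebraMap k H c)
      (Algebra.TensorProduct.map (AlgHom.id k H) (antipodeAlgHomOp k H) t) =
        LinearMap.mul' k H ((antipode k).lTensor H t) * algebraMap k H c := by
    intro t
    induction t using TensorProduct.induction_on with
    | zero => simp
    | add x y hx hy => simp only [map_add, add_mul, hx, hy]
    | tmul x y =>
      rw [Algebra.TensorProduct.map_tmul, envAct_tmul]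
      simp [Algebra.commutes, mul_assoc]
  refine (key (comul h)).trans ?_
  rw [mul_antipode_lTensor_comul_apply, map_mul]

lemma counit_delta_smul (h x : H) :
    counit (R := k) (envAct x (delta k H h)) =
      counit (R := k) h * counit (R := k) x := by
  have key : ∀ t : H ⊗[k] H, counit (R := k) (envAct x
      (Algebra.TensorProduct.map (AlgHom.id k H) (antipodeAlgHomOp k H) t)) =
        counit (R := k) (TensorProduct.lid k H (LinearMap.rTensor H counit t)) *
          counit (R := k) x := by
    intro t
    induction t using TensorProduct.induction_on with
    | zero => simp
    | add x y hx hy => simp only [map_add, add_mul, hx, hy]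
    | tmul x y =>
      rw [Algebra.TensorProduct.map_tmul, envAct_tmul]
      simp
      ring
  refine (key (comul h)).trans ?_
  rw [rTensor_counit_comul]
  simp

variable (k H) in
/-- The inclusion `k → H`, an `H`-linear map for the adjoint action. -/
def unitδ : trivialModule (Bialgebra.counitAlgHom k H) ⟶ (resδ k H).obj (diagonalBimodule k H) :=
  ModuleCat.ofHom (X := trivialModule (Bialgebra.counitAlgHom k H))
    (Y := (resδ k H).obj (diagonalBimodule k H))
    { toFun := fun (c : k) ↦ (algebraMap k H c : H)
      map_add' := fun (c c' : k) ↦ map_add (algebraMap k H) c c'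
      map_smul' := fun h (c : k) ↦ (delta_smul_algebraMap h c).symm }

variable (k H) in
/-- The counit of `H`, an `H`-linear map for the adjoint action. -/
def counitδ : (resδ k H).obj (diagonalBimodule k H) ⟶ trivialModule (Bialgebra.counitAlgHom k H) :=
  ModuleCat.ofHom (X := (resδ k H).obj (diagonalBimodule k H))
    (Y := trivialModule (Bialgebra.counitAlgHom k H))
    { toFun := fun (x : H) ↦ (counit (R := k) x : k)
      map_add' := fun (x y : H) ↦ map_add (counit (R := k) (A := H)) x y
      map_smul' := fun h x ↦ counit_delta_smul (k := k) h x }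

variable (k H) in
/-- The trivial module is a direct summand of `H` with the adjoint action. -/
def retractTrivial : Retract (trivialModule (Bialgebra.counitAlgHom k H))
    ((resδ k H).obj (diagonalBimodule k H)) where
  i := unitδ k H
  r := counitδ k H
  retract := by
    refine ModuleCat.hom_ext (LinearMap.ext fun c ↦ ?_)
    exact Bialgebra.counit_algebraMap (A := H) (show k from c)

/-- The bimodule `H` is induced along `δ` from the trivial module. -/
lemma bijective_unitδ (N : ModuleCat.{u} (Env k H)) : Function.Bijective
    fun g : diagonalBimodule k H ⟶ N ↦ unitδ k H ≫ (resδ k H).map g := by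
  let b := Module.Basis.ofVectorSpace k H
  refine bijective_comp_map_of_bijective (bijective_tmul_mul_delta b).2 (unitδ k H) ?_ N
  refine bijective_congr b.repr.symm.bijective fun c ↦ ?_
  refine Eq.trans ?_ (Module.Basis.repr_symm_apply b c).symm
  refine Eq.trans ?_ (Finsupp.linearCombination_apply k (v := b) (show _ →₀ k from c)).symm
  refine Finset.sum_congr rfl fun j _ ↦ ?_
  refine (diagonalBimodule_smul 1 (MulOpposite.op (b j))
    (algebraMap k H (show k from c j))).trans ?_
  rw [one_mul, MulOpposite.unop_op, ← Algebra.smul_def]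
  rfl

/-- A direct sum of copies of a projective module is projective. -/
lemma IsDirectSum.projective {R : Type u} [Ring R] {J : Type u} {N₀ N : ModuleCat.{u} R}
    {ι : J → (N₀ ⟶ N)} (hι : IsDirectSum ι) [hN₀ : Projective N₀] : Projective N := by
  classical
  obtain ⟨e, -⟩ := hι.exists_proj
  have := (IsProjective.iff_projective N₀).2 hN₀
  exact (IsProjective.iff_projective N).1 (Module.Projective.of_equiv
    (e.trans (finsuppLequivDFinsupp R)).symm)

lemma resδ_preservesProjectiveObjects : (resδ k H).PreservesProjectiveObjects := by
  have : Projective (ModuleCat.of H H) :=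
    (IsProjective.iff_projective (ModuleCat.of H H)).1 inferInstance
  exact preservesProjectiveObjects_restrictScalars
    (isDirectSum_kappa (Module.Basis.ofVectorSpace k H)).projective

end Delta

/-! ### The trivial module of a homologically smooth Hopf algebra -/

/-- An exact functor that preserves projectives does not increase projective dimensions. -/
lemma hasProjectiveDimensionLT_restrictScalars {R T : Type u} [Ring R] [Ring T] (f : R →+* T)
    [(ModuleCat.restrictScalars.{u} f).PreservesProjectiveObjects] (n : ℕ) (M : ModuleCat.{u} T)
    (hM : HasProjectiveDimensionLT M n) :
    HasProjectiveDimensionLT ((ModuleCat.restrictScalars.{u} f).obj M) n := by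
  induction n generalizing M with
  | zero =>
    rw [hasProjectiveDimensionLT_zero_iff_isZero] at hM ⊢
    exact Functor.map_isZero _ hM
  | succ n ih =>
    obtain ⟨S, hS, hP, rfl⟩ := exists_shortExact_projective M
    have hFS := hS.map_of_exact (ModuleCat.restrictScalars.{u} f)
    have hFP : Projective ((ModuleCat.restrictScalars.{u} f).obj S.X₂) :=
      Functor.projective_obj _ _
    obtain _ | n := n
    · rw [zero_add, ← projective_iff_hasProjectiveDimensionLT_one] at hM ⊢
      exact Functor.projective_obj _ _
    · exact (hFS.hasProjectiveDimensionLT_X₃_iff n hFP).2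
        (ih _ ((hS.hasProjectiveDimensionLT_X₃_iff n hP).1 hM))

section Coinvariants

variable {k H : Type u} [Field k] [Ring H] [Algebra k H] (ε : H →ₐ[k] k)

/-- Restriction of an `H`-bimodule to its left `H`-module structure. -/
abbrev resLeft : ModuleCat.{u} (Env k H) ⥤ ModuleCat.{u} H :=
  ModuleCat.restrictScalars.{u}
    (Algebra.TensorProduct.includeLeft : H →ₐ[k] Env k H).toRingHom

/-- Restriction of an `H`-bimodule to its right `H`-module structure. -/
abbrev resRight : ModuleCat.{u} (Env k H) ⥤ ModuleCat.{u} Hᵐᵒᵖ :=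
  ModuleCat.restrictScalars.{u}
    (Algebra.TensorProduct.includeRight : Hᵐᵒᵖ →ₐ[k] Env k H).toRingHom

/-- The relation submodule of `M ⊗_H k`. -/
def coinvRel (M : ModuleCat.{u} (Env k H)) : Submodule H (resLeft (k := k).obj M) :=
  Submodule.span H {z : M | ∃ (h : H) (m : M), z = ((1 : H) ⊗ₜ[k] MulOpposite.op h : Env k H) • m -
    (algebraMap k (Env k H) (ε h)) • m}

/-- The functor `- ⊗_H k` from bimodules to left modules, on objects. -/
abbrev coinv (M : ModuleCat.{u} (Env k H)) : ModuleCat.{u} H :=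
  ModuleCat.of H ((resLeft (k := k).obj M) ⧸ coinvRel ε M)

/-- The quotient map `M → M ⊗_H k`. -/
def coinvMk (M : ModuleCat.{u} (Env k H)) : M →+ coinv ε M :=
  show resLeft (k := k).obj M →+ coinv ε M from
    { toFun := fun m ↦ (coinvRel ε M).mkQ m
      map_zero' := rfl
      map_add' := fun _ _ ↦ rfl }

variable {ε}

lemma coinvMk_surjective (M : ModuleCat.{u} (Env k H)) : Function.Surjective (coinvMk ε M) :=
  (coinvRel ε M).mkQ_surjective

lemma coinvMk_tmul_smul {M : ModuleCat.{u} (Env k H)} (a : H) (m : M) :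
    coinvMk ε M ((a ⊗ₜ[k] (1 : Hᵐᵒᵖ) : Env k H) • m) = a • coinvMk ε M m := rfl

lemma coinvMk_rel {M : ModuleCat.{u} (Env k H)} (h : H) (m : M) :
    coinvMk ε M (((1 : H) ⊗ₜ[k] MulOpposite.op h : Env k H) • m -
      (algebraMap k (Env k H) (ε h)) • m) = 0 :=
  (Submodule.Quotient.mk_eq_zero _).2 (Submodule.subset_span ⟨h, m, rfl⟩)

/-- The relations are spanned additively, because the generators are stable under `H`. -/
lemma coinvMk_induction {M : ModuleCat.{u} (Env k H)} {p : M → Prop} (h0 : p 0)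
    (hadd : ∀ x y, p x → p y → p (x + y))
    (h1 : ∀ (h : H) (m : M), p (((1 : H) ⊗ₜ[k] MulOpposite.op h : Env k H) • m -
      (algebraMap k (Env k H) (ε h)) • m)) (z : M) (hz : coinvMk ε M z = 0) : p z := by
  refine Submodule.closure_induction (R := H) (p := fun (z : resLeft (k := k).obj M) _ ↦ p z)
    h0 (fun x y _ _ ↦ hadd x y) ?_ ((Submodule.Quotient.mk_eq_zero (coinvRel ε M)).1 hz)
  rintro a _ ⟨h, m, rfl⟩
  have h2 : (a ⊗ₜ[k] (1 : Hᵐᵒᵖ) : Env k H) • (((1 : H) ⊗ₜ[k] MulOpposite.op h : Env k H) • m -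
      (algebraMap k (Env k H) (ε h)) • m) =
        ((1 : H) ⊗ₜ[k] MulOpposite.op h : Env k H) • ((a ⊗ₜ[k] (1 : Hᵐᵒᵖ) : Env k H) • m) -
          (algebraMap k (Env k H) (ε h)) • ((a ⊗ₜ[k] (1 : Hᵐᵒᵖ) : Env k H) • m) := by
    rw [smul_sub, ← mul_smul, ← mul_smul, ← mul_smul, ← mul_smul,
      Algebra.TensorProduct.tmul_mul_tmul, Algebra.TensorProduct.tmul_mul_tmul, mul_one, one_mul,
      mul_one, one_mul, Algebra.commutes]
  change p ((a ⊗ₜ[k] (1 : Hᵐᵒᵖ) : Env k H) • (((1 : H) ⊗ₜ[k] MulOpposite.op h : Env k H) • m -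
      (algebraMap k (Env k H) (ε h)) • m))
  rw [h2]
  exact h1 _ _

/-- Maps of right modules preserve the relations. -/
lemma coinvMk_map_eq_zero {M N : ModuleCat.{u} (Env k H)}
    (f : resRight (k := k).obj M ⟶ resRight (k := k).obj N) (z : M) (hz : coinvMk ε M z = 0) :
    coinvMk ε N (f z) = 0 := by
  let g : M → N := fun z ↦ f z
  have g_add : ∀ x y, g (x + y) = g x + g y := fun x y ↦ map_add f.hom x y
  have g_smul : ∀ (b : Hᵐᵒᵖ) (x : M), g (((1 : H) ⊗ₜ[k] b : Env k H) • x) =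
    ((1 : H) ⊗ₜ[k] b : Env k H) • g x := fun b x ↦ by
      exact f.hom.map_smul b x
  have g_sub : ∀ x y, g (x - y) = g x - g y := fun x y ↦ map_sub f.hom x y
  change coinvMk ε N (g z) = 0
  refine coinvMk_induction (p := fun z ↦ coinvMk ε N (g z) = 0) ?_ ?_ ?_ z hz
  · rw [show g 0 = 0 from map_zero f.hom, map_zero]
  · intro x y hx hy
    rw [g_add, map_add, hx, hy, add_zero]
  · intro h m
    have h2 : (algebraMap k (Env k H) (ε h)) =
        ((1 : H) ⊗ₜ[k] MulOpposite.op (algebraMap k H (ε h)) : Env k H) := by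
      rw [Algebra.TensorProduct.algebraMap_apply, Algebra.algebraMap_eq_smul_one,
        TensorProduct.smul_tmul]
      congr 1
    have h3 : g (((1 : H) ⊗ₜ[k] MulOpposite.op h : Env k H) • m -
      (algebraMap k (Env k H) (ε h)) • m) = ((1 : H) ⊗ₜ[k] MulOpposite.op h : Env k H) • g m -
      (algebraMap k (Env k H) (ε h)) • g m := by
      rw [g_sub, g_smul, h2, g_smul]
    rw [h3]
    exact coinvMk_rel _ _

variable (ε) in
/-- The functor `- ⊗_H k` from bimodules to left modules, on morphisms. -/
def coinvMap {M N : ModuleCat.{u} (Env k H)} (f : M ⟶ N) : coinv ε M ⟶ coinv ε N :=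
  ModuleCat.ofHom (Submodule.mapQ _ _ (resLeft.map f).hom fun z hz ↦
    (Submodule.Quotient.mk_eq_zero (coinvRel ε N)).1 (coinvMk_map_eq_zero (resRight.map f) z
      ((Submodule.Quotient.mk_eq_zero (coinvRel ε M)).2 hz)))

lemma coinvMap_coinvMk {M N : ModuleCat.{u} (Env k H)} (f : M ⟶ N) (m : M) :
    coinvMap ε f (coinvMk ε M m) = coinvMk ε N (f m) := rfl

/-- If `X₃` is projective as a right module, then `- ⊗_H k` is exact on `0 → X₁ → X₂ → X₃ → 0`. -/
lemma exists_shortExact_coinv {S : ShortComplex (ModuleCat.{u} (Env k H))} (hS : S.ShortExact)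
    (h₃ : Projective (resRight (k := k).obj S.X₃)) :
    ∃ S' : ShortComplex (ModuleCat.{u} H), S'.ShortExact ∧ S'.X₁ = coinv ε S.X₁ ∧
      S'.X₂ = coinv ε S.X₂ ∧ S'.X₃ = coinv ε S.X₃ := by
  have hR := hS.map_of_exact (resRight (k := k) (H := H))
  have : Projective (S.map (resRight (k := k) (H := H))).X₃ := h₃
  -- The sequence splits over the right action, and the splitting respects the relations.
  let σ := hR.splittingOfProjective
  have hsurj : Function.Surjective S.g := hS.moduleCat_surjective_g
  have hzero : ∀ x, S.g (S.f x) = 0 := fun x ↦ congr($(S.zero) x)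
  let r : S.X₂ → S.X₁ := fun x ↦ σ.r x
  let s : S.X₃ → S.X₂ := fun x ↦ σ.s x
  have hr : ∀ x, r (S.f x) = x := fun x ↦ congr($(σ.f_r) x)
  have hrs : ∀ x, S.f (r x) + s (S.g x) = x := fun x ↦ congr($(σ.id) x)
  have hr0 : ∀ x, coinvMk ε S.X₂ x = 0 → coinvMk ε S.X₁ (r x) = 0 := coinvMk_map_eq_zero σ.r
  have hs0 : ∀ x, coinvMk ε S.X₃ x = 0 → coinvMk ε S.X₂ (s x) = 0 := coinvMk_map_eq_zero σ.s
  have hz : coinvMap ε S.f ≫ coinvMap ε S.g = 0 := by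
    refine ModuleCat.hom_ext (LinearMap.ext fun z ↦ ?_)
    obtain ⟨z, rfl⟩ := coinvMk_surjective _ z
    change coinvMap ε S.g (coinvMap ε S.f (coinvMk ε _ z)) = 0
    rw [coinvMap_coinvMk, coinvMap_coinvMk, hzero, map_zero]
  have hmono : Function.Injective (coinvMap ε S.f) := by
    refine (injective_iff_map_eq_zero (coinvMap ε S.f).hom).2 fun z hz ↦ ?_
    obtain ⟨z, rfl⟩ := coinvMk_surjective _ z
    change coinvMap ε S.f (coinvMk ε _ z) = 0 at hz
    rw [coinvMap_coinvMk] at hz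
    rw [← hr z]
    exact hr0 _ hz
  have hepi : Function.Surjective (coinvMap ε S.g) := by
    intro z
    obtain ⟨z, rfl⟩ := coinvMk_surjective _ z
    obtain ⟨y, rfl⟩ := hsurj z
    exact ⟨_, coinvMap_coinvMk S.g y⟩
  have hmid : Function.Exact (coinvMap ε S.f) (coinvMap ε S.g) := by
    intro z
    constructor
    · obtain ⟨z, rfl⟩ := coinvMk_surjective _ z
      rw [coinvMap_coinvMk]
      intro hz
      refine ⟨coinvMk ε _ (r z), ?_⟩
      rw [coinvMap_coinvMk]
      conv_rhs => rw [← hrs z, map_add, hs0 _ hz, add_zero]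
    · rintro ⟨y, rfl⟩
      exact congr($hz y)
  exact ⟨ShortComplex.mk (coinvMap ε S.f) (coinvMap ε S.g) hz,
    { exact := (ShortComplex.ShortExact.moduleCat_exact_iff_function_exact _).2 hmid
      mono_f := (ModuleCat.mono_iff_injective _).2 hmono
      epi_g := (ModuleCat.epi_iff_surjective _).2 hepi }, rfl, rfl, rfl⟩

variable (ε) in
/-- The algebra homomorphism `H^e → H`, `a ⊗ b ↦ ε(b) a`. -/
def envCounit : Env k H →ₐ[k] H :=
  Algebra.TensorProduct.lift (AlgHom.id k H) ((Algebra.ofId k H).comp (opAugmentation ε))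
    fun x y ↦ (Algebra.commutes (opAugmentation ε y) x).symm

lemma envCounit_tmul (a : H) (b : Hᵐᵒᵖ) :
    envCounit ε (a ⊗ₜ b) = a * algebraMap k H (ε b.unop) := rfl

lemma coinvMk_smul {M : ModuleCat.{u} (Env k H)} (e : Env k H) (m : M) :
    coinvMk ε M (e • m) = envCounit ε e • coinvMk ε M m := by
  induction e using TensorProduct.induction_on with
  | zero =>
    exact (congrArg (coinvMk ε M) (zero_smul (Env k H) m)).trans (by
      rw [map_zero, map_zero, zero_smul])
  | add x y hx hy => rw [map_add, add_smul, add_smul, ← hx, ← hy, map_add]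
  | tmul a b =>
    have h1 : (a ⊗ₜ[k] b : Env k H) = (a ⊗ₜ 1) * (1 ⊗ₜ b) := by simp
    have h2 : (a ⊗ₜ[k] 1) * algebraMap k (Env k H) (ε b.unop) =
        ((a * algebraMap k H (ε b.unop)) ⊗ₜ[k] (1 : Hᵐᵒᵖ) : Env k H) := by
      rw [Algebra.TensorProduct.algebraMap_apply, Algebra.TensorProduct.tmul_mul_tmul, one_mul]
    have h3 := coinvMk_rel (ε := ε) b.unop m
    rw [map_sub, sub_eq_zero, MulOpposite.op_unop] at h3
    rw [envCounit_tmul, ← coinvMk_tmul_smul, ← h2, h1, mul_smul, mul_smul, coinvMk_tmul_smul,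
      coinvMk_tmul_smul, h3]

lemma finite_coinv (M : ModuleCat.{u} (Env k H)) [Module.Finite (Env k H) M] :
    Module.Finite H (coinv ε M) := by
  have : RingHomSurjective (envCounit ε).toRingHom :=
    ⟨fun a ↦ ⟨a ⊗ₜ 1, (envCounit_tmul a 1).trans (by simp)⟩⟩
  let q : M →ₛₗ[(envCounit ε).toRingHom] coinv ε M :=
    { coinvMk ε M with map_smul' := coinvMk_smul }
  exact Module.Finite.of_surjective q (coinvMk_surjective M)

/-- `- ⊗_H k` is left adjoint to an exact functor, hence preserves projectives. -/
lemma projective_coinv (M : ModuleCat.{u} (Env k H)) [Projective M] :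
    Projective (coinv ε M) where
  factors {Y X} f e he := by
    let γ := ModuleCat.restrictScalars.{u} (envCounit ε).toRingHom
    let f' : M ⟶ γ.obj X := ModuleCat.ofHom (Y := γ.obj X)
      { toFun := fun m ↦ f (coinvMk ε M m)
        map_add' := fun x y ↦ (congrArg f (map_add (coinvMk ε M) x y)).trans (map_add f.hom _ _)
        map_smul' := fun a m ↦
          (congrArg f (coinvMk_smul a m)).trans (map_smul f.hom _ _) }
    have : Epi (γ.map e) := inferInstance
    let g₀ := Projective.factorThru f' (γ.map e)
    let g : M → Y := fun m ↦ g₀ m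
    have g_add : ∀ x y, g (x + y) = g x + g y := map_add g₀.hom
    have g_sub : ∀ x y, g (x - y) = g x - g y := map_sub g₀.hom
    have g_smul : ∀ (a : Env k H) m, g (a • m) = envCounit ε a • g m := map_smul g₀.hom
    have hg : ∀ m, e (g m) = f (coinvMk ε M m) :=
      fun m ↦ congr($(Projective.factorThru_comp f' (γ.map e)) m)
    let g' : resLeft (k := k).obj M →ₗ[H] Y :=
      { toFun := g
        map_add' := g_add
        map_smul' := fun a m ↦ by
          refine (g_smul (a ⊗ₜ 1) m).trans ?_
          rw [envCounit_tmul, MulOpposite.unop_one, map_one, map_one, mul_one]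
          rfl }
    refine ⟨ModuleCat.ofHom (Submodule.liftQ _ g' ?_), ?_⟩
    · intro z hz
      refine coinvMk_induction (ε := ε) (p := fun z ↦ g z = 0) ?_ ?_ ?_ z
        ((Submodule.Quotient.mk_eq_zero (coinvRel ε M)).2 hz)
      · exact map_zero g₀.hom
      · intro x y hx hy
        rw [g_add, hx, hy, add_zero]
      · intro h m
        rw [g_sub, g_smul, g_smul, envCounit_tmul, AlgHom.commutes, one_mul, sub_eq_zero]
        rfl
    · refine ModuleCat.hom_ext (LinearMap.ext fun z ↦ ?_)
      obtain ⟨z, rfl⟩ := coinvMk_surjective _ z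
      exact hg z

/-- `- ⊗_H k` preserves finiteness conditions on bimodules that are projective as right
modules. -/
lemma isFP_coinv (hE : Projective (resRight (k := k).obj (ModuleCat.of (Env k H) (Env k H))))
    (n : ℕ) (M : ModuleCat.{u} (Env k H)) (hM : Projective (resRight (k := k).obj M))
    (hn : IsFP n M) : IsFP n (coinv ε M) := by
  induction n generalizing M with
  | zero => trivial
  | succ n ih =>
    obtain ⟨S, hS, hP, hf, hK, rfl⟩ := hn.exists_shortExact
    obtain ⟨S', hS', h1, h2, h3⟩ := exists_shortExact_coinv (ε := ε) hS hM
    have := preservesProjectiveObjects_restrictScalars hE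
    have hR := hS.map_of_exact (resRight (k := k) (H := H))
    have : Projective (S.map (resRight (k := k) (H := H))).X₃ := hM
    -- The syzygy `S.X₁` is a direct summand of the projective right module `S.X₂`.
    let σ := hR.splittingOfProjective
    have hP' : Projective (resRight (k := k).obj S.X₂) := Functor.projective_obj _ _
    have hK' : Projective (resRight (k := k).obj S.X₁) :=
      Retract.projective (Y := resRight (k := k).obj S.X₂) ⟨_, σ.r, σ.f_r⟩
    refine ⟨S', hS', ?_, ?_, ?_, ⟨eqToIso h3⟩⟩
    · rw [h2]
      exact projective_coinv _
    · rw [h2]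
      exact finite_coinv _
    · rw [h1]
      exact ih _ hK' hK

/-- `H ⊗_H k` is the trivial module. -/
lemma nonempty_coinv_diagonalBimodule_iso (ε : H →ₐ[k] k) :
    Nonempty (coinv ε (diagonalBimodule k H) ≅ trivialModule ε) := by
  let q : H →+ coinv ε (diagonalBimodule k H) := coinvMk ε (diagonalBimodule k H)
  have hqs : Function.Surjective q := coinvMk_surjective (diagonalBimodule k H)
  have q_mul : ∀ a x : H, q (a * x) = a • q x := fun a x ↦ by
    have h1 := coinvMk_tmul_smul (ε := ε) (M := diagonalBimodule k H) a x
    refine (congrArg q ((diagonalBimodule_smul a 1 x).trans ?_).symm).trans h1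
    rw [MulOpposite.unop_one, mul_one]
  -- Each `x = 1 · x` is equivalent to `ε x`.
  have hq : ∀ x, q x = q (algebraMap k H (ε x)) := fun x ↦ by
    have h1 := coinvMk_rel (ε := ε) (M := diagonalBimodule k H) x (1 : H)
    rw [map_sub, sub_eq_zero] at h1
    refine (congrArg q ?_).trans (h1.trans (congrArg q ?_))
    · exact ((diagonalBimodule_smul 1 (MulOpposite.op x) (1 : H)).trans (by simp)).symm
    · rw [Algebra.TensorProduct.algebraMap_apply]
      exact (diagonalBimodule_smul _ 1 (1 : H)).trans (by simp)
  let f : trivialModule ε →ₗ[H] coinv ε (diagonalBimodule k H) :=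
    { toFun := fun (c : k) ↦ q (algebraMap k H c)
      map_add' := fun (c c' : k) ↦ by
        change q (algebraMap k H (c + c')) = q (algebraMap k H c) + q (algebraMap k H c')
        rw [map_add, map_add]
      map_smul' := fun h (c : k) ↦ by
        change q (algebraMap k H (ε h * c)) = h • q (algebraMap k H c)
        rw [← q_mul, hq (h * _), map_mul ε, AlgHom.commutes ε]
        rfl }
  have hf : Function.Bijective f := by
    constructor
    · refine (injective_iff_map_eq_zero f).2 fun (c : k) hc ↦ ?_
      have h1 : ε (algebraMap k H c) = 0 := by
        refine coinvMk_induction (ε := ε) (M := diagonalBimodule k H) (p := fun (x : H) ↦ ε x = 0)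
          (map_zero ε) (fun (x y : H) hx hy ↦ ?_) (fun h (m : H) ↦ ?_) _ hc
        · exact (map_add ε x y).trans (by rw [hx, hy, add_zero])
        · have h2 := diagonalBimodule_smul (k := k) 1 (MulOpposite.op h) m
          have h3 := diagonalBimodule_smul (k := k) (algebraMap k H (ε h)) 1 m
          rw [Algebra.TensorProduct.algebraMap_apply]
          refine (map_sub ε _ _).trans (sub_eq_zero.2 ?_)
          refine (congrArg ε h2).trans (Eq.trans ?_ (congrArg ε h3).symm)
          simp [mul_comm]
      rwa [AlgHom.commutes] at h1
    · intro z
      obtain ⟨x, rfl⟩ := hqs z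
      exact ⟨ε x, (hq x).symm⟩
  exact ⟨(LinearEquiv.ofBijective f hf).symm.toModuleIso⟩

variable (k H) in
/-- `H^e` is free as a right `H`-module. -/
lemma projective_resRight_env :
    Projective (resRight (k := k).obj (ModuleCat.of (Env k H) (Env k H))) := by
  classical
  let b := Module.Basis.ofVectorSpace k H
  have : Projective (ModuleCat.of Hᵐᵒᵖ Hᵐᵒᵖ) :=
    (IsProjective.iff_projective (ModuleCat.of Hᵐᵒᵖ Hᵐᵒᵖ)).1 inferInstance
  let ι : _ → (ModuleCat.of Hᵐᵒᵖ Hᵐᵒᵖ ⟶ resRight (k := k).obj (ModuleCat.of (Env k H) (Env k H))) :=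
    fun j ↦ ModuleCat.ofHom
      (Y := resRight (k := k).obj (ModuleCat.of (Env k H) (Env k H)))
      { toFun := fun x ↦ (b j ⊗ₜ x : Env k H)
        map_add' := fun x y ↦ TensorProduct.tmul_add _ _ _
        map_smul' := fun x y ↦ by
          change (b j ⊗ₜ (x * y) : Env k H) = (1 ⊗ₜ x) * (b j ⊗ₜ y)
          rw [Algebra.TensorProduct.tmul_mul_tmul, one_mul] }
  refine IsDirectSum.projective (ι := ι) ?_
  unfold IsDirectSum
  refine bijective_congr (TensorProduct.equivFinsuppOfBasisLeft (N := Hᵐᵒᵖ) b).symm.bijective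
    fun c ↦ ?_
  simp only [TensorProduct.equivFinsuppOfBasisLeft_symm_apply, Finsupp.sum, Finsupp.lsum_apply]
  rfl

variable (k H) in
lemma projective_resRight_diagonalBimodule :
    Projective (resRight (k := k).obj (diagonalBimodule k H)) := by
  let e : Hᵐᵒᵖ ≃ₗ[Hᵐᵒᵖ] resRight (k := k).obj (diagonalBimodule k H) :=
    { toFun := fun x ↦ (x.unop : H)
      invFun := fun (x : H) ↦ MulOpposite.op x
      map_add' := fun x y ↦ rfl
      map_smul' := fun x y ↦ ((diagonalBimodule_smul 1 x y.unop).trans (one_mul _)).symm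
      left_inv := fun x ↦ rfl
      right_inv := fun x ↦ rfl }
  exact (IsProjective.iff_projective (resRight (k := k).obj (diagonalBimodule k H))).1
    (Module.Projective.of_equiv e)

/-- A resolution of the bimodule `H` by finitely generated projectives induces one of the trivial
module. -/
lemma isFP_trivialModule (ε : H →ₐ[k] k) (n : ℕ) (h : IsFP n (diagonalBimodule k H)) :
    IsFP n (trivialModule ε) :=
  (isFP_coinv (projective_resRight_env k H) n _ (projective_resRight_diagonalBimodule k H) h).of_iso
    (nonempty_coinv_diagonalBimodule_iso ε).some

end Coinvariants

/-! ### Van den Bergh duality for Hopf algebras -/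

section VanDenBergh

variable (k H : Type u) [Field k] [Ring H] [HopfAlgebra k H]

/-- `Ext^i_H (k, H)`. -/
abbrev ExtTriv (i : ℕ) : Type u :=
  Ext.{u} (trivialModule (Bialgebra.counitAlgHom k H)) (ModuleCat.of H H) i

/-- `Ext^i_H (k, H^e)`, where `H` acts on `H^e` through `delta`. -/
abbrev ExtDelta (i : ℕ) : Type u :=
  Ext.{u} (trivialModule (Bialgebra.counitAlgHom k H))
    ((resδ k H).obj (ModuleCat.of (Env k H) (Env k H))) i

/-- The map `Ext^i_H (k, H) ⊗ H → Ext^i_H (k, H^e)` given by the maps `kappa y`. -/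
def kappaClass (i : ℕ) : ExtTriv k H i ⊗[k] H →ₗ[k] ExtDelta k H i :=
  TensorProduct.lift (LinearMap.mk₂ k (fun d y ↦ d.comp (Ext.mk₀ (kappa y)) (add_zero i))
    (fun d d' y ↦ Ext.add_comp _ _ _ _) (fun c d y ↦ Ext.smul_comp _ _ _ _)
    (fun d y y' ↦ by
      rw [← Ext.comp_add, ← Ext.mk₀_add]
      congr 2
      refine hom_self_ext ?_
      change delta k H 1 * (1 ⊗ₜ MulOpposite.op (y + y')) =
        delta k H 1 * (1 ⊗ₜ MulOpposite.op y) + delta k H 1 * (1 ⊗ₜ MulOpposite.op y')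
      rw [MulOpposite.op_add, TensorProduct.tmul_add, mul_add])
    (fun c d y ↦ by
      rw [← Ext.comp_smul, ← Ext.mk₀_smul]
      congr 2
      refine hom_self_ext ?_
      change delta k H 1 * (1 ⊗ₜ MulOpposite.op (c • y)) =
        delta k H (algebraMap k H c) * (delta k H 1 * (1 ⊗ₜ MulOpposite.op y))
      rw [MulOpposite.op_smul, TensorProduct.tmul_smul, AlgHom.commutes, map_one, one_mul,
        one_mul (1 ⊗ₜ[k] MulOpposite.op y : Env k H)]
      exact Algebra.smul_def (A := Env k H) c _))

lemma extPreMap_unitδ_smul (i : ℕ) (c : k)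
    (x : Ext.{u} (diagonalBimodule k H) (ModuleCat.of (Env k H) (Env k H)) i) :
    extPreMap (resδ k H) (unitδ k H) (ModuleCat.of (Env k H) (Env k H)) i (c • x) =
      c • extPreMap (resδ k H) (unitδ k H) (ModuleCat.of (Env k H) (Env k H)) i x := by
  rw [extPreMap_apply, extPreMap_apply, Functor.mapExactFunctor_smul, Ext.comp_smul]

/-- The comparison map `Ext_{H^e} (H, H^e) → Ext_H (k, H^e)`. -/
def extResδ (i : ℕ) : ExtEnv k H i →ₗ[k] ExtDelta k H i where
  __ := extPreMap (resδ k H) (unitδ k H) (ModuleCat.of (Env k H) (Env k H)) i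
  map_smul' c x := extPreMap_unitδ_smul k H i c x

variable {k H}

lemma kappaClass_tmul {i : ℕ} (d : ExtTriv k H i) (y : H) :
    kappaClass k H i (d ⊗ₜ y) = d.comp (Ext.mk₀ (kappa y)) (add_zero i) := rfl

/-- Since `k` has a resolution by finitely generated projectives, `Ext_H (k, -)` commutes with the
decomposition of `H^e` into copies of `H`. -/
lemma kappaClass_bijective (hFP : ∀ m, IsFP m (trivialModule (Bialgebra.counitAlgHom k H)))
    (i : ℕ) : Function.Bijective (kappaClass k H i) := by
  classical
  let b := Module.Basis.ofVectorSpace k H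
  have h1 := extSumMap_bijective (isDirectSum_kappa b) _ i (hFP _)
  refine bijective_congr (h1.comp (TensorProduct.equivFinsuppOfBasisRight
    (M := ExtTriv k H i) b).bijective) fun t ↦ ?_
  obtain ⟨c, rfl⟩ :=
    (TensorProduct.equivFinsuppOfBasisRight (M := ExtTriv k H i) b).symm.surjective t
  rw [Function.comp_apply, LinearEquiv.apply_symm_apply,
    TensorProduct.equivFinsuppOfBasisRight_symm_apply, Finsupp.sum, map_sum]
  rfl

/-- Change of rings along `δ`, as the bimodule `H` is induced from `k`. -/
lemma extResδ_bijective (i : ℕ) : Function.Bijective (extResδ k H i) :=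
  have := (isRightFree_delta (k := k) (H := H)).preservesInjectiveObjects
  extPreMap_bijective _ _ bijective_unitδ _ i

lemma extResδ_comp {i : ℕ}
    (x : Ext.{u} (diagonalBimodule k H) (ModuleCat.of (Env k H) (Env k H)) i)
    (f : ModuleCat.of.{u} (Env k H) (Env k H) ⟶ ModuleCat.of (Env k H) (Env k H)) :
    extResδ k H i (x.comp (Ext.mk₀ f) (add_zero i) :) =
      (extResδ k H i x).comp (Ext.mk₀ ((resδ k H).map f)) (add_zero i) := by
  change extPreMap (resδ k H) (unitδ k H) (ModuleCat.of (Env k H) (Env k H)) i _ =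
    Ext.comp (extPreMap (resδ k H) (unitδ k H) (ModuleCat.of (Env k H) (Env k H)) i _) _ _
  simp only [extPreMap_apply, Ext.mapExactFunctor_comp, Ext.mapExactFunctor_mk₀]
  rw [Ext.comp_assoc_of_third_deg_zero]

/-- The left action of `H` on `Ext_{H^e} (H, H^e)` is induced by right multiplication by `1 ⊗ h`. -/
lemma extResδ_smul {i : ℕ} (h : H) (x : ExtEnv k H i) : extResδ k H i (h • x) =
    (extResδ k H i x).comp (Ext.mk₀ ((resδ k H).map
      (envMulRight k H ((1 : H) ⊗ₜ MulOpposite.op h)))) (add_zero i) :=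
  extResδ_comp _ _

/-- The right action of `H` on `Ext_{H^e} (H, H^e)` is induced by right multiplication by `h ⊗ 1`.
-/
lemma extResδ_op_smul {i : ℕ} (h : H) (x : ExtEnv k H i) : extResδ k H i (MulOpposite.op h • x) =
    (extResδ k H i x).comp (Ext.mk₀ ((resδ k H).map
      (envMulRight k H (h ⊗ₜ (1 : Hᵐᵒᵖ))))) (add_zero i) :=
  extResδ_comp _ _

lemma smul_op_smul {i : ℕ} (g h : H) (x : ExtEnv k H i) :
    MulOpposite.op h • (g • x) = g • (MulOpposite.op h • x) := by
  apply (extResδ_bijective i).1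
  rw [extResδ_op_smul, extResδ_smul, extResδ_smul, extResδ_op_smul,
    Ext.comp_assoc_of_third_deg_zero, Ext.mk₀_comp_mk₀, ← Functor.map_comp, envMulRight_comp,
    Ext.comp_assoc_of_third_deg_zero, Ext.mk₀_comp_mk₀, ← Functor.map_comp, envMulRight_comp,
    Algebra.TensorProduct.tmul_mul_tmul, Algebra.TensorProduct.tmul_mul_tmul, mul_one, mul_one,
    one_mul, one_mul]

lemma kappa_comp_left (y h : H) : kappa (k := k) y ≫ (resδ k H).map
    (envMulRight k H ((1 : H) ⊗ₜ MulOpposite.op h)) = kappa (h * y) := by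
  refine hom_self_ext ?_
  change delta k H 1 * (1 ⊗ₜ MulOpposite.op y) * (1 ⊗ₜ MulOpposite.op h) =
    delta k H 1 * (1 ⊗ₜ MulOpposite.op (h * y))
  rw [mul_assoc, Algebra.TensorProduct.tmul_mul_tmul, one_mul, MulOpposite.op_mul]

lemma kappaClass_mul {i : ℕ} (d : ExtTriv k H i) (h y : H) : kappaClass k H i (d ⊗ₜ (h * y)) =
    (kappaClass k H i (d ⊗ₜ y)).comp (Ext.mk₀ ((resδ k H).map
      (envMulRight k H ((1 : H) ⊗ₜ MulOpposite.op h)))) (add_zero i) := by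
  rw [kappaClass_tmul, kappaClass_tmul, Ext.comp_assoc_of_third_deg_zero, Ext.mk₀_comp_mk₀,
    kappa_comp_left]

/-- The map `t = Σ a ⊗ b ↦ Σ δ(a) (1 ⊗ S²(b))` sends the comultiplication of `h` to `h ⊗ 1`. -/
lemma spread_left_map_comul (h : H) :
    spread ((LinearMap.mul k Hᵐᵒᵖ) ∘ₗ (antipodeAlgHomOp k H).toLinearMap)
      (LinearMap.lTensor H ((MulOpposite.opLinearEquiv k).toLinearMap ∘ₗ antipode k ∘ₗ antipode k)
        (comul h)) = h ⊗ₜ 1 := by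
  have h1 := spread_spread
    ((LinearMap.mul k Hᵐᵒᵖ) ∘ₗ (antipodeAlgHomOp k H).toLinearMap) leftInv left_leftInv
    (h ⊗ₜ[k] (1 : Hᵐᵒᵖ))
  have h2 : leftInv.flip (1 : Hᵐᵒᵖ) =
      (MulOpposite.opLinearEquiv k).toLinearMap ∘ₗ antipode k ∘ₗ antipode k := by
    ext x
    simp [leftInv]
  rwa [spread_tmul _ h, h2] at h1

/-- The map `Σ a ⊗ b ↦ Σ δ(a) (1 ⊗ S²(b))` on tensors. -/
def deltaSum : H ⊗[k] H →ₗ[k] Env k H :=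
  spread ((LinearMap.mul k Hᵐᵒᵖ) ∘ₗ (antipodeAlgHomOp k H).toLinearMap) ∘ₗ
    LinearMap.lTensor H ((MulOpposite.opLinearEquiv k).toLinearMap ∘ₗ antipode k ∘ₗ antipode k)

/-- The map `Σ a ⊗ b ↦ Σ R_a κ_{S²(b)}`, with `R_a` the right multiplication by `a`. -/
def kappaSum (t : H ⊗[k] H) :
    ModuleCat.of H H ⟶ (resδ k H).obj (ModuleCat.of (Env k H) (Env k H)) :=
  ModuleCat.ofHom (Y := (resδ k H).obj (ModuleCat.of (Env k H) (Env k H)))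
    { toFun := fun x ↦ (delta k H x * deltaSum t : Env k H)
      map_add' := fun x x' ↦ by rw [map_add, add_mul]; rfl
      map_smul' := fun x x' ↦ by
        change delta k H (x * x') * _ = delta k H x * (delta k H x' * _)
        rw [map_mul, mul_assoc] }

lemma kappaSum_tmul (a b : H) : kappaSum (a ⊗ₜ[k] b) =
    rightMul a ≫ kappa (antipode k (antipode k b)) := by
  refine hom_self_ext ?_
  change delta k H 1 * deltaSum (a ⊗ₜ[k] b) =
    delta k H (1 * a) * (1 ⊗ₜ MulOpposite.op (antipode k (antipode k b)))
  rw [delta_mul_tmul, one_mul, map_one, one_mul]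
  rfl

lemma kappaSum_add (t t' : H ⊗[k] H) : kappaSum (t + t') = kappaSum t + kappaSum t' := by
  refine hom_self_ext ?_
  change delta k H 1 * deltaSum (t + t') =
    delta k H 1 * deltaSum t + delta k H 1 * deltaSum t'
  rw [← mul_add, map_add]

lemma kappa_one_comp (h : H) : kappa (k := k) 1 ≫ (resδ k H).map
    (envMulRight k H (h ⊗ₜ (1 : Hᵐᵒᵖ))) = kappaSum (comul h) := by
  refine hom_self_ext ?_
  change delta k H 1 * (1 ⊗ₜ 1) * (h ⊗ₜ (1 : Hᵐᵒᵖ)) = delta k H 1 * deltaSum (comul h)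
  rw [deltaSum, LinearMap.comp_apply, spread_left_map_comul, map_one, one_mul,
    ← Algebra.TensorProduct.one_def]

/-- The character by which `H` acts on a one-dimensional `Ext^i_H (k, H)`. -/
lemma exists_character {i : ℕ} (e₀ : ExtTriv k H i) (he₀ : e₀ ≠ 0)
    (hgen : ∀ e : ExtTriv k H i, ∃ c : k, c • e₀ = e) : ∃ χ : H →ₐ[k] k, ∀ h,
      e₀.comp (Ext.mk₀ (rightMul h)) (add_zero i) = χ h • e₀ := by
  choose χ hχ using fun h : H ↦ hgen (e₀.comp (Ext.mk₀ (rightMul h)) (add_zero i))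
  have hinj : ∀ c c' : k, c • e₀ = c' • e₀ → c = c' := fun c c' h ↦ smul_left_injective k he₀ h
  have hadd : ∀ g h, χ (g + h) = χ g + χ h := fun g h ↦ hinj _ _ (by
    rw [add_smul, hχ, hχ, hχ, ← Ext.comp_add, ← Ext.mk₀_add]
    congr 2
    exact hom_self_ext (mul_add (1 : H) g h))
  have hsmul : ∀ (c : k) h, χ (c • h) = c * χ h := fun c h ↦ hinj _ _ (by
    rw [mul_smul, hχ, hχ, ← Ext.comp_smul, ← Ext.mk₀_smul]
    congr 2
    refine hom_self_ext ?_
    change 1 * c • h = algebraMap k H c * (1 * h)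
    rw [one_mul, one_mul, Algebra.smul_def])
  have hone : χ 1 = 1 := hinj _ _ (by
    have : rightMul (1 : H) = 𝟙 _ := hom_self_ext (mul_one (1 : H))
    rw [hχ, one_smul, this, Ext.comp_mk₀_id])
  have hmul : ∀ g h, χ (g * h) = χ g * χ h := fun g h ↦ hinj _ _ (by
    rw [hχ, ← rightMul_comp, ← Ext.mk₀_comp_mk₀, ← Ext.comp_assoc_of_third_deg_zero, ← hχ g,
      Ext.smul_comp, ← hχ h, mul_smul])
  exact ⟨AlgHom.ofLinearMap ⟨⟨χ, hadd⟩, hsmul⟩ hone hmul, fun h ↦ (hχ h).symm⟩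

/-- Right multiplication by `h ⊗ 1` on the generator `e₀ ⊗ 1` of `Ext^i_H (k, H^e)`, where `H` acts
on `e₀` through the character `χ`: the result is `e₀ ⊗ S²(χ(h₁) h₂)`. -/
lemma kappaClass_op_smul {i : ℕ} (e₀ : ExtTriv k H i) (χ : H →ₐ[k] k)
    (hχ : ∀ h, e₀.comp (Ext.mk₀ (rightMul h)) (add_zero i) = χ h • e₀) (h : H) :
    (kappaClass k H i (e₀ ⊗ₜ 1)).comp (Ext.mk₀ ((resδ k H).map
      (envMulRight k H (h ⊗ₜ (1 : Hᵐᵒᵖ))))) (add_zero i) =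
        kappaClass k H i (e₀ ⊗ₜ antipode k (antipode k (winding χ.toLinearMap h))) := by
  rw [kappaClass_tmul, Ext.comp_assoc_of_third_deg_zero, Ext.mk₀_comp_mk₀, kappa_one_comp]
  change _ = kappaClass k H i (e₀ ⊗ₜ antipode k (antipode k
    (TensorProduct.lid k H (LinearMap.rTensor H χ.toLinearMap (comul h)))))
  induction comul (R := k) h using TensorProduct.induction_on with
  | zero =>
    have h0 : kappaSum (0 : H ⊗[k] H) = 0 := by
      have := kappaSum_add (0 : H ⊗[k] H) 0
      rwa [add_zero, left_eq_add] at this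
    rw [h0, Ext.mk₀_zero, Ext.comp_zero]
    simp
  | add x y hx hy =>
    rw [kappaSum_add, Ext.mk₀_add, Ext.comp_add, hx, hy]
    simp only [map_add, TensorProduct.tmul_add]
  | tmul x y =>
    rw [kappaSum_tmul, ← Ext.mk₀_comp_mk₀, ← Ext.comp_assoc_of_third_deg_zero, hχ, Ext.smul_comp,
      ← kappaClass_tmul]
    simp

/-- The isomorphism `Ext^i_H (k, H) ⊗ H ≃ Ext^i_{H^e} (H, H^e)`. -/
def extEnvEquiv (hFP : ∀ m, IsFP m (trivialModule (Bialgebra.counitAlgHom k H))) (i : ℕ) :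
    ExtTriv k H i ⊗[k] H ≃ₗ[k] ExtEnv k H i :=
  (LinearEquiv.ofBijective _ (kappaClass_bijective hFP i)).trans
    (LinearEquiv.ofBijective _ (extResδ_bijective i)).symm

lemma extResδ_extEnvEquiv (hFP : ∀ m, IsFP m (trivialModule (Bialgebra.counitAlgHom k H))) {i : ℕ}
    (t : ExtTriv k H i ⊗[k] H) : extResδ k H i (extEnvEquiv hFP i t) = kappaClass k H i t :=
  (LinearEquiv.ofBijective _ (extResδ_bijective i)).apply_symm_apply _

/-- The left action of `H` on `Ext^i_{H^e} (H, H^e) ≃ Ext^i_H (k, H) ⊗ H` is that on the second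
factor. -/
lemma extEnvEquiv_mul (hFP : ∀ m, IsFP m (trivialModule (Bialgebra.counitAlgHom k H))) {i : ℕ}
    (d : ExtTriv k H i) (h y : H) :
    extEnvEquiv hFP i (d ⊗ₜ (h * y)) = h • extEnvEquiv hFP i (d ⊗ₜ y) := by
  apply (extResδ_bijective i).1
  rw [extResδ_extEnvEquiv, extResδ_smul, extResδ_extEnvEquiv, kappaClass_mul]

lemma HasVanDenBerghDuality.isFP {d : ℕ} (hV : HasVanDenBerghDuality k H d) (m : ℕ) :
    IsFP m (trivialModule (Bialgebra.counitAlgHom k H)) := by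
  obtain ⟨P, hP, -⟩ := hV.homologicallySmooth
  exact isFP_trivialModule _ m (isFP_of_projectiveResolution P hP m)

/-- The bimodule `H` has finite projective dimension, and its restriction along `δ` has the trivial
module as a direct summand. -/
lemma HasVanDenBerghDuality.exists_hasProjectiveDimensionLT {d : ℕ}
    (hV : HasVanDenBerghDuality k H d) :
    ∃ p, HasProjectiveDimensionLT (trivialModule (Bialgebra.counitAlgHom k H)) (p + 1) := by
  obtain ⟨P, -, N, hN⟩ := hV.homologicallySmooth
  have := resδ_preservesProjectiveObjects (k := k) (H := H)
  have h1 := hasProjectiveDimensionLT_of_projectiveResolution P (N + 1) (hN _ (by lia))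
  have h2 := hasProjectiveDimensionLT_restrictScalars (delta k H).toRingHom _ _ h1
  exact ⟨N, (retractTrivial k H).hasProjectiveDimensionLT _⟩

/-- `Ext^i_{H^e} (H, H^e)` is the free left `H`-module on `Ext^i_H (k, H)`: it vanishes only if
`Ext^i_H (k, H)` does, and it is invertible only if `Ext^i_H (k, H)` is one-dimensional. -/
lemma HasVanDenBerghDuality.leftASCondition {d : ℕ} (hV : HasVanDenBerghDuality k H d) :
    LeftASCondition k H (Bialgebra.counitAlgHom k H) d := by
  intro i
  split_ifs with hi
  · subst hi
    obtain ⟨V, _, _, _, _, _, _, _, h₁, Θ, hΘ⟩ := hV.invertible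
    have h1 := finrank_eq_one_of_balanced (Bialgebra.counitAlgHom k H) Θ
      (fun h x y ↦ (hΘ h x y).1) (extEnvEquiv hV.isFP i) (extEnvEquiv_mul hV.isFP)
    exact Module.rank_eq_one_iff_finrank_eq_one.2 h1
  · have h1 := hV.ext_eq_zero i hi
    have h2 := (extEnvEquiv hV.isFP i).injective.subsingleton
    refine rank_zero_iff.2 ⟨fun x y ↦ ?_⟩
    -- Recover `x` from `x ⊗ 1` by applying the counit.
    have h3 := congrArg (fun t ↦ TensorProduct.rid k _ (LinearMap.lTensor _ counit t))
      (Subsingleton.elim (x ⊗ₜ[k] (1 : H)) (y ⊗ₜ[k] (1 : H)))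
    simpa using h3

/-- The Nakayama automorphism of `H` is `S² ∘ winding χ`, hence `S` is bijective. -/
lemma HasVanDenBerghDuality.bijective_antipode {d : ℕ} (hV : HasVanDenBerghDuality k H d) :
    Function.Bijective (antipode k : H →ₗ[k] H) := by
  have hFP := hV.isFP
  obtain ⟨e₀, he₀, hgen⟩ := finrank_eq_one_iff'.1
    (Module.finrank_eq_of_rank_eq (n := 1) (by simpa using hV.leftASCondition d))
  obtain ⟨χ, hχ⟩ := exists_character e₀ he₀ hgen
  obtain ⟨V, _, _, _, _, _, _, _, h₁, h₂⟩ := hV.invertible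
  let φ : H →ₗ[k] H := antipode k ∘ₗ antipode k ∘ₗ winding χ.toLinearMap
  -- `Ω (e₀ ⊗ 1)` generates the invertible bimodule freely on the left, and right multiplication
  -- acts on it through `φ`.
  let Ω := extEnvEquiv hFP d
  have hΩ : ∀ y, y • Ω (e₀ ⊗ₜ 1) = Ω (e₀ ⊗ₜ y) := fun y ↦ by
    rw [← extEnvEquiv_mul, mul_one]
  have hφ1 : ∀ h, MulOpposite.op h • Ω (e₀ ⊗ₜ 1) = φ h • Ω (e₀ ⊗ₜ 1) := fun h ↦ by
    rw [hΩ]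
    apply (extResδ_bijective d).1
    rw [extResδ_op_smul, extResδ_extEnvEquiv, extResδ_extEnvEquiv, kappaClass_op_smul e₀ χ hχ]
    rfl
  let s : k ≃ₗ[k] ExtTriv k H d := LinearEquiv.ofBijective (LinearMap.toSpanSingleton k _ e₀)
    ⟨smul_left_injective k he₀, hgen⟩
  let c : H ≃ₗ[k] ExtEnv k H d :=
    (TensorProduct.lid k H).symm.trans ((TensorProduct.congr s (LinearEquiv.refl k H)).trans Ω)
  have hc : ∀ y, c y = y • Ω (e₀ ⊗ₜ 1) := fun y ↦ by
    have hs : s 1 = e₀ := one_smul k e₀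
    rw [hΩ, ← hs]
    rfl
  have hb : Function.Bijective φ := by
    refine bijective_of_balanced h₁ h₂ (Ω (e₀ ⊗ₜ 1)) c.symm.toLinearMap (fun y ↦ ?_) (fun u ↦ ?_)
      φ (fun y h ↦ ?_) (fun g h ↦ map_sub φ g h)
    · rw [← hc]
      exact c.symm_apply_apply y
    · rw [← hc]
      exact c.apply_symm_apply u
    · rw [smul_op_smul, hφ1, mul_smul]
  have hb2 : Function.Bijective ((antipode k : H →ₗ[k] H) ∘ (antipode k : H →ₗ[k] H)) :=
    (Function.Bijective.of_comp_iff _ (winding_bijective χ)).1 hb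
  exact ⟨hb2.1.of_comp, hb2.2.of_comp⟩

end VanDenBergh

/-! ### Equality of the two self-injective dimensions of a noetherian ring -/

section Matrices

variable {R : Type u} [Ring R]

lemma subsingleton_ext_one_iff {S : ShortComplex (ModuleCat.{u} R)} (hS : S.ShortExact)
    [Projective S.X₂] (Y : ModuleCat.{u} R) :
    Subsingleton (Ext.{u} S.X₃ Y 1) ↔ ∀ f : S.X₁ ⟶ Y, ∃ g : S.X₂ ⟶ Y, S.f ≫ g = f := by
  constructor
  · intro h f
    obtain ⟨x, hx⟩ := Ext.contravariant_sequence_exact₁ hS _ (Ext.mk₀ f)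
      (add_zero 1) (Subsingleton.elim _ _)
    obtain ⟨g, rfl⟩ := (Ext.mk₀_bijective _ _).2 x
    rw [Ext.mk₀_comp_mk₀] at hx
    exact ⟨g, (Ext.mk₀_bijective _ _).1 hx⟩
  · intro h
    refine subsingleton_of_forall_eq 0 fun x ↦ ?_
    obtain ⟨x₁, rfl⟩ := Ext.contravariant_sequence_exact₃ hS _ x (Ext.eq_zero_of_projective _)
      (add_zero 1)
    obtain ⟨f, rfl⟩ := (Ext.mk₀_bijective _ _).2 x₁
    obtain ⟨g, rfl⟩ := h f
    rw [← Ext.mk₀_comp_mk₀, hS.extClass_comp_assoc]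

lemma subsingleton_ext_add_two_iff {S : ShortComplex (ModuleCat.{u} R)} (hS : S.ShortExact)
    [Projective S.X₂] (Y : ModuleCat.{u} R) (i : ℕ) :
    Subsingleton (Ext.{u} S.X₃ Y (i + 2)) ↔ Subsingleton (Ext.{u} S.X₁ Y (i + 1)) := by
  constructor
  · intro h
    refine subsingleton_of_forall_eq 0 fun x ↦ ?_
    obtain ⟨x₂, rfl⟩ := Ext.contravariant_sequence_exact₁ hS _ x
      (show 1 + (i + 1) = i + 2 by lia) (Subsingleton.elim _ _)
    rw [Ext.eq_zero_of_projective x₂, Ext.comp_zero]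
  · intro h
    refine subsingleton_of_forall_eq 0 fun x ↦ ?_
    obtain ⟨x₁, rfl⟩ := Ext.contravariant_sequence_exact₃ hS _ x (Ext.eq_zero_of_projective _)
      (show 1 + (i + 1) = i + 2 by lia)
    rw [Subsingleton.elim x₁ 0, Ext.comp_zero]

variable {p q r : ℕ}

/-- The cokernel of the map `R^q → R^p` between modules of row vectors. -/
def cokerMod (b : Matrix (Fin q) (Fin p) R) : ModuleCat.{u} R :=
  ModuleCat.of R ((Fin p → R) ⧸ LinearMap.range b.vecMulLinear)

/-- The maps `R^r → R^q → R^p` between modules of row vectors form an exact sequence. -/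
def RowExact (a : Matrix (Fin r) (Fin q) R) (b : Matrix (Fin q) (Fin p) R) : Prop :=
  Function.Exact a.vecMulLinear b.vecMulLinear

/-- Every solution `z` of the system `a z = 0` in the module `Y` is of the form `b y`. -/
def ColExact (a : Matrix (Fin r) (Fin q) R) (b : Matrix (Fin q) (Fin p) R) (Y : Type u)
    [AddCommGroup Y] [Module R Y] : Prop :=
  ∀ z : Fin q → Y, (∀ i, ∑ j, a i j • z j = 0) → ∃ y : Fin p → Y, ∀ j, ∑ l, b j l • y l = z j

lemma linearCombination_vecMul {Y : Type u} [AddCommGroup Y] [Module R Y]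
    (a : Matrix (Fin r) (Fin q) R) (z : Fin q → Y) (x : Fin r → R) :
    Fintype.linearCombination R z (Matrix.vecMul x a) =
      Fintype.linearCombination R (fun i ↦ ∑ j, a i j • z j) x := by
  simp only [Fintype.linearCombination_apply, Matrix.vecMul, dotProduct, Finset.sum_smul,
    Finset.smul_sum, mul_smul]
  exact Finset.sum_comm

lemma RowExact.mul_eq_zero {a : Matrix (Fin r) (Fin q) R} {b : Matrix (Fin q) (Fin p) R}
    (h : RowExact a b) : a * b = 0 := by
  ext i l
  have h1 := h.apply_apply_eq_zero (Pi.single i 1)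
  rw [Matrix.vecMulLinear_apply, Matrix.vecMulLinear_apply, Matrix.vecMul_vecMul,
    Matrix.single_one_vecMul] at h1
  exact congrFun h1 l

/-- The map `coker a → R^p` induced by `b`. -/
def cokerMap {a : Matrix (Fin r) (Fin q) R} {b : Matrix (Fin q) (Fin p) R} (h : RowExact a b) :
    cokerMod a ⟶ ModuleCat.of R (Fin p → R) :=
  ModuleCat.ofHom (Submodule.liftQ _ b.vecMulLinear h.linearMap_ker_eq.ge)

lemma exists_shortExact_coker {a : Matrix (Fin r) (Fin q) R} {b : Matrix (Fin q) (Fin p) R}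
    (h : RowExact a b) : ∃ (g : ModuleCat.of R (Fin p → R) ⟶ cokerMod b)
      (hz : cokerMap h ≫ g = 0), (ShortComplex.mk (cokerMap h) g hz).ShortExact := by
  have hex : Function.Exact (cokerMap h).hom (LinearMap.range b.vecMulLinear).mkQ := by
    rw [LinearMap.exact_iff, Submodule.ker_mkQ]
    exact (Submodule.range_liftQ _ _ _).symm
  refine ⟨ModuleCat.ofHom (LinearMap.range b.vecMulLinear).mkQ,
    ModuleCat.hom_ext (LinearMap.ext fun x ↦ hex.apply_apply_eq_zero x),
    { exact := (ShortComplex.ShortExact.moduleCat_exact_iff_function_exact _).2 hex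
      mono_f := (ModuleCat.mono_iff_injective _).2 ?_
      epi_g := (ModuleCat.epi_iff_surjective _).2 (Submodule.mkQ_surjective _) }⟩
  refine LinearMap.ker_eq_bot.1 ?_
  refine (Submodule.ker_liftQ_eq_bot _ _ _ ?_)
  exact h.linearMap_ker_eq.le

instance projective_rowVectors : Projective (ModuleCat.of R (Fin p → R)) :=
  (IsProjective.iff_projective (ModuleCat.of R (Fin p → R))).1 inferInstance

/-- The criterion `subsingleton_ext_one_iff` for the presentation of `coker b`, in terms of systems
of linear equations in `Y`. -/
lemma subsingleton_ext_one_cokerMod_iff {a : Matrix (Fin r) (Fin q) R}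
    {b : Matrix (Fin q) (Fin p) R} (h : RowExact a b) (Y : ModuleCat.{u} R) :
    Subsingleton (Ext.{u} (cokerMod b) Y 1) ↔ ColExact a b Y := by
  obtain ⟨g, hz, hS⟩ := exists_shortExact_coker h
  have : Projective (ShortComplex.mk (cokerMap h) g hz).X₂ := projective_rowVectors
  rw [subsingleton_ext_one_iff hS Y]
  have hmk : ∀ x, cokerMap h (Submodule.Quotient.mk x : _ ⧸ LinearMap.range a.vecMulLinear) =
    Matrix.vecMul x b := fun x ↦ rfl
  constructor
  · intro hf z hz
    have h0 : LinearMap.range a.vecMulLinear ≤ LinearMap.ker (Fintype.linearCombination R z) := by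
      rintro _ ⟨x, rfl⟩
      rw [LinearMap.mem_ker, Matrix.vecMulLinear_apply, linearCombination_vecMul]
      simp [Fintype.linearCombination_apply, hz]
    obtain ⟨g, hg⟩ := hf (ModuleCat.ofHom (Submodule.liftQ _ (Fintype.linearCombination R z) h0))
    let g' : (Fin p → R) →ₗ[R] Y := g.hom
    refine ⟨fun l ↦ g' (Pi.single l 1), fun j ↦ ?_⟩
    have h1 : g' (Matrix.vecMul (Pi.single j 1) b) =
        Fintype.linearCombination R z (Pi.single j 1) :=
      congr($hg (Submodule.Quotient.mk (Pi.single j 1) : _ ⧸ LinearMap.range a.vecMulLinear))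
    rw [Fintype.linearCombination_apply_single, one_smul, Matrix.single_one_vecMul] at h1
    rw [← h1]
    conv_rhs => rw [← Finset.univ_sum_single (b.row j), map_sum]
    refine Finset.sum_congr rfl fun l _ ↦ ?_
    rw [← map_smul, ← Pi.single_smul, smul_eq_mul, mul_one]
    rfl
  · intro hY f
    let f' : ((Fin q → R) ⧸ LinearMap.range a.vecMulLinear) →ₗ[R] Y := f.hom
    let z : Fin q → Y := fun j ↦ f' (Submodule.Quotient.mk (Pi.single j 1))
    have hfz : ∀ x, f' (Submodule.Quotient.mk x) = Fintype.linearCombination R z x := by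
      intro x
      conv_lhs => rw [← Finset.univ_sum_single x]
      rw [Fintype.linearCombination_apply, ← Submodule.mkQ_apply, map_sum, map_sum]
      refine Finset.sum_congr rfl fun l _ ↦ ?_
      rw [← map_smul, Submodule.mkQ_apply, ← Submodule.Quotient.mk_smul, ← Pi.single_smul,
        smul_eq_mul, mul_one]
    obtain ⟨y, hy⟩ := hY z fun i ↦ by
      have h0 : (Submodule.Quotient.mk (Matrix.vecMul (Pi.single i 1) a) :
          _ ⧸ LinearMap.range a.vecMulLinear) = 0 :=
        (Submodule.Quotient.mk_eq_zero _).2 ⟨Pi.single i 1, rfl⟩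
      have h1 := hfz (Matrix.vecMul (Pi.single i 1) a)
      rw [h0, map_zero, linearCombination_vecMul,
        Fintype.linearCombination_apply_single, one_smul] at h1
      exact h1.symm
    refine ⟨ModuleCat.ofHom (Fintype.linearCombination R y), ?_⟩
    refine ModuleCat.hom_ext (LinearMap.ext fun x ↦ ?_)
    obtain ⟨x, rfl⟩ := Submodule.Quotient.mk_surjective _ x
    change Fintype.linearCombination R y (Matrix.vecMul x b) = f' (Submodule.Quotient.mk x)
    rw [linearCombination_vecMul, hfz]
    simp only [hy]

lemma subsingleton_ext_cokerMod_add_two_iff {a : Matrix (Fin r) (Fin q) R}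
    {b : Matrix (Fin q) (Fin p) R} (h : RowExact a b) (Y : ModuleCat.{u} R) (i : ℕ) :
    Subsingleton (Ext.{u} (cokerMod b) Y (i + 2)) ↔
      Subsingleton (Ext.{u} (cokerMod a) Y (i + 1)) := by
  obtain ⟨g, hz, hS⟩ := exists_shortExact_coker h
  have : Projective (ShortComplex.mk (cokerMap h) g hz).X₂ := projective_rowVectors
  exact subsingleton_ext_add_two_iff hS Y i

/-- A finitely generated submodule of `R^q` is the row space of a matrix. -/
lemma exists_range_vecMulLinear {N : Submodule R (Fin q → R)} (hN : N.FG) :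
    ∃ (r : ℕ) (a : Matrix (Fin r) (Fin q) R), LinearMap.range a.vecMulLinear = N := by
  obtain ⟨r, s, hs⟩ := Submodule.fg_iff_exists_fin_generating_family.1 hN
  exact ⟨r, Matrix.of s, by rw [range_vecMulLinear, ← hs]; rfl⟩

lemma exists_rowExact [IsNoetherianRing R] (b : Matrix (Fin q) (Fin p) R) :
    ∃ (r : ℕ) (a : Matrix (Fin r) (Fin q) R), RowExact a b := by
  obtain ⟨r, a, ha⟩ := exists_range_vecMulLinear
    (IsNoetherian.noetherian (LinearMap.ker b.vecMulLinear))
  exact ⟨r, a, (LinearMap.exact_iff).2 ha.symm⟩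

lemma exists_cokerMod_iso [IsNoetherianRing R] (M : ModuleCat.{u} R) [Module.Finite R M] :
    ∃ (p q : ℕ) (b : Matrix (Fin q) (Fin p) R), Nonempty (cokerMod b ≅ M) := by
  obtain ⟨p, f, hf⟩ := Module.Finite.exists_fin' R M
  obtain ⟨q, b, hb⟩ := exists_range_vecMulLinear (IsNoetherian.noetherian (LinearMap.ker f))
  exact ⟨p, q, b, ⟨((Submodule.quotEquivOfEq _ _ hb).trans
    (f.quotKerEquivOfSurjective hf)).toModuleIso⟩⟩

/-- The pair `(a, b)` is the end of an exact sequence of `j + 2` matrices. -/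
def RowChain : (j : ℕ) → {r q p : ℕ} → Matrix (Fin r) (Fin q) R → Matrix (Fin q) (Fin p) R → Prop
  | 0, _, _, _, a, b => RowExact a b
  | j + 1, _, _, p, a, b => RowExact a b ∧ ∃ (p' : ℕ) (c : Matrix (Fin p) (Fin p') R),
      RowChain j b c

lemma RowChain.rowExact {j : ℕ} {a : Matrix (Fin r) (Fin q) R} {b : Matrix (Fin q) (Fin p) R}
    (h : RowChain j a b) : RowExact a b := by
  cases j with
  | zero => exact h
  | succ j => exact h.1

/-- A chain of length `j` exhibits `coker a` as a `(j + 1)`-st syzygy up to a projective; by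
dimension shift, solvability in `Y` is the vanishing of `Ext^{j+1}` from the last cokernel to `Y`.
-/
lemma colExact_of_rowChain {Y : ModuleCat.{u} R} {j : ℕ} (hY : HasInjectiveDimensionLT Y (j + 1))
    {a : Matrix (Fin r) (Fin q) R} {b : Matrix (Fin q) (Fin p) R} (h : RowChain j a b) :
    ColExact a b Y := by
  have key : ∀ (j i : ℕ) (hY : HasInjectiveDimensionLT Y (i + j + 1)) {r q p : ℕ}
      {a : Matrix (Fin r) (Fin q) R} {b : Matrix (Fin q) (Fin p) R}, RowChain j a b →
      Subsingleton (Ext.{u} (cokerMod b) Y (i + 1)) := by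
    intro j
    induction j with
    | zero => exact fun i hY _ _ _ _ _ _ ↦ HasInjectiveDimensionLT.subsingleton Y _ _ le_rfl _
    | succ j ih =>
      intro i hY r q p a b h
      obtain ⟨_, p', c, hc⟩ := h
      rw [← subsingleton_ext_cokerMod_add_two_iff hc.rowExact Y i]
      exact ih (i + 1) (by rwa [show i + 1 + j + 1 = i + (j + 1) + 1 by lia]) hc
  exact (subsingleton_ext_one_cokerMod_iff h.rowExact Y).1 (key j 0 (by rwa [zero_add]) h)

/-- The converse of `colExact_of_rowChain`: every chain extends to the left, so that the hypothesis
gives `Ext^{j+1} (R ⧸ I, Y) = 0` for all left ideals `I`. -/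
lemma hasInjectiveDimensionLT_of_rowChain [IsNoetherianRing R] {Y : ModuleCat.{u} R} {j : ℕ}
    (hY : ∀ {r q p : ℕ} {a : Matrix (Fin r) (Fin q) R} {b : Matrix (Fin q) (Fin p) R},
      RowChain j a b → ColExact a b Y) : HasInjectiveDimensionLT Y (j + 1) := by
  have key : ∀ (i j' : ℕ) (hj : i + j' = j) {r q p : ℕ} {a : Matrix (Fin r) (Fin q) R}
      {b : Matrix (Fin q) (Fin p) R}, RowChain j' a b →
      Subsingleton (Ext.{u} (cokerMod b) Y (i + 1)) := by
    intro i
    induction i with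
    | zero =>
      intro j' hj r q p a b h
      obtain rfl : j' = j := by lia
      exact (subsingleton_ext_one_cokerMod_iff h.rowExact Y).2 (hY h)
    | succ i ih =>
      intro j' hj r q p a b h
      obtain ⟨s, c, hc⟩ := exists_rowExact a
      rw [subsingleton_ext_cokerMod_add_two_iff h.rowExact Y i]
      exact ih (j' + 1) (by lia) ⟨hc, _, b, h⟩
  refine hasInjectiveDimensionLT_of_ideal Y j fun I ↦ ?_
  obtain ⟨p, q, b, ⟨e⟩⟩ := exists_cokerMod_iso (ModuleCat.of R (R ⧸ I))
  obtain ⟨r, a, ha⟩ := exists_rowExact b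
  have h1 := key j 0 (add_zero j) (show RowChain 0 a b from ha)
  refine subsingleton_of_forall_eq 0 fun x ↦ ?_
  have h2 : x = (Ext.mk₀ e.inv).comp ((Ext.mk₀ e.hom).comp x (zero_add (j + 1)))
      (zero_add (j + 1)) := by
    rw [Ext.mk₀_comp_mk₀_assoc, e.inv_hom_id, Ext.mk₀_id_comp]
  rw [h2, Subsingleton.elim ((Ext.mk₀ e.hom).comp x (zero_add (j + 1))) 0, Ext.comp_zero]

lemma RowExact.colExact_of_injective {a : Matrix (Fin r) (Fin q) R}
    {b : Matrix (Fin q) (Fin p) R} (h : RowExact a b) (I : ModuleCat.{u} R) [Injective I] :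
    ColExact a b I :=
  (subsingleton_ext_one_cokerMod_iff h I).1
    (subsingleton_of_forall_eq 0 Ext.eq_zero_of_injective)

/-- Exactness is detected by injective modules. -/
lemma rowExact_of_forall_injective {a : Matrix (Fin r) (Fin q) R} {b : Matrix (Fin q) (Fin p) R}
    (hab : a * b = 0) (h : ∀ I : ModuleCat.{u} R, Injective I → ColExact a b I) :
    RowExact a b := by
  intro x
  refine ⟨fun hx ↦ ?_, ?_⟩
  -- An embedding of `coker a` into an injective module `I` gives a solution of `a z = 0` in `I`;
  -- that it has the form `b y` shows that `x b = 0` implies `x = 0` in `coker a`.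
  · let I := Injective.under (cokerMod a)
    let f : ((Fin q → R) ⧸ LinearMap.range a.vecMulLinear) →ₗ[R] I :=
      (Injective.ι (cokerMod a)).hom
    have hf : Function.Injective f := (ModuleCat.mono_iff_injective _).1
      (inferInstance : Mono (Injective.ι (cokerMod a)))
    let F : (Fin q → R) →ₗ[R] I := f ∘ₗ (LinearMap.range a.vecMulLinear).mkQ
    have hF : ∀ x, F x = Fintype.linearCombination R (fun j ↦ F (Pi.single j 1)) x := by
      intro x
      conv_lhs => rw [← Finset.univ_sum_single x]
      rw [Fintype.linearCombination_apply, map_sum]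
      refine Finset.sum_congr rfl fun l _ ↦ ?_
      rw [← map_smul, ← Pi.single_smul, smul_eq_mul, mul_one]
    obtain ⟨y, hy⟩ := h I inferInstance (fun j ↦ F (Pi.single j 1)) fun i ↦ by
      have h1 := hF (Matrix.vecMul (Pi.single i 1) a)
      rw [linearCombination_vecMul, Fintype.linearCombination_apply_single, one_smul] at h1
      rw [← h1]
      refine (congrArg f ?_).trans (map_zero f)
      exact (Submodule.Quotient.mk_eq_zero _).2 ⟨_, rfl⟩
    have h2 : F x = 0 := by
      rw [Matrix.vecMulLinear_apply] at hx
      rw [hF, ← funext hy, ← linearCombination_vecMul, hx, map_zero]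
    exact (Submodule.Quotient.mk_eq_zero _).1 (hf (h2.trans (map_zero f).symm))
  · rintro ⟨w, rfl⟩
    rw [Matrix.vecMulLinear_apply, Matrix.vecMulLinear_apply, Matrix.vecMul_vecMul, hab,
      Matrix.vecMul_zero]

/-- A system with finitely many unknowns is solved coordinatewise; zero is solved by zero, to keep
the supports finite. -/
lemma ColExact.finsupp {a : Matrix (Fin r) (Fin q) R} {b : Matrix (Fin q) (Fin p) R}
    (h : ColExact a b R) (X : Type u) : ColExact a b (X →₀ R) := by
  classical
  have h' : ∀ z : Fin q → R, ∃ y : Fin p → R, (z = 0 → y = 0) ∧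
      ((∀ i, ∑ j, a i j • z j = 0) → ∀ j, ∑ l, b j l • y l = z j) := by
    intro z
    by_cases hz : z = 0
    · exact ⟨0, fun _ ↦ rfl, fun _ j ↦ by simp [hz]⟩
    · by_cases hz' : ∀ i, ∑ j, a i j • z j = 0
      · obtain ⟨y, hy⟩ := h z hz'
        exact ⟨y, fun h ↦ absurd h hz, fun _ ↦ hy⟩
      · exact ⟨0, fun _ ↦ rfl, fun h ↦ absurd h hz'⟩
  choose Y hY0 hY using h'
  intro z hz
  refine ⟨fun l ↦ Finsupp.onFinset (Finset.univ.biUnion fun j ↦ (z j).support)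
    (fun x ↦ Y (fun j ↦ z j x) l) fun x hx ↦ ?_, fun j ↦ Finsupp.ext fun x ↦ ?_⟩
  · by_contra hcon
    refine hx (congrFun (hY0 _ (funext fun j ↦ ?_)) l)
    by_contra hj
    exact hcon (Finset.mem_biUnion.2 ⟨j, Finset.mem_univ _, Finsupp.mem_support_iff.2 hj⟩)
  · have h1 := hY (fun j ↦ z j x) (fun i ↦ by
      have := DFunLike.congr_fun (hz i) x
      simpa [Finsupp.finsetSum_apply] using this) j
    simpa [Finsupp.finsetSum_apply] using h1

lemma ColExact.of_retract {a : Matrix (Fin r) (Fin q) R} {b : Matrix (Fin q) (Fin p) R}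
    {Y Z : Type u} [AddCommGroup Y] [Module R Y] [AddCommGroup Z] [Module R Z]
    (h : ColExact a b Y) (i : Z →ₗ[R] Y) (s : Y →ₗ[R] Z) (his : ∀ z, s (i z) = z) :
    ColExact a b Z := by
  intro z hz
  obtain ⟨y, hy⟩ := h (fun j ↦ i (z j)) fun l ↦ by
    simp only [← map_smul, ← map_sum, hz, map_zero]
  refine ⟨fun l ↦ s (y l), fun j ↦ ?_⟩
  simp only [← map_smul, ← map_sum, hy, his]

end Matrices

section Zaks

variable {R S : Type u} [Ring R] [Ring S] {p q r : ℕ}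

/-- The action of a matrix on column vectors with entries in a module. -/
def colAct {Y : Type u} [AddCommGroup Y] [Module R Y] (a : Matrix (Fin r) (Fin q) R)
    (z : Fin q → Y) : Fin r → Y := fun i ↦ ∑ j, a i j • z j

lemma colExact_iff {Y : Type u} [AddCommGroup Y] [Module R Y] {a : Matrix (Fin r) (Fin q) R}
    {b : Matrix (Fin q) (Fin p) R} :
    ColExact a b Y ↔ ∀ z : Fin q → Y, colAct a z = 0 → ∃ y, colAct b y = z :=
  forall_congr' fun _ ↦ imp_congr funext_iff.symm (exists_congr fun _ ↦ funext_iff.symm)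

lemma colAct_sub {Y : Type u} [AddCommGroup Y] [Module R Y] (a : Matrix (Fin r) (Fin q) R)
    (z z' : Fin q → Y) : colAct a (z - z') = colAct a z - colAct a z' :=
  funext fun i ↦ by simp [colAct, smul_sub]

lemma colAct_colAct {Y : Type u} [AddCommGroup Y] [Module R Y] (a : Matrix (Fin r) (Fin q) R)
    (b : Matrix (Fin q) (Fin p) R) (z : Fin p → Y) :
    colAct a (colAct b z) = colAct (a * b) z := by
  ext i
  simp only [colAct, Matrix.mul_apply, Finset.sum_smul, Finset.smul_sum, mul_smul]
  exact Finset.sum_comm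

lemma colAct_zero_left {Y : Type u} [AddCommGroup Y] [Module R Y] (z : Fin q → Y) :
    colAct (0 : Matrix (Fin r) (Fin q) R) z = 0 :=
  funext fun i ↦ by simp [colAct]

lemma colAct_map {Y Z : Type u} [AddCommGroup Y] [Module R Y] [AddCommGroup Z] [Module R Z]
    (f : Y →ₗ[R] Z) (a : Matrix (Fin r) (Fin q) R) (z : Fin q → Y) :
    colAct a (fun j ↦ f (z j)) = fun i ↦ f (colAct a z i) :=
  funext fun i ↦ by simp [colAct]

variable (τ : R ≃+* Sᵐᵒᵖ)

/-- The transpose of a matrix, with entries in the opposite ring. -/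
def opMat (a : Matrix (Fin r) (Fin q) R) : Matrix (Fin q) (Fin r) S :=
  Matrix.of fun j i ↦ (τ (a i j)).unop

lemma opMat_surjective (c : Matrix (Fin q) (Fin r) S) :
    ∃ a : Matrix (Fin r) (Fin q) R, opMat τ a = c :=
  ⟨Matrix.of fun i j ↦ τ.symm (MulOpposite.op (c j i)), by ext; simp [opMat]⟩

lemma opMat_mul (a : Matrix (Fin r) (Fin q) R) (b : Matrix (Fin q) (Fin p) R) :
    opMat τ (a * b) = opMat τ b * opMat τ a := by
  ext l i
  simp [opMat, Matrix.mul_apply]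

lemma opMat_eq_zero {a : Matrix (Fin r) (Fin q) R} : opMat τ a = 0 ↔ a = 0 := by
  constructor
  · intro h
    ext i j
    have := congrFun (congrFun h j) i
    simpa [opMat] using this
  · rintro rfl
    ext i j
    simp [opMat]

lemma colAct_opMat (b : Matrix (Fin q) (Fin p) R) (x : Fin q → R) :
    colAct (opMat τ b) (fun j ↦ (τ (x j)).unop) = fun l ↦ (τ (Matrix.vecMul x b l)).unop := by
  ext l
  simp [colAct, opMat, Matrix.vecMul, dotProduct]

/-- Row vectors over `R` are column vectors over `S`, so exactness over `R` is solvability of the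
transposed system in `S`. -/
lemma rowExact_iff {a : Matrix (Fin r) (Fin q) R} {b : Matrix (Fin q) (Fin p) R} :
    RowExact a b ↔ a * b = 0 ∧ ColExact (opMat τ b) (opMat τ a) S := by
  have hsurj : ∀ {n : ℕ} (z : Fin n → S), ∃ x : Fin n → R, z = fun j ↦ (τ (x j)).unop :=
    fun z ↦ ⟨fun j ↦ τ.symm (MulOpposite.op (z j)), by simp⟩
  have hinj : ∀ {n : ℕ} {x y : Fin n → R}, (fun j ↦ (τ (x j)).unop) = (fun j ↦ (τ (y j)).unop) →
      x = y := fun h ↦ funext fun j ↦ τ.injective (MulOpposite.unop_injective (congrFun h j))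
  have hzero : ∀ {n : ℕ}, (0 : Fin n → S) = fun j ↦ (τ ((0 : Fin n → R) j)).unop :=
    fun {n} ↦ by ext; simp
  rw [colExact_iff]
  constructor
  · refine fun h ↦ ⟨h.mul_eq_zero, fun z hz ↦ ?_⟩
    obtain ⟨x, rfl⟩ := hsurj z
    rw [colAct_opMat, hzero] at hz
    obtain ⟨w, rfl⟩ := (h x).1 (hinj hz)
    exact ⟨_, colAct_opMat τ a w⟩
  · rintro ⟨hab, h⟩ x
    constructor
    · intro hx
      rw [Matrix.vecMulLinear_apply] at hx
      obtain ⟨y, hy⟩ := h (fun j ↦ (τ (x j)).unop) (by rw [colAct_opMat, hx, ← hzero])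
      obtain ⟨w, rfl⟩ := hsurj y
      rw [colAct_opMat] at hy
      exact ⟨w, hinj hy⟩
    · rintro ⟨w, rfl⟩
      rw [Matrix.vecMulLinear_apply, Matrix.vecMulLinear_apply, Matrix.vecMul_vecMul, hab,
        Matrix.vecMul_zero]

lemma rowExact_opMat_iff {a : Matrix (Fin r) (Fin q) R} {b : Matrix (Fin q) (Fin p) R} :
    RowExact (opMat τ b) (opMat τ a) ↔ a * b = 0 ∧ ColExact a b R := by
  let τ' : S ≃+* Rᵐᵒᵖ := (RingEquiv.opOp S).trans (RingEquiv.op τ.symm)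
  have h : ∀ {n m : ℕ} (a : Matrix (Fin n) (Fin m) R), opMat τ' (opMat τ a) = a := fun a ↦ by
    ext
    simp [opMat, τ']
  rw [rowExact_iff τ', h, h, ← opMat_mul, opMat_eq_zero]

/-- The module `M` has flat dimension at most `j`: systems of equations whose transposes belong to
a chain of `j + 2` matrices over the opposite ring `S` can be solved in `M`, that is, `Tor_{j+1}`
vanishes on finitely presented modules over `S`. For `j = 0` this is the equational criterion for
flatness. -/
def IsColExact (j : ℕ) (M : Type u) [AddCommGroup M] [Module R M] : Prop :=
  ∀ {r q p : ℕ} (a : Matrix (Fin r) (Fin q) R) (b : Matrix (Fin q) (Fin p) R),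
    RowChain j (opMat τ b) (opMat τ a) → ColExact a b M

/-- Free modules are flat. -/
lemma isColExact_finsupp (X : Type u) : IsColExact τ 0 (X →₀ R) :=
  fun _ _ h ↦ ((rowExact_opMat_iff τ).1 h).2.finsupp X

variable {M N P : Type u} [AddCommGroup M] [Module R M] [AddCommGroup N] [Module R N]
  [AddCommGroup P] [Module R P] {f : M →ₗ[R] N} {g : N →ₗ[R] P}

variable {τ} in
/-- The kernel `M` of a surjection from a flat module `N` onto a module of flat dimension at most `j
+ 1` has flat dimension at most `j`. -/
lemma IsColExact.syzygy [IsNoetherianRing S] (hf : Function.Injective f)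
    (hg : Function.Surjective g) (hfg : Function.Exact f g) (hN : IsColExact τ 0 N) {j : ℕ}
    (hP : IsColExact τ (j + 1) P) : IsColExact τ j M := by
  intro r q p a b h
  obtain ⟨s, e, he⟩ := exists_rowExact (opMat τ b)
  obtain ⟨c, rfl⟩ := opMat_surjective τ e
  have hbc := ((rowExact_opMat_iff τ).1 he).1
  have hP' := colExact_iff.1 (hP b c ⟨he, _, _, h⟩)
  have hN' := colExact_iff.1 (hN a b h.rowExact)
  rw [colExact_iff]
  intro z hz
  obtain ⟨y, hy⟩ := hN' (fun j ↦ f (z j)) (by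
    rw [colAct_map, hz]
    exact funext fun _ ↦ map_zero f)
  obtain ⟨w, hw⟩ := hP' (fun j ↦ g (y j)) (by
    rw [colAct_map, hy]
    exact funext fun _ ↦ hfg.apply_apply_eq_zero _)
  choose w' hw' using fun j ↦ hg (w j)
  have h1 : ∀ i, g ((y - colAct c w') i) = 0 := fun i ↦ by
    have h2 := congrFun (colAct_map g c w') i
    rw [funext hw', hw] at h2
    rw [Pi.sub_apply, map_sub, ← h2, sub_self]
  choose y' hy' using fun i ↦ (hfg _).1 (h1 i)
  refine ⟨y', funext fun i ↦ hf ?_⟩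
  have h3 := congrFun (colAct_map f b y') i
  rw [← h3, funext hy', colAct_sub, hy, colAct_colAct, hbc, colAct_zero_left, sub_zero]

variable {τ} in
/-- The quotient of a flat module by a submodule of flat dimension at most `j` has flat dimension at
most `j + 1`. -/
lemma IsColExact.cosyzygy (hf : Function.Injective f) (hg : Function.Surjective g)
    (hfg : Function.Exact f g) (hN : IsColExact τ 0 N) {j : ℕ} (hM : IsColExact τ j M) :
    IsColExact τ (j + 1) P := by
  intro r q p a b h
  obtain ⟨h0, p', c, hc⟩ := h
  obtain ⟨d, rfl⟩ := opMat_surjective τ c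
  have hda := ((rowExact_opMat_iff τ).1 hc.rowExact).1
  have hM' := colExact_iff.1 (hM d a hc)
  have hN' := colExact_iff.1 (hN a b h0)
  rw [colExact_iff]
  intro z hz
  choose z' hz' using fun j ↦ hg (z j)
  have h1 : ∀ i, g (colAct a z' i) = 0 := fun i ↦ by
    have h2 := congrFun (colAct_map g a z') i
    rw [funext hz', hz] at h2
    exact h2.symm
  choose y hy using fun i ↦ (hfg _).1 (h1 i)
  obtain ⟨x, hx⟩ := hM' y (funext fun i ↦ hf (by
    have h2 := congrFun (colAct_map f d y) i
    rw [← h2, funext hy, colAct_colAct, hda, colAct_zero_left]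
    exact (map_zero f).symm))
  obtain ⟨w, hw⟩ := hN' (z' - fun j ↦ f (x j)) (by
    rw [colAct_sub, colAct_map, hx, funext hy, sub_eq_zero])
  refine ⟨fun l ↦ g (w l), ?_⟩
  rw [colAct_map, hw]
  refine funext fun i ↦ ?_
  rw [Pi.sub_apply, map_sub, hfg.apply_apply_eq_zero, sub_zero, hz']

lemma exists_shortExact_finsupp (M : ModuleCat.{u} R) :
    ∃ (T : ShortComplex (ModuleCat.{u} R)) (_ : T.ShortExact) (X : Type u),
      T.X₂ = ModuleCat.of R (X →₀ R) ∧ T.X₃ = M := by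
  let g : (M →₀ R) →ₗ[R] M := Finsupp.linearCombination R id
  have hg : Function.Surjective g := Finsupp.linearCombination_id_surjective R M
  exact ⟨g.shortComplexKer, LinearMap.shortExact_shortComplexKer hg, M, rfl, rfl⟩

variable {τ} in
/-- If `M` has flat dimension at most `i + 1` and `Ext^{i+1}` from `M` to flat modules vanishes,
then `M` has flat dimension at most `i`. -/
lemma IsColExact.of_subsingleton_ext [IsNoetherianRing S] (i : ℕ) (M : ModuleCat.{u} R)
    (hM : IsColExact τ (i + 1) M)
    (h : ∀ Z : ModuleCat.{u} R, IsColExact τ 0 Z → Subsingleton (Ext.{u} M Z (i + 1))) :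
    IsColExact τ i M := by
  induction i generalizing M with
  | zero =>
    obtain ⟨T, hT, X, hX, rfl⟩ := exists_shortExact_finsupp M
    have hfg := (ShortComplex.ShortExact.moduleCat_exact_iff_function_exact _).1 hT.exact
    have hX0 : IsColExact τ 0 T.X₂ := by
      rw [hX]
      exact isColExact_finsupp τ X
    have hX' : Projective T.X₂ := by
      rw [hX]
      exact (IsProjective.iff_projective (ModuleCat.of R (X →₀ R))).1 inferInstance
    have h1 : IsColExact τ 0 T.X₁ := IsColExact.syzygy (f := T.f.hom) (g := T.g.hom)
      hT.moduleCat_injective_f hT.moduleCat_surjective_g hfg hX0 hM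
    -- The first syzygy `T.X₁` is flat, so that the presentation of `M` splits and `M` is a direct
    -- summand of a free module.
    obtain ⟨ρ, hρ⟩ := (subsingleton_ext_one_iff hT T.X₁).1 (h _ h1) (𝟙 _)
    have := hT.epi_g
    let σ := ShortComplex.Splitting.ofExactOfRetraction T hT.exact ρ hρ hT.epi_g
    intro r q p a b hab
    exact (hX0 a b hab).of_retract σ.s.hom T.g.hom fun z ↦ congr($(σ.s_g) z)
  | succ i ih =>
    obtain ⟨T, hT, X, hX, rfl⟩ := exists_shortExact_finsupp M
    have hfg := (ShortComplex.ShortExact.moduleCat_exact_iff_function_exact _).1 hT.exact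
    have hX0 : IsColExact τ 0 T.X₂ := by
      rw [hX]
      exact isColExact_finsupp τ X
    have hX' : Projective T.X₂ := by
      rw [hX]
      exact (IsProjective.iff_projective (ModuleCat.of R (X →₀ R))).1 inferInstance
    have h1 : IsColExact τ (i + 1) T.X₁ := IsColExact.syzygy (f := T.f.hom) (g := T.g.hom)
      hT.moduleCat_injective_f hT.moduleCat_surjective_g hfg hX0 hM
    intro r q p a b hab
    exact IsColExact.cosyzygy (f := T.f.hom) (g := T.g.hom)
      hT.moduleCat_injective_f hT.moduleCat_surjective_g hfg hX0
      (ih T.X₁ h1 fun Z hZ ↦ (subsingleton_ext_add_two_iff hT Z i).1 (h Z hZ)) a b hab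

/-- Flat modules over a noetherian ring have at most the injective dimension of the ring. -/
lemma IsColExact.hasInjectiveDimensionLT [IsNoetherianRing R] {n : ℕ}
    (hR : HasInjectiveDimensionLT (ModuleCat.of R R) (n + 1)) (Z : ModuleCat.{u} R)
    (hZ : IsColExact τ 0 Z) : HasInjectiveDimensionLT Z (n + 1) :=
  hasInjectiveDimensionLT_of_rowChain fun {_ _ _ a b} h ↦
    hZ a b ((rowExact_opMat_iff τ).2 ⟨h.rowExact.mul_eq_zero, colExact_of_rowChain hR h⟩)

/-- If a two-sided noetherian ring has finite injective dimension on both sides, then the two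
dimensions agree (Zaks). By descending induction on a bound `m + 1 > n` for the dimension of `S`:
injective `R`-modules have flat dimension at most `m + 1` by the bound for `S`, hence at most `m`,
since flat `R`-modules have injective dimension at most `n`. As injective modules detect exactness,
this improves the bound for `S` to `m`. -/
theorem hasInjectiveDimensionLT_op (τ : R ≃+* Sᵐᵒᵖ) [IsNoetherianRing R] [IsNoetherianRing S]
    {n m : ℕ}
    (hR : HasInjectiveDimensionLT (ModuleCat.of R R) (n + 1))
    (hS : HasInjectiveDimensionLT (ModuleCat.of S S) (m + 1)) :
    HasInjectiveDimensionLT (ModuleCat.of S S) (n + 1) := by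
  induction m with
  | zero => exact hasInjectiveDimensionLT_of_ge _ 1 (n + 1) (by lia)
  | succ m ih =>
    rcases lt_or_ge m n with hmn | hmn
    · exact hasInjectiveDimensionLT_of_ge _ (m + 1 + 1) (n + 1) (by lia)
    · refine ih (hasInjectiveDimensionLT_of_rowChain fun {r q p c d} h ↦ ?_)
      obtain ⟨b, rfl⟩ := opMat_surjective τ c
      obtain ⟨a, rfl⟩ := opMat_surjective τ d
      have hab : a * b = 0 := ((rowExact_opMat_iff τ).1 h.rowExact).1
      refine ((rowExact_iff τ).1 (rowExact_of_forall_injective hab fun I hI ↦ ?_)).2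
      refine IsColExact.of_subsingleton_ext m I ?_ ?_ a b h
      -- Flat dimension at most `m + 1`. The matrices here shadow those of the goal.
      · intro r q p a b h
        have h1 : RowExact a b := (rowExact_iff τ).2
          ⟨((rowExact_opMat_iff τ).1 h.rowExact).1, colExact_of_rowChain hS h⟩
        exact h1.colExact_of_injective I
      · intro Z hZ
        have := hZ.hasInjectiveDimensionLT τ hR
        exact HasInjectiveDimensionLT.subsingleton Z (n + 1) (m + 1) (by lia) I

end Zaks

/-! ### The smash product as a smash extension -/

section SmashProduct

variable {k A H : Type u} [Field k] [Ring H] [HopfAlgebra k H] [Ring A] [Algebra k A]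

variable (k A H) in
/-- The identity map from `A ⊗ H` to `A ♯ H`. -/
def smashOf : A ⊗[k] H →ₗ[k] SmashProduct k A H :=
  (LinearMap.id : A ⊗[k] H →ₗ[k] A ⊗[k] H)

variable (k A H) in
/-- The map `a ⊗ (g ⊗ h) ↦ (a ⊗ g) ⊗ h` from `A ⊗ (H ⊗ H)` to `(A ♯ H) ⊗ H`. -/
def smashAssoc : A ⊗[k] (H ⊗[k] H) →ₗ[k] SmashProduct k A H ⊗[k] H :=
  LinearMap.rTensor H (smashOf k A H) ∘ₗ (TensorProduct.assoc k A H H).symm.toLinearMap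

@[simp] lemma smashAssoc_tmul (a : A) (g h : H) :
    smashAssoc k A H (a ⊗ₜ (g ⊗ₜ h)) = smashOf k A H (a ⊗ₜ g) ⊗ₜ h := by
  simp [smashAssoc]

variable [Module H A] [IsScalarTower k H A]

/-- `H` acts on `1 : A` through the counit. -/
lemma smashT_one_tmul_one [IsModuleAlgebra k H A] (h : H) :
    smashT k A H h ((1 : A) ⊗ₜ[k] (1 : H)) = 1 ⊗ₜ h := by
  have key : ∀ t : H ⊗[k] H,
      TensorProduct.map (orbitMap k (1 : A)) (LinearMap.mulRight k 1) t =
        (1 : A) ⊗ₜ TensorProduct.lid k H (LinearMap.rTensor H counit t) := by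
    intro t
    induction t using TensorProduct.induction_on with
    | zero => simp
    | tmul x y =>
      simp [IsModuleAlgebra.smul_one' (k := k), Algebra.algebraMap_eq_smul_one,
        TensorProduct.smul_tmul]
    | add x y hx hy => simp only [map_add, TensorProduct.tmul_add, hx, hy]
  rw [smashT_tmul, key, rTensor_counit_comul]
  simp

/-- An algebra homomorphism on `A ♯ H`, from a linear map on `A ⊗ H` that is compatible with left
multiplication by `A` and by `H`. -/
def smashLift [IsModuleAlgebra k H A] {B : Type u} [Ring B] [Algebra k B] (f : A ⊗[k] H →ₗ[k] B)
    (hone : f (1 ⊗ₜ 1) = 1)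
    (hL : ∀ (a b : A) (h : H), f (smashL k A H a (b ⊗ₜ h)) = f (a ⊗ₜ 1) * f (b ⊗ₜ h))
    (hT : ∀ (g : H) (b : A) (h : H), f (smashT k A H g (b ⊗ₜ h)) = f (1 ⊗ₜ g) * f (b ⊗ₜ h)) :
    SmashProduct k A H →ₐ[k] B :=
  AlgHom.ofLinearMap (A := SmashProduct k A H) f hone (by
    have hL' : ∀ (a : A) (y : A ⊗[k] H), f (smashL k A H a y) = f (a ⊗ₜ 1) * f y := by
      intro a y
      induction y using TensorProduct.induction_on with
      | zero => simp
      | tmul b h => exact hL a b h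
      | add x y hx hy => simp only [map_add, mul_add, hx, hy]
    have hT' : ∀ (g : H) (y : A ⊗[k] H), f (smashT k A H g y) = f (1 ⊗ₜ g) * f y := by
      intro a y
      induction y using TensorProduct.induction_on with
      | zero => simp
      | tmul b h => exact hT a b h
      | add x y hx hy => simp only [map_add, mul_add, hx, hy]
    have key : ∀ x y : A ⊗[k] H, f (smashMul k A H x y) = f x * f y := by
      intro x y
      induction x using TensorProduct.induction_on with
      | zero => simp
      | add x y hx hy => simp only [map_add, LinearMap.add_apply, add_mul, hx, hy]
      | tmul a h =>
        have h1 : (a ⊗ₜ[k] h : A ⊗[k] H) = smashL k A H a (1 ⊗ₜ h) := by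
          rw [smashL_tmul, mul_one]
        rw [smashMul_tmul, Module.End.mul_apply, hL', hT', h1, hL', mul_assoc]
    exact key)

variable (k A H) in
/-- The inclusion `a ↦ a ⊗ 1` of `A` in `A ♯ H`. -/
def smashInclLeft [IsModuleAlgebra k H A] : A →ₐ[k] SmashProduct k A H :=
  AlgHom.ofLinearMap (B := SmashProduct k A H) ((TensorProduct.mk k A H).flip 1) rfl
    (fun a b ↦ by
      change (a * b) ⊗ₜ[k] (1 : H) = smashMul k A H (a ⊗ₜ 1) (b ⊗ₜ 1)
      rw [smashMul_tmul, map_one, mul_one, smashL_tmul])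

variable (k A H) in
/-- The inclusion `h ↦ 1 ⊗ h` of `H` in `A ♯ H`. -/
def smashInclRight [IsModuleAlgebra k H A] : H →ₐ[k] SmashProduct k A H :=
  AlgHom.ofLinearMap (B := SmashProduct k A H) (TensorProduct.mk k A H 1) rfl
    (fun g h ↦ by
      change (1 : A) ⊗ₜ[k] (g * h) = smashMul k A H (1 ⊗ₜ g) (1 ⊗ₜ h)
      rw [← smashT_one_tmul_one, ← smashT_one_tmul_one (A := A) h, smashMul_tmul, map_one, map_mul,
        one_mul, Module.End.mul_apply])

/-- The projection `a ⊗ h ↦ ε(a) h` of `A ♯ H` onto `H`. -/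
def smashProj [IsModuleAlgebra k H A] (ε : A →ₐ[k] k)
    (hε : ∀ (h : H) (a : A), ε a = 0 → ε (h • a) = 0) : SmashProduct k A H →ₐ[k] H :=
  smashLift (TensorProduct.lid k H ∘ₗ LinearMap.rTensor H ε.toLinearMap) (by simp)
    (fun a b h ↦ by simp [mul_smul, smul_comm (ε a) (ε b)])
    (fun g b h ↦ by
      have key : ∀ t : H ⊗[k] H, TensorProduct.lid k H (LinearMap.rTensor H ε.toLinearMap
          (TensorProduct.map (orbitMap k b) (LinearMap.mulRight k h) t)) =
            ε b • (TensorProduct.lid k H (LinearMap.rTensor H counit t) * h) := by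
        intro t
        induction t using TensorProduct.induction_on with
        | zero => simp
        | tmul x y => simp [augmentation_smul ε hε, mul_smul, smul_comm (ε b)]
        | add x y hx hy => simp only [map_add, add_mul, smul_add, hx, hy]
      simp only [LinearMap.comp_apply, LinearEquiv.coe_coe]
      rw [smashT_tmul, key, rTensor_counit_comul]
      simp)

lemma smashOf_mul [IsModuleAlgebra k H A] (a b : A) (g h : H) :
    smashOf k A H (a ⊗ₜ g) * smashOf k A H (b ⊗ₜ h) =
      smashOf k A H (smashL k A H a (smashT k A H g (b ⊗ₜ h))) :=
  congr($(smashMul_tmul a g) (b ⊗ₜ h))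

variable (k A H) in
/-- The coaction `a ⊗ h ↦ (a ⊗ h₁) ⊗ h₂` of `H` on `A ♯ H`. -/
def smashCoaction [IsModuleAlgebra k H A] :
    SmashProduct k A H →ₐ[k] SmashProduct k A H ⊗[k] H :=
  smashLift (smashAssoc k A H ∘ₗ LinearMap.lTensor A comul)
    (by
      rw [LinearMap.comp_apply, LinearMap.lTensor_tmul, Bialgebra.comul_one]
      rfl)
    (fun a b h ↦ by
      rw [smashL_tmul, LinearMap.comp_apply, LinearMap.comp_apply, LinearMap.comp_apply,
        LinearMap.lTensor_tmul, LinearMap.lTensor_tmul, LinearMap.lTensor_tmul,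
        Bialgebra.comul_one, Algebra.TensorProduct.one_def, smashAssoc_tmul]
      induction comul (R := k) h using TensorProduct.induction_on with
      | zero => simp
      | add x y hx hy => simp only [map_add, TensorProduct.tmul_add, mul_add, hx, hy]
      | tmul x y => simp [smashOf_mul])
    (fun g b h ↦ by
      let F : H ⊗[k] H → H ⊗[k] (H ⊗[k] H) →ₗ[k] SmashProduct k A H ⊗[k] H := fun u ↦
        smashAssoc k A H ∘ₗ TensorProduct.map (orbitMap k b) (LinearMap.mulRight k u)
      have h1 : ∀ t : H ⊗[k] H, smashAssoc k A H (LinearMap.lTensor A comul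
          (TensorProduct.map (orbitMap k b) (LinearMap.mulRight k h) t)) =
            F (comul h) (LinearMap.lTensor H comul t) := by
        intro t
        induction t using TensorProduct.induction_on with
        | zero => simp
        | add x y hx hy => simp only [map_add, hx, hy]
        | tmul x y => simp [F]
      have h2 : ∀ t u : H ⊗[k] H, F u (TensorProduct.assoc k H H H (LinearMap.rTensor H comul t)) =
          smashAssoc k A H (1 ⊗ₜ t) * smashAssoc k A H (b ⊗ₜ u) := by
        intro t u
        induction t using TensorProduct.induction_on with
        | zero => simp
        | add x y hx hy => simp only [map_add, TensorProduct.tmul_add, add_mul, hx, hy]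
        | tmul x y =>
          induction u using TensorProduct.induction_on with
          | zero => simp [F]
          | add u v hu hv =>
            have h3 : F (u + v) = F u + F v := by
              refine TensorProduct.ext' fun z w ↦ ?_
              simp [F, mul_add, TensorProduct.tmul_add]
            simp only [map_add, TensorProduct.tmul_add, mul_add, hu, hv, h3, LinearMap.add_apply]
          | tmul u v =>
            rw [smashAssoc_tmul, smashAssoc_tmul, Algebra.TensorProduct.tmul_mul_tmul, smashOf_mul,
              map_one, Module.End.one_apply, smashT_tmul, LinearMap.rTensor_tmul]
            induction comul (R := k) x using TensorProduct.induction_on with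
            | zero => simp
            | add x y hx hy => simp only [map_add, TensorProduct.add_tmul, hx, hy]
            | tmul z w => simp [F]
      rw [LinearMap.comp_apply, LinearMap.comp_apply, LinearMap.comp_apply,
        LinearMap.lTensor_tmul, LinearMap.lTensor_tmul, smashT_tmul, h1, ← coassoc_apply, h2])

/-- The smash product is a smash extension. The multiplication map `H ⊗ A → A ♯ H` is the twist
`h ⊗ a ↦ h₁ a ⊗ h₂`, which is bijective because the antipode is. -/
def SmashExtension.ofSmashProduct [IsModuleAlgebra k H A] (ε : A →ₐ[k] k)
    (hε : ∀ (h : H) (a : A), ε a = 0 → ε (h • a) = 0)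
    (hS : Function.Bijective (antipode k : H →ₗ[k] H)) :
    SmashExtension k A H (SmashProduct k A H) where
  iA := smashInclLeft k A H
  iH := smashInclRight k A H
  ε := ε
  π := smashProj ε hε
  ρ := smashCoaction k A H
  π_iA a := by
    change TensorProduct.lid k H (LinearMap.rTensor H ε.toLinearMap (a ⊗ₜ 1)) = _
    simp [Algebra.algebraMap_eq_smul_one]
  π_iH h := by
    change TensorProduct.lid k H (LinearMap.rTensor H ε.toLinearMap (1 ⊗ₜ h)) = _
    simp
  ρ_iA a := by
    change smashAssoc k A H (LinearMap.lTensor A comul (a ⊗ₜ 1)) = _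
    rw [LinearMap.lTensor_tmul, Bialgebra.comul_one]
    rfl
  ρ_iH h := by
    change smashAssoc k A H (LinearMap.lTensor A comul (1 ⊗ₜ h)) =
      TensorProduct.map (smashOf k A H ∘ₗ TensorProduct.mk k A H 1) LinearMap.id (comul h)
    rw [LinearMap.lTensor_tmul]
    induction comul (R := k) h using TensorProduct.induction_on with
    | zero => simp
    | add x y hx hy => simp only [map_add, TensorProduct.tmul_add, hx, hy]
    | tmul x y => simp
  bijective_mul := by
    have h1 : LinearMap.mul' k (SmashProduct k A H) ∘ₗ TensorProduct.map
        (smashInclLeft k A H).toLinearMap (smashInclRight k A H).toLinearMap = smashOf k A H := by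
      refine TensorProduct.ext' fun a h ↦ ?_
      change smashMul k A H (a ⊗ₜ 1) (1 ⊗ₜ h) = a ⊗ₜ h
      rw [smashMul_tmul, map_one, mul_one, smashL_tmul, mul_one]
    rw [h1]
    exact Function.bijective_id
  bijective_mul' := by
    have h1 : LinearMap.mul' k (SmashProduct k A H) ∘ₗ TensorProduct.map
        (smashInclRight k A H).toLinearMap (smashInclLeft k A H).toLinearMap =
          smashOf k A H ∘ₗ twist (Algebra.lsmul k k A : H →ₐ[k] Module.End k A) := by
      refine TensorProduct.ext' fun h a ↦ ?_
      change smashMul k A H (1 ⊗ₜ h) (a ⊗ₜ 1) = twist _ (h ⊗ₜ a)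
      rw [smashMul_tmul, map_one, one_mul, smashT_tmul, twist_tmul, LinearMap.mulRight_one]
      rfl
    rw [h1]
    exact twist_bijective hS _
  bijective_antipode := hS

/-- The augmentation of `A ♯ H` factors through the projection onto `H`. -/
lemma counit_comp_smashProj [IsModuleAlgebra k H A] (ε : A →ₐ[k] k)
    (hε : ∀ (h : H) (a : A), ε a = 0 → ε (h • a) = 0) :
    (Bialgebra.counitAlgHom k H).comp (smashProj ε hε) = smashAugmentation ε hε := by
  refine AlgHom.ext fun x ↦ ?_
  change counit (R := k) (TensorProduct.lid k H (LinearMap.rTensor H ε.toLinearMap x)) =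
    smashCounit H ε x
  induction x using TensorProduct.induction_on with
  | zero => simp
  | tmul a h => simp [smashCounit_tmul]
  | add x y hx hy => simp only [map_add, hx, hy]

end SmashProduct

/-! ### The opposite of a smash extension -/

section Opposite

variable {k A H Λ : Type u} [Field k] [Ring A] [Algebra k A] [Ring H] [HopfAlgebra k H]
  [Ring Λ] [Algebra k Λ]

variable (k H) in
/-- The antipode as an algebra homomorphism `H → Hᵐᵒᵖ`. -/
def antipodeOp : Cop H →ₐ[k] Hᵐᵒᵖ :=
  AlgHom.ofLinearMap
    ((MulOpposite.opLinearEquiv k).toLinearMap ∘ₗ (antipode k : H →ₗ[k] H))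
    (by
      change MulOpposite.op (antipode k (1 : H)) = 1
      rw [antipode_one, MulOpposite.op_one])
    (fun g h ↦ congrArg MulOpposite.op (antipode_mul_antidistrib (R := k) (A := H) g h))

/-- The inverse of the antipode as an algebra homomorphism `Hᵐᵒᵖ → H`. -/
def antipodeSymmOp (hS : Function.Bijective (antipode k : H →ₗ[k] H)) : Hᵐᵒᵖ →ₐ[k] Cop H :=
  AlgHom.ofLinearMap (B := Cop H)
    ((antipodeEquiv H hS).symm.toLinearMap ∘ₗ (MulOpposite.opLinearEquiv k).symm.toLinearMap)
    (antipodeEquiv_symm_one hS)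
    (fun g h ↦ antipodeEquiv_symm_mul hS h.unop g.unop)

/-- The opposite of a smash extension of `A` by `H` is a smash extension of the opposite of `A` by
the co-opposite of `H`, where `H` is mapped to the opposite of `Λ` by means of the antipode. -/
def SmashExtension.op (D : SmashExtension k A H Λ) :
    letI := copHopfAlgebra D.bijective_antipode
    SmashExtension k Aᵐᵒᵖ (Cop H) Λᵐᵒᵖ :=
  letI := copHopfAlgebra D.bijective_antipode
  { iA := AlgHom.op D.iA
    iH := (AlgHom.op D.iH).comp (antipodeOp k H)
    ε := opAugmentation D.ε
    π := (antipodeSymmOp D.bijective_antipode).comp (AlgHom.op D.π)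
    ρ := (Algebra.TensorProduct.map (AlgHom.id k Λᵐᵒᵖ)
      (antipodeSymmOp D.bijective_antipode)).comp
        ((Algebra.TensorProduct.opAlgEquiv k k Λ H).symm.toAlgHom.comp (AlgHom.op D.ρ))
    π_iA := fun a ↦ by
      change (antipodeEquiv H D.bijective_antipode).symm (D.π (D.iA a.unop)) = _
      rw [D.π_iA, antipodeEquiv_symm_algebraMap]
      rfl
    π_iH := fun (h : H) ↦ by
      change (antipodeEquiv H D.bijective_antipode).symm (D.π (D.iH (antipode k h))) = h
      rw [D.π_iH, antipodeEquiv_symm_antipode]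
    ρ_iA := fun a ↦ by
      change Algebra.TensorProduct.map (AlgHom.id k Λᵐᵒᵖ) (antipodeSymmOp D.bijective_antipode)
        ((Algebra.TensorProduct.opAlgEquiv k k Λ H).symm
          (MulOpposite.op (D.ρ (D.iA a.unop)))) = _
      rw [D.ρ_iA, Algebra.TensorProduct.opAlgEquiv_symm_tmul, Algebra.TensorProduct.map_tmul,
        MulOpposite.op_one, map_one]
      rfl
    ρ_iH := fun (h : H) ↦ by
      change Algebra.TensorProduct.map (AlgHom.id k Λᵐᵒᵖ) (antipodeSymmOp D.bijective_antipode)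
        ((Algebra.TensorProduct.opAlgEquiv k k Λ H).symm
          (MulOpposite.op (D.ρ (D.iH (antipode k h))))) = _
      rw [D.ρ_iH, comul_antipode]
      let G : H ⊗[k] H →ₗ[k] Λᵐᵒᵖ ⊗[k] Cop H :=
        TensorProduct.map ((AlgHom.op D.iH).comp (antipodeOp k H)).toLinearMap
          (LinearMap.id : Cop H →ₗ[k] Cop H)
      change _ = G (TensorProduct.comm k H H (comul h))
      induction comul (R := k) h using TensorProduct.induction_on with
      | zero => simp
      | add x y hx hy => simp only [map_add, MulOpposite.op_add, hx, hy]
      | tmul x y =>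
        change Algebra.TensorProduct.map (AlgHom.id k Λᵐᵒᵖ) (antipodeSymmOp D.bijective_antipode)
          ((Algebra.TensorProduct.opAlgEquiv k k Λ H).symm
            (MulOpposite.op (D.iH (antipode k y) ⊗ₜ antipode k x))) =
          (MulOpposite.op (D.iH (antipode k y))) ⊗ₜ[k] (x : Cop H)
        rw [Algebra.TensorProduct.opAlgEquiv_symm_tmul, Algebra.TensorProduct.map_tmul]
        exact congrArg (_ ⊗ₜ[k] ·) (antipodeEquiv_symm_antipode D.bijective_antipode x)
    bijective_mul := by
      let e : Aᵐᵒᵖ ⊗[k] Cop H ≃ₗ[k] H ⊗[k] A :=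
        (TensorProduct.comm k _ _).trans (TensorProduct.congr
          (antipodeEquiv H D.bijective_antipode : Cop H ≃ₗ[k] H)
          (MulOpposite.opLinearEquiv k).symm)
      convert (MulOpposite.opLinearEquiv k (M := Λ)).bijective.comp
        (D.bijective_mul'.comp e.bijective) using 1
      rw [← LinearEquiv.coe_coe, ← LinearEquiv.coe_coe, ← LinearMap.coe_comp, ← LinearMap.coe_comp]
      exact congrArg DFunLike.coe (TensorProduct.ext' fun a h ↦ rfl)
    bijective_mul' := by
      let e : Cop H ⊗[k] Aᵐᵒᵖ ≃ₗ[k] A ⊗[k] H :=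
        (TensorProduct.comm k _ _).trans (TensorProduct.congr
          (MulOpposite.opLinearEquiv k).symm
          (antipodeEquiv H D.bijective_antipode : Cop H ≃ₗ[k] H))
      convert (MulOpposite.opLinearEquiv k (M := Λ)).bijective.comp
        (D.bijective_mul.comp e.bijective) using 1
      rw [← LinearEquiv.coe_coe, ← LinearEquiv.coe_coe, ← LinearMap.coe_comp, ← LinearMap.coe_comp]
      exact congrArg DFunLike.coe (TensorProduct.ext' fun h a ↦ rfl)
    bijective_antipode := (antipodeEquiv H D.bijective_antipode).symm.bijective }

/-- The augmentation of the opposite of a smash extension. -/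
lemma SmashExtension.counit_comp_op_π (D : SmashExtension k A H Λ) :
    letI := copHopfAlgebra D.bijective_antipode
    (Bialgebra.counitAlgHom k (Cop H)).comp D.op.π =
      opAugmentation ((Bialgebra.counitAlgHom k H).comp D.π) := by
  refine AlgHom.ext fun x ↦ ?_
  change counit (R := k) ((antipodeEquiv H D.bijective_antipode).symm (D.π x.unop)) =
    counit (R := k) (D.π x.unop)
  conv_rhs => rw [← antipode_antipodeEquiv_symm D.bijective_antipode (D.π x.unop), counit_antipode]

end Opposite

/-! ### Consequences for smash products -/

section SelfInjDim

variable {k B : Type u} [Field k] [Ring B] [Algebra k B] {ε : B →ₐ[k] k} {n : ℕ}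

lemma leftSelfInjDim_le_iff (m : ℕ) :
    leftSelfInjDim B ≤ m ↔ HasInjectiveDimensionLT (ModuleCat.of B B) (m + 1) :=
  injectiveDimension_le_iff _ _

lemma rightSelfInjDim_le_iff (m : ℕ) :
    rightSelfInjDim B ≤ m ↔ HasInjectiveDimensionLT (ModuleCat.of Bᵐᵒᵖ Bᵐᵒᵖ) (m + 1) :=
  injectiveDimension_le_iff _ _

/-- `Ext^n (k, B)` does not vanish. -/
lemma LeftASCondition.le_leftSelfInjDim (h : LeftASCondition k B ε n) :
    (n : WithBot ℕ∞) ≤ leftSelfInjDim B := by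
  by_contra! hn
  have : HasInjectiveDimensionLT (ModuleCat.of B B) n := injectiveDimension_lt_iff.1 hn
  have h1 := HasInjectiveDimensionLT.subsingleton (ModuleCat.of B B) n n le_rfl (trivialModule ε)
  have h2 := h n
  rw [if_pos rfl, rank_subsingleton' k] at h2
  exact zero_ne_one h2

/-- The Artin-Schelter condition bounds the injective dimensions from below, so that neither of them
is `⊥`, and a finite upper bound makes them natural numbers. -/
lemma ASCondition.hasFiniteSelfInjDims (h : ASCondition k B ε n) {l r : ℕ}
    (hl : leftSelfInjDim B ≤ l) (hr : rightSelfInjDim B ≤ r) : HasFiniteSelfInjDims B := by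
  have key : ∀ (x : WithBot ℕ∞) (m : ℕ), (n : WithBot ℕ∞) ≤ x → x ≤ m → ∃ m : ℕ, x = m := by
    intro x m h1 h2
    induction x with
    | bot => simp at h1
    | coe x =>
      induction x with
      | top => exact absurd (top_le_iff.1 (WithBot.coe_le_coe.1 h2)) (ENat.natCast_ne_top m)
      | coe x => exact ⟨x, rfl⟩
  exact ⟨key _ l h.1.le_leftSelfInjDim hl,
    key _ r (LeftASCondition.le_leftSelfInjDim h.2) hr⟩

/-- The two injective dimensions of a two-sided noetherian ring agree if both are finite. -/
lemma HasFiniteSelfInjDims.exists_hasSelfInjDim (h : HasFiniteSelfInjDims B)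
    (hB : IsTwoSidedNoetherian B) : ∃ m, HasSelfInjDim B m := by
  obtain ⟨⟨l, hl⟩, ⟨r, hr⟩⟩ := h
  have := hB.1
  have := hB.2
  have hl' := (leftSelfInjDim_le_iff l).1 hl.le
  have hr' := (rightSelfInjDim_le_iff r).1 hr.le
  have h1 := (rightSelfInjDim_le_iff l).2 (hasInjectiveDimensionLT_op (RingEquiv.opOp B) hl' hr')
  have h2 := (leftSelfInjDim_le_iff r).2
    (hasInjectiveDimensionLT_op (RingEquiv.refl Bᵐᵒᵖ) hr' hl')
  exact ⟨l, hl, le_antisymm h1 (hr ▸ hl ▸ h2)⟩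

end SelfInjDim

section General

variable {k A H : Type u} [Field k] [Ring H] [HopfAlgebra k H] [Ring A] [Algebra k A]

/-- Over a noetherian ring the finitely generated module `k` has a resolution by finitely generated
projectives. -/
lemma isFP_trivialModule_of_isNoetherianRing [IsNoetherianRing A] (ε : A →ₐ[k] k) (m : ℕ) :
    IsFP m (trivialModule ε) := by
  have : Module.Finite A (trivialModule ε) := by
    refine Module.Finite.of_surjective (LinearMap.toSpanSingleton A (trivialModule ε) (1 : k))
      fun (c : k) ↦ ⟨algebraMap k A c, ?_⟩
    change ε (algebraMap k A c) * 1 = c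
    rw [AlgHom.commutes, mul_one]
    rfl
  exact isFP_of_isNoetherianRing m _

variable (k H) in
/-- The properties of a Hopf algebra `H` that enter the theorem: the antipode is bijective, `H`
satisfies the left Artin-Schelter condition, and the trivial module has finite projective dimension
and is of type `FP_∞`. -/
structure IsLeftASHopf (d : ℕ) : Prop where
  bijective_antipode : Function.Bijective (antipode k : H →ₗ[k] H)
  isFP : ∀ m, IsFP m (trivialModule (Bialgebra.counitAlgHom k H))
  leftASCondition : LeftASCondition k H (Bialgebra.counitAlgHom k H) d
  hasProjectiveDimensionLT :
    HasProjectiveDimensionLT (trivialModule (Bialgebra.counitAlgHom k H)) (d + 1)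

lemma LeftASCondition.subsingleton {B : Type u} [Ring B] [Algebra k B] {ε : B →ₐ[k] k} {n i : ℕ}
    (h : LeftASCondition k B ε n) (hi : i ≠ n) :
    Subsingleton (Ext.{u} (trivialModule ε) (ModuleCat.of B B) i) := by
  have h1 := h i
  rw [if_neg hi] at h1
  exact rank_zero_iff.1 h1

/-- A finite projective dimension of the trivial module is automatically `d`, the largest degree in
which `Ext_H (k, H)` does not vanish. -/
lemma IsLeftASHopf.mk' {d p : ℕ} (hS : Function.Bijective (antipode k : H →ₗ[k] H))
    (hFP : ∀ m, IsFP m (trivialModule (Bialgebra.counitAlgHom k H)))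
    (hH : LeftASCondition k H (Bialgebra.counitAlgHom k H) d)
    (hp : HasProjectiveDimensionLT (trivialModule (Bialgebra.counitAlgHom k H)) p) :
    IsLeftASHopf k H d :=
  ⟨hS, hFP, hH, hasProjectiveDimensionLT_of_forall_subsingleton_ext _ p d hFP hp
    fun _ hi ↦ hH.subsingleton hi.ne'⟩

lemma HasVanDenBerghDuality.isLeftASHopf {d : ℕ} (hV : HasVanDenBerghDuality k H d) :
    IsLeftASHopf k H d :=
  have ⟨_, hp⟩ := hV.exists_hasProjectiveDimensionLT
  .mk' hV.bijective_antipode hV.isFP hV.leftASCondition hp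

lemma IsASRegular.isLeftASHopf {d : ℕ} (hH : IsASRegular k H (Bialgebra.counitAlgHom k H) d)
    (hS : Function.Bijective (antipode k : H →ₗ[k] H))
    (hFG : HasFGProjectiveResolution (trivialModule (Bialgebra.counitAlgHom k H))) :
    IsLeftASHopf k H d := by
  obtain ⟨P, hP⟩ := hFG
  obtain ⟨N, hN⟩ := hH.glDim.1
  exact .mk' hS (isFP_of_projectiveResolution P hP) hH.asCondition.1 (hN _)

/-- All properties concern the left modules and the counit of `H`, which `Cop H` shares, or the
antipode, which is replaced by its inverse. -/
lemma IsLeftASHopf.cop {d : ℕ} (h : IsLeftASHopf k H d) :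
    letI := copHopfAlgebra h.bijective_antipode
    IsLeftASHopf k (Cop H) d :=
  letI := copHopfAlgebra h.bijective_antipode
  ⟨(antipodeEquiv H h.bijective_antipode).symm.bijective, h.isFP, h.leftASCondition,
    h.hasProjectiveDimensionLT⟩

variable {Λ : Type u} [Ring Λ] [Algebra k Λ]

/-- The Artin-Schelter condition on the right is that on the left for the opposite smash extension.
-/
lemma SmashExtension.asCondition (D : SmashExtension k A H Λ) {n d : ℕ}
    (hnoeth : IsTwoSidedNoetherian A) (hA : ASCondition k A D.ε n) (hH : IsLeftASHopf k H d) :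
    ASCondition k Λ ((Bialgebra.counitAlgHom k H).comp D.π) (n + d) := by
  have := hnoeth.1
  have := hnoeth.2
  let := copHopfAlgebra hH.bijective_antipode
  refine ⟨D.leftASCondition (isFP_trivialModule_of_isNoetherianRing _) hA.1 hH.isFP
    hH.leftASCondition, ?_⟩
  rw [← D.counit_comp_op_π]
  exact D.op.leftASCondition (isFP_trivialModule_of_isNoetherianRing _) hA.2 hH.cop.isFP
    hH.cop.leftASCondition

/-- The upper bounds for both injective dimensions. -/
lemma SmashExtension.selfInjDim_le (D : SmashExtension k A H Λ) {m d : ℕ}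
    (hnoeth : IsTwoSidedNoetherian A) (hA : HasSelfInjDim A m) (hH : IsLeftASHopf k H d) :
    leftSelfInjDim Λ ≤ (m + d : ℕ) ∧ rightSelfInjDim Λ ≤ (m + d : ℕ) := by
  have := hnoeth.1
  have := hnoeth.2
  let := copHopfAlgebra hH.bijective_antipode
  exact ⟨(leftSelfInjDim_le_iff _).2 (D.hasInjectiveDimensionLT_self m d
      ((leftSelfInjDim_le_iff m).1 hA.1.le) hH.isFP hH.hasProjectiveDimensionLT),
    (rightSelfInjDim_le_iff _).2 (D.op.hasInjectiveDimensionLT_self m d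
      ((rightSelfInjDim_le_iff m).1 hA.2.le) hH.cop.isFP hH.cop.hasProjectiveDimensionLT)⟩

lemma SmashExtension.hasFiniteGlobalDimension (D : SmashExtension k A H Λ) {d : ℕ}
    (hA : HasFiniteGlobalDimension A) (hH : IsLeftASHopf k H d) :
    HasFiniteGlobalDimension Λ := by
  obtain ⟨⟨l, hl⟩, ⟨r, hr⟩⟩ := hA
  let := copHopfAlgebra hH.bijective_antipode
  have h1 := D.hasProjectiveDimensionLT (l + 1) d hl hH.isFP hH.hasProjectiveDimensionLT
  have h2 := D.op.hasProjectiveDimensionLT (r + 1) d hr hH.cop.isFP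
    hH.cop.hasProjectiveDimensionLT
  exact ⟨⟨l + d, fun M ↦ by have := h1 M; rwa [add_right_comm] at this⟩,
    ⟨r + d, fun M ↦ by have := h2 M; rwa [add_right_comm] at this⟩⟩

/-- The lower bound `n` for the injective dimensions is attained. -/
lemma ASCondition.hasSelfInjDim {B : Type u} [Ring B] [Algebra k B] {ε : B →ₐ[k] k} {n : ℕ}
    (h : ASCondition k B ε n) (hB : leftSelfInjDim B ≤ n ∧ rightSelfInjDim B ≤ n) :
    HasSelfInjDim B n :=
  ⟨le_antisymm hB.1 h.1.le_leftSelfInjDim,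
    le_antisymm hB.2 (LeftASCondition.le_leftSelfInjDim h.2)⟩

/-- The homological properties of `Λ = A ♯ H`, for noetherian `A`. -/
theorem SmashExtension.asGorenstein (D : SmashExtension k A H Λ) {n d : ℕ}
    (hnoeth : IsTwoSidedNoetherian A) (hA : IsASGorenstein k A D.ε n) (hH : IsLeftASHopf k H d) :
    ASCondition k Λ ((Bialgebra.counitAlgHom k H).comp D.π) (n + d) ∧
    HasFiniteSelfInjDims Λ ∧
    ((HasSelfInjDim A n ∨ IsTwoSidedNoetherian Λ) →
      IsASGorenstein k Λ ((Bialgebra.counitAlgHom k H).comp D.π) (n + d)) ∧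
    (HasSelfInjDim A n → HasSelfInjDim Λ (n + d)) := by
  have h1 := D.asCondition hnoeth hA.asCondition hH
  obtain ⟨m, hm⟩ := hA.injDim
  have h2 := D.selfInjDim_le hnoeth hm hH
  have h3 := h1.hasFiniteSelfInjDims h2.1 h2.2
  have h4 : HasSelfInjDim A n → HasSelfInjDim Λ (n + d) := fun h ↦
    h1.hasSelfInjDim (D.selfInjDim_le hnoeth h hH)
  exact ⟨h1, h3, fun h ↦ ⟨h1, h.elim (fun h ↦ ⟨_, h4 h⟩) h3.exists_hasSelfInjDim⟩, h4⟩

lemma SmashExtension.hasSelfInjDim_of_finite (D : SmashExtension k A H Λ) [hfin : Module.Finite k H]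
    {m : ℕ} (hA : HasSelfInjDim A m) : HasSelfInjDim Λ m := by
  let := copHopfAlgebra D.bijective_antipode
  have : Module.Finite k (Cop H) := hfin
  exact ⟨(injectiveDimension_eq_of_finite D).trans hA.1,
    (injectiveDimension_eq_of_finite D.op).trans hA.2⟩

lemma SmashExtension.isASGorenstein_of_finite (D : SmashExtension k A H Λ)
    [hfin : Module.Finite k H] {n : ℕ} (hA : IsASGorenstein k A D.ε n) :
    IsASGorenstein k Λ ((Bialgebra.counitAlgHom k H).comp D.π) n := by
  let := copHopfAlgebra D.bijective_antipode
  have : Module.Finite k (Cop H) := hfin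
  obtain ⟨m, hm⟩ := hA.injDim
  refine ⟨⟨D.leftASCondition_of_finite hA.asCondition.1, ?_⟩, m, D.hasSelfInjDim_of_finite hm⟩
  rw [← D.counit_comp_op_π]
  exact D.op.leftASCondition_of_finite hA.asCondition.2

end General

end

end ASSmash

theorem theorem5 (k A H : Type u) [Field k] [Ring H] [HopfAlgebra k H] [Ring A] [Algebra k A]
    [Module H A] [IsScalarTower k H A] [ASSmash.IsModuleAlgebra k H A]
    (ε : A →ₐ[k] k) (hε : ∀ (h : H) (a : A), ε a = 0 → ε (h • a) = 0)
    (hnoeth : ASSmash.IsTwoSidedNoetherian A)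
    (n : ℕ) (hA : ASSmash.IsASGorenstein k A ε n) :
    -- `A` of finite global dimension, `H` with Van den Bergh duality
    (ASSmash.HasFiniteGlobalDimension A → ∀ d : ℕ, ASSmash.HasVanDenBerghDuality k H d →
      ASSmash.ASCondition k (ASSmash.SmashProduct k A H) (ASSmash.smashAugmentation ε hε) (n + d) ∧
      ASSmash.HasFiniteGlobalDimension (ASSmash.SmashProduct k A H) ∧
      ASSmash.HasFiniteSelfInjDims (ASSmash.SmashProduct k A H) ∧
      ((ASSmash.HasSelfInjDim A n ∨
          ASSmash.IsTwoSidedNoetherian (ASSmash.SmashProduct k A H)) →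
        ASSmash.IsASRegular k (ASSmash.SmashProduct k A H) (ASSmash.smashAugmentation ε hε)
          (n + d)) ∧
      (ASSmash.HasSelfInjDim A n →
        ASSmash.HasSelfInjDim (ASSmash.SmashProduct k A H) (n + d))) ∧
    -- `H` finite-dimensional
    (Module.Finite k H →
      ASSmash.IsASGorenstein k (ASSmash.SmashProduct k A H) (ASSmash.smashAugmentation ε hε) n ∧
      ∀ m : ℕ, ASSmash.HasSelfInjDim A m →
        ASSmash.HasSelfInjDim (ASSmash.SmashProduct k A H) m) ∧
    -- `H` with Van den Bergh duality
    (∀ d : ℕ, ASSmash.HasVanDenBerghDuality k H d →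
      ASSmash.ASCondition k (ASSmash.SmashProduct k A H) (ASSmash.smashAugmentation ε hε) (n + d) ∧
      ASSmash.HasFiniteSelfInjDims (ASSmash.SmashProduct k A H) ∧
      ((ASSmash.HasSelfInjDim A n ∨
          ASSmash.IsTwoSidedNoetherian (ASSmash.SmashProduct k A H)) →
        ASSmash.IsASGorenstein k (ASSmash.SmashProduct k A H) (ASSmash.smashAugmentation ε hε)
          (n + d)) ∧
      (ASSmash.HasSelfInjDim A n →
        ASSmash.HasSelfInjDim (ASSmash.SmashProduct k A H) (n + d))) ∧
    -- `A` and `H` Artin-Schelter regular, the antipode of `H` bijective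
    (ASSmash.HasFiniteGlobalDimension A →
      Function.Bijective (HopfAlgebra.antipode k : H →ₗ[k] H) →
      ASSmash.HasFGProjectiveResolution
        (ASSmash.trivialModule (Bialgebra.counitAlgHom k H)) →
      ∀ d : ℕ, ASSmash.IsASRegular k H (Bialgebra.counitAlgHom k H) d →
      ASSmash.ASCondition k (ASSmash.SmashProduct k A H) (ASSmash.smashAugmentation ε hε) (n + d) ∧
      ASSmash.HasFiniteGlobalDimension (ASSmash.SmashProduct k A H) ∧
      ASSmash.HasFiniteSelfInjDims (ASSmash.SmashProduct k A H) ∧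
      ((ASSmash.HasSelfInjDim A n ∨
          ASSmash.IsTwoSidedNoetherian (ASSmash.SmashProduct k A H)) →
        ASSmash.IsASRegular k (ASSmash.SmashProduct k A H) (ASSmash.smashAugmentation ε hε)
          (n + d)) ∧
      (ASSmash.HasSelfInjDim A n →
        ASSmash.HasSelfInjDim (ASSmash.SmashProduct k A H) (n + d))) := by
  have hπ := ASSmash.counit_comp_smashProj (H := H) ε hε
  have key : ∀ d, ASSmash.IsLeftASHopf k H d →
      ASSmash.ASCondition k (ASSmash.SmashProduct k A H) (ASSmash.smashAugmentation ε hε) (n + d) ∧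
      ASSmash.HasFiniteSelfInjDims (ASSmash.SmashProduct k A H) ∧
      ((ASSmash.HasSelfInjDim A n ∨
          ASSmash.IsTwoSidedNoetherian (ASSmash.SmashProduct k A H)) →
        ASSmash.IsASGorenstein k (ASSmash.SmashProduct k A H) (ASSmash.smashAugmentation ε hε)
          (n + d)) ∧
      (ASSmash.HasSelfInjDim A n →
        ASSmash.HasSelfInjDim (ASSmash.SmashProduct k A H) (n + d)) := by
    intro d hH
    rw [← hπ]
    exact (ASSmash.SmashExtension.ofSmashProduct ε hε hH.bijective_antipode).asGorenstein
      hnoeth hA hH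
  have key' : ASSmash.HasFiniteGlobalDimension A → ∀ d, ASSmash.IsLeftASHopf k H d →
      ASSmash.HasFiniteGlobalDimension (ASSmash.SmashProduct k A H) := fun h d hH ↦
    (ASSmash.SmashExtension.ofSmashProduct ε hε hH.bijective_antipode).hasFiniteGlobalDimension h hH
  refine ⟨fun h d hV ↦ ?_, fun hfin ↦ ?_, fun d hV ↦ key d hV.isLeftASHopf,
    fun h hS hFG d hreg ↦ ?_⟩
  · obtain ⟨h1, h2, h3, h4⟩ := key d hV.isLeftASHopf
    have h5 := key' h d hV.isLeftASHopf
    exact ⟨h1, h5, h2, fun h ↦ ⟨h3 h, h5⟩, h4⟩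
  · obtain ⟨hS, -⟩ := ASSmash.exists_isIntegral_dual_bases (k := k) (H := H)
    refine ⟨?_, fun m hm ↦
      (ASSmash.SmashExtension.ofSmashProduct ε hε hS).hasSelfInjDim_of_finite hm⟩
    rw [← hπ]
    exact (ASSmash.SmashExtension.ofSmashProduct ε hε hS).isASGorenstein_of_finite hA
  · obtain ⟨h1, h2, h3, h4⟩ := key d (hreg.isLeftASHopf hS hFG)
    have h5 := key' h d (hreg.isLeftASHopf hS hFG)
    exact ⟨h1, h5, h2, fun h ↦ ⟨h3 h, h5⟩, h4⟩
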